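/- Fix an integer $m\ge 1$. Let $R$ be the generator of rotations about the third axis of $\mathbb R^3$ and $\vec k=(0,0,1)$. Let $\Sigma_m$ be the set of maps $u:\mathbb R^2\to\mathbb S^2\subset\mathbb R^3$ of the form $u=e^{m\theta R}v(r)$ in polar coordinates with $u\in\dot H^1(\mathbb R^2)$, $v$ continuous on $(0,\infty)$, $\lim_{r\to0}v=-\vec k$, $\lim_{r\to\infty}v=\vec k$. Let $\mathcal E(u)=\frac12\int_{\mathbb R^2}|\nabla u|^2\,dx$ and $\delta(u)=\sqrt{\mathcal E(u)-4\pi m}$. Put $h_1(r)=\frac{2r^m}{r^{2m}+1}$, $h_3(r)=\frac{r^{2m}-1}{r^{2m}+1}$, $h=(h_1,0,h_3)$, $Q=e^{m\theta R}h(r)$ and $\mathcal O_m=\{e^{\alpha R}Q(\cdot/s): s>0,\ \alpha\in\mathbb R\}$. *Function $q$.* A Coulomb frame along $u\in\Sigma_m$ is a map $\hat e:(0,\infty)\to\mathbb R^3$, absolutely continuous on compact subintervals, with $\hat e_r=-(\hat e\cdot v_r)v$ a.e. and $\lim_{r\to\infty}\hat e(r)=(1,0,0)$. With $J^v=v\times\cdot\,$,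 set $q=(v_r-\frac mr J^vRv)\cdot(\hat e+iJ^v\hat e)$ and $\tilde q=e^{i(m+1)\theta}q(r)$. *Scale $s(u)$.* For $s>0$ and $\alpha\in\mathbb R/2\pi\mathbb Z$ write $e^{-\alpha R}v(s\,\cdot)=z_1\mathbf j+z_2J^h\mathbf j+(1+\gamma)h$ with $\mathbf j=(0,1,0)$, and $z=z_1+iz_2$. For a constant $K>0$, call $(s,\alpha)=(s(u),\alpha(u))$ modulation parameters of $u$ (with constant $K$) if $$\int_0^\infty\Big(z_r\,(h_1)_r+\frac{m^2}{r^2}\,z\,h_1\Big)r\,dr=0\quad\text{and}\quad\Big|\frac{s}{s_*}-1\Big|+|\alpha-\alpha_*|\le K\,\delta(u)$$ for some $(s_*,\alpha_*)$ such that $e^{\alpha_*R}Q(\cdot/s_*)$ is a closest point to $u$ in $\mathcal O_m$ with respect to $\|\cdot\|_{\dot H^1}$. **Proposition 3.8.** There is $K_0>0$ such that for every $K\ge K_0$ there exist $\delta_0>0$ and $C>0$ (depending only on $m$ and $K$) such that, for every $u\in\Sigma_m\cap\dot H^3$ with $\delta(u)<\delta_0$, a Coulomb frame and modulation parameters with constant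 $K$ exist, and, for every such choice, $$\|u\|_{\dot H^3}\le C\left(\|\Delta\tilde q\|_{L^2(\mathbb R^2)}+\|q\|_{L^6(\mathbb R^2)}^2+s(u)^{-2}\right),$$ where $\Delta$ is the distributional Laplacian and $\|\cdot\|_{\dot H^3}$ is the $L^2$ norm of the third-order weak derivatives. -/

import Mathlib

open MeasureTheory Filter Topology
open scoped ContDiff ENNReal

noncomputable section

namespace SchrodingerMap

/-- The Euclidean plane `ℝ²`. -/
abbrev Plane : Type := EuclideanSpace ℝ (Fin 2)

/-- Euclidean three-space `ℝ³`, containing the unit sphere `𝕊²`. -/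
abbrev Space : Type := EuclideanSpace ℝ (Fin 3)

/-! ### Weak derivatives and homogeneous Sobolev norms on the plane -/

section Sobolev

variable {F : Type*} [NormedAddCommGroup F] [NormedSpace ℝ F]

/-- `g` is the weak partial derivative `∂_{I 0} ⋯ ∂_{I (k-1)} f` of the locally integrable `f`:
`∫ (∂_I φ) f = (-1)^k ∫ φ g` for all test functions `φ ∈ C_c^∞(ℝ²)`. -/
def IsWeakDeriv {k : ℕ} (I : Fin k → Fin 2) (f g : Plane → F) : Prop :=
  LocallyIntegrable f ∧ LocallyIntegrable g ∧
    ∀ φ : Plane → ℝ, ContDiff ℝ ∞ φ → HasCompactSupport φ →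
      ∫ x, (iteratedFDeriv ℝ k φ x (fun j => EuclideanSpace.single (I j) (1 : ℝ))) • f x
        = (-1 : ℝ) ^ k • ∫ x, φ x • g x

/-- `g` is the distributional Laplacian of the locally integrable `f`:
`∫ (Δφ) f = ∫ φ g` for all test functions `φ ∈ C_c^∞(ℝ²)`. -/
def IsWeakLaplacian (f g : Plane → F) : Prop :=
  LocallyIntegrable f ∧ LocallyIntegrable g ∧
    ∀ φ : Plane → ℝ, ContDiff ℝ ∞ φ → HasCompactSupport φ →
      ∫ x, (Laplacian.laplacian φ x) • f x = ∫ x, φ x • g x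

/-- The `L²` norm of the weak derivative `∂_I f` (`∞` if `∂_I f` is not a function in `L²`;
weak derivatives are unique up to null sets). -/
def weakDerivENorm {k : ℕ} (I : Fin k → Fin 2) (f : Plane → F) : ℝ≥0∞ :=
  ⨅ (g : Plane → F) (_ : IsWeakDeriv I f g), eLpNorm g 2 volume

/-- The `L²` norm of the distributional Laplacian of `f` (`∞` if it is not a function in `L²`). -/
def laplacianENorm (f : Plane → F) : ℝ≥0∞ :=
  ⨅ (g : Plane → F) (_ : IsWeakLaplacian f g), eLpNorm g 2 volume

/-- The homogeneous Sobolev norm `‖f‖_{Ḣ^k} = (∑_{|I| = k} ‖∂_I f‖_{L²}²)^{1/2}`. -/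
def hdotENorm (k : ℕ) (f : Plane → F) : ℝ≥0∞ :=
  (∑ I : Fin k → Fin 2, weakDerivENorm I f ^ 2) ^ (1 / 2 : ℝ)

/-- `f ∈ Ḣ^k`: all weak derivatives of order `k` exist and are in `L²`. -/
def MemHdot (k : ℕ) (f : Plane → F) : Prop :=
  ∀ I : Fin k → Fin 2, ∃ g : Plane → F, IsWeakDeriv I f g ∧ MemLp g 2 volume

end Sobolev

/-! ### Equivariant maps -/

/-- The polar angle of a point of the plane. -/
def angle (x : Plane) : ℝ := Complex.arg ⟨x 0, x 1⟩

/-- The matrix `R`, the generator of rotations around the third axis. -/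
def rotGen (y : Space) : Space := !₂[-(y 1), y 0, 0]

/-- The rotation `e^{αR}` by the angle `α` around the third axis. -/
def rot (α : ℝ) (y : Space) : Space :=
  !₂[Real.cos α * y 0 - Real.sin α * y 1, Real.sin α * y 0 + Real.cos α * y 1, y 2]

/-- The vector product `J^a b = a × b`. -/
def cross (a b : Space) : Space := WithLp.toLp 2 (crossProduct a.ofLp b.ofLp)

/-- The unit vector `k = (0,0,1)`. -/
def northPole : Space := !₂[0, 0, 1]

/-- The radial profile `v` of `u = e^{mθR} v(r)`, read off on the ray `θ = 0`. -/
def profile (u : Plane → Space) (r : ℝ) : Space := u !₂[r, 0]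

/-- The class `Σ_m` of `m`-equivariant maps `u = e^{mθR} v(r)` in `Ḣ¹(ℝ²; 𝕊²)` with
`v(0) = -k` and `v(∞) = k`. Each map is represented by the version whose profile is continuous on
`(0,∞)`, which is the one to which the boundary values refer. -/
structure IsSigma (m : ℕ) (u : Plane → Space) : Prop where
  sphere : ∀ x, ‖u x‖ = 1
  equivariant : ∀ r : ℝ, 0 < r → ∀ θ : ℝ,
    u !₂[r * Real.cos θ, r * Real.sin θ] = rot (m * θ) (profile u r)
  continuousOn : ContinuousOn (profile u) (Set.Ioi 0)
  tendsto_zero : Tendsto (profile u) (𝓝[>] 0) (𝓝 (-northPole))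
  tendsto_infty : Tendsto (profile u) atTop (𝓝 northPole)
  memHdot : MemHdot 1 u

/-- The energy `E(u) = ½ ∫ |∇u|²`. -/
def energy (u : Plane → Space) : ℝ := (1 / 2) * (hdotENorm 1 u).toReal ^ 2

/-- `δ(u) = (E(u) - 4πm)^{1/2}`. -/
def excess (m : ℕ) (u : Plane → Space) : ℝ := Real.sqrt (energy u - 4 * Real.pi * m)

/-! ### Harmonic maps -/

/-- `h₁(r) = 2 r^m / (r^{2m} + 1)`. -/
def h₁ (m : ℕ) (r : ℝ) : ℝ := 2 * r ^ m / (r ^ (2 * m) + 1)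

/-- `h₃(r) = (r^{2m} - 1) / (r^{2m} + 1)`. -/
def h₃ (m : ℕ) (r : ℝ) : ℝ := (r ^ (2 * m) - 1) / (r ^ (2 * m) + 1)

/-- The harmonic map `Q = e^{mθR} h(r)` with `h = (h₁, 0, h₃)`. -/
def harmonicQ (m : ℕ) (x : Plane) : Space := rot (m * angle x) !₂[h₁ m ‖x‖, 0, h₃ m ‖x‖]

/-- The member `e^{αR} Q(·/s)` of the family `𝒪_m` of harmonic maps. -/
def harmonicMap (m : ℕ) (s α : ℝ) (x : Plane) : Space := rot α (harmonicQ m (s⁻¹ • x))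

/-- The `Ḣ¹` distance from `u` to the family `𝒪_m = {e^{αR} Q(·/s) : s > 0, α ∈ ℝ}`. -/
def harmonicDist (m : ℕ) (u : Plane → Space) : ℝ≥0∞ :=
  ⨅ (s : ℝ) (_ : 0 < s) (α : ℝ), hdotENorm 1 (fun x => u x - harmonicMap m s α x)

/-- `(s_*, α_*)` are the parameters of an `Ḣ¹`-closest harmonic map to `u`. -/
def IsClosestHarmonic (m : ℕ) (u : Plane → Space) (s α : ℝ) : Prop :=
  0 < s ∧ hdotENorm 1 (fun x => u x - harmonicMap m s α x) = harmonicDist m u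

/-! ### The parameters `(s(u), α(u))` -/

/-- The coordinate `z = z₁ + i z₂` of `e^{-αR} v(s ·) = z₁ j + z₂ J^h j + (1 + γ) h`, where
`j = (0,1,0)` and `J^h j = (-h₃, 0, h₁)`; the basis is orthonormal, so `z₁` and `z₂` are the inner
products with `j` and `J^h j`. -/
def zCoord (m : ℕ) (u : Plane → Space) (s α : ℝ) (r : ℝ) : ℂ :=
  ⟨inner ℝ (rot (-α) (profile u (s * r))) !₂[0, 1, 0],
    inner ℝ (rot (-α) (profile u (s * r))) !₂[-(h₃ m r), 0, h₁ m r]⟩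

/-- The inner product `⟨f, g⟩_{Ḣ¹_e} = ∫₀^∞ (f_r \bar{g_r} + (m²/r²) f \bar g) r dr`. -/
def innerHe (m : ℕ) (f g : ℝ → ℂ) : ℂ :=
  ∫ r in Set.Ioi (0 : ℝ),
    (deriv f r * starRingEnd ℂ (deriv g r)
      + ((m : ℂ) ^ 2 / (r : ℂ) ^ 2) * (f r * starRingEnd ℂ (g r))) * (r : ℂ)

/-- `(s, α)` is a pair `(s(u), α(u))`: the orthogonality condition `⟨z, h₁⟩_{Ḣ¹_e} = 0` holds and
`|s/s_* - 1| + |α - α_*| ≤ K δ(u)` for the closest harmonic map `e^{α_* R} Q(·/s_*)`.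
Angles are real representatives of elements of `ℝ/2πℤ`; as `α_*` ranges over all representatives,
`|α - α_*|` is the distance on the circle. -/
def IsModulation (m : ℕ) (K : ℝ) (u : Plane → Space) (s α : ℝ) : Prop :=
  0 < s ∧ innerHe m (zCoord m u s α) (fun r => (h₁ m r : ℂ)) = 0 ∧
    ∃ s' α' : ℝ, IsClosestHarmonic m u s' α' ∧ |s / s' - 1| + |α - α'| ≤ K * excess m u

/-! ### The Coulomb frame and the function `q` -/

/-- `e : (0,∞) → ℝ³` is the Coulomb frame along `u`: it is absolutely continuous on compact
subintervals of `(0,∞)`, tends to `(1,0,0)` at infinity, and `e_r = -(e ⬝ v_r) v` a.e. -/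
structure IsCoulombFrame (u : Plane → Space) (e : ℝ → Space) : Prop where
  absolutelyContinuous : ∀ a b : ℝ, 0 < a → a ≤ b → AbsolutelyContinuousOnInterval e a b
  tendsto_infty : Tendsto e atTop (𝓝 !₂[1, 0, 0])
  parallel : ∀ᵐ r ∂(volume.restrict (Set.Ioi (0 : ℝ))),
    HasDerivAt e (-(inner ℝ (e r) (deriv (profile u) r) • profile u r)) r

/-- `W = v_r - (m/r) J^v R v`. -/
def wField (m : ℕ) (u : Plane → Space) (r : ℝ) : Space :=
  deriv (profile u) r - ((m : ℝ) / r) • cross (profile u r) (rotGen (profile u r))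

/-- `q = W ⬝ (e + i J^v e)`. -/
def qFun (m : ℕ) (u : Plane → Space) (e : ℝ → Space) (r : ℝ) : ℂ :=
  ⟨inner ℝ (wField m u r) (e r), inner ℝ (wField m u r) (cross (profile u r) (e r))⟩

/-- `q̃ = e^{i(m+1)θ} q(r)`, a function on the plane. -/
def qTilde (m : ℕ) (u : Plane → Space) (e : ℝ → Space) (x : Plane) : ℂ :=
  Complex.exp (Complex.I * ((m + 1) * angle x : ℝ)) * qFun m u e ‖x‖

end SchrodingerMap

end

noncomputable section

open Real

namespace SchrodingerMap

/-! ### Integration of radial functions on the plane -/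

theorem continuous_of_hasDerivAt {E : Type*} [NormedAddCommGroup E] [NormedSpace ℝ E] {f f' : ℝ → E}
    (h : ∀ t, HasDerivAt f (f' t) t) : Continuous f :=
  continuous_iff_continuousAt.2 fun t => (h t).continuousAt

section Radial

theorem lintegral_fun_norm {f : ℝ → ℝ≥0∞} (hf : Measurable f) :
    ∫⁻ x : Plane, f ‖x‖ = ENNReal.ofReal (2 * π) *
      ∫⁻ r in Set.Ioi (0 : ℝ), ENNReal.ofReal r * f r := by
  have hmp := (volume : Measure Plane).measurePreserving_homeomorphUnitSphereProd
  have h1 : ∫⁻ x : Plane, f ‖x‖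
      = ∫⁻ x : ({0}ᶜ : Set Plane), f ‖(x : Plane)‖ ∂(volume.comap Subtype.val) := by
    rw [lintegral_subtype_comap (measurableSet_singleton _).compl (fun x : Plane => f ‖x‖),
      MeasureTheory.restrict_compl_singleton]
  rw [h1]
  have h2 := hmp.lintegral_comp_emb (Homeomorph.measurableEmbedding _)
    (fun z : Metric.sphere (0 : Plane) 1 × Set.Ioi (0 : ℝ) => f z.2)
  simp only [homeomorphUnitSphereProd_apply_snd_coe] at h2
  rw [h2, lintegral_prod _ (by fun_prop)]
  simp only [lintegral_const]
  rw [Measure.volumeIoiPow, lintegral_withDensity_eq_lintegral_mul _ (by fun_prop) (by fun_prop)]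
  rw [Measure.toSphere_apply_univ]
  have h3 : (volume : Measure Plane) (Metric.ball 0 1) = ENNReal.ofReal π := by
    rw [EuclideanSpace.volume_ball_fin_two]
    simp
  rw [h3]
  have h4 : ∫⁻ r in Set.Ioi (0 : ℝ), ENNReal.ofReal r * f r
      = ∫⁻ r : Set.Ioi (0 : ℝ), ENNReal.ofReal r * f r ∂(volume.comap Subtype.val) := by
    rw [lintegral_subtype_comap measurableSet_Ioi (fun r : ℝ => ENNReal.ofReal r * f r)]
  rw [h4, mul_comm]
  congr 1
  · rw [ENNReal.ofReal_mul (by norm_num)]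
    simp
  · simp

theorem ae_norm_of_ae {p : ℝ → Prop} (h : ∀ᵐ r ∂(volume.restrict (Set.Ioi (0 : ℝ))), p r) :
    ∀ᵐ x : Plane, p ‖x‖ := by
  rw [ae_iff] at h
  obtain ⟨N, hN, hNm, hN0⟩ := exists_measurable_superset_of_null h
  have h1 := lintegral_fun_norm (f := N.indicator 1) (measurable_one.indicator hNm)
  have h2 : ∫⁻ r in Set.Ioi (0 : ℝ), ENNReal.ofReal r * N.indicator 1 r = 0 := by
    rw [lintegral_eq_zero_iff' (by
      exact (ENNReal.measurable_ofReal.mul (measurable_one.indicator hNm)).aemeasurable)]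
    have : ∀ᵐ r ∂(volume.restrict (Set.Ioi (0 : ℝ))), r ∉ N := by
      rw [ae_iff]; simpa using hN0
    filter_upwards [this] with r hr
    simp [hr]
  rw [h2, mul_zero, lintegral_eq_zero_iff (by
    exact (measurable_one.indicator hNm).comp measurable_norm)] at h1
  filter_upwards [h1] with x hx
  by_contra hp
  have : ‖x‖ ∈ N := hN hp
  simp [this] at hx

theorem lintegral_Ioi_eq_exp {f : ℝ → ℝ≥0∞} :
    ∫⁻ r in Set.Ioi (0 : ℝ), f r = ∫⁻ t : ℝ, ENNReal.ofReal (exp t) * f (exp t) := by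
  have := lintegral_image_eq_lintegral_abs_deriv_mul (s := Set.univ) (f := exp)
    (f' := exp) MeasurableSet.univ (fun x _ => (hasDerivAt_exp x).hasDerivWithinAt)
    exp_injective.injOn f
  rw [Set.image_univ, range_exp] at this
  rw [this]
  simp [abs_of_pos (exp_pos _)]

/-- Radial integrals in the logarithmic coordinate `r = e^t`. -/
theorem lintegral_fun_norm_exp {f : ℝ → ℝ≥0∞} (hf : Measurable f) :
    ∫⁻ x : Plane, f ‖x‖ = ENNReal.ofReal (2 * π) *
      ∫⁻ t : ℝ, ENNReal.ofReal (exp (2 * t)) * f (exp t) := by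
  rw [lintegral_fun_norm hf, lintegral_Ioi_eq_exp]
  congr 1
  refine lintegral_congr fun t => ?_
  rw [← mul_assoc, ← ENNReal.ofReal_mul (exp_nonneg _), ← exp_add]
  ring_nf

theorem ae_Ioi_of_ae_exp {p : ℝ → Prop} (h : ∀ᵐ t : ℝ, p (exp t)) :
    ∀ᵐ r ∂(volume.restrict (Set.Ioi (0 : ℝ))), p r := by
  rw [ae_restrict_iff' measurableSet_Ioi, ae_iff]
  rw [ae_iff] at h
  have := addHaar_image_eq_zero_of_differentiableOn_of_addHaar_eq_zero
    (f := exp) volume Real.differentiable_exp.differentiableOn h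
  refine measure_mono_null ?_ this
  intro r hr
  simp only [Classical.not_imp, Set.mem_ofPred_eq, Set.mem_Ioi] at hr
  exact ⟨log r, by simpa [exp_log hr.1] using hr.2, exp_log hr.1⟩

theorem ae_exp_of_ae_Ioi {p : ℝ → Prop}
    (h : ∀ᵐ r ∂(volume.restrict (Set.Ioi (0 : ℝ))), p r) : ∀ᵐ t : ℝ, p (exp t) := by
  rw [ae_restrict_iff' measurableSet_Ioi, ae_iff] at h
  have := addHaar_image_eq_zero_of_differentiableOn_of_addHaar_eq_zero
    (f := log) (s := {r | ¬ (r ∈ Set.Ioi (0 : ℝ) → p r)}) volume (fun r hr => by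
      simp only [Classical.not_imp, Set.mem_ofPred_eq, Set.mem_Ioi] at hr
      exact (Real.differentiableAt_log hr.1.ne').differentiableWithinAt) h
  rw [ae_iff]
  refine measure_mono_null ?_ this
  intro t ht
  exact ⟨exp t, by simpa [exp_pos] using ht, log_exp t⟩

end Radial

/-! ### Partial derivatives and convolutions -/

section Conv

variable {F : Type*} [NormedAddCommGroup F] [NormedSpace ℝ F]

/-- The `i`-th partial derivative. -/
def pd (i : Fin 2) (f : Plane → F) (x : Plane) : F :=
  fderiv ℝ f x (EuclideanSpace.single i (1 : ℝ))

/-- The iterated partial derivative `∂_{I 0} ⋯ ∂_{I (k-1)}`. -/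
def pdI {k : ℕ} (I : Fin k → Fin 2) (f : Plane → F) (x : Plane) : F :=
  iteratedFDeriv ℝ k f x (fun j => EuclideanSpace.single (I j) (1 : ℝ))

theorem pdI_zero (I : Fin 0 → Fin 2) (f : Plane → F) : pdI I f = f := by
  ext x; simp [pdI]

theorem pdI_succ {k : ℕ} (I : Fin (k + 1) → Fin 2) {f : Plane → F} (hf : ContDiff ℝ ∞ f) :
    pdI I f = pd (I 0) (pdI (Fin.tail I) f) := by
  ext x
  unfold pdI pd
  rw [iteratedFDeriv_succ_apply_left]
  have hd : DifferentiableAt ℝ (iteratedFDeriv ℝ k f) x :=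
    (hf.differentiable_iteratedFDeriv (by exact_mod_cast WithTop.coe_lt_top _)).differentiableAt
  have h := (hd.hasFDerivAt.continuousMultilinear_apply_const
    (fun j => EuclideanSpace.single (Fin.tail I j) (1 : ℝ))).fderiv
  erw [h]
  rfl

theorem contDiff_pd {i : Fin 2} {f : Plane → F} (hf : ContDiff ℝ ∞ f) : ContDiff ℝ ∞ (pd i f) := by
  unfold pd
  exact (hf.fderiv_right (m := ∞) (by simp)).clm_apply contDiff_const

theorem contDiff_pdI {k : ℕ} {I : Fin k → Fin 2} {f : Plane → F} (hf : ContDiff ℝ ∞ f) :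
    ContDiff ℝ ∞ (pdI I f) := by
  induction k with
  | zero => rwa [pdI_zero]
  | succ k ih => rw [pdI_succ I hf]; exact contDiff_pd ih

theorem hasCompactSupport_pd {i : Fin 2} {f : Plane → F} (hf : HasCompactSupport f) :
    HasCompactSupport (pd i f) :=
  (hf.fderiv (𝕜 := ℝ)).comp_left (g := fun L : Plane →L[ℝ] F => L (EuclideanSpace.single i 1)) rfl

theorem hasCompactSupport_pdI {k : ℕ} {I : Fin k → Fin 2} {f : Plane → F}
    (hc : HasCompactSupport f) : HasCompactSupport (pdI I f) :=
  (hc.iteratedFDeriv (𝕜 := ℝ) k).comp_left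
    (g := fun L : Plane [×k]→L[ℝ] F => L (fun j => EuclideanSpace.single (I j) (1 : ℝ))) rfl

theorem pd_comp_sub_left {i : Fin 2} {f : Plane → F} (hf : Differentiable ℝ f) (x : Plane) :
    pd i (fun y => f (x - y)) = fun y => - pd i f (x - y) := by
  ext y
  unfold pd
  have h := (hf (x - y)).hasFDerivAt.comp y ((hasFDerivAt_id y).const_sub x)
  have h2 : fderiv ℝ (fun y => f (x - y)) y = _ := h.fderiv
  rw [h2]
  simp

theorem pd_const_smul {i : Fin 2} {f : Plane → F} (c : ℝ) :
    pd i (fun y => c • f y) = fun y => c • pd i f y := by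
  ext y
  unfold pd
  have : (fun y => c • f y) = c • f := rfl
  rw [this, fderiv_const_smul_field]
  rfl

theorem contDiff_comp_sub_left {f : Plane → F} (hf : ContDiff ℝ ∞ f) (x : Plane) :
    ContDiff ℝ ∞ (fun y => f (x - y)) :=
  hf.comp (contDiff_const.sub contDiff_id)

theorem pdI_comp_sub_left {k : ℕ} {I : Fin k → Fin 2} {f : Plane → F} (hf : ContDiff ℝ ∞ f)
    (x : Plane) : pdI I (fun y => f (x - y)) = fun y => (-1 : ℝ) ^ k • pdI I f (x - y) := by
  induction k with
  | zero => simp [pdI_zero]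
  | succ k ih =>
    rw [pdI_succ I (contDiff_comp_sub_left hf x), pdI_succ I hf, ih, pd_const_smul,
      pd_comp_sub_left ((contDiff_pdI hf).differentiable (by simp))]
    ext y
    simp [pow_succ]

/-- The convolution of a scalar kernel and a vector valued function. -/
def conv (φ : Plane → ℝ) (f : Plane → F) (x : Plane) : F := ∫ t, φ t • f (x - t)

theorem conv_eq (φ : Plane → ℝ) (f : Plane → F) :
    conv φ f = convolution φ f (ContinuousLinearMap.lsmul ℝ ℝ) volume := rfl

theorem conv_eq_swap (φ : Plane → ℝ) (f : Plane → F) (x : Plane) :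
    conv φ f x = ∫ t, φ (x - t) • f t := by
  rw [conv_eq, convolution_lsmul_swap]

theorem integrable_conv {φ : Plane → ℝ} {f : Plane → F} (hφ : Continuous φ)
    (hc : HasCompactSupport φ) (hf : LocallyIntegrable f) (x : Plane) :
    Integrable (fun t => φ t • f (x - t)) :=
  hc.convolutionExists_left (ContinuousLinearMap.lsmul ℝ ℝ) hφ hf x

theorem contDiff_conv {φ : Plane → ℝ} {f : Plane → F} (hφ : ContDiff ℝ ∞ φ)
    (hc : HasCompactSupport φ) (hf : LocallyIntegrable f) : ContDiff ℝ ∞ (conv φ f) := by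
  rw [conv_eq]
  exact hc.contDiff_convolution_left _ hφ hf

theorem pd_conv {φ : Plane → ℝ} {f : Plane → F} (hφ : ContDiff ℝ ∞ φ)
    (hc : HasCompactSupport φ) (hf : LocallyIntegrable f) (i : Fin 2) :
    pd i (conv φ f) = conv (pd i φ) f := by
  ext x
  unfold pd
  rw [conv_eq, (hc.hasFDerivAt_convolution_left (ContinuousLinearMap.lsmul ℝ ℝ)
    (hφ.of_le (by simp)) hf x).fderiv, convolution_def]
  rw [ContinuousLinearMap.integral_apply]
  · rfl
  · exact (hc.fderiv (𝕜 := ℝ)).convolutionExists_left _ (hφ.continuous_fderiv (by simp)) hf x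

theorem pdI_conv {k : ℕ} {I : Fin k → Fin 2} {φ : Plane → ℝ} {f : Plane → F}
    (hφ : ContDiff ℝ ∞ φ) (hc : HasCompactSupport φ) (hf : LocallyIntegrable f) :
    pdI I (conv φ f) = conv (pdI I φ) f := by
  induction k with
  | zero => simp [pdI_zero]
  | succ k ih =>
    rw [pdI_succ I (contDiff_conv hφ hc hf), pdI_succ I hφ, ih,
      pd_conv (contDiff_pdI hφ) (hasCompactSupport_pdI hc) hf]

theorem hasCompactSupport_sub_left {E : Type*} [Zero E] {φ : Plane → E} (hc : HasCompactSupport φ)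
    (x : Plane) : HasCompactSupport (fun y => φ (x - y)) :=
  hc.comp_homeomorph (Homeomorph.subLeft x)

theorem IsWeakDeriv.pdI_conv {k : ℕ} {I : Fin k → Fin 2} {φ : Plane → ℝ} {f g : Plane → F}
    (h : IsWeakDeriv I f g) (hφ : ContDiff ℝ ∞ φ) (hc : HasCompactSupport φ) :
    pdI I (conv φ f) = conv φ g := by
  ext x
  rw [SchrodingerMap.pdI_conv hφ hc h.1, conv_eq_swap, conv_eq_swap]
  have := h.2.2 (fun y => φ (x - y)) (hφ.comp (contDiff_const.sub contDiff_id))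
    (hasCompactSupport_sub_left hc x)
  have h2 : ∀ y, iteratedFDeriv ℝ k (fun y => φ (x - y)) y
      (fun j => EuclideanSpace.single (I j) (1 : ℝ)) = (-1 : ℝ) ^ k • pdI I φ (x - y) :=
    fun y => congrFun (pdI_comp_sub_left (I := I) hφ x) y
  simp only [h2, smul_assoc] at this
  rw [integral_smul] at this
  exact smul_right_injective F (pow_ne_zero k (by norm_num : (-1 : ℝ) ≠ 0)) this

theorem laplacian_eq_pd {f : Plane → F} (hf : ContDiff ℝ ∞ f) :
    Laplacian.laplacian f = fun x => ∑ i, pd i (pd i f) x := by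
  rw [InnerProductSpace.laplacian_eq_iteratedFDeriv_orthonormalBasis f
    (EuclideanSpace.basisFun (Fin 2) ℝ)]
  ext x
  refine Finset.sum_congr rfl fun i _ => ?_
  have h := congrFun (pdI_succ (k := 1) ![i, i] hf) x
  rw [pdI_succ (Fin.tail ![i, i]) hf, pdI_zero] at h
  refine Eq.trans ?_ h
  unfold pdI
  congr 1
  ext j k
  fin_cases j <;> simp

theorem laplacian_comp_sub_left {φ : Plane → F} (hφ : ContDiff ℝ ∞ φ) (x : Plane) :
    Laplacian.laplacian (fun y => φ (x - y)) = fun y => Laplacian.laplacian φ (x - y) := by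
  rw [laplacian_eq_pd (contDiff_comp_sub_left hφ x), laplacian_eq_pd hφ]
  ext y
  refine Finset.sum_congr rfl fun i _ => ?_
  rw [pd_comp_sub_left (hφ.differentiable (by simp))]
  have := pd_const_smul (i := i) (f := fun y => pd i φ (x - y)) (-1)
  simp only [neg_smul, one_smul] at this
  rw [this, pd_comp_sub_left ((contDiff_pd hφ).differentiable (by simp))]
  simp

theorem conv_add_left {φ ψ : Plane → ℝ} {f : Plane → F} (hφ : Continuous φ)
    (hc : HasCompactSupport φ) (hψ : Continuous ψ) (hd : HasCompactSupport ψ)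
    (hf : LocallyIntegrable f) (x : Plane) :
    conv (fun y => φ y + ψ y) f x = conv φ f x + conv ψ f x := by
  unfold conv
  rw [← integral_add (integrable_conv hφ hc hf x) (integrable_conv hψ hd hf x)]
  simp [add_smul]

theorem IsWeakLaplacian.laplacian_conv {φ : Plane → ℝ} {f g : Plane → F}
    (h : IsWeakLaplacian f g) (hφ : ContDiff ℝ ∞ φ) (hc : HasCompactSupport φ) :
    Laplacian.laplacian (conv φ f) = conv φ g := by
  ext x
  rw [laplacian_eq_pd (contDiff_conv hφ hc h.1)]
  have h0 : ∀ i, pd i (pd i (conv φ f)) = conv (pd i (pd i φ)) f := fun i => by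
    rw [pd_conv hφ hc h.1, pd_conv (contDiff_pd hφ) (hasCompactSupport_pd hc) h.1]
  simp only [h0, Fin.sum_univ_two]
  rw [← conv_add_left (contDiff_pd (contDiff_pd hφ)).continuous
    (hasCompactSupport_pd (hasCompactSupport_pd hc)) (contDiff_pd (contDiff_pd hφ)).continuous
    (hasCompactSupport_pd (hasCompactSupport_pd hc)) h.1]
  have h1 : (fun y => pd 0 (pd 0 φ) y + pd 1 (pd 1 φ) y) = Laplacian.laplacian φ := by
    rw [laplacian_eq_pd hφ]; simp [Fin.sum_univ_two]
  rw [h1, conv_eq_swap, conv_eq_swap]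
  have := h.2.2 (fun y => φ (x - y)) (hφ.comp (contDiff_const.sub contDiff_id))
    (hasCompactSupport_sub_left hc x)
  rw [laplacian_comp_sub_left hφ] at this
  exact this

end Conv

/-! ### Young's inequality and mollifiers -/

section Mollifier

theorem eLpNorm_two_sq {F : Type*} [NormedAddCommGroup F] {α : Type*} [MeasurableSpace α]
    {μ : Measure α} (f : α → F) :
    eLpNorm f 2 μ ^ 2 = ∫⁻ x, ‖f x‖ₑ ^ 2 ∂μ := by
  rw [eLpNorm_eq_lintegral_rpow_enorm_toReal (by norm_num) (by norm_num)]
  rw [← ENNReal.rpow_natCast, ← ENNReal.rpow_mul]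
  simp

variable {F : Type*} [NormedAddCommGroup F] [NormedSpace ℝ F]

theorem conv_enorm_sq_le {k : Plane → ℝ} {g : Plane → F} (hk : Continuous k)
    (hg : AEStronglyMeasurable g) (x : Plane) :
    ‖conv k g x‖ₑ ^ 2 ≤ (∫⁻ t, ‖k t‖ₑ) * ∫⁻ t, ‖k t‖ₑ * ‖g (x - t)‖ₑ ^ 2 := by
  have hg' : AEStronglyMeasurable (fun t => g (x - t)) :=
    hg.comp_quasiMeasurePreserving (quasiMeasurePreserving_sub_left volume x)
  have h1 : ‖conv k g x‖ₑ ≤ ∫⁻ t, ‖k t‖ₑ * ‖g (x - t)‖ₑ := by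
    refine (enorm_integral_le_lintegral_enorm _).trans (le_of_eq ?_)
    exact lintegral_congr fun t => by rw [enorm_smul]
  have h2 := ENNReal.lintegral_mul_le_Lp_mul_Lq (volume : Measure Plane)
    (p := 2) (q := 2) ⟨by norm_num, by norm_num, by norm_num⟩
    (f := fun t => ‖k t‖ₑ ^ (1 / 2 : ℝ)) (g := fun t => ‖k t‖ₑ ^ (1 / 2 : ℝ) * ‖g (x - t)‖ₑ)
    (hk.measurable.enorm.pow_const _).aemeasurable
    ((hk.measurable.enorm.pow_const _).aemeasurable.mul hg'.enorm)
  have h3 : ∀ t, ((fun t => ‖k t‖ₑ ^ (1 / 2 : ℝ)) *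
      fun t => ‖k t‖ₑ ^ (1 / 2 : ℝ) * ‖g (x - t)‖ₑ) t = ‖k t‖ₑ * ‖g (x - t)‖ₑ := fun t => by
    simp only [Pi.mul_apply]
    rw [← mul_assoc, ← ENNReal.rpow_add_of_nonneg _ _ (by norm_num) (by norm_num)]
    norm_num
  have h4 : ∀ t, (‖k t‖ₑ ^ (1 / 2 : ℝ)) ^ (2 : ℝ) = ‖k t‖ₑ := fun t => by
    rw [← ENNReal.rpow_mul]; norm_num
  have h5 : ∀ t, (‖k t‖ₑ ^ (1 / 2 : ℝ) * ‖g (x - t)‖ₑ) ^ (2 : ℝ) = ‖k t‖ₑ * ‖g (x - t)‖ₑ ^ 2 :=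
    fun t => by
      rw [ENNReal.mul_rpow_of_nonneg _ _ (by norm_num), h4]
      norm_cast
  simp only [h3, h4, h5] at h2
  calc ‖conv k g x‖ₑ ^ 2 ≤ ((∫⁻ t, ‖k t‖ₑ) ^ (1 / (2 : ℝ)) *
        (∫⁻ t, ‖k t‖ₑ * ‖g (x - t)‖ₑ ^ 2) ^ (1 / (2 : ℝ))) ^ 2 := by
        gcongr; exact h1.trans h2
    _ = _ := by
        rw [mul_pow, ← ENNReal.rpow_natCast, ← ENNReal.rpow_natCast, ← ENNReal.rpow_mul,
          ← ENNReal.rpow_mul]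
        norm_num

theorem ENNReal_le_of_sq_le {a b : ℝ≥0∞} (h : a ^ 2 ≤ b ^ 2) : a ≤ b :=
  (ENNReal.pow_right_strictMono (n := 2) (by norm_num)).le_iff_le.1 h

theorem eLpNorm_conv_le {k : Plane → ℝ} {g : Plane → F} (hk : Continuous k)
    (hg : AEStronglyMeasurable g) :
    eLpNorm (conv k g) 2 volume ≤ (∫⁻ t, ‖k t‖ₑ) * eLpNorm g 2 volume := by
  have hm : AEMeasurable (fun p : Plane × Plane => ‖k p.2‖ₑ * ‖g (p.1 - p.2)‖ₑ ^ 2)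
      ((volume : Measure Plane).prod volume) :=
    AEMeasurable.mul (hk.measurable.enorm.comp measurable_snd).aemeasurable
      ((hg.comp_quasiMeasurePreserving (quasiMeasurePreserving_sub volume volume)).enorm.pow_const 2)
  refine ENNReal_le_of_sq_le ?_
  rw [mul_pow, eLpNorm_two_sq, eLpNorm_two_sq, sq (∫⁻ t, ‖k t‖ₑ), mul_assoc]
  calc ∫⁻ x, ‖conv k g x‖ₑ ^ 2
      ≤ ∫⁻ x, (∫⁻ t, ‖k t‖ₑ) * ∫⁻ t, ‖k t‖ₑ * ‖g (x - t)‖ₑ ^ 2 :=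
        lintegral_mono fun x => conv_enorm_sq_le hk hg x
    _ ≤ (∫⁻ t, ‖k t‖ₑ) * ∫⁻ x, ∫⁻ t, ‖k t‖ₑ * ‖g (x - t)‖ₑ ^ 2 := by
        by_cases h : (∫⁻ t, ‖k t‖ₑ) = 0
        · simp [h]
        rw [lintegral_const_mul'' _ hm.lintegral_prod_right']
    _ = (∫⁻ t, ‖k t‖ₑ) * ((∫⁻ t, ‖k t‖ₑ) * ∫⁻ x, ‖g x‖ₑ ^ 2) := by
        congr 1
        rw [lintegral_lintegral_swap]
        · have : ∀ t, ∫⁻ x, ‖k t‖ₑ * ‖g (x - t)‖ₑ ^ 2 = ‖k t‖ₑ * ∫⁻ x, ‖g x‖ₑ ^ 2 := fun t => by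
            rw [lintegral_const_mul' _ _ (by simp),
              lintegral_sub_right_eq_self (fun x => ‖g x‖ₑ ^ 2)]
          simp only [this]
          rw [lintegral_mul_const _ hk.measurable.enorm]
        · exact hm

theorem memLp_conv {k : Plane → ℝ} {g : Plane → F} (hk : ContDiff ℝ ∞ k)
    (hc : HasCompactSupport k) (hgl : LocallyIntegrable g) (hg : MemLp g 2 volume) :
    MemLp (conv k g) 2 volume := by
  refine ⟨(contDiff_conv hk hc hgl).continuous.aestronglyMeasurable, ?_⟩
  refine (eLpNorm_conv_le hk.continuous hg.1).trans_lt (ENNReal.mul_lt_top ?_ hg.2)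
  exact (hk.continuous.integrable_of_hasCompactSupport hc).hasFiniteIntegral

/-- A smooth cutoff on the half line, supported in `|y| ≤ (n+1)⁻²`. -/
def mollBump (n : ℕ) : ContDiffBump (0 : ℝ) where
  rIn := ((n + 1 : ℝ) ^ 2)⁻¹ / 2
  rOut := ((n + 1 : ℝ) ^ 2)⁻¹
  rIn_pos := by positivity
  rIn_lt_rOut := half_lt_self (by positivity)

/-- Unnormalised radial kernels. -/
def mollAux (n : ℕ) (x : Plane) : ℝ := mollBump n (‖x‖ ^ 2)

/-- A sequence of smooth, radial, nonnegative kernels of integral one with shrinking supports. -/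
def moll (n : ℕ) (x : Plane) : ℝ := (∫ y, mollAux n y)⁻¹ * mollAux n x

theorem contDiff_mollAux (n : ℕ) : ContDiff ℝ ∞ (mollAux n) :=
  (mollBump n).contDiff.comp (contDiff_norm_sq ℝ)

theorem support_mollAux (n : ℕ) :
    Function.support (mollAux n) ⊆ Metric.ball 0 ((n + 1 : ℝ)⁻¹) := by
  intro x hx
  have h : ‖x‖ ^ 2 ∈ Function.support (mollBump n) := hx
  rw [(mollBump n).support_eq, Metric.mem_ball, dist_zero_right, Real.norm_eq_abs,
    abs_of_nonneg (by positivity)] at h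
  rw [Metric.mem_ball, dist_zero_right]
  change ‖x‖ ^ 2 < ((n + 1 : ℝ) ^ 2)⁻¹ at h
  rw [← inv_pow] at h
  exact lt_of_pow_lt_pow_left₀ 2 (by positivity) h

theorem hasCompactSupport_mollAux (n : ℕ) : HasCompactSupport (mollAux n) :=
  HasCompactSupport.of_support_subset_isCompact (isCompact_closedBall 0 ((n + 1 : ℝ)⁻¹))
    ((support_mollAux n).trans Metric.ball_subset_closedBall)

theorem mollAux_nonneg (n : ℕ) (x : Plane) : 0 ≤ mollAux n x := (mollBump n).nonneg

theorem integral_mollAux_pos (n : ℕ) : 0 < ∫ y, mollAux n y := by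
  refine (contDiff_mollAux n).continuous.integral_pos_of_hasCompactSupport_nonneg_nonzero
    (μ := volume) (x := 0) (hasCompactSupport_mollAux n) (mollAux_nonneg n) ?_
  have : mollAux n 0 = 1 := (mollBump n).one_of_mem_closedBall (by
    have := (mollBump n).rIn_pos.le
    simpa using this)
  rw [this]; exact one_ne_zero

theorem contDiff_moll (n : ℕ) : ContDiff ℝ ∞ (moll n) :=
  contDiff_const.mul (contDiff_mollAux n)

theorem hasCompactSupport_moll (n : ℕ) : HasCompactSupport (moll n) :=
  (hasCompactSupport_mollAux n).mul_left

theorem moll_nonneg (n : ℕ) (x : Plane) : 0 ≤ moll n x :=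
  mul_nonneg (inv_nonneg.2 (integral_mollAux_pos n).le) (mollAux_nonneg n x)

theorem integral_moll (n : ℕ) : ∫ x, moll n x = 1 := by
  unfold moll
  rw [integral_const_mul, inv_mul_cancel₀ (integral_mollAux_pos n).ne']

theorem support_moll (n : ℕ) : Function.support (moll n) ⊆ Metric.ball 0 ((n + 1 : ℝ)⁻¹) :=
  (Function.support_mul_subset_right _ _).trans (support_mollAux n)

theorem moll_eq_of_norm_eq (n : ℕ) {x y : Plane} (h : ‖x‖ = ‖y‖) : moll n x = moll n y := by
  simp [moll, mollAux, h]

theorem lintegral_moll (n : ℕ) : ∫⁻ x, ‖moll n x‖ₑ = 1 := by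
  have h := ofReal_integral_eq_lintegral_ofReal (μ := volume) (f := moll n)
    ((contDiff_moll n).continuous.integrable_of_hasCompactSupport (hasCompactSupport_moll n))
    (Eventually.of_forall (moll_nonneg n))
  rw [integral_moll, ENNReal.ofReal_one] at h
  rw [h]
  exact lintegral_congr fun x => by rw [Real.enorm_eq_ofReal (moll_nonneg n x)]

theorem tendsto_support_moll :
    Tendsto (fun n => Function.support (moll n)) atTop (𝓝 0).smallSets := by
  rw [tendsto_smallSets_iff]
  intro t ht
  obtain ⟨ε, hε, hb⟩ := Metric.mem_nhds_iff.1 ht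
  have : Tendsto (fun n : ℕ => ((n + 1 : ℝ))⁻¹) atTop (𝓝 0) := by
    simpa using tendsto_one_div_add_atTop_nhds_zero_nat (𝕜 := ℝ)
  filter_upwards [this.eventually (gt_mem_nhds hε)] with n hn
  exact (support_moll n).trans ((Metric.ball_subset_ball hn.le).trans hb)

theorem tendsto_conv_moll [CompleteSpace F] {f : Plane → F} (hf : LocallyIntegrable f) {x : Plane}
    (hx : ContinuousAt f x) : Tendsto (fun n => conv (moll n) f x) atTop (𝓝 (f x)) := by
  refine convolution_tendsto_right (φ := moll) (g := fun _ => f) (k := fun _ => x)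
    (Eventually.of_forall moll_nonneg) (Eventually.of_forall integral_moll)
    tendsto_support_moll (Eventually.of_forall fun _ => hf.aestronglyMeasurable) ?_
    tendsto_const_nhds
  exact hx.tendsto.comp tendsto_snd

theorem conv_sub_right {k : Plane → ℝ} {f g : Plane → F} (hk : Continuous k)
    (hc : HasCompactSupport k) (hf : LocallyIntegrable f) (hg : LocallyIntegrable g) :
    conv k (f - g) = conv k f - conv k g := by
  ext x
  simp only [conv, Pi.sub_apply]
  rw [← integral_sub (integrable_conv hk hc hf x) (integrable_conv hk hc hg x)]
  simp [smul_sub]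

theorem conv_norm_le {k : Plane → ℝ} {f : Plane → F} {M : ℝ}
    (hk : ∀ x, 0 ≤ k x) (hk1 : ∫ x, k x = 1) (hf : ∀ x, ‖f x‖ ≤ M) (x : Plane) :
    ‖conv k f x‖ ≤ M := by
  have hi : Integrable k := by
    by_contra h
    rw [integral_undef h] at hk1
    norm_num at hk1
  have hle : ∀ t, ‖k t • f (x - t)‖ ≤ k t * M := fun t => by
    rw [norm_smul, Real.norm_of_nonneg (hk t)]
    exact mul_le_mul_of_nonneg_left (hf _) (hk t)
  refine (norm_integral_le_of_norm_le (hi.mul_const M) (Eventually.of_forall hle)).trans ?_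
  rw [integral_mul_const, hk1, one_mul]

theorem tendsto_eLpNorm_conv_moll_of_hasCompactSupport [CompleteSpace F] {c : Plane → F}
    (hc : Continuous c)
    (hcs : HasCompactSupport c) :
    Tendsto (fun n => eLpNorm (conv (moll n) c - c) 2 volume) atTop (𝓝 0) := by
  obtain ⟨M, hM⟩ := hc.bounded_above_of_compact_support hcs
  have hM0 : 0 ≤ M := (norm_nonneg _).trans (hM 0)
  set K := Metric.cthickening 1 (tsupport c)
  have hK : IsCompact K := hcs.isCompact.cthickening
  have hout : ∀ n x, x ∉ K → conv (moll n) c x - c x = 0 := by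
    intro n x hx
    have hx0 : c x = 0 := by
      by_contra h
      exact hx (Metric.self_subset_cthickening _ (subset_tsupport c h))
    rw [hx0, sub_zero]
    unfold conv
    refine integral_eq_zero_of_ae (Eventually.of_forall fun t => ?_)
    by_cases ht : moll n t = 0
    · simp [ht]
    have h1 : ‖t‖ < (n + 1 : ℝ)⁻¹ := by simpa using support_moll n ht
    have h2 : (n + 1 : ℝ)⁻¹ ≤ 1 := inv_le_one_of_one_le₀ (by linarith [n.cast_nonneg (α := ℝ)])
    by_cases h : c (x - t) = 0
    · simp [h]
    exfalso
    refine hx (Metric.mem_cthickening_of_dist_le x (x - t) 1 _ (subset_tsupport c h) ?_)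
    rw [dist_eq_norm]; simpa using (h1.le.trans h2)
  have hsq : Tendsto (fun n => ∫⁻ x, ‖(conv (moll n) c - c) x‖ₑ ^ 2) atTop (𝓝 0) := by
    have h0 : (0 : ℝ≥0∞) = ∫⁻ _ : Plane, 0 := by simp
    rw [h0]
    refine tendsto_lintegral_of_dominated_convergence
      (K.indicator fun _ => ENNReal.ofReal (2 * M) ^ 2) ?_ ?_ ?_ ?_
    · intro n
      exact (((contDiff_conv (contDiff_moll n) (hasCompactSupport_moll n)
        hc.locallyIntegrable).continuous.sub hc).enorm.measurable.pow_const 2)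
    · intro n
      refine Eventually.of_forall fun x => ?_
      by_cases hx : x ∈ K
      · simp only [Set.indicator_of_mem hx]
        gcongr
        rw [← ofReal_norm]
        refine ENNReal.ofReal_le_ofReal ((norm_sub_le _ _).trans ?_)
        linarith [hM x, conv_norm_le (moll_nonneg n) (integral_moll n) hM x]
      · simp [Set.indicator_of_notMem hx, hout n x hx]
    · rw [lintegral_indicator hK.measurableSet]
      simp only [lintegral_const, Measure.restrict_apply_univ]
      exact (ENNReal.mul_lt_top (ENNReal.pow_lt_top ENNReal.ofReal_lt_top) hK.measure_lt_top).ne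
    · refine Eventually.of_forall fun x => ?_
      have := (tendsto_conv_moll hc.locallyIntegrable hc.continuousAt (x := x)).sub_const (c x)
      rw [sub_self] at this
      have := this.enorm
      simpa [Function.comp_def] using (ENNReal.continuous_pow 2).continuousAt.tendsto.comp this
  have h := (ENNReal.continuous_rpow_const (y := (1 / 2 : ℝ))).continuousAt.tendsto.comp hsq
  simp only [Function.comp_def] at h
  rw [ENNReal.zero_rpow_of_pos (by norm_num)] at h
  refine h.congr fun n => ?_
  rw [← eLpNorm_two_sq, ← ENNReal.rpow_natCast, ← ENNReal.rpow_mul]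
  norm_num

theorem tendsto_eLpNorm_conv_moll [CompleteSpace F] {g : Plane → F}
    (hg : MemLp g 2 volume) :
    Tendsto (fun n => eLpNorm (conv (moll n) g - g) 2 volume) atTop (𝓝 0) := by
  have hgl : LocallyIntegrable g := hg.locallyIntegrable (by norm_num)
  rw [ENNReal.tendsto_nhds_zero]
  intro ε hε
  obtain ⟨c, hcs, hcg, hcc, hcL⟩ := hg.exists_hasCompactSupport_eLpNorm_sub_le (by norm_num)
    (ε := ε / 3) (by simpa using hε.ne')
  have h := ENNReal.tendsto_nhds_zero.1 (tendsto_eLpNorm_conv_moll_of_hasCompactSupport hcc hcs)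
    (ε / 3) (by simpa using hε.ne')
  filter_upwards [h] with n hn
  have hkc := (contDiff_moll n).continuous
  have heq : conv (moll n) g - g = (conv (moll n) (g - c)) + ((conv (moll n) c - c) + (c - g)) := by
    rw [conv_sub_right hkc (hasCompactSupport_moll n) hgl hcc.locallyIntegrable]
    abel
  have hm1 : AEStronglyMeasurable (conv (moll n) (g - c)) := (contDiff_conv (contDiff_moll n)
    (hasCompactSupport_moll n) (hgl.sub hcc.locallyIntegrable)).continuous.aestronglyMeasurable
  have hm2 : AEStronglyMeasurable (conv (moll n) c - c) := ((contDiff_conv (contDiff_moll n)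
    (hasCompactSupport_moll n) hcc.locallyIntegrable).continuous.sub hcc).aestronglyMeasurable
  have hm3 : AEStronglyMeasurable (c - g) := hcc.aestronglyMeasurable.sub hg.1
  rw [heq]
  refine (eLpNorm_add_le hm1 (hm2.add hm3) (by norm_num)).trans ?_
  have h1 : eLpNorm (conv (moll n) (g - c)) 2 volume ≤ ε / 3 := by
    refine (eLpNorm_conv_le hkc (hg.1.sub hcc.aestronglyMeasurable)).trans ?_
    rw [lintegral_moll, one_mul]; exact hcg
  have h3 : eLpNorm (c - g) 2 volume ≤ ε / 3 := by rwa [eLpNorm_sub_comm]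
  calc _ ≤ ε / 3 + (ε / 3 + ε / 3) :=
        add_le_add h1 ((eLpNorm_add_le hm2 hm3 (by norm_num)).trans (add_le_add hn h3))
    _ = ε := by rw [← add_assoc]; exact ENNReal.add_thirds ε

end Mollifier

/-! ### Rotations of the plane and of space -/

section Rotations

theorem hasDerivAt_euclidean {d : ℕ} {f : ℝ → EuclideanSpace ℝ (Fin d)}
    {f' : EuclideanSpace ℝ (Fin d)} {t : ℝ} :
    HasDerivAt f f' t ↔ ∀ i, HasDerivAt (fun s => f s i) (f' i) t := by
  constructor
  · intro h i
    exact (EuclideanSpace.proj (𝕜 := ℝ) i).hasFDerivAt.comp_hasDerivAt t h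
  · intro h
    have h1 : HasDerivAt (fun s => (f s).ofLp) f'.ofLp t := hasDerivAt_pi.2 h
    exact (PiLp.continuousLinearEquiv 2 ℝ (fun _ : Fin d => ℝ)).symm.hasFDerivAt.comp_hasDerivAt
      t h1

theorem rot_add (a b : ℝ) (y : Space) : rot (a + b) y = rot a (rot b y) := by
  ext i
  fin_cases i <;> simp [rot, cos_add, sin_add] <;> ring

@[simp] theorem rot_zero (y : Space) : rot 0 y = y := by
  ext i
  fin_cases i <;> simp [rot]

theorem inner_space (x y : Space) : inner ℝ x y = x 0 * y 0 + x 1 * y 1 + x 2 * y 2 := by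
  simp [PiLp.inner_apply, Fin.sum_univ_three]; ring

theorem norm_sq_space (x : Space) : ‖x‖ ^ 2 = x 0 ^ 2 + x 1 ^ 2 + x 2 ^ 2 := by
  rw [EuclideanSpace.norm_sq_eq]; simp [Fin.sum_univ_three]

theorem norm_sq_plane (x : Plane) : ‖x‖ ^ 2 = x 0 ^ 2 + x 1 ^ 2 := by
  rw [EuclideanSpace.norm_sq_eq]; simp [Fin.sum_univ_two]

theorem norm_rot (a : ℝ) (y : Space) : ‖rot a y‖ = ‖y‖ := by
  rw [← sq_eq_sq₀ (norm_nonneg _) (norm_nonneg _), norm_sq_space, norm_sq_space]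
  simp [rot]
  linear_combination (y 0 ^ 2 + y 1 ^ 2) * sin_sq_add_cos_sq a

/-- The rotation `e^{αR}` as a linear map. -/
def rotL (a : ℝ) : Space →L[ℝ] Space := LinearMap.toContinuousLinearMap
  { toFun := rot a
    map_add' := fun x y => by ext i; fin_cases i <;> simp [rot] <;> ring
    map_smul' := fun c x => by ext i; fin_cases i <;> simp [rot] <;> ring }

@[simp] theorem rotL_apply (a : ℝ) (y : Space) : rotL a y = rot a y := rfl

/-- The generator `R` as a linear map. -/
def rotGenL : Space →L[ℝ] Space := LinearMap.toContinuousLinearMap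
  { toFun := rotGen
    map_add' := fun x y => by ext i; fin_cases i <;> simp [rotGen] <;> ring
    map_smul' := fun c x => by ext i; fin_cases i <;> (simp [rotGen]) }

@[simp] theorem rotGenL_apply (y : Space) : rotGenL y = rotGen y := rfl

theorem rotGen_rot (a : ℝ) (y : Space) : rotGen (rot a y) = rot a (rotGen y) := by
  ext i
  fin_cases i <;> simp [rot, rotGen] <;> ring

theorem norm_rotGen_le (y : Space) : ‖rotGen y‖ ≤ ‖y‖ := by
  refine le_of_sq_le_sq ?_ (norm_nonneg _)
  rw [norm_sq_space, norm_sq_space]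
  simp [rotGen]
  nlinarith [sq_nonneg (y 2)]
where
  le_of_sq_le_sq {a b : ℝ} (h : a ^ 2 ≤ b ^ 2) (hb : 0 ≤ b) : a ≤ b := by
    by_contra hc
    push Not at hc
    nlinarith

theorem hasDerivAt_rot (n θ : ℝ) (y : Space) :
    HasDerivAt (fun θ => rot (n * θ) y) (n • rotGen (rot (n * θ) y)) θ := by
  have h1 : HasDerivAt (fun θ => n * θ) n θ := by simpa using (hasDerivAt_id θ).const_mul n
  have hc := h1.cos
  have hs := h1.sin
  rw [hasDerivAt_euclidean]
  intro i
  fin_cases i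
  · exact ((hc.mul_const (y 0)).sub (hs.mul_const (y 1))).congr_deriv (by
      simp [rot, rotGen]; ring)
  · exact ((hs.mul_const (y 0)).add (hc.mul_const (y 1))).congr_deriv (by
      simp [rot, rotGen]; ring)
  · exact (hasDerivAt_const θ (y 2)).congr_deriv (by simp [rot, rotGen])

/-- The rotation of the plane by `θ`. -/
def rotP (θ : ℝ) : Plane ≃ₗᵢ[ℝ] Plane where
  toFun x := !₂[cos θ * x 0 - sin θ * x 1, sin θ * x 0 + cos θ * x 1]
  invFun x := !₂[cos θ * x 0 + sin θ * x 1, -sin θ * x 0 + cos θ * x 1]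
  map_add' x y := by ext i; fin_cases i <;> simp <;> ring
  map_smul' c x := by ext i; fin_cases i <;> simp <;> ring
  left_inv x := by
    have h := sin_sq_add_cos_sq θ
    ext i; fin_cases i <;> simp
    · linear_combination x 0 * h
    · linear_combination x 1 * h
  right_inv x := by
    have h := sin_sq_add_cos_sq θ
    ext i; fin_cases i <;> simp
    · linear_combination x 0 * h
    · linear_combination x 1 * h
  norm_map' x := by
    rw [← sq_eq_sq₀ (norm_nonneg _) (norm_nonneg _), norm_sq_plane, norm_sq_plane]
    simp
    linear_combination (x 0 ^ 2 + x 1 ^ 2) * sin_sq_add_cos_sq θ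

theorem rotP_apply (θ : ℝ) (x : Plane) :
    rotP θ x = !₂[cos θ * x 0 - sin θ * x 1, sin θ * x 0 + cos θ * x 1] := rfl

/-- The radial unit vector. -/
def er (θ : ℝ) : Plane := !₂[cos θ, sin θ]

/-- The angular unit vector. -/
def et (θ : ℝ) : Plane := !₂[-sin θ, cos θ]

theorem norm_er (θ : ℝ) : ‖er θ‖ = 1 := by
  rw [← sq_eq_sq₀ (norm_nonneg _) zero_le_one, norm_sq_plane]
  simp [er]

theorem er_ne_zero (θ : ℝ) : er θ ≠ 0 := by
  rw [← norm_ne_zero_iff, norm_er]; exact one_ne_zero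

theorem polar_eq (r θ : ℝ) : (!₂[r * cos θ, r * sin θ] : Plane) = r • er θ := by
  ext i; fin_cases i <;> simp [er]

theorem axis_eq (r : ℝ) : (!₂[r, 0] : Plane) = r • er 0 := by
  ext i; fin_cases i <;> simp [er]

theorem rotP_er (θ φ : ℝ) : rotP θ (er φ) = er (θ + φ) := by
  ext i; fin_cases i <;> simp [rotP_apply, er, cos_add, sin_add]

theorem eq_norm_smul_er (x : Plane) : x = ‖x‖ • er (angle x) := by
  have hn : ‖(⟨x 0, x 1⟩ : ℂ)‖ = ‖x‖ := by
    rw [← sq_eq_sq₀ (norm_nonneg _) (norm_nonneg _), norm_sq_plane, ← Complex.normSq_eq_norm_sq,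
      Complex.normSq_mk]
    ring
  have h1 := Complex.norm_mul_cos_arg (⟨x 0, x 1⟩ : ℂ)
  have h2 := Complex.norm_mul_sin_arg (⟨x 0, x 1⟩ : ℂ)
  rw [hn] at h1 h2
  ext i
  fin_cases i
  · simpa [er, angle] using h1.symm
  · simpa [er, angle] using h2.symm

theorem er_eq (θ : ℝ) : er θ = cos θ • EuclideanSpace.single 0 (1 : ℝ)
    + sin θ • EuclideanSpace.single 1 (1 : ℝ) := by
  ext i; fin_cases i <;> simp [er]

theorem et_eq (θ : ℝ) : et θ = (-sin θ) • EuclideanSpace.single 0 (1 : ℝ)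
    + cos θ • EuclideanSpace.single 1 (1 : ℝ) := by
  ext i; fin_cases i <;> simp [et]

end Rotations

/-! ### Equivariant maps and their profiles -/

section Equivariant

/-- Equivariance away from the origin. -/
def IsEquivariant (n : ℕ) (f : Plane → Space) : Prop :=
  ∀ (θ : ℝ) (x : Plane), x ≠ 0 → f (rotP θ x) = rot (n * θ) (f x)

theorem profile_eq (f : Plane → Space) (r : ℝ) : profile f r = f (r • er 0) := by
  rw [profile, axis_eq]

theorem IsEquivariant.apply_polar {n : ℕ} {f : Plane → Space} (h : IsEquivariant n f) {r : ℝ}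
    (hr : 0 < r) (θ : ℝ) : f (r • er θ) = rot (n * θ) (profile f r) := by
  rw [profile_eq, ← h θ _ (smul_ne_zero hr.ne' (er_ne_zero 0)), map_smul, rotP_er, add_zero]

theorem IsEquivariant.apply_eq {n : ℕ} {f : Plane → Space} (h : IsEquivariant n f) {x : Plane}
    (hx : x ≠ 0) : f x = rot (n * angle x) (profile f ‖x‖) := by
  conv_lhs => rw [eq_norm_smul_er x]
  exact h.apply_polar (norm_pos_iff.2 hx) _

theorem IsEquivariant.of_polar {n : ℕ} {f : Plane → Space} {p : ℝ → Space}
    (h : ∀ r : ℝ, 0 < r → ∀ θ : ℝ, f (r • er θ) = rot (n * θ) (p r)) : IsEquivariant n f := by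
  intro θ x hx
  have h0 := norm_pos_iff.2 hx
  rw [eq_norm_smul_er x, map_smul, rotP_er, h _ h0, h _ h0, mul_add, rot_add]

theorem IsSigma.isEquivariant {m : ℕ} {u : Plane → Space} (h : IsSigma m u) :
    IsEquivariant m u :=
  IsEquivariant.of_polar (p := profile u) fun r hr θ => by rw [← polar_eq, h.equivariant r hr θ]

theorem IsEquivariant.sub {n : ℕ} {f g : Plane → Space} (hf : IsEquivariant n f)
    (hg : IsEquivariant n g) : IsEquivariant n (fun x => f x - g x) := by
  intro θ x hx
  simp only
  rw [hf θ x hx, hg θ x hx, ← rotL_apply, ← rotL_apply, ← rotL_apply, map_sub]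

theorem IsEquivariant.conv {n : ℕ} {f : Plane → Space} (h : IsEquivariant n f) {φ : Plane → ℝ}
    (hφ : Continuous φ) (hc : HasCompactSupport φ) (hf : LocallyIntegrable f)
    (hrad : ∀ x y : Plane, ‖x‖ = ‖y‖ → φ x = φ y) : IsEquivariant n (conv φ f) := by
  intro θ x _
  have h1 : SchrodingerMap.conv φ f (rotP θ x) = ∫ t, φ (rotP θ t) • f (rotP θ x - rotP θ t) :=
    ((rotP θ).measurePreserving.integral_comp (rotP θ).toHomeomorph.measurableEmbedding
      (fun t => φ t • f (rotP θ x - t))).symm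
  rw [h1, ← rotL_apply]
  unfold SchrodingerMap.conv
  rw [← (rotL (n * θ)).integral_comp_comm (integrable_conv hφ hc hf x)]
  refine integral_congr_ae ?_
  have hne : ∀ᵐ t : Plane, t ≠ x := by simp [ae_iff]
  filter_upwards [hne] with t ht
  rw [hrad (rotP θ t) t ((rotP θ).norm_map t), ← map_sub, h θ (x - t) (sub_ne_zero.2 ht.symm),
    map_smul, rotL_apply]

variable {n : ℕ} {f : Plane → Space}

theorem contDiff_profile (hf : ContDiff ℝ ∞ f) : ContDiff ℝ ∞ (profile f) := by
  have : profile f = fun r => f (r • er 0) := funext (profile_eq f)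
  rw [this]
  exact hf.comp (contDiff_id.smul contDiff_const)

theorem hasDerivAt_ray {F : Type*} [NormedAddCommGroup F] [NormedSpace ℝ F] {f : Plane → F}
    {r θ : ℝ} (hf : DifferentiableAt ℝ f (r • er θ)) :
    HasDerivAt (fun r : ℝ => f (r • er θ)) (fderiv ℝ f (r • er θ) (er θ)) r := by
  have h : HasDerivAt (fun r : ℝ => r • er θ) (er θ) r := by
    simpa using (hasDerivAt_id r).smul_const (er θ)
  exact hf.hasFDerivAt.comp_hasDerivAt r h

theorem IsEquivariant.fderiv_er (h : IsEquivariant n f) (hf : ∀ x, x ≠ 0 → DifferentiableAt ℝ f x) {r : ℝ}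
    (hr : 0 < r) (θ : ℝ) :
    fderiv ℝ f (r • er θ) (er θ) = rot (n * θ) (deriv (profile f) r) := by
  have h1 := hasDerivAt_ray (hf (r • er θ) (smul_ne_zero hr.ne' (er_ne_zero θ)))
  have h0 := hasDerivAt_ray (hf (r • er 0) (smul_ne_zero hr.ne' (er_ne_zero 0)))
  have hp : deriv (profile f) r = fderiv ℝ f (r • er 0) (er 0) := by
    have : profile f = fun r => f (r • er 0) := funext (profile_eq f)
    rw [this]; exact h0.deriv
  have h2 : HasDerivAt (fun s => rotL (n * θ) (profile f s))
      (rotL (n * θ) (deriv (profile f) r)) r := by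
    rw [hp]
    have : profile f = fun r => f (r • er 0) := funext (profile_eq f)
    rw [this]
    exact (rotL (n * θ)).hasFDerivAt.comp_hasDerivAt r h0
  have h3 : (fun s => f (s • er θ)) =ᶠ[𝓝 r] fun s => rotL (n * θ) (profile f s) := by
    filter_upwards [lt_mem_nhds hr] with s hs
    exact h.apply_polar hs θ
  exact h1.unique (h2.congr_of_eventuallyEq h3)

/-- Rotation of the plane by a right angle. -/
def rightAngle : Plane →L[ℝ] Plane := LinearMap.toContinuousLinearMap
  { toFun := fun x => !₂[-(x 1), x 0]
    map_add' := fun x y => by ext i; fin_cases i <;> simp <;> ring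
    map_smul' := fun c x => by ext i; fin_cases i <;> simp }

theorem rightAngle_apply (x : Plane) : rightAngle x = !₂[-(x 1), x 0] := rfl

theorem rightAngle_rightAngle (x : Plane) : rightAngle (rightAngle x) = -x := by
  ext i; fin_cases i <;> simp [rightAngle_apply]

theorem rightAngle_er (θ : ℝ) : rightAngle (er θ) = et θ := by
  ext i; fin_cases i <;> simp [rightAngle_apply, er, et]

theorem hasDerivAt_rotP (x : Plane) : HasDerivAt (fun θ => rotP θ x) (rightAngle x) 0 := by
  rw [hasDerivAt_euclidean]
  have hc := Real.hasDerivAt_cos 0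
  have hs := Real.hasDerivAt_sin 0
  intro i
  fin_cases i
  · exact ((hc.mul_const (x 0)).sub (hs.mul_const (x 1))).congr_deriv (by simp [rightAngle_apply])
  · exact ((hs.mul_const (x 0)).add (hc.mul_const (x 1))).congr_deriv (by simp [rightAngle_apply])

theorem rotP_zero (x : Plane) : rotP 0 x = x := by
  ext i; fin_cases i <;> simp [rotP_apply]

theorem IsEquivariant.fderiv_rightAngle (h : IsEquivariant n f) (hf : ∀ x, x ≠ 0 → DifferentiableAt ℝ f x)
    {x : Plane} (hx : x ≠ 0) : fderiv ℝ f x (rightAngle x) = (n : ℝ) • rotGen (f x) := by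
  have h1 : HasDerivAt (fun θ => f (rotP θ x)) (fderiv ℝ f x (rightAngle x)) 0 := by
    have hd := (hf (rotP 0 x) (by rwa [rotP_zero])).hasFDerivAt.comp_hasDerivAt (0 : ℝ) (hasDerivAt_rotP x)
    rwa [rotP_zero] at hd
  have h2 := hasDerivAt_rot n 0 (f x)
  simp only [mul_zero, rot_zero] at h2
  have h3 : (fun θ => f (rotP θ x)) = fun θ => rot (n * θ) (f x) := funext fun θ => h θ x hx
  rw [h3] at h1
  exact h1.unique h2

theorem IsEquivariant.fderiv_et (h : IsEquivariant n f) (hf : ∀ x, x ≠ 0 → DifferentiableAt ℝ f x) {r : ℝ}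
    (hr : 0 < r) (θ : ℝ) :
    fderiv ℝ f (r • er θ) (et θ) = (n / r : ℝ) • rot (n * θ) (rotGen (profile f r)) := by
  have h1 := h.fderiv_rightAngle hf (smul_ne_zero hr.ne' (er_ne_zero θ))
  rw [map_smul, rightAngle_er, map_smul, h.apply_polar hr, rotGen_rot] at h1
  rw [← inv_smul_smul₀ hr.ne' (fderiv ℝ f (r • er θ) (et θ)), h1, smul_smul, inv_mul_eq_div]

theorem norm_sq_frame {V : Type*} [NormedAddCommGroup V] [InnerProductSpace ℝ V] (a b : V) (θ : ℝ) :
    ‖cos θ • a + sin θ • b‖ ^ 2 + ‖(-sin θ) • a + cos θ • b‖ ^ 2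
      = ‖a‖ ^ 2 + ‖b‖ ^ 2 := by
  rw [@norm_add_sq_real, @norm_add_sq_real]
  simp only [norm_smul, inner_smul_left, inner_smul_right, mul_pow, Real.norm_eq_abs, sq_abs]
  simp
  linear_combination (‖a‖ ^ 2 + ‖b‖ ^ 2) * sin_sq_add_cos_sq θ

theorem fderiv_er_eq {F : Type*} [NormedAddCommGroup F] [NormedSpace ℝ F] (f : Plane → F)
    (x : Plane) (θ : ℝ) :
    fderiv ℝ f x (er θ) = cos θ • pd 0 f x + sin θ • pd 1 f x := by
  rw [er_eq, map_add, map_smul, map_smul]; rfl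

theorem fderiv_et_eq {F : Type*} [NormedAddCommGroup F] [NormedSpace ℝ F] (f : Plane → F)
    (x : Plane) (θ : ℝ) :
    fderiv ℝ f x (et θ) = (-sin θ) • pd 0 f x + cos θ • pd 1 f x := by
  rw [et_eq, map_add, map_smul, map_smul]; rfl

/-- The squared gradient of an equivariant map in terms of its profile. -/
theorem IsEquivariant.sum_norm_pd_sq (h : IsEquivariant n f) (hf : ∀ x, x ≠ 0 → DifferentiableAt ℝ f x) {x : Plane}
    (hx : x ≠ 0) : ‖pd 0 f x‖ ^ 2 + ‖pd 1 f x‖ ^ 2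
      = ‖deriv (profile f) ‖x‖‖ ^ 2 + (n / ‖x‖) ^ 2 * ‖rotGen (profile f ‖x‖)‖ ^ 2 := by
  have hr := norm_pos_iff.2 hx
  have h1 := h.fderiv_er hf hr (angle x)
  have h2 := h.fderiv_et hf hr (angle x)
  rw [← eq_norm_smul_er] at h1 h2
  rw [← norm_sq_frame (pd 0 f x) (pd 1 f x) (angle x), ← fderiv_er_eq, ← fderiv_et_eq, h1, h2,
    norm_smul, norm_rot, norm_rot, mul_pow, Real.norm_eq_abs, sq_abs]

end Equivariant

section Polar

theorem fderiv_fderiv_apply {F : Type*} [NormedAddCommGroup F] [NormedSpace ℝ F] {f : Plane → F}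
    (hf : ContDiff ℝ ∞ f) (x v w : Plane) :
    fderiv ℝ (fun y => fderiv ℝ f y v) x w = fderiv ℝ (fderiv ℝ f) x w v := by
  have hd : DifferentiableAt ℝ (fderiv ℝ f) x :=
    ((hf.fderiv_right (m := ∞) (by simp)).differentiable (by simp)) x
  have h := hd.hasFDerivAt.clm_apply (hasFDerivAt_const v x)
  rw [h.fderiv]
  simp

theorem pd_pd_eq {F : Type*} [NormedAddCommGroup F] [NormedSpace ℝ F] {f : Plane → F}
    (hf : ContDiff ℝ ∞ f) (i j : Fin 2) (x : Plane) :
    pd i (pd j f) x = fderiv ℝ (fderiv ℝ f) x (EuclideanSpace.single i (1 : ℝ))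
      (EuclideanSpace.single j (1 : ℝ)) :=
  fderiv_fderiv_apply hf x _ _

theorem pd_comm {F : Type*} [NormedAddCommGroup F] [NormedSpace ℝ F] {f : Plane → F}
    (hf : ContDiff ℝ ∞ f) (i j : Fin 2) : pd i (pd j f) = pd j (pd i f) := by
  ext x
  rw [pd_pd_eq hf, pd_pd_eq hf]
  have : IsSymmSndFDerivAt ℝ f x := hf.contDiffAt.isSymmSndFDerivAt (by
    simp only [minSmoothness_of_isRCLikeNormedField]; exact WithTop.coe_le_coe.2 (le_top : (2 : ℕ∞) ≤ ⊤))
  exact this _ _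

/-- The radial part `p'' + p'/r + n² R² p / r²` of the Laplacian of an equivariant map. -/
def radLap (n : ℕ) (p : ℝ → Space) (r : ℝ) : Space :=
  deriv (deriv p) r + r⁻¹ • deriv p r + (n / r : ℝ) ^ 2 • rotGen (rotGen (p r))

variable {n : ℕ} {f : Plane → Space}

theorem IsEquivariant.laplacian_apply (h : IsEquivariant n f) (hf : ContDiff ℝ ∞ f) {r : ℝ}
    (hr : 0 < r) (θ : ℝ) :
    Laplacian.laplacian f (r • er θ) = rot (n * θ) (radLap n (profile f) r) := by
  set x := r • er θ with hx
  have hx0 : x ≠ 0 := smul_ne_zero hr.ne' (er_ne_zero θ)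
  set B := fderiv ℝ (fderiv ℝ f) x with hB
  have hdf : Differentiable ℝ f := hf.differentiable (by simp)
  have hdf2 : Differentiable ℝ (fderiv ℝ f) :=
    (hf.fderiv_right (m := ∞) (by simp)).differentiable (by simp)
  have hsum : Laplacian.laplacian f x = B (er θ) (er θ) + B (et θ) (et θ) := by
    rw [laplacian_eq_pd hf]
    simp only [Fin.sum_univ_two, pd_pd_eq hf, ← hB, er_eq, et_eq]
    simp only [map_add, map_smul, add_apply, smul_apply]
    have h1 := sin_sq_add_cos_sq θ
    simp only [smul_add, smul_smul]
    generalize B (EuclideanSpace.single 0 1) (EuclideanSpace.single 0 1) = b00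
    generalize B (EuclideanSpace.single 0 1) (EuclideanSpace.single 1 1) = b01
    generalize B (EuclideanSpace.single 1 1) (EuclideanSpace.single 0 1) = b10
    generalize B (EuclideanSpace.single 1 1) (EuclideanSpace.single 1 1) = b11
    ext i
    simp
    linear_combination (-b00 i - b11 i) * h1
  have hrr : B (er θ) (er θ) = rot (n * θ) (deriv (deriv (profile f)) r) := by
    have hd1 : Differentiable ℝ (fun y => fderiv ℝ f y (er θ)) := fun y =>
      (hdf2 y).clm_apply (differentiableAt_const _)
    have h1 := hasDerivAt_ray (hd1 (r • er θ))
    rw [fderiv_fderiv_apply hf, ← hx, ← hB] at h1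
    have hp2 : HasDerivAt (deriv (profile f)) (deriv (deriv (profile f)) r) r := by
      have : ContDiff ℝ ∞ (deriv (profile f)) := (contDiff_infty_iff_deriv.1 (contDiff_profile hf)).2
      exact (this.differentiable (by simp) r).hasDerivAt
    have h2 := (rotL (n * θ)).hasFDerivAt.comp_hasDerivAt r hp2
    have h3 : (fun s => fderiv ℝ f (s • er θ) (er θ)) =ᶠ[𝓝 r]
        (rotL (n * θ)) ∘ deriv (profile f) := by
      filter_upwards [lt_mem_nhds hr] with s hs
      exact h.fderiv_er (fun x _ => hdf x) hs θ
    exact h1.unique (h2.congr_of_eventuallyEq h3)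
  have htt : B (rightAngle x) (rightAngle x)
      = (n : ℝ) ^ 2 • rotGen (rotGen (f x)) + fderiv ℝ f x x := by
    have h1 := (hdf2 x).hasFDerivAt.clm_apply (rightAngle.hasFDerivAt (x := x))
    have h2 : HasFDerivAt (fun y => (n : ℝ) • rotGenL (f y))
        ((n : ℝ) • (rotGenL ∘L fderiv ℝ f x)) x :=
      (rotGenL.hasFDerivAt.comp x (hdf x).hasFDerivAt).const_smul (n : ℝ)
    have h3 : (fun y => fderiv ℝ f y (rightAngle y)) =ᶠ[𝓝 x] fun y => (n : ℝ) • rotGenL (f y) := by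
      filter_upwards [isOpen_ne.mem_nhds hx0] with y hy
      exact h.fderiv_rightAngle (fun x _ => hdf x) hy
    have h4 := h1.unique (h2.congr_of_eventuallyEq h3)
    have h5 := congrArg (fun L : Plane →L[ℝ] Space => L (rightAngle x)) h4
    simp only [add_apply, smul_apply, ContinuousLinearMap.comp_apply,
      ContinuousLinearMap.flip_apply, rightAngle_rightAngle, map_neg] at h5
    rw [h.fderiv_rightAngle (fun x _ => hdf x) hx0, rotGenL.map_smul, smul_smul, ← sq, ← hB, rotGenL_apply] at h5
    rw [← sub_eq_iff_eq_add, sub_eq_add_neg, add_comm]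
    exact h5
  rw [hsum, hrr]
  have h6 : B (et θ) (et θ) = (r⁻¹ * r⁻¹) • B (rightAngle x) (rightAngle x) := by
    rw [hx, map_smul, rightAngle_er]
    simp only [map_smul, smul_apply, smul_smul]
    rw [show r⁻¹ * r⁻¹ * (r * r) = 1 by field_simp, one_smul]
  have h7 : fderiv ℝ f x x = r • rot (n * θ) (deriv (profile f) r) := by
    conv_lhs => rw [hx, map_smul, h.fderiv_er (fun x _ => hdf x) hr]
  rw [h6, htt, h7, hx, h.apply_polar hr, rotGen_rot, rotGen_rot]
  unfold radLap
  simp only [← rotL_apply, map_add, map_smul, smul_add, smul_smul]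
  rw [show r⁻¹ * r⁻¹ * r = r⁻¹ by field_simp, show r⁻¹ * r⁻¹ * (n : ℝ) ^ 2 = (n / r : ℝ) ^ 2 by
    field_simp]
  abel

theorem IsEquivariant.laplacian (h : IsEquivariant n f) (hf : ContDiff ℝ ∞ f) :
    IsEquivariant n (Laplacian.laplacian f) :=
  IsEquivariant.of_polar fun _ hr θ => h.laplacian_apply hf hr θ

theorem IsEquivariant.profile_laplacian (h : IsEquivariant n f) (hf : ContDiff ℝ ∞ f) {r : ℝ}
    (hr : 0 < r) : profile (Laplacian.laplacian f) r = radLap n (profile f) r := by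
  rw [profile_eq, h.laplacian_apply hf hr]; simp

theorem contDiff_laplacian (hf : ContDiff ℝ ∞ f) : ContDiff ℝ ∞ (Laplacian.laplacian f) := by
  rw [laplacian_eq_pd hf]
  exact ContDiff.sum fun i _ => contDiff_pd (contDiff_pd hf)

theorem IsEquivariant.norm_laplacian (h : IsEquivariant n f) (hf : ContDiff ℝ ∞ f) {x : Plane}
    (hx : x ≠ 0) : ‖Laplacian.laplacian f x‖ = ‖radLap n (profile f) ‖x‖‖ := by
  conv_lhs => rw [eq_norm_smul_er x]
  rw [h.laplacian_apply hf (norm_pos_iff.2 hx), norm_rot]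

/-- The gradient of the Laplacian of an equivariant map. -/
theorem IsEquivariant.sum_norm_pd_laplacian_sq (h : IsEquivariant n f) (hf : ContDiff ℝ ∞ f)
    {x : Plane} (hx : x ≠ 0) :
    ‖pd 0 (Laplacian.laplacian f) x‖ ^ 2 + ‖pd 1 (Laplacian.laplacian f) x‖ ^ 2
      = ‖deriv (radLap n (profile f)) ‖x‖‖ ^ 2
        + (n / ‖x‖) ^ 2 * ‖rotGen (radLap n (profile f) ‖x‖)‖ ^ 2 := by
  rw [(h.laplacian hf).sum_norm_pd_sq (fun x _ => (contDiff_laplacian hf).differentiable (by simp) x) hx]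
  have hr := norm_pos_iff.2 hx
  rw [h.profile_laplacian hf hr]
  have : profile (Laplacian.laplacian f) =ᶠ[𝓝 ‖x‖] radLap n (profile f) := by
    filter_upwards [lt_mem_nhds hr] with s hs
    exact h.profile_laplacian hf hs
  rw [this.deriv_eq]

theorem IsEquivariant.norm_iteratedDeriv_profile_le (h : IsEquivariant n f)
    (hf : ContDiff ℝ ∞ f) (k : ℕ) {x : Plane} (hx : x ≠ 0) :
    ‖iteratedDeriv k (profile f) ‖x‖‖ ≤ ∑ I : Fin k → Fin 2, ‖pdI I f x‖ := by
  have hr := norm_pos_iff.2 hx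
  set θ := angle x
  set r := ‖x‖ with hrdef
  have hxe : x = r • er θ := eq_norm_smul_er x
  let L : ℝ →L[ℝ] Plane := ContinuousLinearMap.toSpanSingleton ℝ (er θ)
  have h1 : profile f =ᶠ[𝓝 r] rotL (-(n * θ)) ∘ (f ∘ L) := by
    filter_upwards [lt_mem_nhds hr] with s hs
    have : L s = s • er θ := rfl
    simp only [Function.comp_apply, this, h.apply_polar hs θ, rotL_apply]
    rw [← rot_add]; simp
  have h2 : iteratedFDeriv ℝ k (profile f) r = iteratedFDeriv ℝ k (rotL (-(n * θ)) ∘ (f ∘ L)) r :=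
    (h1.iteratedFDeriv ℝ k).eq_of_nhds
  have hL : L r = x := by rw [hxe]; rfl
  have hcd : ContDiff ℝ ∞ (f ∘ L) := hf.comp L.contDiff
  have h3 : iteratedFDeriv ℝ k (rotL (-(n * θ)) ∘ (f ∘ L)) r
      = (rotL (-(n * θ))).compContinuousMultilinearMap (iteratedFDeriv ℝ k (f ∘ L) r) :=
    (rotL (-(n * θ))).iteratedFDeriv_comp_left hcd.contDiffAt (by exact_mod_cast le_top)
  have h4 : iteratedFDeriv ℝ k (f ∘ L) r
      = (iteratedFDeriv ℝ k f x).compContinuousLinearMap (fun _ => L) := by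
    rw [L.iteratedFDeriv_comp_right hf r (by exact_mod_cast le_top), hL]
  rw [iteratedDeriv_eq_iteratedFDeriv, h2, h3, h4]
  simp only [ContinuousLinearMap.compContinuousMultilinearMap_coe, Function.comp_apply,
    rotL_apply, norm_rot, ContinuousMultilinearMap.compContinuousLinearMap_apply]
  have hL1 : L 1 = ∑ i : Fin 2, (er θ i) • EuclideanSpace.single i (1 : ℝ) := by
    have : L 1 = er θ := by simp [L]
    rw [this, Fin.sum_univ_two]
    exact er_eq θ
  simp only [hL1]
  rw [ContinuousMultilinearMap.map_sum]
  refine (norm_sum_le _ _).trans (Finset.sum_le_sum fun I _ => ?_)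
  rw [ContinuousMultilinearMap.map_smul_univ, norm_smul]
  refine mul_le_of_le_one_left (norm_nonneg _) ?_
  rw [norm_prod]
  refine Finset.prod_le_one (fun _ _ => norm_nonneg _) fun j _ => ?_
  have := EuclideanSpace.norm_eq (er θ)
  exact (PiLp.norm_apply_le (er θ) (I j)).trans (norm_er θ).le

end Polar

section SecondOrder

theorem memLp_pdI_conv {φ : Plane → ℝ} {g : Plane → Space} (hφ : ContDiff ℝ ∞ φ)
    (hc : HasCompactSupport φ) (hg : MemLp g 2 volume) {k : ℕ} (I : Fin k → Fin 2) :
    MemLp (pdI I (conv φ g)) 2 volume := by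
  have hgl : LocallyIntegrable g := hg.locallyIntegrable (by norm_num)
  rw [pdI_conv hφ hc hgl]
  exact memLp_conv (contDiff_pdI hφ) (hasCompactSupport_pdI hc) hgl hg

theorem integrable_inner_of_memLp {α : Type*} [MeasurableSpace α] {μ : Measure α} {f g : α → Space}
    (hf : MemLp f 2 μ) (hg : MemLp g 2 μ) : Integrable (fun x => inner ℝ (f x) (g x)) μ := by
  refine (hf.norm.integrable_mul hg.norm).mono (hf.1.inner hg.1) (Eventually.of_forall fun x => ?_)
  simpa using norm_inner_le_norm (𝕜 := ℝ) (f x) (g x)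

theorem eLpNorm_two_sq_eq_ofReal {α : Type*} [MeasurableSpace α] {μ : Measure α} {f : α → Space}
    (hf : MemLp f 2 μ) : eLpNorm f 2 μ ^ 2 = ENNReal.ofReal (∫ x, inner ℝ (f x) (f x) ∂μ) := by
  rw [eLpNorm_two_sq, ofReal_integral_eq_lintegral_ofReal (integrable_inner_of_memLp hf hf)
    (Eventually.of_forall fun x => real_inner_self_nonneg)]
  refine lintegral_congr fun x => ?_
  rw [real_inner_self_eq_norm_sq, ENNReal.ofReal_pow (norm_nonneg _), ofReal_norm]

theorem integral_inner_pd {f g : Plane → Space} (hf : ContDiff ℝ ∞ f) (hg : ContDiff ℝ ∞ g)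
    (i : Fin 2) (h1 : MemLp f 2 volume) (h2 : MemLp g 2 volume) (h3 : MemLp (pd i f) 2 volume)
    (h4 : MemLp (pd i g) 2 volume) :
    ∫ x, inner ℝ (pd i f x) (g x) = - ∫ x, inner ℝ (f x) (pd i g x) := by
  have := integral_bilinear_fderiv_right_eq_neg_left_of_integrable (μ := (volume : Measure Plane))
    (f := f) (g := g) (B := innerSL ℝ) (v := EuclideanSpace.single i (1 : ℝ))
    (integrable_inner_of_memLp h3 h2) (integrable_inner_of_memLp h1 h4)
    (integrable_inner_of_memLp h1 h2)
    (fun x _ => hf.differentiable (by simp) x) (fun x _ => hg.differentiable (by simp) x)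
  change ∫ x, inner ℝ (f x) (pd i g x) = - ∫ x, inner ℝ (pd i f x) (g x) at this
  rw [this, neg_neg]

/-- The `L²` norms of the Hessian and of the Laplacian agree. -/
theorem sum_eLpNorm_pd_pd_conv {φ : Plane → ℝ} {g : Plane → Space} (hφ : ContDiff ℝ ∞ φ)
    (hc : HasCompactSupport φ) (hg : MemLp g 2 volume) :
    ∑ i, ∑ j, eLpNorm (pd i (pd j (conv φ g))) 2 volume ^ 2
      = eLpNorm (Laplacian.laplacian (conv φ g)) 2 volume ^ 2 := by
  have hgl : LocallyIntegrable g := hg.locallyIntegrable (by norm_num)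
  set h := conv φ g with hh
  have hs : ContDiff ℝ ∞ h := contDiff_conv hφ hc hgl
  have m1 : ∀ i, MemLp (pd i h) 2 volume := fun i => by
    have := memLp_pdI_conv hφ hc hg ![i]
    rwa [pdI_succ _ hs, pdI_zero] at this
  have m2 : ∀ i j, MemLp (pd i (pd j h)) 2 volume := fun i j => by
    have := memLp_pdI_conv hφ hc hg ![i, j]
    rwa [pdI_succ _ hs, pdI_succ _ hs, pdI_zero] at this
  have m3 : ∀ i j k, MemLp (pd i (pd j (pd k h))) 2 volume := fun i j k => by
    have := memLp_pdI_conv hφ hc hg ![i, j, k]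
    rwa [pdI_succ _ hs, pdI_succ _ hs, pdI_succ _ hs, pdI_zero] at this
  have s1 : ∀ i, ContDiff ℝ ∞ (pd i h) := fun i => contDiff_pd hs
  have s2 : ∀ i j, ContDiff ℝ ∞ (pd i (pd j h)) := fun i j => contDiff_pd (s1 j)
  have key : ∀ i j, ∫ x, inner ℝ (pd i (pd j h) x) (pd i (pd j h) x)
      = ∫ x, inner ℝ (pd j (pd j h) x) (pd i (pd i h) x) := fun i j => by
    rw [integral_inner_pd (s1 j) (s2 i j) i (m1 j) (m2 i j) (m2 i j) (m3 i i j)]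
    rw [pd_comm hs i j, pd_comm (s1 i) i j, integral_inner_pd (s1 j) (s2 i i) j (m1 j) (m2 i i)
      (m2 j j) (m3 j i i)]
  have hL : MemLp (Laplacian.laplacian h) 2 volume := by
    rw [laplacian_eq_pd hs]
    exact memLp_finsetSum _ fun i _ => m2 i i
  simp only [eLpNorm_two_sq_eq_ofReal (m2 _ _), eLpNorm_two_sq_eq_ofReal hL]
  have hnn : ∀ i j, 0 ≤ ∫ x, inner ℝ (pd i (pd j h) x) (pd i (pd j h) x) := fun i j =>
    integral_nonneg fun x => real_inner_self_nonneg
  simp only [Fin.sum_univ_two]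
  rw [← ENNReal.ofReal_add (hnn _ _) (hnn _ _), ← ENNReal.ofReal_add (hnn _ _) (hnn _ _),
    ← ENNReal.ofReal_add (add_nonneg (hnn _ _) (hnn _ _)) (add_nonneg (hnn _ _) (hnn _ _))]
  congr 1
  rw [key 0 0, key 0 1, key 1 0, key 1 1]
  have hi : ∀ i j k l, Integrable (fun x => inner ℝ (pd i (pd j h) x) (pd k (pd l h) x)) :=
    fun i j k l => integrable_inner_of_memLp (m2 i j) (m2 k l)
  have hi2 : ∀ i j k l i' j' k' l', Integrable (fun x => inner ℝ (pd i (pd j h) x) (pd k (pd l h) x)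
      + inner ℝ (pd i' (pd j' h) x) (pd k' (pd l' h) x)) :=
    fun i j k l i' j' k' l' => (hi i j k l).add (hi i' j' k' l')
  rw [← integral_add (hi _ _ _ _) (hi _ _ _ _), ← integral_add (hi _ _ _ _) (hi _ _ _ _),
    ← integral_add (hi2 _ _ _ _ _ _ _ _) (hi2 _ _ _ _ _ _ _ _)]
  refine integral_congr_ae (Eventually.of_forall fun x => ?_)
  rw [laplacian_eq_pd hs]
  simp only [Fin.sum_univ_two, Pi.add_apply, inner_add_left, inner_add_right]

end SecondOrder

/-! ### Limits of derivatives on the half line -/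

section Limits

set_option linter.unusedSectionVars false

variable {E : Type*} [NormedAddCommGroup E] [NormedSpace ℝ E] [CompleteSpace E]

/-- Convergence in `L¹` on compact subintervals of `(0,∞)`. -/
def TendstoL1Loc (g : ℕ → ℝ → E) (γ : ℝ → E) : Prop :=
  ∀ a b : ℝ, 0 < a → a ≤ b → IntervalIntegrable γ volume a b ∧
    Tendsto (fun j => ∫ t in a..b, ‖g j t - γ t‖) atTop (𝓝 0)

theorem intervalIntegrable_of_pos {γ : ℝ → E}
    (h : ∀ a b : ℝ, 0 < a → a ≤ b → IntervalIntegrable γ volume a b) {a b : ℝ} (ha : 0 < a)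
    (hb : 0 < b) : IntervalIntegrable γ volume a b := by
  rcases le_total a b with hab | hab
  · exact h a b ha hab
  · exact (h b a hb hab).symm

theorem norm_sub_primitive_le {g g' : ℝ → E} {γ : ℝ → E} {c : E} {a b r : ℝ}
    (hg : ∀ t, HasDerivAt g (g' t) t) (hg' : Continuous g') (hab : a ≤ b)
    (hγ : IntervalIntegrable γ volume a b) (h1 : (1 : ℝ) ∈ Set.Icc a b) (hr : r ∈ Set.Icc a b) :
    ‖g r - (c + ∫ t in (1 : ℝ)..r, γ t)‖ ≤ ‖g 1 - c‖ + ∫ t in a..b, ‖g' t - γ t‖ := by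
  have hγ1 : IntervalIntegrable γ volume 1 r := hγ.mono_set (by
    rw [Set.uIcc_of_le hab]; exact Set.uIcc_subset_Icc h1 hr)
  have hftc : ∫ t in (1 : ℝ)..r, g' t = g r - g 1 :=
    intervalIntegral.integral_eq_sub_of_hasDerivAt (fun t _ => hg t) (hg'.intervalIntegrable _ _)
  have : g r - (c + ∫ t in (1 : ℝ)..r, γ t) = (g 1 - c) + ∫ t in (1 : ℝ)..r, (g' t - γ t) := by
    rw [intervalIntegral.integral_sub (hg'.intervalIntegrable _ _) hγ1, hftc]; abel
  rw [this]
  refine (norm_add_le _ _).trans (add_le_add le_rfl ?_)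
  refine intervalIntegral.norm_integral_le_abs_integral_norm.trans ?_
  have hi : IntervalIntegrable (fun t => ‖g' t - γ t‖) volume a b :=
    ((hg'.intervalIntegrable _ _).sub hγ).norm
  rw [intervalIntegral.abs_integral_eq_abs_integral_uIoc, intervalIntegral.integral_of_le hab,
    abs_of_nonneg (integral_nonneg fun t => norm_nonneg _)]
  refine setIntegral_mono_set ?_ (Eventually.of_forall fun t => norm_nonneg _)
    (LE.le.eventuallyLE ?_)
  · rwa [intervalIntegrable_iff_integrableOn_Ioc_of_le hab] at hi
  · exact Set.Ioc_subset_Ioc (le_min h1.1 hr.1) (max_le h1.2 hr.2)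

theorem continuousOn_primitive_Ioi {γ : ℝ → E}
    (h : ∀ a b : ℝ, 0 < a → a ≤ b → IntervalIntegrable γ volume a b) :
    ContinuousOn (fun r => ∫ t in (1 : ℝ)..r, γ t) (Set.Ioi 0) := by
  intro r hr
  have hr0 : (0 : ℝ) < r := hr
  have hab : min 1 (r / 2) ≤ max 1 (2 * r) := (min_le_left _ _).trans (le_max_left _ _)
  have ha : 0 < min 1 (r / 2) := by positivity
  have hc := intervalIntegral.continuousOn_primitive_interval' (a := 1) (h _ _ ha hab)
    (by rw [Set.uIcc_of_le hab]; exact ⟨min_le_left _ _, le_max_left _ _⟩)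
  rw [Set.uIcc_of_le hab] at hc
  refine (hc.continuousAt (Icc_mem_nhds ?_ ?_)).continuousWithinAt
  · exact (min_le_right _ _).trans_lt (by linarith)
  · exact lt_of_lt_of_le (by linarith) (le_max_right _ _)

/-- If the derivatives converge in `L¹` and the values at `1` converge, then the functions converge
pointwise and in `L¹`. -/
theorem TendstoL1Loc.primitive {g g' : ℕ → ℝ → E} {γ : ℝ → E} {c : E}
    (hg : ∀ j t, HasDerivAt (g j) (g' j t) t) (hg' : ∀ j, Continuous (g' j))
    (h : TendstoL1Loc g' γ) (h1 : Tendsto (fun j => g j 1) atTop (𝓝 c)) :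
    (∀ r, 0 < r → Tendsto (fun j => g j r) atTop (𝓝 (c + ∫ t in (1 : ℝ)..r, γ t))) ∧
      TendstoL1Loc g (fun r => c + ∫ t in (1 : ℝ)..r, γ t) := by
  have hb : ∀ a b : ℝ, 0 < a → a ≤ b → (1 : ℝ) ∈ Set.Icc a b →
      Tendsto (fun j => ‖g j 1 - c‖ + ∫ t in a..b, ‖g' j t - γ t‖) atTop (𝓝 0) := by
    intro a b ha hab _
    have h2 := tendsto_iff_norm_sub_tendsto_zero.1 h1
    simpa using h2.add (h a b ha hab).2
  have hint := fun a b ha hab => (h a b ha hab).1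
  constructor
  · intro r hr
    rw [tendsto_iff_norm_sub_tendsto_zero]
    have hm1 : (1 : ℝ) ∈ Set.Icc (min 1 r) (max 1 r) := ⟨min_le_left _ _, le_max_left _ _⟩
    have hm2 : r ∈ Set.Icc (min 1 r) (max 1 r) := ⟨min_le_right _ _, le_max_right _ _⟩
    have ha : 0 < min 1 r := lt_min one_pos hr
    have hab : min 1 r ≤ max 1 r := hm1.1.trans hm1.2
    exact squeeze_zero (fun _ => norm_nonneg _) (fun j => norm_sub_primitive_le (hg j) (hg' j) hab
      (hint _ _ ha hab) hm1 hm2) (hb _ _ ha hab hm1)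
  · intro a b ha hab
    have hcont : ContinuousOn (fun r => c + ∫ t in (1 : ℝ)..r, γ t) (Set.Icc a b) :=
      continuousOn_const.add ((continuousOn_primitive_Ioi hint).mono fun x hx => ha.trans_le hx.1)
    have hii : IntervalIntegrable (fun r => c + ∫ t in (1 : ℝ)..r, γ t) volume a b :=
      (by rwa [Set.uIcc_of_le hab] : ContinuousOn _ (Set.uIcc a b)).intervalIntegrable
    refine ⟨hii, ?_⟩
    set a' := min 1 a
    set b' := max 1 b
    have ha' : 0 < a' := lt_min one_pos ha
    have hab' : a' ≤ b' := (min_le_left _ _).trans (le_max_left _ _)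
    have hm1 : (1 : ℝ) ∈ Set.Icc a' b' := ⟨min_le_left _ _, le_max_left _ _⟩
    have hlim := (hb a' b' ha' hab' hm1).const_mul (b - a)
    rw [mul_zero] at hlim
    refine squeeze_zero (fun j => intervalIntegral.integral_nonneg hab fun _ _ => norm_nonneg _)
      (fun j => ?_) hlim
    have hgc : Continuous (g j) :=
      continuous_of_hasDerivAt (hg j)
    calc ∫ t in a..b, ‖g j t - (c + ∫ s in (1 : ℝ)..t, γ s)‖
        ≤ ∫ t in a..b, (‖g j 1 - c‖ + ∫ t in a'..b', ‖g' j t - γ t‖) := by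
          refine intervalIntegral.integral_mono_on hab
            ((hgc.intervalIntegrable _ _).sub hii).norm (by simp) fun t ht => ?_
          exact norm_sub_primitive_le (hg j) (hg' j) hab' (hint _ _ ha' hab') hm1
            ⟨(min_le_right _ _).trans ht.1, ht.2.trans (le_max_right _ _)⟩
      _ = _ := by rw [intervalIntegral.integral_const, smul_eq_mul]

/-- If second derivatives converge in `L¹(1,2)` and the increments of the functions converge, then
the first derivatives converge at `1`. -/
theorem exists_tendsto_deriv_one {f g g' : ℕ → ℝ → E} {γ : ℝ → E} {L : E}
    (hf : ∀ j t, HasDerivAt (f j) (g j t) t) (hg : ∀ j t, HasDerivAt (g j) (g' j t) t)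
    (hg' : ∀ j, Continuous (g' j)) (hγ : IntervalIntegrable γ volume 1 2)
    (h : Tendsto (fun j => ∫ t in (1 : ℝ)..2, ‖g' j t - γ t‖) atTop (𝓝 0))
    (hL : Tendsto (fun j => f j 2 - f j 1) atTop (𝓝 L)) :
    ∃ c, Tendsto (fun j => g j 1) atTop (𝓝 c) := by
  set Γ : ℝ → E := fun r => ∫ t in (1 : ℝ)..r, γ t
  have hm1 : (1 : ℝ) ∈ Set.Icc (1 : ℝ) 2 := by norm_num
  have hΓc : ContinuousOn Γ (Set.uIcc 1 2) :=
    intervalIntegral.continuousOn_primitive_interval' hγ Set.left_mem_uIcc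
  refine ⟨L - ∫ t in (1 : ℝ)..2, Γ t, ?_⟩
  have hgc : ∀ j, Continuous (g j) := fun j =>
    continuous_of_hasDerivAt (hg j)
  have heq : ∀ j, g j 1 = (f j 2 - f j 1) - ∫ t in (1 : ℝ)..2, (g j t - g j 1) := fun j => by
    rw [intervalIntegral.integral_sub ((hgc j).intervalIntegrable _ _) (by simp),
      intervalIntegral.integral_eq_sub_of_hasDerivAt (fun t _ => hf j t)
        ((hgc j).intervalIntegrable _ _), intervalIntegral.integral_const]
    norm_num
  refine Tendsto.congr (fun j => (heq j).symm) (hL.sub ?_)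
  rw [tendsto_iff_norm_sub_tendsto_zero]
  refine squeeze_zero (fun _ => norm_nonneg _) (fun j => ?_) h
  have hi1 : IntervalIntegrable (fun t => g j t - g j 1) volume 1 2 :=
    ((hgc j).sub continuous_const).intervalIntegrable _ _
  rw [← intervalIntegral.integral_sub hi1 hΓc.intervalIntegrable]
  calc ‖∫ t in (1 : ℝ)..2, (g j t - g j 1 - Γ t)‖
      ≤ ∫ t in (1 : ℝ)..2, ‖g j t - g j 1 - Γ t‖ :=
        intervalIntegral.norm_integral_le_integral_norm (by norm_num)
    _ ≤ ∫ t in (1 : ℝ)..2, (∫ t in (1 : ℝ)..2, ‖g' j t - γ t‖) := by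
        refine intervalIntegral.integral_mono_on (by norm_num)
          ((((hgc j).sub continuous_const).intervalIntegrable _ _).sub
            hΓc.intervalIntegrable).norm (by simp) fun t ht => ?_
        have := norm_sub_primitive_le (c := g j 1) (hg j) (hg' j) (by norm_num) hγ hm1 ht
        rw [sub_self, norm_zero, zero_add] at this
        rwa [sub_sub]
    _ = _ := by rw [intervalIntegral.integral_const]; norm_num

theorem hasDerivAt_of_eq_primitive {f G : ℝ → E} (hG : ContinuousOn G (Set.Ioi 0))
    (hf : ∀ r, 0 < r → f r = f 1 + ∫ t in (1 : ℝ)..r, G t) {r : ℝ} (hr : 0 < r) :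
    HasDerivAt f (G r) r := by
  have hi : IntervalIntegrable G volume 1 r := (hG.mono fun x hx =>
    lt_of_lt_of_le (lt_min one_pos hr) hx.1).intervalIntegrable
  have h1 : HasDerivAt (fun r => ∫ t in (1 : ℝ)..r, G t) (G r) r := by
    refine intervalIntegral.integral_hasDerivAt_right hi ?_ (hG.continuousAt (Ioi_mem_nhds hr))
    exact ContinuousOn.stronglyMeasurableAtFilter isOpen_Ioi hG r hr
  refine (h1.const_add (f 1)).congr_of_eventuallyEq ?_
  filter_upwards [lt_mem_nhds hr] with s hs using hf s hs

/-- Second order version: pointwise convergence of functions and `L¹` convergence of second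
derivatives. -/
theorem limit_second {p p1 p2 : ℕ → ℝ → E} {f γ : ℝ → E}
    (h1 : ∀ j t, HasDerivAt (p j) (p1 j t) t) (h2 : ∀ j t, HasDerivAt (p1 j) (p2 j t) t)
    (hc : ∀ j, Continuous (p2 j)) (hf : ∀ r, 0 < r → Tendsto (fun j => p j r) atTop (𝓝 (f r)))
    (h : TendstoL1Loc p2 γ) :
    ∃ f1 : ℝ → E, (∀ r, 0 < r → HasDerivAt f (f1 r) r) ∧
      (∀ r, 0 < r → f1 r = f1 1 + ∫ t in (1 : ℝ)..r, γ t) ∧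
      (∀ r, 0 < r → Tendsto (fun j => p1 j r) atTop (𝓝 (f1 r))) := by
  have hint := fun a b ha hab => (h a b ha hab).1
  obtain ⟨c, hcl⟩ := exists_tendsto_deriv_one h1 h2 hc (h 1 2 one_pos (by norm_num)).1
    (h 1 2 one_pos (by norm_num)).2 ((hf 2 (by norm_num)).sub (hf 1 one_pos))
  obtain ⟨ha, hb⟩ := TendstoL1Loc.primitive h2 hc h hcl
  have hcont : ContinuousOn (fun r => c + ∫ t in (1 : ℝ)..r, γ t) (Set.Ioi 0) :=
    continuousOn_const.add (continuousOn_primitive_Ioi hint)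
  have hc1 : ∀ j, Continuous (p1 j) := fun j =>
    continuous_of_hasDerivAt (h2 j)
  refine ⟨fun r => c + ∫ t in (1 : ℝ)..r, γ t, fun r hr => ?_, fun r _ => by simp, ha⟩
  refine hasDerivAt_of_eq_primitive hcont (fun s hs => ?_) hr
  exact tendsto_nhds_unique (hf s hs) ((TendstoL1Loc.primitive h1 hc1 hb (hf 1 one_pos)).1 s hs)

/-- Third order version. -/
theorem limit_third {p p1 p2 p3 : ℕ → ℝ → E} {f γ : ℝ → E}
    (h1 : ∀ j t, HasDerivAt (p j) (p1 j t) t) (h2 : ∀ j t, HasDerivAt (p1 j) (p2 j t) t)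
    (h3 : ∀ j t, HasDerivAt (p2 j) (p3 j t) t) (hc : ∀ j, Continuous (p3 j))
    (hf : ∀ r, 0 < r → Tendsto (fun j => p j r) atTop (𝓝 (f r))) (h : TendstoL1Loc p3 γ) :
    ∃ f1 f2 : ℝ → E, (∀ r, 0 < r → HasDerivAt f (f1 r) r) ∧
      (∀ r, 0 < r → HasDerivAt f1 (f2 r) r) ∧
      (∀ r, 0 < r → f2 r = f2 1 + ∫ t in (1 : ℝ)..r, γ t) ∧
      (∀ r, 0 < r → Tendsto (fun j => p1 j r) atTop (𝓝 (f1 r))) ∧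
      (∀ r, 0 < r → Tendsto (fun j => p2 j r) atTop (𝓝 (f2 r))) := by
  have hint := fun a b ha hab => (h a b ha hab).1
  have hc2 : ∀ j, Continuous (p2 j) := fun j =>
    continuous_of_hasDerivAt (h3 j)
  have hshift : ∀ {F F' : ℝ → E} {t : ℝ}, (∀ s, HasDerivAt F (F' s) s) →
      HasDerivAt (fun s => F (s + 1) - F s) (F' (t + 1) - F' t) t := fun {F F' t} hF =>
    ((hF (t + 1)).comp_add_const t 1).sub (hF t)
  -- increments of the first derivatives
  have hinc : ∃ L, Tendsto (fun j => p1 j 2 - p1 j 1) atTop (𝓝 L) := by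
    have := exists_tendsto_deriv_one (f := fun j t => p j (t + 1) - p j t)
      (g := fun j t => p1 j (t + 1) - p1 j t) (g' := fun j t => p2 j (t + 1) - p2 j t)
      (γ := fun r => ∫ t in r..r + 1, γ t) (L := (f 3 - f 2) - (f 2 - f 1))
      (fun j t => hshift (h1 j)) (fun j t => hshift (h2 j))
      (fun j => ((hc2 j).comp (continuous_add_const 1)).sub (hc2 j)) ?_ ?_ ?_
    · obtain ⟨c, hcl⟩ := this
      exact ⟨c, by convert hcl using 4; norm_num⟩
    · have hco : ContinuousOn (fun r => (∫ t in (1 : ℝ)..r + 1, γ t) - ∫ t in (1 : ℝ)..r, γ t)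
          (Set.uIcc 1 2) := by
        refine ContinuousOn.sub ?_ ?_
        · refine (continuousOn_primitive_Ioi hint).comp (by fun_prop) fun x hx => ?_
          rw [Set.uIcc_of_le (by norm_num)] at hx
          exact (by linarith [hx.1] : (0 : ℝ) < x + 1)
        · refine (continuousOn_primitive_Ioi hint).mono fun x hx => ?_
          rw [Set.uIcc_of_le (by norm_num)] at hx
          exact (by linarith [hx.1] : (0 : ℝ) < x)
      refine (hco.congr fun r hr => ?_).intervalIntegrable
      rw [Set.uIcc_of_le (by norm_num)] at hr
      have hr0 : (0 : ℝ) < r := by linarith [hr.1]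
      exact (intervalIntegral.integral_interval_sub_left
        (intervalIntegrable_of_pos hint one_pos (by linarith))
        (intervalIntegrable_of_pos hint one_pos hr0)).symm
    · have hlim := (h 1 3 one_pos (by norm_num)).2
      refine squeeze_zero (fun j => intervalIntegral.integral_nonneg (by norm_num)
        fun _ _ => norm_nonneg _) (fun j => ?_) hlim
      have hp3 : IntervalIntegrable (fun t => ‖p3 j t - γ t‖) volume 1 3 :=
        (((hc j).intervalIntegrable _ _).sub (hint 1 3 one_pos (by norm_num))).norm
      have hbd : ∀ r ∈ Set.uIoc (1 : ℝ) 2,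
          ‖‖p2 j (r + 1) - p2 j r - ∫ t in r..r + 1, γ t‖‖ ≤ ∫ t in (1 : ℝ)..3, ‖p3 j t - γ t‖ := by
        intro r hr
        rw [Set.uIoc_of_le (by norm_num)] at hr
        have hr0 : (0 : ℝ) < r := by linarith [hr.1]
        have hγr : IntervalIntegrable γ volume r (r + 1) := hint _ _ hr0 (by linarith)
        rw [norm_norm, ← intervalIntegral.integral_eq_sub_of_hasDerivAt (fun t _ => h3 j t)
          ((hc j).intervalIntegrable _ _), ← intervalIntegral.integral_sub
          ((hc j).intervalIntegrable _ _) hγr]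
        refine (intervalIntegral.norm_integral_le_integral_norm (by linarith)).trans ?_
        refine intervalIntegral.integral_mono_interval hr.1.le (by linarith) (by linarith [hr.2])
          (Eventually.of_forall fun t => norm_nonneg _) hp3
      have := intervalIntegral.norm_integral_le_of_norm_le_const hbd
      norm_num at this
      exact (le_abs_self _).trans (by simpa using this)
    · convert ((hf 3 (by norm_num)).sub (hf 2 (by norm_num))).sub
        ((hf 2 (by norm_num)).sub (hf 1 one_pos)) using 4 <;> norm_num
  obtain ⟨L, hL⟩ := hinc
  obtain ⟨c, hcl⟩ := exists_tendsto_deriv_one h2 h3 hc (h 1 2 one_pos (by norm_num)).1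
    (h 1 2 one_pos (by norm_num)).2 hL
  obtain ⟨ha, hb⟩ := TendstoL1Loc.primitive h3 hc h hcl
  obtain ⟨f1, hf1, hf1p, hf1t⟩ := limit_second h1 h2 hc2 hf hb
  refine ⟨f1, fun r => c + ∫ t in (1 : ℝ)..r, γ t, hf1, fun r hr => ?_, fun r _ => by simp,
    hf1t, ha⟩
  exact hasDerivAt_of_eq_primitive
    (continuousOn_const.add (continuousOn_primitive_Ioi hint)) hf1p hr

end Limits

/-! ### Radial functions: `L²` on the plane and `L¹` on compact subintervals -/

theorem map_norm_apply {S : Set ℝ} (hS : MeasurableSet S) :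
    (volume : Measure Plane).map norm S = ENNReal.ofReal (2 * π) *
      ∫⁻ r in Set.Ioi (0 : ℝ), ENNReal.ofReal r * S.indicator 1 r := by
  rw [← lintegral_indicator_one hS, lintegral_map (measurable_one.indicator hS) measurable_norm]
  exact lintegral_fun_norm (measurable_one.indicator hS)

theorem restrict_Ioi_absolutelyContinuous :
    volume.restrict (Set.Ioi (0 : ℝ)) ≪ (volume : Measure Plane).map norm := by
  refine Measure.AbsolutelyContinuous.mk fun S hS h => ?_
  rw [map_norm_apply hS, mul_eq_zero] at h
  have h2 := h.resolve_left (by simp [pi_pos])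
  rw [lintegral_eq_zero_iff (by
    exact ENNReal.measurable_ofReal.mul (measurable_one.indicator hS))] at h2
  rw [measure_eq_zero_iff_ae_notMem]
  filter_upwards [h2, ae_restrict_mem measurableSet_Ioi] with r hr hr0 hrS
  have : ¬ r ≤ 0 := not_le.2 hr0
  simp [hrS, this] at hr

theorem restrict_Ioc_le {a b : ℝ} (ha : 0 < a) :
    volume.restrict (Set.Ioc a b) ≤
      ENNReal.ofReal (2 * π * a)⁻¹ • (volume : Measure Plane).map norm := by
  rw [Measure.le_iff]
  intro S hS
  rw [Measure.smul_apply, smul_eq_mul, map_norm_apply hS, Measure.restrict_apply hS, ← mul_assoc,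
    ← ENNReal.ofReal_mul (by positivity)]
  have h1 : (2 * π * a)⁻¹ * (2 * π) = a⁻¹ := by
    field_simp
  rw [h1, ← lintegral_const_mul _ (by
    exact ENNReal.measurable_ofReal.mul (measurable_one.indicator hS)),
    ← lintegral_indicator_one (hS.inter measurableSet_Ioc),
    ← lintegral_indicator measurableSet_Ioi]
  refine lintegral_mono fun r => ?_
  by_cases hr : r ∈ S ∩ Set.Ioc a b
  · have hr0 : r ∈ Set.Ioi (0 : ℝ) := ha.trans hr.2.1
    rw [Set.indicator_of_mem hr, Set.indicator_of_mem hr0, Set.indicator_of_mem hr.1]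
    simp only [Pi.one_apply, mul_one]
    rw [← ENNReal.ofReal_mul (by positivity), ENNReal.one_le_ofReal]
    rw [inv_mul_eq_div, one_le_div ha]
    exact hr.2.1.le
  · rw [Set.indicator_of_notMem hr]
    exact zero_le

section Cauchy

set_option linter.unusedSectionVars false

variable {E : Type*} [NormedAddCommGroup E] [NormedSpace ℝ E] [CompleteSpace E]

theorem exists_tendsto_eLpNorm {α : Type*} [MeasurableSpace α] {μ : Measure α} {f : ℕ → α → E}
    (hf : ∀ j, MemLp (f j) 2 μ)
    (h : Tendsto (fun n : ℕ × ℕ => eLpNorm (f n.1 - f n.2) 2 μ) atTop (𝓝 0)) :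
    ∃ g, MemLp g 2 μ ∧ Tendsto (fun n => eLpNorm (f n - g) 2 μ) atTop (𝓝 0) := by
  have : Fact ((1 : ℝ≥0∞) ≤ 2) := ⟨by norm_num⟩
  have hc : CauchySeq fun j => (hf j).toLp (f j) := by
    rw [EMetric.cauchySeq_iff]
    intro ε hε
    have := (tendsto_order.1 h).2 ε hε
    rw [eventually_atTop] at this
    obtain ⟨⟨N, M⟩, hN⟩ := this
    refine ⟨max N M, fun a ha b hb => ?_⟩
    rw [Lp.edist_toLp_toLp]
    exact hN (a, b) ⟨(le_max_left _ _).trans ha, (le_max_right _ _).trans hb⟩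
  obtain ⟨g, hg⟩ := cauchySeq_tendsto_of_complete hc
  refine ⟨g, Lp.memLp g, ?_⟩
  rw [← Lp.tendsto_Lp_iff_tendsto_eLpNorm'' f hf g (Lp.memLp g)]
  simpa using hg

theorem exists_tendstoL1Loc {g : ℕ → ℝ → E} (hg : ∀ j, Continuous (g j))
    (hm : ∀ j, MemLp (fun x : Plane => g j ‖x‖) 2 volume)
    (h : Tendsto (fun n : ℕ × ℕ => eLpNorm (fun x : Plane => g n.1 ‖x‖ - g n.2 ‖x‖) 2 volume)
      atTop (𝓝 0)) :
    ∃ γ, TendstoL1Loc g γ ∧ ∃ ns : ℕ → ℕ, StrictMono ns ∧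
      ∀ᵐ r ∂(volume.restrict (Set.Ioi (0 : ℝ))), Tendsto (fun i => g (ns i) r) atTop (𝓝 (γ r)) := by
  set μ := (volume : Measure Plane).map norm with hμ
  have hn : AEMeasurable (norm : Plane → ℝ) volume := measurable_norm.aemeasurable
  have hm' : ∀ j, MemLp (g j) 2 μ := fun j =>
    (memLp_map_measure_iff (hg j).aestronglyMeasurable hn).2 (hm j)
  have h' : Tendsto (fun n : ℕ × ℕ => eLpNorm (g n.1 - g n.2) 2 μ) atTop (𝓝 0) := by
    refine h.congr fun n => ?_
    rw [hμ, eLpNorm_map_measure ((hg _).sub (hg _)).aestronglyMeasurable hn]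
    rfl
  obtain ⟨γ, hγ, hlim⟩ := exists_tendsto_eLpNorm hm' h'
  refine ⟨γ, fun a b ha hab => ?_, ?_⟩
  · have hle := restrict_Ioc_le (b := b) ha
    set c := ENNReal.ofReal (2 * π * a)⁻¹
    have hbd : ∀ f : ℝ → E, AEStronglyMeasurable f μ → eLpNorm f 1 (volume.restrict (Set.Ioc a b)) ≤
        c ^ (1 / 2 : ℝ≥0∞).toReal * eLpNorm f 2 μ *
          (volume.restrict (Set.Ioc a b)) Set.univ ^ (1 / (1 : ℝ≥0∞).toReal - 1 / (2 : ℝ≥0∞).toReal) := by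
      intro f hf
      have hf' : AEStronglyMeasurable f (volume.restrict (Set.Ioc a b)) :=
        (hf.smul_measure c).mono_measure hle
      refine (eLpNorm_le_eLpNorm_mul_rpow_measure_univ (q := 2) (by norm_num) hf').trans ?_
      gcongr
      refine (eLpNorm_mono_measure f hle).trans ?_
      rw [eLpNorm_smul_measure_of_ne_top (by norm_num), smul_eq_mul]
    have hfin : ∀ f : ℝ → E, MemLp f 2 μ → MemLp f 1 (volume.restrict (Set.Ioc a b)) := by
      intro f hf
      refine ⟨(hf.1.smul_measure c).mono_measure hle, (hbd f hf.1).trans_lt ?_⟩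
      refine ENNReal.mul_lt_top (ENNReal.mul_lt_top ?_ hf.2) ?_
      · exact ENNReal.rpow_lt_top_of_nonneg (by simp) (by simp [c])
      · exact ENNReal.rpow_lt_top_of_nonneg (by norm_num) (by simp)
    have hγi : IntervalIntegrable γ volume a b := by
      rw [intervalIntegrable_iff_integrableOn_Ioc_of_le hab]
      exact memLp_one_iff_integrable.1 (hfin γ hγ)
    refine ⟨hγi, ?_⟩
    have hz : Tendsto (fun j => eLpNorm (g j - γ) 1 (volume.restrict (Set.Ioc a b))) atTop (𝓝 0) := by
      have hfz : ∀ A B : ℝ≥0∞, A ≠ ⊤ → B ≠ ⊤ →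
          Tendsto (fun j => A * eLpNorm (g j - γ) 2 μ * B) atTop (𝓝 0) := by
        intro A B hA hB
        have := ENNReal.Tendsto.mul_const (ENNReal.Tendsto.const_mul hlim (Or.inr hA)) (Or.inr hB)
        simpa using this
      refine tendsto_of_tendsto_of_tendsto_of_le_of_le tendsto_const_nhds
        (hfz _ _ ?_ ?_) (fun _ => zero_le) fun j => hbd _ ((hm' j).1.sub hγ.1)
      · exact (ENNReal.rpow_lt_top_of_nonneg (by simp) (by simp [c])).ne
      · exact (ENNReal.rpow_lt_top_of_nonneg (by norm_num) (by simp)).ne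
    have hz2 := (ENNReal.tendsto_toReal ENNReal.zero_ne_top).comp hz
    refine hz2.congr fun j => ?_
    simp only [Function.comp_apply]
    have h1 := integral_norm_eq_lintegral_enorm (hfin _ ((hm' j).sub hγ)).1
    rw [intervalIntegral.integral_of_le hab, eLpNorm_one_eq_lintegral_enorm]
    exact h1.symm
  · have hin := tendstoInMeasure_of_tendsto_eLpNorm (by norm_num) (fun j => (hm' j).1) hγ.1 hlim
    obtain ⟨ns, hns, hae⟩ := hin.exists_seq_tendsto_ae
    exact ⟨ns, hns, restrict_Ioi_absolutelyContinuous.ae_le hae⟩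

end Cauchy

theorem pdI_sub {F : Type*} [NormedAddCommGroup F] [NormedSpace ℝ F] {k : ℕ} (I : Fin k → Fin 2)
    {f g : Plane → F} (hf : ContDiff ℝ ∞ f) (hg : ContDiff ℝ ∞ g) :
    pdI I (fun x => f x - g x) = pdI I f - pdI I g := by
  funext x
  have h := iteratedFDeriv_sub (𝕜 := ℝ) (i := k) (hf.of_le (by exact_mod_cast le_top))
    (hg.of_le (by exact_mod_cast le_top))
  unfold pdI
  rw [show (fun x => f x - g x) = f - g from rfl, h]
  rfl

/-- The `k`-th profile derivatives of a sequence of smooth equivariant maps whose `k`-th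
derivatives are Cauchy in `L²` converge. -/
theorem exists_tendstoL1Loc_profile {n : ℕ} {f : ℕ → Plane → Space} (he : ∀ j, IsEquivariant n (f j))
    (hs : ∀ j, ContDiff ℝ ∞ (f j)) (k : ℕ)
    (hm : ∀ j, ∀ I : Fin k → Fin 2, MemLp (pdI I (f j)) 2 volume)
    (h : ∀ I : Fin k → Fin 2, Tendsto (fun a : ℕ × ℕ => eLpNorm (pdI I (f a.1) - pdI I (f a.2)) 2
      volume) atTop (𝓝 0)) :
    ∃ γ, TendstoL1Loc (fun j => iteratedDeriv k (profile (f j))) γ ∧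
      ∃ ns : ℕ → ℕ, StrictMono ns ∧ ∀ᵐ r ∂(volume.restrict (Set.Ioi (0 : ℝ))),
        Tendsto (fun i => iteratedDeriv k (profile (f (ns i))) r) atTop (𝓝 (γ r)) := by
  have hae : ∀ᵐ x : Plane, x ≠ 0 := by
    simp [ae_iff]
  have hle : ((k : ℕ) : WithTop ℕ∞) ≤ (∞ : WithTop ℕ∞) := by exact_mod_cast le_top
  have hc : ∀ j, Continuous (iteratedDeriv k (profile (f j))) := fun j =>
    (contDiff_profile (hs j)).continuous_iteratedDeriv k hle
  refine exists_tendstoL1Loc hc (fun j => ?_) ?_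
  · have hsum : MemLp (fun x => ∑ I : Fin k → Fin 2, ‖pdI I (f j) x‖) 2 volume :=
      memLp_finsetSum _ fun I _ => (hm j I).norm
    refine hsum.mono ((hc j).comp continuous_norm).aestronglyMeasurable ?_
    filter_upwards [hae] with x hx
    refine ((he j).norm_iteratedDeriv_profile_le (hs j) k hx).trans (Real.le_norm_self _)
  · have hsum : Tendsto (fun a : ℕ × ℕ => ∑ I : Fin k → Fin 2,
        eLpNorm (pdI I (f a.1) - pdI I (f a.2)) 2 volume) atTop (𝓝 0) := by
      simpa using tendsto_finsetSum Finset.univ fun I _ => h I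
    refine tendsto_of_tendsto_of_tendsto_of_le_of_le tendsto_const_nhds hsum (fun _ => zero_le)
      fun a => ?_
    have hcd := fun I : Fin k → Fin 2 => (contDiff_pdI (I := I) (hs a.1)).continuous.sub
      (contDiff_pdI (I := I) (hs a.2)).continuous
    refine le_trans ?_ ((eLpNorm_sum_le (f := fun I x => ‖(pdI I (f a.1) - pdI I (f a.2)) x‖)
      (fun I _ => (hcd I).norm.aestronglyMeasurable) (by norm_num)).trans
      (le_of_eq (Finset.sum_congr rfl fun I _ => eLpNorm_norm _)))
    refine eLpNorm_mono_ae ?_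
    filter_upwards [hae] with x hx
    have h1 := ((he a.1).sub (he a.2)).norm_iteratedDeriv_profile_le ((hs a.1).sub (hs a.2)) k hx
    have h2 : iteratedDeriv k (profile fun x => f a.1 x - f a.2 x) ‖x‖ =
        iteratedDeriv k (profile (f a.1)) ‖x‖ - iteratedDeriv k (profile (f a.2)) ‖x‖ :=
      iteratedDeriv_sub ((contDiff_profile (hs a.1)).contDiffAt.of_le hle)
        ((contDiff_profile (hs a.2)).contDiffAt.of_le hle)
    rw [h2] at h1
    refine h1.trans ((le_of_eq ?_).trans (Real.le_norm_self _))
    rw [Finset.sum_apply]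
    refine Finset.sum_congr rfl fun I _ => ?_
    rw [pdI_sub I (hs a.1) (hs a.2)]

/-! ### Regularity away from the origin and weak derivatives -/

/-- The plane as the complex line. -/
def toC : Plane →L[ℝ] ℂ := LinearMap.toContinuousLinearMap
  { toFun := fun x => ⟨x 0, x 1⟩
    map_add' := fun x y => by apply Complex.ext <;> simp
    map_smul' := fun c x => by apply Complex.ext <;> simp }

theorem toC_apply (x : Plane) : toC x = ⟨x 0, x 1⟩ := rfl

theorem norm_toC (x : Plane) : ‖toC x‖ = ‖x‖ := by
  rw [← sq_eq_sq₀ (norm_nonneg _) (norm_nonneg _), norm_sq_plane, Complex.sq_norm,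
    Complex.normSq_apply, toC_apply]
  ring

theorem toC_pow (n : ℕ) (x : Plane) :
    toC x ^ n = (‖x‖ ^ n : ℝ) * Complex.exp ((n * angle x : ℝ) * Complex.I) := by
  have h := Complex.norm_mul_exp_arg_mul_I (toC x)
  rw [norm_toC] at h
  have ha : (toC x).arg = angle x := rfl
  rw [ha] at h
  conv_lhs => rw [← h]
  rw [mul_pow, ← Complex.exp_nat_mul]
  push_cast
  ring_nf

theorem re_toC_pow (n : ℕ) (x : Plane) :
    (toC x ^ n).re = ‖x‖ ^ n * cos (n * angle x) := by
  rw [toC_pow, Complex.re_ofReal_mul, Complex.exp_ofReal_mul_I_re]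

theorem im_toC_pow (n : ℕ) (x : Plane) :
    (toC x ^ n).im = ‖x‖ ^ n * sin (n * angle x) := by
  rw [toC_pow, Complex.im_ofReal_mul, Complex.exp_ofReal_mul_I_im]

theorem contDiff_re_toC_pow (n : ℕ) {k : WithTop ℕ∞} :
    ContDiff ℝ k fun x => (toC x ^ n).re :=
  Complex.reCLM.contDiff.comp (toC.contDiff.pow n)

theorem contDiff_im_toC_pow (n : ℕ) {k : WithTop ℕ∞} :
    ContDiff ℝ k fun x => (toC x ^ n).im :=
  Complex.imCLM.contDiff.comp (toC.contDiff.pow n)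

theorem rot_eq_smul (a : ℝ) (y : Space) :
    rot a y = cos a • (-rotGenL (rotGenL y)) + sin a • rotGenL y
      + (y + rotGenL (rotGenL y)) := by
  ext i; fin_cases i <;> simp [rot, rotGen] <;> ring

theorem IsEquivariant.contDiffAt {n : ℕ} {f : Plane → Space} (h : IsEquivariant n f)
    {k : WithTop ℕ∞} (hp : ContDiffOn ℝ k (profile f) (Set.Ioi 0)) {x : Plane} (hx : x ≠ 0) :
    ContDiffAt ℝ k f x := by
  have hr : 0 < ‖x‖ := norm_pos_iff.2 hx
  have hnorm : ContDiffAt ℝ k (fun y : Plane => ‖y‖) x := contDiffAt_norm ℝ hx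
  have hP : ContDiffAt ℝ k (fun y : Plane => profile f ‖y‖) x :=
    (hp.contDiffAt (Ioi_mem_nhds hr)).comp x hnorm
  have hR : ContDiffAt ℝ k (fun y : Plane => rotGenL (profile f ‖y‖)) x :=
    rotGenL.contDiff.contDiffAt.comp x hP
  have hRR : ContDiffAt ℝ k (fun y : Plane => rotGenL (rotGenL (profile f ‖y‖))) x :=
    rotGenL.contDiff.contDiffAt.comp x hR
  have hne : ‖x‖ ^ n ≠ 0 := pow_ne_zero _ hr.ne'
  have hc : ContDiffAt ℝ k (fun y : Plane => (toC y ^ n).re / ‖y‖ ^ n) x :=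
    (contDiff_re_toC_pow n).contDiffAt.div (hnorm.pow n) hne
  have hs : ContDiffAt ℝ k (fun y : Plane => (toC y ^ n).im / ‖y‖ ^ n) x :=
    (contDiff_im_toC_pow n).contDiffAt.div (hnorm.pow n) hne
  refine (((hc.smul hRR.neg).add (hs.smul hR)).add (hP.add hRR)).congr_of_eventuallyEq ?_
  filter_upwards [isOpen_ne.mem_nhds hx] with y hy
  have hy0 : ‖y‖ ^ n ≠ 0 := pow_ne_zero _ (norm_ne_zero_iff.2 hy)
  change f y = ((toC y ^ n).re / ‖y‖ ^ n) • _ + ((toC y ^ n).im / ‖y‖ ^ n) • _ + _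
  rw [h.apply_eq hy, rot_eq_smul, re_toC_pow, im_toC_pow, mul_div_cancel_left₀ _ hy0,
    mul_div_cancel_left₀ _ hy0]

theorem IsEquivariant.continuousAt {n : ℕ} {f : Plane → Space} (h : IsEquivariant n f)
    (hp : ContinuousOn (profile f) (Set.Ioi 0)) {x : Plane} (hx : x ≠ 0) : ContinuousAt f x :=
  (h.contDiffAt (k := 0) (contDiffOn_zero.2 hp) hx).continuousAt

theorem pdI_one (I : Fin 1 → Fin 2) {F : Type*} [NormedAddCommGroup F] [NormedSpace ℝ F]
    {φ : Plane → F} (hφ : ContDiff ℝ ∞ φ) : pdI I φ = pd (I 0) φ := by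
  rw [pdI_succ I hφ, pdI_zero]

/-- Integration by parts of a test function against a map that is `C¹` on the support. -/
theorem integral_pd_smul {F : Type*} [NormedAddCommGroup F] [NormedSpace ℝ F]
    {φ : Plane → ℝ} {f : Plane → F} {U : Set Plane} (hU : IsOpen U)
    (hφ : ContDiff ℝ ∞ φ) (hc : HasCompactSupport φ) (hs : tsupport φ ⊆ U)
    (hf : ContDiffOn ℝ 1 f U) (i : Fin 2) :
    ∫ x, pd i φ x • f x = - ∫ x, φ x • pd i f x := by
  have hcont : ∀ {G : Type _} [NormedAddCommGroup G] [NormedSpace ℝ G] {ψ : Plane → ℝ} {g : Plane → G},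
      Continuous ψ → tsupport ψ ⊆ tsupport φ → ContinuousOn g U →
      Integrable (fun x => ψ x • g x) := by
    intro G _ _ ψ g hψ hψs hg
    have hcs : HasCompactSupport ψ := hc.mono' ((subset_tsupport _).trans hψs)
    refine Continuous.integrable_of_hasCompactSupport ?_ hcs.smul_right
    refine continuous_of_tsupport fun x hx => ?_
    have hxU : x ∈ U := hs (hψs (tsupport_smul_subset_left ψ g hx))
    exact hψ.continuousAt.smul (hg.continuousAt (hU.mem_nhds hxU))
  have hpd : ContinuousOn (pd i f) U :=
    (hf.continuousOn_fderiv_of_isOpen hU le_rfl).clm_apply continuousOn_const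
  have hsub : tsupport (pd i φ) ⊆ tsupport φ := by
    refine closure_minimal ?_ (isClosed_tsupport _)
    intro x hx
    have : fderiv ℝ φ x ≠ 0 := fun h0 => hx (by simp [pd, h0])
    exact support_fderiv_subset ℝ this
  have h1 := hcont (contDiff_pd (i := i) hφ).continuous hsub hf.continuousOn
  have h2 := hcont hφ.continuous subset_rfl hpd
  have h3 := hcont hφ.continuous subset_rfl hf.continuousOn
  have := integral_bilinear_fderiv_right_eq_neg_left_of_integrable (μ := (volume : Measure Plane))
    (f := φ) (g := f) (B := ContinuousLinearMap.lsmul ℝ ℝ) (v := EuclideanSpace.single i (1 : ℝ))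
    h1 h2 h3 (fun x _ => hφ.differentiable (by simp) x)
    (fun x hx => (hf.differentiableOn (by simp)).differentiableAt (hU.mem_nhds (hs hx)))
  change ∫ x, φ x • pd i f x = - ∫ x, pd i φ x • f x at this
  rw [this, neg_neg]

theorem contDiffOn_compl_zero {n : ℕ} {f : Plane → Space} (h : IsEquivariant n f)
    {k : WithTop ℕ∞} (hp : ContDiffOn ℝ k (profile f) (Set.Ioi 0)) : ContDiffOn ℝ k f {0}ᶜ :=
  fun _ hx => (h.contDiffAt hp hx).contDiffWithinAt

/-- A weak first derivative of a map that is `C¹` off the origin is the classical one. -/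
theorem IsWeakDeriv.ae_eq_pd {F : Type*} [NormedAddCommGroup F] [NormedSpace ℝ F] [CompleteSpace F]
    {f g : Plane → F} {I : Fin 1 → Fin 2} (h : IsWeakDeriv I f g)
    (hf : ContDiffOn ℝ 1 f {0}ᶜ) : g =ᵐ[volume] pd (I 0) f := by
  have hU : IsOpen ({0}ᶜ : Set Plane) := isOpen_compl_singleton
  have hpd : ContinuousOn (pd (I 0) f) {0}ᶜ :=
    (hf.continuousOn_fderiv_of_isOpen hU le_rfl).clm_apply continuousOn_const
  have hpl : LocallyIntegrableOn (pd (I 0) f) {0}ᶜ volume :=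
    hpd.locallyIntegrableOn hU.measurableSet
  have key := hU.ae_eq_zero_of_integral_contDiff_smul_eq_zero
    (f := fun x => g x - pd (I 0) f x) ((h.2.1.locallyIntegrableOn _).sub hpl) ?_
  · have hae : ∀ᵐ x : Plane, x ≠ 0 := by simp [ae_iff]
    filter_upwards [key, hae] with x hx hx0
    exact sub_eq_zero.1 (hx hx0)
  · intro φ hφ hc hs
    have h1 := h.2.2 φ hφ hc
    have h2 := integral_pd_smul hU hφ hc hs hf (I 0)
    change ∫ x, pdI I φ x • f x = _ at h1
    rw [pdI_one I hφ, h2] at h1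
    have hi1 : Integrable fun x => φ x • g x :=
      h.2.1.integrable_smul_left_of_hasCompactSupport hφ.continuous hc
    have hi2 : Integrable fun x => φ x • pd (I 0) f x := by
      refine Continuous.integrable_of_hasCompactSupport ?_ hc.smul_right
      refine continuous_of_tsupport fun x hx => ?_
      exact hφ.continuous.continuousAt.smul
        (hpd.continuousAt (hU.mem_nhds (hs (tsupport_smul_subset_left φ _ hx))))
    simp only [smul_sub]
    rw [integral_sub hi1 hi2]
    simp only [pow_one, neg_smul, one_smul, neg_inj] at h1
    rw [h1, sub_self]

theorem weakDerivENorm_eq {F : Type*} [NormedAddCommGroup F] [NormedSpace ℝ F] [CompleteSpace F]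
    {f : Plane → F} {I : Fin 1 → Fin 2} (hf : ContDiffOn ℝ 1 f {0}ᶜ)
    (h : ∃ g, IsWeakDeriv I f g) : weakDerivENorm I f = eLpNorm (pd (I 0) f) 2 volume := by
  obtain ⟨g, hg⟩ := h
  refine le_antisymm ?_ ?_
  · rw [← eLpNorm_congr_ae (hg.ae_eq_pd hf)]
    exact iInf₂_le g hg
  · refine le_iInf₂ fun g' hg' => ?_
    rw [eLpNorm_congr_ae (hg'.ae_eq_pd hf)]

theorem ofReal_norm_sq {F : Type*} [NormedAddCommGroup F] (x : F) :
    ENNReal.ofReal (‖x‖ ^ 2) = ‖x‖ₑ ^ 2 := by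
  rw [ENNReal.ofReal_pow (norm_nonneg _), ofReal_norm]

/-- The `Ḣ¹` norm of an equivariant map in terms of its profile. -/
theorem IsEquivariant.hdotENorm_one_sq {n : ℕ} {f : Plane → Space} (h : IsEquivariant n f)
    (hp : ContDiffOn ℝ 1 (profile f) (Set.Ioi 0))
    (hw : ∀ I : Fin 1 → Fin 2, ∃ g, IsWeakDeriv I f g) :
    hdotENorm 1 f ^ 2 = ∫⁻ x : Plane, ENNReal.ofReal (‖deriv (profile f) ‖x‖‖ ^ 2
      + (n / ‖x‖) ^ 2 * ‖rotGen (profile f ‖x‖)‖ ^ 2) := by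
  have hf := contDiffOn_compl_zero h hp
  have hU : IsOpen ({0}ᶜ : Set Plane) := isOpen_compl_singleton
  have hpm : ∀ i, AEMeasurable (fun x => ‖pd i f x‖ₑ ^ 2) := fun i => by
    obtain ⟨g, hg⟩ := hw (fun _ => i)
    have := (hg.ae_eq_pd hf)
    exact (AEStronglyMeasurable.congr hg.2.1.aestronglyMeasurable this).enorm.pow_const 2
  rw [hdotENorm, ← ENNReal.rpow_natCast, ← ENNReal.rpow_mul]
  norm_num
  have hsum : ∑ I : Fin 1 → Fin 2, weakDerivENorm I f ^ 2 = ∑ i : Fin 2, eLpNorm (pd i f) 2 volume ^ 2 := by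
    refine Fintype.sum_equiv (Equiv.funUnique (Fin 1) (Fin 2)) _ _ fun I => ?_
    rw [weakDerivENorm_eq hf (hw I)]
    rfl
  rw [hsum, Fin.sum_univ_two, eLpNorm_two_sq, eLpNorm_two_sq, ← lintegral_add_left' (hpm 0)]
  refine lintegral_congr_ae ?_
  have hae : ∀ᵐ x : Plane, x ≠ 0 := by simp [ae_iff]
  filter_upwards [hae] with x hx
  rw [← h.sum_norm_pd_sq (fun y hy => (h.contDiffAt hp hy).differentiableAt (by simp)) hx,
    ENNReal.ofReal_add (by positivity) (by positivity), ofReal_norm_sq, ofReal_norm_sq]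

/-! ### The `Ḣ³` norm of an equivariant map -/

theorem tendsto_eLpNorm_of_sub {α E : Type*} [MeasurableSpace α] {μ : Measure α}
    [NormedAddCommGroup E] {f : ℕ → α → E} {g : α → E} (hf : ∀ j, MemLp (f j) 2 μ) (hg : MemLp g 2 μ)
    (h : Tendsto (fun j => eLpNorm (f j - g) 2 μ) atTop (𝓝 0)) :
    Tendsto (fun j => eLpNorm (f j) 2 μ) atTop (𝓝 (eLpNorm g 2 μ)) := by
  have : Fact ((1 : ℝ≥0∞) ≤ 2) := ⟨by norm_num⟩
  have h1 := ((Lp.tendsto_Lp_iff_tendsto_eLpNorm'' f hf g hg).2 h).enorm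
  simpa only [MeasureTheory.Lp.enorm_toLp] using h1

theorem tendsto_eLpNorm_cauchy {α E : Type*} [MeasurableSpace α] {μ : Measure α}
    [NormedAddCommGroup E] {f : ℕ → α → E} {g : α → E} (hf : ∀ j, MemLp (f j) 2 μ) (hg : MemLp g 2 μ)
    (h : Tendsto (fun j => eLpNorm (f j - g) 2 μ) atTop (𝓝 0)) :
    Tendsto (fun n : ℕ × ℕ => eLpNorm (f n.1 - f n.2) 2 μ) atTop (𝓝 0) := by
  have h2 : Tendsto (fun n : ℕ × ℕ => eLpNorm (f n.1 - g) 2 μ + eLpNorm (f n.2 - g) 2 μ)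
      atTop (𝓝 0) := by
    rw [← prod_atTop_atTop_eq]
    simpa using (h.comp tendsto_fst).add (h.comp tendsto_snd)
  refine tendsto_of_tendsto_of_tendsto_of_le_of_le tendsto_const_nhds h2 (fun _ => zero_le)
    fun n => ?_
  have : f n.1 - f n.2 = (f n.1 - g) - (f n.2 - g) := by abel
  rw [this]
  exact eLpNorm_sub_le ((hf _).sub hg).1 ((hf _).sub hg).1 (by norm_num)

/-- `p'' + p'/r + n² R² p / r²` as a function of the jet of `p`. -/
def radLapJet (n : ℕ) (r : ℝ) (a b c : Space) : Space :=
  c + r⁻¹ • b + (n / r : ℝ) ^ 2 • rotGenL (rotGenL a)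

/-- The derivative of `p'' + p'/r + n² R² p / r²` as a function of the jet of `p`. -/
def derivRadLapJet (n : ℕ) (r : ℝ) (a b c d : Space) : Space :=
  d + (r⁻¹ • c - (r ^ 2)⁻¹ • b) +
    ((n / r : ℝ) ^ 2 • rotGenL (rotGenL b) - (2 * n ^ 2 / r ^ 3 : ℝ) • rotGenL (rotGenL a))

theorem hasDerivAt_radLapJet {n : ℕ} {p p1 p2 : ℝ → Space} {p3 : Space} {r : ℝ} (hr : r ≠ 0)
    (h0 : HasDerivAt p (p1 r) r) (h1 : HasDerivAt p1 (p2 r) r) (h2 : HasDerivAt p2 p3 r) :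
    HasDerivAt (fun s => radLapJet n s (p s) (p1 s) (p2 s))
      (derivRadLapJet n r (p r) (p1 r) (p2 r) p3) r := by
  have hi : HasDerivAt (fun s : ℝ => s⁻¹) (-(r ^ 2)⁻¹) r := hasDerivAt_inv hr
  have hq : HasDerivAt (fun s : ℝ => (n / s : ℝ) ^ 2) (-(2 * n ^ 2 / r ^ 3)) r := by
    have h3 := (hi.const_mul (n : ℝ)).pow 2
    simp only [div_eq_mul_inv]
    refine h3.congr_deriv ?_
    field_simp
    simp
    field_simp
  have hR : HasDerivAt (fun s => rotGenL (rotGenL (p s))) (rotGenL (rotGenL (p1 r))) r :=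
    (rotGenL.comp rotGenL).hasFDerivAt.comp_hasDerivAt r h0
  refine ((h2.add (hi.smul h1)).add (hq.smul hR)).congr_deriv ?_
  unfold derivRadLapJet
  simp only [neg_smul]
  abel

theorem sum_fin_cons {k : ℕ} {M : Type*} [AddCommMonoid M] (F : (Fin (k + 1) → Fin 2) → M) :
    ∑ I, F I = ∑ i, ∑ J : Fin k → Fin 2, F (Fin.cons i J) := by
  rw [← (Fin.consEquiv fun _ : Fin (k + 1) => Fin 2).sum_comp, Fintype.sum_prod_type]
  rfl

theorem pdI_cons {F : Type*} [NormedAddCommGroup F] [NormedSpace ℝ F] {k : ℕ} (i : Fin 2)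
    (J : Fin k → Fin 2) {f : Plane → F} (hf : ContDiff ℝ ∞ f) :
    pdI (Fin.cons i J : Fin (k + 1) → Fin 2) f = pd i (pdI J f) := by
  rw [pdI_succ _ hf, Fin.cons_zero, Fin.tail_cons]

theorem pd_laplacian {F : Type*} [NormedAddCommGroup F] [NormedSpace ℝ F] {f : Plane → F}
    (hf : ContDiff ℝ ∞ f) (l : Fin 2) :
    pd l (Laplacian.laplacian f) = Laplacian.laplacian (pd l f) := by
  rw [laplacian_eq_pd hf, laplacian_eq_pd (contDiff_pd hf)]
  funext x
  have hd : ∀ i : Fin 2, DifferentiableAt ℝ (pd i (pd i f)) x := fun i =>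
    (contDiff_pd (contDiff_pd hf)).differentiable (by simp) x
  have h1 : pd l (fun x => ∑ i, pd i (pd i f) x) x = ∑ i, pd l (pd i (pd i f)) x := by
    change fderiv ℝ (fun x => ∑ i, pd i (pd i f) x) x (EuclideanSpace.single l (1 : ℝ)) = _
    rw [fderiv_fun_sum fun i _ => hd i, sum_apply]
    rfl
  rw [h1]
  refine Finset.sum_congr rfl fun i _ => ?_
  rw [pd_comm (contDiff_pd hf) l i, pd_comm hf l i]

/-- The third derivatives of a mollified map in terms of the gradient of the Laplacian. -/
theorem sum_eLpNorm_pdI_three {u : Plane → Space} (hu : LocallyIntegrable u) {φ : Plane → ℝ}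
    (hφ : ContDiff ℝ ∞ φ) (hc : HasCompactSupport φ) {g : Fin 2 → Plane → Space}
    (hg : ∀ l, IsWeakDeriv (fun _ : Fin 1 => l) u (g l)) (hg2 : ∀ l, MemLp (g l) 2 volume) :
    ∑ I : Fin 3 → Fin 2, eLpNorm (pdI I (conv φ u)) 2 volume ^ 2 =
      ∑ l, eLpNorm (pd l (Laplacian.laplacian (conv φ u))) 2 volume ^ 2 := by
  have hs := contDiff_conv hφ hc hu
  have h1 : ∀ l, pd l (conv φ u) = conv φ (g l) := fun l => by
    rw [← (hg l).pdI_conv hφ hc, pdI_one _ hs]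
  simp only [pd_laplacian hs, h1, ← sum_eLpNorm_pd_pd_conv hφ hc (hg2 _)]
  simp only [sum_fin_cons (k := 2), sum_fin_cons (k := 1), sum_fin_cons (k := 0), pdI_cons _ _ hs,
    Finset.univ_unique, Finset.sum_singleton, pdI_zero, h1]
  simp only [Fin.sum_univ_two]
  ring

theorem contDiff_conv_moll {F : Type*} [NormedAddCommGroup F] [NormedSpace ℝ F] {u : Plane → F}
    (hu : LocallyIntegrable u) (j : ℕ) : ContDiff ℝ ∞ (conv (moll j) u) :=
  contDiff_conv (contDiff_moll j) (hasCompactSupport_moll j) hu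

theorem IsEquivariant.conv_moll {n : ℕ} {u : Plane → Space} (h : IsEquivariant n u)
    (hu : LocallyIntegrable u) (j : ℕ) : IsEquivariant n (SchrodingerMap.conv (moll j) u) :=
  h.conv (contDiff_moll j).continuous (hasCompactSupport_moll j) hu
    fun _ _ hxy => moll_eq_of_norm_eq j hxy

theorem IsEquivariant.tendsto_profile_conv_moll {n : ℕ} {u : Plane → Space} (h : IsEquivariant n u)
    (hu : LocallyIntegrable u) (hp : ContinuousOn (profile u) (Set.Ioi 0)) {r : ℝ} (hr : 0 < r) :
    Tendsto (fun j => profile (SchrodingerMap.conv (moll j) u) r) atTop (𝓝 (profile u r)) := by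
  simp only [profile_eq]
  exact tendsto_conv_moll hu (h.continuousAt hp (smul_ne_zero hr.ne' (er_ne_zero 0)))

theorem hasDerivAt_iteratedDeriv {f : ℝ → Space} (hf : ContDiff ℝ ∞ f) (k : ℕ) (t : ℝ) :
    HasDerivAt (iteratedDeriv k f) (iteratedDeriv (k + 1) f t) t := by
  rw [iteratedDeriv_succ, iteratedDeriv_eq_iterate]
  exact ((hf.iterate_deriv k : ContDiff ℝ ∞ _).differentiable (by simp) t).hasDerivAt

/-- The energy density of the gradient of the Laplacian as a function of the jet of the profile. -/
def jetEnergy (n : ℕ) (r : ℝ) (y : Space × Space × Space × Space) : ℝ :=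
  ‖derivRadLapJet n r y.1 y.2.1 y.2.2.1 y.2.2.2‖ ^ 2 +
    (n / r) ^ 2 * ‖rotGen (radLapJet n r y.1 y.2.1 y.2.2.1)‖ ^ 2

theorem continuous_jetEnergy (n : ℕ) (r : ℝ) : Continuous (jetEnergy n r) := by
  unfold jetEnergy derivRadLapJet radLapJet
  simp only [← rotGenL_apply]
  fun_prop

theorem IsEquivariant.sum_norm_pd_laplacian_sq_jet {n : ℕ} {f : Plane → Space}
    (h : IsEquivariant n f) (hf : ContDiff ℝ ∞ f) {x : Plane} (hx : x ≠ 0) :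
    ‖pd 0 (Laplacian.laplacian f) x‖ ^ 2 + ‖pd 1 (Laplacian.laplacian f) x‖ ^ 2 =
      jetEnergy n ‖x‖ (iteratedDeriv 0 (profile f) ‖x‖, iteratedDeriv 1 (profile f) ‖x‖,
        iteratedDeriv 2 (profile f) ‖x‖, iteratedDeriv 3 (profile f) ‖x‖) := by
  have hp := contDiff_profile hf
  have hjet : radLap n (profile f) = fun s => radLapJet n s (iteratedDeriv 0 (profile f) s)
      (iteratedDeriv 1 (profile f) s) (iteratedDeriv 2 (profile f) s) := by
    funext s
    simp only [radLap, radLapJet, iteratedDeriv_zero, iteratedDeriv_succ, rotGenL_apply]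
  rw [h.sum_norm_pd_laplacian_sq hf hx, hjet, (hasDerivAt_radLapJet (norm_ne_zero_iff.2 hx)
    (hasDerivAt_iteratedDeriv hp 0 _) (hasDerivAt_iteratedDeriv hp 1 _)
    (hasDerivAt_iteratedDeriv hp 2 _)).deriv]
  rfl

theorem exists_profile_jet {m : ℕ} {u : Plane → Space} (he : IsEquivariant m u)
    (hcont : ContinuousOn (profile u) (Set.Ioi 0)) (h1 : MemHdot 1 u) (h3 : MemHdot 3 u) :
    ∃ v1 v2 γ : ℝ → Space, (∀ r, 0 < r → HasDerivAt (profile u) (v1 r) r) ∧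
      (∀ r, 0 < r → HasDerivAt v1 (v2 r) r) ∧
      (∀ a b : ℝ, 0 < a → a ≤ b → IntervalIntegrable γ volume a b) ∧
      (∀ r, 0 < r → v2 r = v2 1 + ∫ t in (1 : ℝ)..r, γ t) ∧
      hdotENorm 3 u ^ 2 ≤ ∫⁻ x : Plane,
        ENNReal.ofReal (jetEnergy m ‖x‖ (profile u ‖x‖, v1 ‖x‖, v2 ‖x‖, γ ‖x‖)) := by
  choose g hg hg2 using h3
  choose g' hg' hg2' using h1
  have hu : LocallyIntegrable u := (hg' fun _ => 0).1
  set U : ℕ → Plane → Space := fun j => conv (moll j) u with hU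
  have hs : ∀ j, ContDiff ℝ ∞ (U j) := contDiff_conv_moll hu
  have heq : ∀ j, IsEquivariant m (U j) := he.conv_moll hu
  have hpd : ∀ (I : Fin 3 → Fin 2) j, pdI I (U j) = conv (moll j) (g I) := fun I j =>
    (hg I).pdI_conv (contDiff_moll j) (hasCompactSupport_moll j)
  have hpm : ∀ (I : Fin 3 → Fin 2) j, MemLp (pdI I (U j)) 2 volume := fun I j => by
    rw [hpd]
    exact memLp_conv (contDiff_moll j) (hasCompactSupport_moll j) (hg I).2.1 (hg2 I)
  have hpt : ∀ I : Fin 3 → Fin 2,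
      Tendsto (fun j => eLpNorm (pdI I (U j) - g I) 2 volume) atTop (𝓝 0) := fun I => by
    simp only [hpd]
    exact tendsto_eLpNorm_conv_moll (hg2 I)
  have hca : ∀ I : Fin 3 → Fin 2, Tendsto (fun a : ℕ × ℕ =>
      eLpNorm (pdI I (U a.1) - pdI I (U a.2)) 2 volume) atTop (𝓝 0) := fun I =>
    tendsto_eLpNorm_cauchy (f := fun j => pdI I (U j)) (hpm I) (hg2 I) (hpt I)
  obtain ⟨γ, hγ, ns, hns, hae⟩ := exists_tendstoL1Loc_profile heq hs 3 (fun j I => hpm I j) hca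
  have hps := fun j => contDiff_profile (hs j)
  have hlim0 : ∀ r, 0 < r → Tendsto (fun j => iteratedDeriv 0 (profile (U j)) r) atTop
      (𝓝 (profile u r)) := fun r hr => by
    simpa only [iteratedDeriv_zero] using he.tendsto_profile_conv_moll hu hcont hr
  have d : ∀ k j t, HasDerivAt (iteratedDeriv k (profile (U j)))
      (iteratedDeriv (k + 1) (profile (U j)) t) t := fun k j t => hasDerivAt_iteratedDeriv (hps j) k t
  have hc3 : ∀ j, Continuous (iteratedDeriv 3 (profile (U j))) := fun j =>
    (hps j).continuous_iteratedDeriv 3 (WithTop.coe_le_coe.2 (le_top : (3 : ℕ∞) ≤ ⊤))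
  obtain ⟨v1, v2, hv1, hv2, hv3, ht1, ht2⟩ := limit_third
    (p := fun j => iteratedDeriv 0 (profile (U j))) (p1 := fun j => iteratedDeriv 1 (profile (U j)))
    (p2 := fun j => iteratedDeriv 2 (profile (U j))) (p3 := fun j => iteratedDeriv 3 (profile (U j)))
    (d 0) (d 1) (d 2) hc3 hlim0 hγ
  refine ⟨v1, v2, γ, hv1, hv2, fun a b ha hab => (hγ a b ha hab).1, hv3, ?_⟩
  -- the gradient of the Laplacian
  set G : Fin 2 → Plane → Space := fun l => ∑ i : Fin 2, g (Fin.cons l fun _ => i) with hG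
  have hGm : ∀ l, MemLp (G l) 2 volume := fun l => memLp_finsetSum' _ fun i _ => hg2 _
  have hlap : ∀ l j, pd l (Laplacian.laplacian (U j)) =
      ∑ i : Fin 2, pdI (Fin.cons l fun _ : Fin 2 => i) (U j) := fun l j => by
    rw [pd_laplacian (hs j), laplacian_eq_pd (contDiff_pd (hs j))]
    funext x
    rw [Finset.sum_apply]
    refine Finset.sum_congr rfl fun i _ => ?_
    rw [pdI_cons _ _ (hs j), pdI_succ _ (hs j), pdI_one _ (hs j), pd_comm (contDiff_pd (hs j)) l,
      pd_comm (hs j) l]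
    rfl
  have hlm : ∀ l j, MemLp (pd l (Laplacian.laplacian (U j))) 2 volume := fun l j => by
    rw [hlap]; exact memLp_finsetSum' _ fun i _ => hpm _ _
  have hlt : ∀ l, Tendsto (fun j => eLpNorm (pd l (Laplacian.laplacian (U j)) - G l) 2 volume)
      atTop (𝓝 0) := fun l => by
    have hsum : Tendsto (fun j => ∑ i : Fin 2,
        eLpNorm (pdI (Fin.cons l fun _ : Fin 2 => i) (U j) - g (Fin.cons l fun _ => i)) 2 volume)
        atTop (𝓝 0) := by
      simpa using tendsto_finsetSum Finset.univ fun i _ => hpt (Fin.cons l fun _ : Fin 2 => i)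
    refine tendsto_of_tendsto_of_tendsto_of_le_of_le tendsto_const_nhds hsum (fun _ => zero_le)
      fun j => ?_
    simp only [hlap, hG]
    rw [← Finset.sum_sub_distrib]
    exact eLpNorm_sum_le (fun i _ => ((hpm _ _).sub (hg2 _)).1) (by norm_num)
  have hnorm : hdotENorm 3 u ^ 2 ≤ ∑ l, eLpNorm (G l) 2 volume ^ 2 := by
    have ha : Tendsto (fun j => ∑ I : Fin 3 → Fin 2, eLpNorm (pdI I (U j)) 2 volume ^ 2) atTop
        (𝓝 (∑ I : Fin 3 → Fin 2, eLpNorm (g I) 2 volume ^ 2)) :=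
      tendsto_finsetSum _ fun I _ =>
        ENNReal.Tendsto.pow (tendsto_eLpNorm_of_sub (hpm I) (hg2 I) (hpt I))
    have hb : Tendsto (fun j => ∑ l, eLpNorm (pd l (Laplacian.laplacian (U j))) 2 volume ^ 2) atTop
        (𝓝 (∑ l, eLpNorm (G l) 2 volume ^ 2)) :=
      tendsto_finsetSum _ fun l _ =>
        ENNReal.Tendsto.pow (tendsto_eLpNorm_of_sub (hlm l) (hGm l) (hlt l))
    have hab : ∀ j, ∑ I : Fin 3 → Fin 2, eLpNorm (pdI I (U j)) 2 volume ^ 2 =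
        ∑ l, eLpNorm (pd l (Laplacian.laplacian (U j))) 2 volume ^ 2 := fun j =>
      sum_eLpNorm_pdI_three hu (contDiff_moll j) (hasCompactSupport_moll j)
        (fun l => hg' fun _ => l) (fun l => hg2' _)
    simp only [hab] at ha
    rw [← tendsto_nhds_unique ha hb, hdotENorm, ← ENNReal.rpow_natCast, ← ENNReal.rpow_mul]
    norm_num
    exact Finset.sum_le_sum fun I _ => by gcongr; exact iInf₂_le (g I) (hg I)
  refine hnorm.trans (le_of_eq ?_)
  rw [Fin.sum_univ_two, eLpNorm_two_sq, eLpNorm_two_sq,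
    ← lintegral_add_left' ((hGm 0).1.enorm.pow_const 2)]
  refine lintegral_congr_ae ?_
  -- a common subsequence
  have hsub : ∀ l, Tendsto (fun i => eLpNorm (pd l (Laplacian.laplacian (U (ns i))) - G l) 2 volume)
      atTop (𝓝 0) := fun l => (hlt l).comp hns.tendsto_atTop
  obtain ⟨ks, hks, hk⟩ := (tendstoInMeasure_of_tendsto_eLpNorm (by norm_num)
    (fun i => (hlm 0 (ns i)).1) (hGm 0).1 (hsub 0)).exists_seq_tendsto_ae
  obtain ⟨ls, hls, hl⟩ := (tendstoInMeasure_of_tendsto_eLpNorm (by norm_num)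
    (fun i => (hlm 1 (ns (ks i))).1) (hGm 1).1 ((hsub 1).comp hks.tendsto_atTop)).exists_seq_tendsto_ae
  have hx0 : ∀ᵐ x : Plane, x ≠ 0 := by simp [ae_iff]
  filter_upwards [hk, hl, ae_norm_of_ae hae, hx0] with x h0 h1 h3 hx
  have hr := norm_pos_iff.2 hx
  have hsubs : Tendsto (fun i => ns (ks (ls i))) atTop atTop :=
    hns.tendsto_atTop.comp (hks.tendsto_atTop.comp hls.tendsto_atTop)
  have hA : Tendsto (fun i => ‖pd 0 (Laplacian.laplacian (U (ns (ks (ls i))))) x‖ ^ 2 +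
      ‖pd 1 (Laplacian.laplacian (U (ns (ks (ls i))))) x‖ ^ 2) atTop (𝓝 (‖G 0 x‖ ^ 2 + ‖G 1 x‖ ^ 2)) :=
    ((h0.comp hls.tendsto_atTop).norm.pow 2).add (h1.norm.pow 2)
  have l0 := (hlim0 ‖x‖ hr).comp hsubs
  have l1 := (ht1 ‖x‖ hr).comp hsubs
  have l2 := (ht2 ‖x‖ hr).comp hsubs
  have l3 := h3.comp ((hks.comp hls).tendsto_atTop)
  have hB : Tendsto (fun i => jetEnergy m ‖x‖ (iteratedDeriv 0 (profile (U (ns (ks (ls i))))) ‖x‖,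
      iteratedDeriv 1 (profile (U (ns (ks (ls i))))) ‖x‖,
      iteratedDeriv 2 (profile (U (ns (ks (ls i))))) ‖x‖,
      iteratedDeriv 3 (profile (U (ns (ks (ls i))))) ‖x‖)) atTop
      (𝓝 (jetEnergy m ‖x‖ (profile u ‖x‖, v1 ‖x‖, v2 ‖x‖, γ ‖x‖))) :=
    ((continuous_jetEnergy m ‖x‖).tendsto _).comp
      (l0.prodMk_nhds (l1.prodMk_nhds (l2.prodMk_nhds l3)))
  have hE : ‖G 0 x‖ ^ 2 + ‖G 1 x‖ ^ 2 =
      jetEnergy m ‖x‖ (profile u ‖x‖, v1 ‖x‖, v2 ‖x‖, γ ‖x‖) :=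
    tendsto_nhds_unique hA (hB.congr fun i =>
      ((heq _).sum_norm_pd_laplacian_sq_jet (hs _) hx).symm)
  rw [← ofReal_norm_sq, ← ofReal_norm_sq, ← ENNReal.ofReal_add (by positivity) (by positivity), hE]

/-! ### The Laplacian of an equivariant `L²` map -/

theorem conv_sub_left {F : Type*} [NormedAddCommGroup F] [NormedSpace ℝ F] {φ ψ : Plane → ℝ}
    {f : Plane → F} (hφ : Continuous φ) (hc : HasCompactSupport φ) (hψ : Continuous ψ)
    (hd : HasCompactSupport ψ) (hf : LocallyIntegrable f) :
    conv (φ - ψ) f = conv φ f - conv ψ f := by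
  funext x
  rw [Pi.sub_apply]
  unfold conv
  rw [← integral_sub (integrable_conv hφ hc hf x) (integrable_conv hψ hd hf x)]
  simp only [Pi.sub_apply, sub_smul]

theorem eLpNorm_pdI_two_conv_le {φ : Plane → ℝ} {g : Plane → Space} (hφ : ContDiff ℝ ∞ φ)
    (hc : HasCompactSupport φ) (hg : MemLp g 2 volume) (hgl : LocallyIntegrable g)
    (I : Fin 2 → Fin 2) :
    eLpNorm (pdI I (conv φ g)) 2 volume ≤ eLpNorm (Laplacian.laplacian (conv φ g)) 2 volume := by
  have hs := contDiff_conv hφ hc hgl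
  refine ENNReal_le_of_sq_le ?_
  rw [← sum_eLpNorm_pd_pd_conv hφ hc hg, pdI_succ I hs, pdI_one _ hs]
  refine le_trans ?_ (Finset.single_le_sum (f := fun i => ∑ j, eLpNorm (pd i (pd j (conv φ g))) 2
    volume ^ 2) (fun i _ => zero_le) (Finset.mem_univ (I 0)))
  exact Finset.single_le_sum (f := fun j => eLpNorm (pd (I 0) (pd j (conv φ g))) 2
    volume ^ 2) (fun i _ => zero_le) (Finset.mem_univ (Fin.tail I 0))

theorem exists_profile_jet_two {n : ℕ} {f G : Plane → Space} (he : IsEquivariant n f)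
    (hcont : ContinuousOn (profile f) (Set.Ioi 0)) (hf : MemLp f 2 volume)
    (hG : IsWeakLaplacian f G) (hG2 : MemLp G 2 volume) :
    ∃ f1 f2 : ℝ → Space, (∀ r, 0 < r → HasDerivAt (profile f) (f1 r) r) ∧
      (∀ a b : ℝ, 0 < a → a ≤ b → IntervalIntegrable f2 volume a b) ∧
      (∀ r, 0 < r → f1 r = f1 1 + ∫ t in (1 : ℝ)..r, f2 t) ∧
      ∫⁻ x : Plane, ENNReal.ofReal (‖radLapJet n ‖x‖ (profile f ‖x‖) (f1 ‖x‖) (f2 ‖x‖)‖ ^ 2)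
        ≤ eLpNorm G 2 volume ^ 2 := by
  have hl : LocallyIntegrable f := hG.1
  set U : ℕ → Plane → Space := fun j => conv (moll j) f with hU
  have hs : ∀ j, ContDiff ℝ ∞ (U j) := contDiff_conv_moll hl
  have heq : ∀ j, IsEquivariant n (U j) := he.conv_moll hl
  have hpm : ∀ j (I : Fin 2 → Fin 2), MemLp (pdI I (U j)) 2 volume := fun j I =>
    memLp_pdI_conv (contDiff_moll j) (hasCompactSupport_moll j) hf I
  have hgm : ∀ j, MemLp (conv (moll j) G) 2 volume := fun j =>
    memLp_conv (contDiff_moll j) (hasCompactSupport_moll j) hG.2.1 hG2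
  have hgc : Tendsto (fun a : ℕ × ℕ => eLpNorm (conv (moll a.1) G - conv (moll a.2) G) 2 volume)
      atTop (𝓝 0) :=
    tendsto_eLpNorm_cauchy (f := fun j => conv (moll j) G) hgm hG2 (tendsto_eLpNorm_conv_moll hG2)
  have hca : ∀ I : Fin 2 → Fin 2, Tendsto (fun a : ℕ × ℕ =>
      eLpNorm (pdI I (U a.1) - pdI I (U a.2)) 2 volume) atTop (𝓝 0) := fun I => by
    refine tendsto_of_tendsto_of_tendsto_of_le_of_le tendsto_const_nhds hgc (fun _ => zero_le)
      fun a => ?_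
    have hd : ContDiff ℝ ∞ (moll a.1 - moll a.2) := (contDiff_moll _).sub (contDiff_moll _)
    have hdc : HasCompactSupport (moll a.1 - moll a.2) :=
      (hasCompactSupport_moll _).sub (hasCompactSupport_moll _)
    have h1 := eLpNorm_pdI_two_conv_le hd hdc hf hl I
    rw [hG.laplacian_conv hd hdc] at h1
    simp only [conv_sub_left (contDiff_moll _).continuous (hasCompactSupport_moll _)
      (contDiff_moll _).continuous (hasCompactSupport_moll _) hl,
      conv_sub_left (contDiff_moll _).continuous (hasCompactSupport_moll _)
      (contDiff_moll _).continuous (hasCompactSupport_moll _) hG.2.1] at h1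
    rw [← pdI_sub I (hs _) (hs _)]
    exact h1
  obtain ⟨γ, hγ, ns, hns, hae⟩ := exists_tendstoL1Loc_profile heq hs 2 hpm hca
  have hps := fun j => contDiff_profile (hs j)
  have hlim0 : ∀ r, 0 < r → Tendsto (fun j => iteratedDeriv 0 (profile (U j)) r) atTop
      (𝓝 (profile f r)) := fun r hr => by
    simpa only [iteratedDeriv_zero] using he.tendsto_profile_conv_moll hl hcont hr
  have d : ∀ k j t, HasDerivAt (iteratedDeriv k (profile (U j)))
      (iteratedDeriv (k + 1) (profile (U j)) t) t := fun k j t => hasDerivAt_iteratedDeriv (hps j) k t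
  have hc2 : ∀ j, Continuous (iteratedDeriv 2 (profile (U j))) := fun j =>
    (hps j).continuous_iteratedDeriv 2 (WithTop.coe_le_coe.2 (le_top : (2 : ℕ∞) ≤ ⊤))
  obtain ⟨f1, hf1, hf2, ht1⟩ := limit_second
    (p := fun j => iteratedDeriv 0 (profile (U j))) (p1 := fun j => iteratedDeriv 1 (profile (U j)))
    (p2 := fun j => iteratedDeriv 2 (profile (U j))) (d 0) (d 1) hc2 hlim0 hγ
  refine ⟨f1, γ, hf1, fun a b ha hab => (hγ a b ha hab).1, hf2, ?_⟩
  have hx0 : ∀ᵐ x : Plane, x ≠ 0 := by simp [ae_iff]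
  have hlapm : ∀ j, Measurable fun x => ‖Laplacian.laplacian (U j) x‖ₑ ^ 2 := fun j =>
    ((contDiff_laplacian (hs j)).continuous.enorm.measurable).pow_const 2
  have hle : ∀ j, ∫⁻ x, ‖Laplacian.laplacian (U j) x‖ₑ ^ 2 ≤ eLpNorm G 2 volume ^ 2 := fun j => by
    rw [← eLpNorm_two_sq, hU, hG.laplacian_conv (contDiff_moll j) (hasCompactSupport_moll j)]
    have := eLpNorm_conv_le (contDiff_moll j).continuous hG2.1
    rw [lintegral_moll, one_mul] at this
    gcongr
  calc ∫⁻ x : Plane, ENNReal.ofReal (‖radLapJet n ‖x‖ (profile f ‖x‖) (f1 ‖x‖) (γ ‖x‖)‖ ^ 2)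
      ≤ ∫⁻ x, liminf (fun i => ‖Laplacian.laplacian (U (ns i)) x‖ₑ ^ 2) atTop := by
        refine lintegral_mono_ae ?_
        filter_upwards [ae_norm_of_ae hae, hx0] with x h2 hx
        have hr := norm_pos_iff.2 hx
        have l0 := (hlim0 ‖x‖ hr).comp hns.tendsto_atTop
        have l1 := (ht1 ‖x‖ hr).comp hns.tendsto_atTop
        have hcB : Continuous fun y : Space × Space × Space =>
            ‖radLapJet n ‖x‖ y.1 y.2.1 y.2.2‖ₑ ^ 2 := by
          have : Continuous fun y : Space × Space × Space =>
            radLapJet n ‖x‖ y.1 y.2.1 y.2.2 := by unfold radLapJet; fun_prop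
          exact (ENNReal.continuous_pow 2).comp this.enorm
        have hB := (hcB.tendsto _).comp (l0.prodMk_nhds (l1.prodMk_nhds h2))
        rw [ofReal_norm_sq]
        refine le_of_eq (Tendsto.liminf_eq (hB.congr fun i => ?_)).symm
        have e1 := (heq (ns i)).norm_laplacian (hs (ns i)) hx
        have hjet : radLap n (profile (U (ns i))) ‖x‖ = radLapJet n ‖x‖
            (iteratedDeriv 0 (profile (U (ns i))) ‖x‖) (iteratedDeriv 1 (profile (U (ns i))) ‖x‖)
            (iteratedDeriv 2 (profile (U (ns i))) ‖x‖) := by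
          simp only [radLap, radLapJet, iteratedDeriv_zero, iteratedDeriv_succ, rotGenL_apply]
        rw [hjet] at e1
        simp only [Function.comp_apply]
        rw [← ofReal_norm_sq, ← ofReal_norm_sq, e1]
    _ ≤ liminf (fun i => ∫⁻ x, ‖Laplacian.laplacian (U (ns i)) x‖ₑ ^ 2) atTop :=
        lintegral_liminf_le fun i => hlapm _
    _ ≤ eLpNorm G 2 volume ^ 2 := by
        refine (liminf_le_liminf (Eventually.of_forall fun i => hle (ns i))).trans ?_
        simp

/-- The isometric embedding of the complex line into `ℝ³` as the equatorial plane. -/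
def ofC : ℂ →L[ℝ] Space := LinearMap.toContinuousLinearMap
  { toFun := fun z => !₂[z.re, z.im, 0]
    map_add' := fun x y => by ext i; fin_cases i <;> simp
    map_smul' := fun c x => by ext i; fin_cases i <;> simp }

theorem ofC_apply (z : ℂ) : ofC z = !₂[z.re, z.im, 0] := rfl

theorem norm_ofC (z : ℂ) : ‖ofC z‖ = ‖z‖ := by
  rw [← sq_eq_sq₀ (norm_nonneg _) (norm_nonneg _), norm_sq_space, Complex.sq_norm,
    Complex.normSq_apply, ofC_apply]
  simp
  ring

/-- The projection of `ℝ³` onto the equatorial plane. -/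
def toCL : Space →L[ℝ] ℂ := LinearMap.toContinuousLinearMap
  { toFun := fun y => ⟨y 0, y 1⟩
    map_add' := fun x y => by apply Complex.ext <;> simp
    map_smul' := fun c x => by apply Complex.ext <;> simp }

theorem toCL_apply (y : Space) : toCL y = ⟨y 0, y 1⟩ := rfl

theorem toCL_ofC (z : ℂ) : toCL (ofC z) = z := by
  rw [toCL_apply, ofC_apply]; apply Complex.ext <;> simp

theorem norm_toCL_le (y : Space) : ‖toCL y‖ ≤ ‖y‖ := by
  rw [← sq_le_sq₀ (norm_nonneg _) (norm_nonneg _), norm_sq_space, Complex.sq_norm,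
    Complex.normSq_apply, toCL_apply]
  simp only
  nlinarith [sq_nonneg (y 2)]

theorem rot_ofC (a : ℝ) (z : ℂ) : rot a (ofC z) = ofC (Complex.exp (a * Complex.I) * z) := by
  ext i
  fin_cases i <;>
    simp [rot, ofC_apply, Complex.exp_ofReal_mul_I_re, Complex.exp_ofReal_mul_I_im, add_comm]

theorem toCL_rotGen_rotGen (y : Space) : toCL (rotGenL (rotGenL y)) = -toCL y := by
  apply Complex.ext <;> simp [toCL_apply, rotGen]

theorem IsWeakLaplacian.comp_clm {F F' : Type*} [NormedAddCommGroup F] [NormedSpace ℝ F]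
    [NormedAddCommGroup F'] [NormedSpace ℝ F'] [CompleteSpace F] [CompleteSpace F']
    {f g : Plane → F} (h : IsWeakLaplacian f g)
    (L : F →L[ℝ] F') : IsWeakLaplacian (fun x => L (f x)) (fun x => L (g x)) := by
  have hloc : ∀ {k : Plane → F}, LocallyIntegrable k → LocallyIntegrable fun x => L (k x) :=
    fun {k} hk => fun x => by
      obtain ⟨s, hs, hi⟩ := hk x
      exact ⟨s, hs, L.integrable_comp hi⟩
  refine ⟨hloc h.1, hloc h.2.1, fun φ hφ hc => ?_⟩
  have hlap : Continuous (Laplacian.laplacian φ) := by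
    rw [laplacian_eq_pd hφ]
    exact continuous_finsetSum _ fun i _ => (contDiff_pd (contDiff_pd hφ)).continuous
  have hlc : HasCompactSupport (Laplacian.laplacian φ) := by
    rw [laplacian_eq_pd hφ]
    simp only [Fin.sum_univ_two]
    exact (hasCompactSupport_pd (hasCompactSupport_pd hc)).add
      (hasCompactSupport_pd (hasCompactSupport_pd hc))
  have h1 := L.integral_comp_comm (h.1.integrable_smul_left_of_hasCompactSupport hlap hlc)
  have h2 := L.integral_comp_comm (h.2.1.integrable_smul_left_of_hasCompactSupport hφ.continuous hc)
  simp only [map_smul] at h1 h2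
  rw [h1, h2, h.2.2 φ hφ hc]

theorem exists_jet_of_isWeakLaplacian {n : ℕ} {q : ℝ → ℂ} {f G : Plane → ℂ}
    (hfq : ∀ x, x ≠ 0 → f x = Complex.exp ((n * angle x : ℝ) * Complex.I) * q ‖x‖)
    (hcont : ContinuousOn q (Set.Ioi 0)) (hf : MemLp f 2 volume)
    (hG : IsWeakLaplacian f G) (hG2 : MemLp G 2 volume) :
    ∃ q1 q2 : ℝ → ℂ, (∀ r, 0 < r → HasDerivAt q (q1 r) r) ∧
      (∀ a b : ℝ, 0 < a → a ≤ b → IntervalIntegrable q2 volume a b) ∧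
      (∀ r, 0 < r → q1 r = q1 1 + ∫ t in (1 : ℝ)..r, q2 t) ∧
      ∫⁻ x : Plane, ENNReal.ofReal (‖q2 ‖x‖ + (‖x‖⁻¹ : ℝ) • q1 ‖x‖ - (n / ‖x‖ : ℝ) ^ 2 • q ‖x‖‖ ^ 2)
        ≤ eLpNorm G 2 volume ^ 2 := by
  have hang : ∀ r : ℝ, 0 < r → angle (r • er 0) = 0 := fun r hr => by
    rw [← axis_eq, angle]
    exact Complex.arg_ofReal_of_nonneg hr.le
  have hprof : ∀ r, 0 < r → profile (fun x => ofC (f x)) r = ofC (q r) := fun r hr => by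
    rw [profile_eq, hfq _ (smul_ne_zero hr.ne' (er_ne_zero 0)), hang r hr, norm_smul, norm_er,
      Real.norm_of_nonneg hr.le]
    simp
  have he : IsEquivariant n fun x => ofC (f x) := by
    have key : ∀ x, x ≠ 0 → ofC (f x) = rot (n * angle x) (ofC (q ‖x‖)) := fun x hx => by
      rw [hfq x hx, rot_ofC]
    have hz : ∀ x : Plane, x ≠ 0 → ∀ a : ℝ, ofC (f (rotP a x)) = rot (n * a) (ofC (f x)) := by
      intro x hx a
      have hx' : rotP a x ≠ 0 := by simpa using hx
      have hr : 0 < ‖x‖ := norm_pos_iff.2 hx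
      have hrn : ‖x‖ ^ n ≠ 0 := pow_ne_zero _ hr.ne'
      have hN : ‖rotP a x‖ = ‖x‖ := (rotP a).norm_map x
      have h1 : toC (rotP a x) = Complex.exp ((a : ℝ) * Complex.I) * toC x := by
        apply Complex.ext <;>
          simp [toC_apply, rotP_apply, Complex.exp_ofReal_mul_I_re, Complex.exp_ofReal_mul_I_im,
            add_comm]
      have h2 := toC_pow n (rotP a x)
      rw [h1, mul_pow, toC_pow, hN, ← Complex.exp_nat_mul] at h2
      have h3 : Complex.exp ((n * angle (rotP a x) : ℝ) * Complex.I) =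
          Complex.exp ((n * a : ℝ) * Complex.I) * Complex.exp ((n * angle x : ℝ) * Complex.I) := by
        have hc : ((‖x‖ ^ n : ℝ) : ℂ) ≠ 0 := by exact_mod_cast hrn
        apply mul_left_cancel₀ hc
        rw [← h2]
        push_cast
        ring_nf
      rw [key _ hx', key _ hx, hN, rot_ofC, rot_ofC, rot_ofC, h3, mul_assoc]
    exact fun a x hx => hz x hx a
  have hmf : MemLp (fun x => ofC (f x)) 2 volume := ofC.comp_memLp' hf
  have hmG : MemLp (fun x => ofC (G x)) 2 volume := ofC.comp_memLp' hG2
  have hc : ContinuousOn (profile fun x => ofC (f x)) (Set.Ioi 0) :=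
    (ofC.continuous.comp_continuousOn hcont).congr fun r hr => hprof r hr
  obtain ⟨f1, f2, h1, h2, h3, h4⟩ := exists_profile_jet_two he hc hmf (hG.comp_clm ofC) hmG
  refine ⟨fun r => toCL (f1 r), fun r => toCL (f2 r), fun r hr => ?_, fun a b ha hab => ?_,
    fun r hr => ?_, ?_⟩
  · have := toCL.hasFDerivAt.comp_hasDerivAt r (h1 r hr)
    refine this.congr_of_eventuallyEq ?_
    filter_upwards [lt_mem_nhds hr] with s hs
    rw [Function.comp_apply, hprof s hs, toCL_ofC]
  · exact ⟨toCL.integrable_comp (h2 a b ha hab).1, toCL.integrable_comp (h2 a b ha hab).2⟩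
  · have hi : IntervalIntegrable f2 volume 1 r := intervalIntegrable_of_pos h2 one_pos hr
    change toCL (f1 r) = toCL (f1 1) + ∫ t in (1 : ℝ)..r, toCL (f2 t)
    rw [h3 r hr, map_add, ← toCL.intervalIntegral_comp_comm hi]
  · have hn : eLpNorm (fun x => ofC (G x)) 2 volume = eLpNorm G 2 volume :=
      eLpNorm_congr_norm_ae (Eventually.of_forall fun x => norm_ofC _)
    rw [hn] at h4
    refine le_trans (lintegral_mono_ae ?_) h4
    have hx0 : ∀ᵐ x : Plane, x ≠ 0 := by simp [ae_iff]
    filter_upwards [hx0] with x hx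
    refine ENNReal.ofReal_le_ofReal ?_
    refine pow_le_pow_left₀ (norm_nonneg _) ?_ 2
    refine le_trans (le_of_eq ?_) (norm_toCL_le _)
    congr 1
    rw [radLapJet, map_add, map_add, map_smul, map_smul, toCL_rotGen_rotGen,
      hprof _ (norm_pos_iff.2 hx), toCL_ofC, smul_neg, sub_eq_add_neg]

/-! ### The harmonic maps -/

theorem harmonicQ_apply (m : ℕ) (x : Plane) : harmonicQ m x =
    !₂[2 * (toC x ^ m).re / ((‖x‖ ^ 2) ^ m + 1), 2 * (toC x ^ m).im / ((‖x‖ ^ 2) ^ m + 1),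
      ((‖x‖ ^ 2) ^ m - 1) / ((‖x‖ ^ 2) ^ m + 1)] := by
  rw [re_toC_pow, im_toC_pow, ← pow_mul]
  ext i
  fin_cases i <;> simp [harmonicQ, rot, h₁, h₃] <;> ring

theorem contDiff_harmonicQ (m : ℕ) : ContDiff ℝ ∞ (harmonicQ m) := by
  have hN : ContDiff ℝ ∞ fun x : Plane => (‖x‖ ^ 2) ^ m := (contDiff_norm_sq ℝ).pow m
  have hne : ∀ x : Plane, (‖x‖ ^ 2) ^ m + 1 ≠ 0 := fun x => by positivity
  rw [show harmonicQ m = _ from funext (harmonicQ_apply m)]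
  rw [contDiff_euclidean]
  intro i
  fin_cases i
  · exact (contDiff_const.mul (contDiff_re_toC_pow m)).div (hN.add contDiff_const) hne
  · exact (contDiff_const.mul (contDiff_im_toC_pow m)).div (hN.add contDiff_const) hne
  · exact (hN.sub contDiff_const).div (hN.add contDiff_const) hne

theorem contDiff_harmonicMap (m : ℕ) (s α : ℝ) : ContDiff ℝ ∞ (harmonicMap m s α) :=
  (rotL α).contDiff.comp ((contDiff_harmonicQ m).comp (contDiff_const_smul s⁻¹))

theorem angle_smul_er (m : ℕ) {r : ℝ} (hr : 0 < r) (θ : ℝ) (y : Space) :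
    rot (m * angle (r • er θ)) y = rot (m * θ) y := by
  have hn : ‖r • er θ‖ = r := by rw [norm_smul, norm_er, Real.norm_of_nonneg hr.le, mul_one]
  have h1 : toC (r • er θ) = (r : ℂ) * Complex.exp ((θ : ℝ) * Complex.I) := by
    apply Complex.ext <;> simp [toC_apply, er, Complex.exp_ofReal_mul_I_re, Complex.exp_ofReal_mul_I_im]
  have h2 : toC (r • er θ) ^ m = (r ^ m : ℝ) * Complex.exp ((m * θ : ℝ) * Complex.I) := by
    rw [h1, mul_pow, ← Complex.exp_nat_mul]
    push_cast
    ring_nf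
  have hc := re_toC_pow m (r • er θ)
  have hs := im_toC_pow m (r • er θ)
  rw [h2, hn, Complex.re_ofReal_mul, Complex.exp_ofReal_mul_I_re] at hc
  rw [h2, hn, Complex.im_ofReal_mul, Complex.exp_ofReal_mul_I_im] at hs
  have hrm : r ^ m ≠ 0 := pow_ne_zero _ hr.ne'
  rw [rot_eq_smul, rot_eq_smul, mul_left_cancel₀ hrm hc, mul_left_cancel₀ hrm hs]

theorem isEquivariant_harmonicMap (m : ℕ) {s : ℝ} (hs : 0 < s) (α : ℝ) :
    IsEquivariant m (harmonicMap m s α) :=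
  IsEquivariant.of_polar (p := fun r => rot α !₂[h₁ m (r / s), 0, h₃ m (r / s)]) fun r hr θ => by
    have hr' : 0 < s⁻¹ * r := by positivity
    have hn : ‖(s⁻¹ * r) • er θ‖ = r / s := by
      rw [norm_smul, norm_er, Real.norm_of_nonneg hr'.le, mul_one, inv_mul_eq_div]
    rw [harmonicMap, smul_smul, harmonicQ, angle_smul_er m hr', hn, ← rot_add, ← rot_add, add_comm]

theorem profile_harmonicMap (m : ℕ) {s r : ℝ} (hs : 0 < s) (hr : 0 < r) (α : ℝ) :
    profile (harmonicMap m s α) r = rot α !₂[h₁ m (r / s), 0, h₃ m (r / s)] := by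
  have hr' : 0 < s⁻¹ * r := by positivity
  have hn : ‖(s⁻¹ * r) • er 0‖ = r / s := by
    rw [norm_smul, norm_er, Real.norm_of_nonneg hr'.le, mul_one, inv_mul_eq_div]
  rw [profile_eq, harmonicMap, smul_smul, harmonicQ, angle_smul_er m hr', hn]
  simp

theorem isWeakDeriv_of_contDiff {f : Plane → Space} (hf : ContDiff ℝ ∞ f) (I : Fin 1 → Fin 2) :
    IsWeakDeriv I f (pd (I 0) f) := by
  refine ⟨hf.continuous.locallyIntegrable, (contDiff_pd hf).continuous.locallyIntegrable,
    fun φ hφ hc => ?_⟩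
  change ∫ x, pdI I φ x • f x = _
  rw [pdI_one I hφ, integral_pd_smul isOpen_univ hφ hc (Set.subset_univ _)
    ((hf.of_le (WithTop.coe_le_coe.2 (le_top : (1 : ℕ∞) ≤ ⊤))).contDiffOn)]
  simp

theorem IsWeakDeriv.sub {f g f' g' : Plane → Space} {k : ℕ} {I : Fin k → Fin 2}
    (h : IsWeakDeriv I f f') (h' : IsWeakDeriv I g g') :
    IsWeakDeriv I (fun x => f x - g x) (fun x => f' x - g' x) := by
  refine ⟨h.1.sub h'.1, h.2.1.sub h'.2.1, fun φ hφ hc => ?_⟩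
  have hd : Continuous (pdI I φ) := (contDiff_pdI hφ).continuous
  have hdc : HasCompactSupport (pdI I φ) := hasCompactSupport_pdI hc
  have e1 := h.2.2 φ hφ hc
  have e2 := h'.2.2 φ hφ hc
  change ∫ x, pdI I φ x • f x = _ at e1
  change ∫ x, pdI I φ x • g x = _ at e2
  change ∫ x, pdI I φ x • (f x - g x) = _
  simp only [smul_sub]
  rw [integral_sub (h.1.integrable_smul_left_of_hasCompactSupport hd hdc)
    (h'.1.integrable_smul_left_of_hasCompactSupport hd hdc),
    integral_sub (h.2.1.integrable_smul_left_of_hasCompactSupport hφ.continuous hc)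
    (h'.2.1.integrable_smul_left_of_hasCompactSupport hφ.continuous hc), smul_sub, e1, e2]

/-! ### Logarithmic coordinates -/

/-- `h₁` in the logarithmic coordinate: `sech (m t)`. -/
def H₁ (m : ℕ) (t : ℝ) : ℝ := h₁ m (exp t)

/-- `h₃` in the logarithmic coordinate: `tanh (m t)`. -/
def H₃ (m : ℕ) (t : ℝ) : ℝ := h₃ m (exp t)

/-- The harmonic profile in the logarithmic coordinate. -/
def Hp (m : ℕ) (t : ℝ) : Space := !₂[H₁ m t, 0, H₃ m t]

theorem H₁_eq (m : ℕ) (t : ℝ) :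
    H₁ m t = 2 * exp (m * t) / (exp (m * t) ^ 2 + 1) := by
  rw [H₁, h₁, exp_nat_mul, mul_comm 2 m, pow_mul]

theorem H₃_eq (m : ℕ) (t : ℝ) :
    H₃ m t = (exp (m * t) ^ 2 - 1) / (exp (m * t) ^ 2 + 1) := by
  rw [H₃, h₃, exp_nat_mul, mul_comm 2 m, pow_mul]

theorem H₁_pos (m : ℕ) (t : ℝ) : 0 < H₁ m t := by
  rw [H₁_eq]; positivity

theorem H_sq (m : ℕ) (t : ℝ) : H₁ m t ^ 2 + H₃ m t ^ 2 = 1 := by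
  rw [H₁_eq, H₃_eq]
  have : (exp (m * t) ^ 2 + 1) ≠ 0 := by positivity
  field_simp
  ring

theorem H₁_le_one (m : ℕ) (t : ℝ) : H₁ m t ≤ 1 := by
  nlinarith [H_sq m t, H₁_pos m t, sq_nonneg (H₃ m t)]

theorem abs_H₃_le_one (m : ℕ) (t : ℝ) : |H₃ m t| ≤ 1 := by
  rw [← sq_le_one_iff_abs_le_one]
  nlinarith [H_sq m t, sq_nonneg (H₁ m t)]

theorem hasDerivAt_exp_mul (m : ℕ) (t : ℝ) :
    HasDerivAt (fun t => exp (m * t)) (m * exp (m * t)) t := by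
  have h := ((hasDerivAt_id t).const_mul (m : ℝ)).exp
  simpa [mul_comm] using h

theorem hasDerivAt_H₁ (m : ℕ) (t : ℝ) : HasDerivAt (H₁ m) (-(m * H₁ m t * H₃ m t)) t := by
  have h := hasDerivAt_exp_mul m t
  have hne : exp (m * t) ^ 2 + 1 ≠ 0 := by positivity
  have h2 := (h.const_mul 2).div ((h.pow 2).add_const 1) hne
  rw [show H₁ m = _ from funext (H₁_eq m)]
  refine h2.congr_deriv ?_
  rw [H₃_eq]
  simp only [Pi.pow_apply]
  field_simp
  ring

theorem hasDerivAt_H₃ (m : ℕ) (t : ℝ) : HasDerivAt (H₃ m) (m * H₁ m t ^ 2) t := by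
  have h := hasDerivAt_exp_mul m t
  have hne : exp (m * t) ^ 2 + 1 ≠ 0 := by positivity
  have h2 := ((h.pow 2).sub_const 1).div ((h.pow 2).add_const 1) hne
  rw [show H₃ m = _ from funext (H₃_eq m)]
  refine h2.congr_deriv ?_
  rw [H₁_eq]
  simp only [Pi.pow_apply]
  field_simp
  ring

theorem continuous_H₁ (m : ℕ) : Continuous (H₁ m) :=
  continuous_of_hasDerivAt (hasDerivAt_H₁ m)

theorem continuous_H₃ (m : ℕ) : Continuous (H₃ m) :=
  continuous_of_hasDerivAt (hasDerivAt_H₃ m)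

theorem tendsto_exp_mul_atBot {m : ℕ} (hm : 1 ≤ m) :
    Tendsto (fun t : ℝ => exp (m * t)) atBot (𝓝 0) := by
  have hm' : (0 : ℝ) < m := by exact_mod_cast hm
  exact tendsto_exp_atBot.comp (tendsto_id.const_mul_atBot hm')

theorem tendsto_exp_mul_atTop {m : ℕ} (hm : 1 ≤ m) :
    Tendsto (fun t : ℝ => exp (m * t)) atTop atTop := by
  have hm' : (0 : ℝ) < m := by exact_mod_cast hm
  exact tendsto_exp_atTop.comp (tendsto_id.const_mul_atTop hm')

theorem tendsto_H₃_atBot {m : ℕ} (hm : 1 ≤ m) : Tendsto (H₃ m) atBot (𝓝 (-1)) := by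
  rw [show H₃ m = _ from funext (H₃_eq m)]
  have h := (tendsto_exp_mul_atBot hm).pow 2
  have := (h.sub_const 1).div (h.add_const 1) (by norm_num)
  norm_num at this
  exact this

theorem H₃_eq' (m : ℕ) (t : ℝ) : H₃ m t = 1 - 2 * (exp (m * t) ^ 2 + 1)⁻¹ := by
  rw [H₃_eq]; field_simp; ring

theorem tendsto_H₃_atTop {m : ℕ} (hm : 1 ≤ m) : Tendsto (H₃ m) atTop (𝓝 1) := by
  rw [show H₃ m = _ from funext (H₃_eq' m)]
  have h := ((tendsto_pow_atTop (α := ℝ) two_ne_zero).comp (tendsto_exp_mul_atTop hm))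
  have h2 := (tendsto_inv_atTop_zero.comp (tendsto_atTop_add_const_right _ 1 h)).const_mul 2
  simpa using h2.const_sub 1

theorem tendsto_H₁ {m : ℕ} {l : Filter ℝ} {c : ℝ} (h : Tendsto (H₃ m) l (𝓝 c)) (hc : c ^ 2 = 1) :
    Tendsto (H₁ m) l (𝓝 0) := by
  have h1 : H₁ m = fun t => sqrt (1 - H₃ m t ^ 2) := by
    funext t
    rw [← H_sq m t, add_sub_cancel_right, sqrt_sq (H₁_pos m t).le]
  rw [h1]
  have := (Real.continuous_sqrt.tendsto _).comp ((h.pow 2).const_sub 1)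
  rw [hc, sub_self, sqrt_zero] at this
  exact this

theorem integrable_of_hasDerivAt_of_nonneg {f f' : ℝ → ℝ} {B : ℝ} (hd : ∀ t, HasDerivAt f (f' t) t)
    (hc : Continuous f') (h0 : ∀ t, 0 ≤ f' t) (hB : ∀ t, |f t| ≤ B) : Integrable f' := by
  refine integrable_of_intervalIntegral_norm_bounded (ι := ℝ) (l := atTop) (a := fun x => -x)
    (b := fun x => x) (2 * B) (fun i => (hc.integrableOn_Icc).mono_set Set.Ioc_subset_Icc_self)
    tendsto_neg_atTop_atBot tendsto_id (Eventually.of_forall fun x => ?_)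
  simp only [Real.norm_of_nonneg (h0 _)]
  rw [intervalIntegral.integral_eq_sub_of_hasDerivAt (fun t _ => hd t) (hc.intervalIntegrable _ _)]
  linarith [(abs_le.1 (hB x)).2, (abs_le.1 (hB (-x))).1]

theorem integrable_H₁_sq {m : ℕ} (hm : 1 ≤ m) : Integrable (fun t => H₁ m t ^ 2) := by
  have hm' : (m : ℝ) ≠ 0 := by positivity
  have h : Integrable (fun t => m * H₁ m t ^ 2) :=
    integrable_of_hasDerivAt_of_nonneg (hasDerivAt_H₃ m)
      (continuous_const.mul ((continuous_H₁ m).pow 2)) (fun t => by positivity) (abs_H₃_le_one m)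
  simpa [hm'] using h.const_mul (m : ℝ)⁻¹

theorem integral_H₁_sq {m : ℕ} (hm : 1 ≤ m) : ∫ t, H₁ m t ^ 2 = 2 / m := by
  have hm' : (m : ℝ) ≠ 0 := by positivity
  have h := integral_of_hasDerivAt_of_tendsto (fun t => hasDerivAt_H₃ m t)
    ((integrable_H₁_sq hm).const_mul (m : ℝ)) (tendsto_H₃_atBot hm) (tendsto_H₃_atTop hm)
  rw [integral_const_mul] at h
  field_simp
  linarith

/-! ### Equivariant maps in the logarithmic coordinate -/

theorem lintegral_fun_norm_exp_of_aemeasurable {f : ℝ → ℝ≥0∞}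
    (hf : AEMeasurable f (volume.restrict (Set.Ioi (0 : ℝ)))) :
    ∫⁻ x : Plane, f ‖x‖ = ENNReal.ofReal (2 * π) *
      ∫⁻ t : ℝ, ENNReal.ofReal (exp (2 * t)) * f (exp t) := by
  have h1 : ∫⁻ x : Plane, f ‖x‖ = ∫⁻ x : Plane, hf.mk f ‖x‖ := by
    refine lintegral_congr_ae ?_
    filter_upwards [ae_norm_of_ae hf.ae_eq_mk] with x hx using hx
  have h2 : ∫⁻ t : ℝ, ENNReal.ofReal (exp (2 * t)) * f (exp t) =
      ∫⁻ t : ℝ, ENNReal.ofReal (exp (2 * t)) * hf.mk f (exp t) := by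
    refine lintegral_congr_ae ?_
    filter_upwards [ae_exp_of_ae_Ioi hf.ae_eq_mk] with t ht
    rw [ht]
  rw [h1, h2]
  exact lintegral_fun_norm_exp hf.measurable_mk

/-- The profile in the logarithmic coordinate. -/
def logProfile (u : Plane → Space) (t : ℝ) : Space := profile u (exp t)

/-- The logarithmic derivative `r v'(r)` in the logarithmic coordinate. -/
def logDeriv (v' : ℝ → Space) (t : ℝ) : Space := exp t • v' (exp t)

theorem hasDerivAt_comp_exp {E : Type*} [NormedAddCommGroup E] [NormedSpace ℝ E] {p : ℝ → E} {p' : E}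
    {t : ℝ} (h : HasDerivAt p p' (exp t)) :
    HasDerivAt (fun t => p (exp t)) (exp t • p') t :=
  h.scomp t (hasDerivAt_exp t)

theorem IsEquivariant.hdotENorm_one_sq_exp {n : ℕ} {f : Plane → Space} (h : IsEquivariant n f)
    {P1 : ℝ → Space} (hp : ContDiffOn ℝ 1 (profile f) (Set.Ioi 0))
    (hP : ∀ t, HasDerivAt (logProfile f) (P1 t) t)
    (hw : ∀ I : Fin 1 → Fin 2, ∃ g, IsWeakDeriv I f g) :
    hdotENorm 1 f ^ 2 = ENNReal.ofReal (2 * π) *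
      ∫⁻ t : ℝ, ENNReal.ofReal (‖P1 t‖ ^ 2 + n ^ 2 * ‖rotGen (logProfile f t)‖ ^ 2) := by
  rw [h.hdotENorm_one_sq hp hw]
  have hd : ContinuousOn (deriv (profile f)) (Set.Ioi 0) :=
    hp.continuousOn_deriv_of_isOpen isOpen_Ioi le_rfl
  rw [lintegral_fun_norm_exp_of_aemeasurable (f := fun r => ENNReal.ofReal
    (‖deriv (profile f) r‖ ^ 2 + (n / r) ^ 2 * ‖rotGen (profile f r)‖ ^ 2))]
  · congr 1
    refine lintegral_congr fun t => ?_
    have hdiff : DifferentiableAt ℝ (profile f) (exp t) :=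
      (hp.differentiableOn (by simp)).differentiableAt (Ioi_mem_nhds (exp_pos t))
    have : P1 t = exp t • deriv (profile f) (exp t) :=
      (hP t).unique (hasDerivAt_comp_exp hdiff.hasDerivAt)
    rw [← ENNReal.ofReal_mul (exp_nonneg _), this, norm_smul, Real.norm_of_nonneg
      (exp_nonneg _), two_mul, exp_add, logProfile]
    congr 1
    have := (exp_pos t).ne'
    field_simp
  · refine (ENNReal.continuous_ofReal.comp_continuousOn ?_).aemeasurable measurableSet_Ioi
    refine (hd.norm.pow 2).add ((ContinuousOn.pow ?_ 2).mul
      ((rotGenL.continuous.comp_continuousOn hp.continuousOn).norm.pow 2))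
    exact continuousOn_const.div continuousOn_id fun r hr => (ne_of_gt hr)

/-- A `C¹` finite energy profile in the logarithmic coordinate, connecting the two poles. -/
structure Traj (m : ℕ) (V V1 : ℝ → Space) : Prop where
  norm : ∀ t, ‖V t‖ = 1
  deriv : ∀ t, HasDerivAt V (V1 t) t
  cont : Continuous V1
  bot : Tendsto V atBot (𝓝 (-northPole))
  top : Tendsto V atTop (𝓝 northPole)
  int : Integrable fun t => ‖V1 t‖ ^ 2 + m ^ 2 * ‖rotGen (V t)‖ ^ 2

/-- The vector field `V_t - m (k - V₃ V)`, whose square is the energy density up to a derivative. -/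
def bog (m : ℕ) (V V1 : ℝ → Space) (t : ℝ) : Space := V1 t - (m : ℝ) • (northPole - V t 2 • V t)

/-- The squared excess up to the factor `π`. -/
def bogEnergy (m : ℕ) (V V1 : ℝ → Space) : ℝ := ∫ t, ‖bog m V V1 t‖ ^ 2

section Traj

variable {m : ℕ} {V V1 : ℝ → Space}

theorem Traj.sq (h : Traj m V V1) (t : ℝ) : V t 0 ^ 2 + V t 1 ^ 2 + V t 2 ^ 2 = 1 := by
  rw [← norm_sq_space, h.norm, one_pow]

theorem hasDerivAt_coord {d : ℕ} {f : ℝ → EuclideanSpace ℝ (Fin d)} {f' : EuclideanSpace ℝ (Fin d)}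
    {t : ℝ} (h : HasDerivAt f f' t) (i : Fin d) : HasDerivAt (fun s => f s i) (f' i) t :=
  hasDerivAt_euclidean.1 h i

theorem Traj.orth (h : Traj m V V1) (t : ℝ) :
    V t 0 * V1 t 0 + V t 1 * V1 t 1 + V t 2 * V1 t 2 = 0 := by
  have h0 := hasDerivAt_coord (h.deriv t) 0
  have h1 := hasDerivAt_coord (h.deriv t) 1
  have h2 := hasDerivAt_coord (h.deriv t) 2
  have hs := ((h0.pow 2).add (h1.pow 2)).add (h2.pow 2)
  have hc : HasDerivAt ((fun s => V s 0) ^ 2 + (fun s => V s 1) ^ 2 + (fun s => V s 2) ^ 2) 0 t := by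
    have : (fun s => V s 0) ^ 2 + (fun s => V s 1) ^ 2 + (fun s => V s 2) ^ 2 = fun _ => (1 : ℝ) := by
      funext s; exact h.sq s
    rw [this]; exact hasDerivAt_const _ _
  have := hs.unique hc
  norm_num at this
  linarith

theorem bog_apply (m : ℕ) (V V1 : ℝ → Space) (t : ℝ) :
    bog m V V1 t 0 = V1 t 0 + m * (V t 2 * V t 0) ∧ bog m V V1 t 1 = V1 t 1 + m * (V t 2 * V t 1) ∧
      bog m V V1 t 2 = V1 t 2 - m * (1 - V t 2 ^ 2) := by
  refine ⟨?_, ?_, ?_⟩ <;> simp [bog, northPole, -mul_eq_mul_left_iff] <;> ring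

theorem norm_rotGen_sq (y : Space) : ‖rotGen y‖ ^ 2 = y 0 ^ 2 + y 1 ^ 2 := by
  rw [norm_sq_space]; simp [rotGen]; ring

theorem Traj.norm_bog_sq (h : Traj m V V1) (t : ℝ) :
    ‖V1 t‖ ^ 2 + m ^ 2 * ‖rotGen (V t)‖ ^ 2 = ‖bog m V V1 t‖ ^ 2 + 2 * m * V1 t 2 := by
  obtain ⟨b0, b1, b2⟩ := bog_apply m V V1 t
  rw [norm_sq_space, norm_rotGen_sq, norm_sq_space, b0, b1, b2]
  linear_combination (-2 * m * V t 2) * h.orth t + (m ^ 2 * (1 - V t 2 ^ 2)) * h.sq t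

theorem Traj.continuous (h : Traj m V V1) : Continuous V :=
  continuous_of_hasDerivAt h.deriv

theorem Traj.bog_orth (h : Traj m V V1) (t : ℝ) :
    V t 0 * bog m V V1 t 0 + V t 1 * bog m V V1 t 1 + V t 2 * bog m V V1 t 2 = 0 := by
  obtain ⟨b0, b1, b2⟩ := bog_apply m V V1 t
  rw [b0, b1, b2]
  linear_combination h.orth t + m * V t 2 * h.sq t

theorem continuous_coord {d : ℕ} {f : ℝ → EuclideanSpace ℝ (Fin d)} (hf : Continuous f) (i : Fin d) :
    Continuous fun t => f t i :=
  (EuclideanSpace.proj (𝕜 := ℝ) i).continuous.comp hf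

theorem Traj.continuous_bog (h : Traj m V V1) : Continuous (bog m V V1) := by
  unfold bog
  have := continuous_coord h.continuous 2
  have h1 := h.cont
  have h2 := h.continuous
  fun_prop

theorem Traj.integrable_norm_deriv_sq (h : Traj m V V1) : Integrable fun t => ‖V1 t‖ ^ 2 :=
  h.int.mono' (h.cont.norm.pow 2).aestronglyMeasurable (Eventually.of_forall fun t => by
    rw [Real.norm_of_nonneg (by positivity)]; nlinarith [sq_nonneg (m * ‖rotGen (V t)‖)])

theorem Traj.tendsto_coord_bot (h : Traj m V V1) (i : Fin 3) :
    Tendsto (fun t => V t i) atBot (𝓝 ((-northPole) i)) :=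
  ((EuclideanSpace.proj (𝕜 := ℝ) i).continuous.tendsto _).comp h.bot

theorem Traj.tendsto_coord_top (h : Traj m V V1) (i : Fin 3) :
    Tendsto (fun t => V t i) atTop (𝓝 (northPole i)) :=
  ((EuclideanSpace.proj (𝕜 := ℝ) i).continuous.tendsto _).comp h.top

theorem Traj.norm_bog_sq_le (h : Traj m V V1) (hm : 1 ≤ m) (t : ℝ) :
    ‖bog m V V1 t‖ ^ 2 ≤ 2 * (‖V1 t‖ ^ 2 + m ^ 2 * ‖rotGen (V t)‖ ^ 2) ∧
    |V1 t 2| ≤ ‖V1 t‖ ^ 2 + m ^ 2 * ‖rotGen (V t)‖ ^ 2 := by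
  have hm' : (1 : ℝ) ≤ m := by exact_mod_cast hm
  have hq := h.norm_bog_sq t
  have ho := h.orth t
  have hs := h.sq t
  have h1 : |V1 t 2| * |V1 t 2| ≤ ‖V1 t‖ ^ 2 * ‖rotGen (V t)‖ ^ 2 := by
    rw [abs_mul_abs_self, norm_sq_space, norm_rotGen_sq]
    have e : V t 2 ^ 2 * V1 t 2 ^ 2 ≤ (V t 0 ^ 2 + V t 1 ^ 2) * (V1 t 0 ^ 2 + V1 t 1 ^ 2) := by
      have : V t 2 * V1 t 2 = -(V t 0 * V1 t 0 + V t 1 * V1 t 1) := by linarith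
      rw [← mul_pow, this]
      nlinarith [sq_nonneg (V t 0 * V1 t 1 - V t 1 * V1 t 0)]
    nlinarith
  have h2 : 2 * (m * |V1 t 2|) ≤ ‖V1 t‖ ^ 2 + m ^ 2 * ‖rotGen (V t)‖ ^ 2 := by
    have : (m * |V1 t 2|) ≤ ‖V1 t‖ * (m * ‖rotGen (V t)‖) := by
      rw [← sq_le_sq₀ (by positivity) (by positivity)]
      nlinarith [mul_le_mul_of_nonneg_left h1 (sq_nonneg (m : ℝ))]
    nlinarith [sq_nonneg (‖V1 t‖ - m * ‖rotGen (V t)‖)]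
  constructor
  · nlinarith [abs_nonneg (V1 t 2), neg_abs_le (V1 t 2)]
  · nlinarith [abs_nonneg (V1 t 2)]

theorem Traj.integrable_bog (h : Traj m V V1) (hm : 1 ≤ m) :
    Integrable fun t => ‖bog m V V1 t‖ ^ 2 :=
  (h.int.const_mul 2).mono' (h.continuous_bog.norm.pow 2).aestronglyMeasurable
    (Eventually.of_forall fun t => by
      rw [Real.norm_of_nonneg (by positivity)]; exact (h.norm_bog_sq_le hm t).1)

/-- The Bogomolny identity. -/
theorem Traj.integral_energy (h : Traj m V V1) (hm : 1 ≤ m) :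
    ∫ t, (‖V1 t‖ ^ 2 + m ^ 2 * ‖rotGen (V t)‖ ^ 2) = bogEnergy m V V1 + 4 * m := by
  have hi : Integrable fun t => V1 t 2 :=
    h.int.mono' (continuous_coord h.cont 2).aestronglyMeasurable
      (Eventually.of_forall fun t => (h.norm_bog_sq_le hm t).2)
  have hz := integral_of_hasDerivAt_of_tendsto (fun t => hasDerivAt_coord (h.deriv t) 2) hi
    (h.tendsto_coord_bot 2) (h.tendsto_coord_top 2)
  simp only [h.norm_bog_sq]
  rw [integral_add (h.integrable_bog hm) (hi.const_mul _), integral_const_mul, hz, bogEnergy]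
  simp [northPole]
  ring

end Traj

theorem traj_logProfile {m : ℕ} {u : Plane → Space} (h : IsSigma m u) {v1 : ℝ → Space}
    (hd : ∀ r, 0 < r → HasDerivAt (profile u) (v1 r) r) (hc : ContinuousOn v1 (Set.Ioi 0)) :
    Traj m (logProfile u) (logDeriv v1) ∧
      hdotENorm 1 u ^ 2 = ENNReal.ofReal (2 * π *
        ∫ t, (‖exp t • v1 (exp t)‖ ^ 2 + m ^ 2 * ‖rotGen (logProfile u t)‖ ^ 2)) := by
  have hD : ∀ t, HasDerivAt (logProfile u) (exp t • v1 (exp t)) t := fun t =>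
    hasDerivAt_comp_exp (hd _ (exp_pos t))
  have hC : Continuous fun t => exp t • v1 (exp t) :=
    continuous_exp.smul (hc.comp_continuous continuous_exp fun t => exp_pos t)
  have hp : ContDiffOn ℝ 1 (profile u) (Set.Ioi 0) := by
    rw [show (1 : WithTop ℕ∞) = 0 + 1 by simp, contDiffOn_succ_iff_deriv_of_isOpen isOpen_Ioi]
    refine ⟨fun r hr => (hd r hr).differentiableAt.differentiableWithinAt, by simp, ?_⟩
    exact contDiffOn_zero.2 (hc.congr fun r hr => (hd r hr).deriv)
  have hw : ∀ I : Fin 1 → Fin 2, ∃ g, IsWeakDeriv I u g := fun I => by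
    obtain ⟨g, hg, _⟩ := h.memHdot I
    exact ⟨g, hg⟩
  have hnorm := h.isEquivariant.hdotENorm_one_sq_exp hp hD hw
  have hfin : hdotENorm 1 u ^ 2 ≠ ⊤ := by
    refine ENNReal.pow_ne_top ?_
    rw [hdotENorm]
    refine ENNReal.rpow_ne_top_of_nonneg (by norm_num) (ENNReal.sum_ne_top.2 fun I _ => ?_)
    obtain ⟨g, hg, hg2⟩ := h.memHdot I
    exact ENNReal.pow_ne_top (ne_top_of_le_ne_top hg2.2.ne (iInf₂_le g hg))
  have hcV : Continuous (logProfile u) := continuous_of_hasDerivAt hD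
  have hcont : Continuous fun t => ‖exp t • v1 (exp t)‖ ^ 2 +
      m ^ 2 * ‖rotGen (logProfile u t)‖ ^ 2 :=
    (hC.norm.pow 2).add (continuous_const.mul ((rotGenL.continuous.comp hcV).norm.pow 2))
  have hint : Integrable fun t => ‖exp t • v1 (exp t)‖ ^ 2 +
      m ^ 2 * ‖rotGen (logProfile u t)‖ ^ 2 := by
    refine ⟨hcont.aestronglyMeasurable, ?_⟩
    rw [hasFiniteIntegral_iff_ofReal (Eventually.of_forall fun t => by positivity)]
    rw [hnorm] at hfin
    refine lt_top_iff_ne_top.2 fun htop => hfin ?_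
    rw [htop, ENNReal.mul_top (by simp [pi_pos])]
  refine ⟨⟨fun t => ?_, hD, hC, ?_, ?_, hint⟩, ?_⟩
  · rw [logProfile, profile_eq]; exact h.sphere _
  · exact h.tendsto_zero.comp tendsto_exp_atBot_nhdsGT
  · exact h.tendsto_infty.comp tendsto_exp_atTop
  · rw [hnorm, ← ofReal_integral_eq_lintegral_ofReal hint
      (Eventually.of_forall fun t => by positivity), ← ENNReal.ofReal_mul (by positivity)]

/-- The excess in terms of the profile. -/
theorem excess_sq {m : ℕ} (hm : 1 ≤ m) {u : Plane → Space} {V1 : ℝ → Space}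
    (h : Traj m (logProfile u) V1)
    (hn : hdotENorm 1 u ^ 2 = ENNReal.ofReal (2 * π *
        ∫ t, (‖V1 t‖ ^ 2 + m ^ 2 * ‖rotGen (logProfile u t)‖ ^ 2))) :
    excess m u = sqrt (π * bogEnergy m (logProfile u) V1) := by
  have h0 : 0 ≤ ∫ t, (‖V1 t‖ ^ 2 + m ^ 2 * ‖rotGen (logProfile u t)‖ ^ 2) :=
    integral_nonneg fun t => by positivity
  have hpi := pi_pos
  have : (hdotENorm 1 u).toReal ^ 2 = 2 * π *
      ∫ t, (‖V1 t‖ ^ 2 + m ^ 2 * ‖rotGen (logProfile u t)‖ ^ 2) := by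
    rw [← ENNReal.toReal_pow, hn, ENNReal.toReal_ofReal (by positivity)]
  rw [excess, energy, this, h.integral_energy hm]
  congr 1
  ring

/-! ### Stability of the harmonic profile -/

theorem inner_sq_le_of_orth {F V H : Space} (hV : ‖V‖ = 1) (hH : ‖H‖ = 1) (ho : inner ℝ F V = 0) :
    inner ℝ F H ^ 2 ≤ ‖F‖ ^ 2 * (1 - inner ℝ V H ^ 2) := by
  have h1 : inner ℝ F H = inner ℝ F (H - inner ℝ V H • V) := by
    rw [inner_sub_right, inner_smul_right, ho]; ring
  have h2 : ‖H - inner ℝ V H • V‖ ^ 2 = 1 - inner ℝ V H ^ 2 := by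
    rw [@norm_sub_sq_real, norm_smul, inner_smul_right, hV, hH, real_inner_comm, mul_one,
      Real.norm_eq_abs, sq_abs]
    ring
  rw [h1, ← h2, ← mul_pow, ← sq_abs]
  gcongr
  exact abs_real_inner_le_norm _ _

theorem norm_northPole : ‖northPole‖ = 1 := by
  rw [← sq_eq_sq₀ (norm_nonneg _) zero_le_one, norm_sq_space]; simp [northPole]

theorem norm_Hp (m : ℕ) (t : ℝ) : ‖Hp m t‖ = 1 := by
  rw [← sq_eq_sq₀ (norm_nonneg _) zero_le_one, norm_sq_space]
  simp [Hp, H_sq]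

theorem continuous_Hp (m : ℕ) : Continuous (Hp m) := by
  refine continuous_iff_continuousAt.2 fun t => HasDerivAt.continuousAt
    (f' := !₂[-(m * H₁ m t * H₃ m t), 0, m * H₁ m t ^ 2]) ?_
  rw [hasDerivAt_euclidean]
  intro i
  fin_cases i
  · exact hasDerivAt_H₁ m t
  · exact hasDerivAt_const _ _
  · exact hasDerivAt_H₃ m t

theorem H₁_neg (m : ℕ) (t : ℝ) : H₁ m (-t) = H₁ m t := by
  rw [H₁_eq, H₁_eq, mul_neg, exp_neg]
  have := (exp_pos (m * t)).ne'
  field_simp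
  ring

theorem H₃_neg (m : ℕ) (t : ℝ) : H₃ m (-t) = -H₃ m t := by
  rw [H₃_eq, H₃_eq, mul_neg, exp_neg]
  have := (exp_pos (m * t)).ne'
  field_simp
  ring

theorem H₃_nonneg (m : ℕ) {t : ℝ} (ht : 0 ≤ t) : 0 ≤ H₃ m t := by
  rw [H₃_eq]
  have : 1 ≤ exp (m * t) := Real.one_le_exp (by positivity)
  refine div_nonneg ?_ (by positivity)
  nlinarith

theorem neg_one_lt_H₃ (m : ℕ) (t : ℝ) : -1 < H₃ m t := by
  rw [H₃_eq, lt_div_iff₀ (by positivity)]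
  nlinarith [exp_pos (m * t), sq_nonneg (exp (m * t))]

section Traj

variable {m : ℕ} {V V1 : ℝ → Space}

theorem Traj.inner_bog (h : Traj m V V1) (t : ℝ) : inner ℝ (bog m V V1 t) (V t) = 0 := by
  rw [inner_space]; linarith [h.bog_orth t]

theorem Traj.bog_two_sq_le (h : Traj m V V1) (t : ℝ) :
    bog m V V1 t 2 ^ 2 ≤ ‖bog m V V1 t‖ ^ 2 * (1 - V t 2 ^ 2) := by
  have := inner_sq_le_of_orth (h.norm t) norm_northPole (h.inner_bog t)
  simpa [inner_space, northPole] using this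

theorem Traj.deriv_two (t : ℝ) : V1 t 2 = m * (1 - V t 2 ^ 2) + bog m V V1 t 2 := by
  rw [(bog_apply m V V1 t).2.2]; ring

theorem Traj.one_sub_sq_nonneg (h : Traj m V V1) (t : ℝ) : 0 ≤ 1 - V t 2 ^ 2 := by
  nlinarith [h.sq t, sq_nonneg (V t 0), sq_nonneg (V t 1)]

theorem Traj.deriv_two_ge (h : Traj m V V1) (hm : 1 ≤ m) (t : ℝ) :
    0 ≤ V1 t 2 + ‖bog m V V1 t‖ ^ 2 / (4 * m) := by
  have hm' : (0 : ℝ) < m := by exact_mod_cast hm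
  have h1 := h.bog_two_sq_le t
  have hy := h.one_sub_sq_nonneg t
  rw [Traj.deriv_two (m := m) (V := V) (V1 := V1)]
  set y := 1 - V t 2 ^ 2
  set N := ‖bog m V V1 t‖ ^ 2
  have hN : 0 ≤ N := by positivity
  have h2 : |4 * m * bog m V V1 t 2| ≤ 4 * m ^ 2 * y + N := by
    refine abs_le_of_sq_le_sq ?_ (by positivity)
    nlinarith [sq_nonneg (4 * m ^ 2 * y - N), mul_le_mul_of_nonneg_left h1 (sq_nonneg (m : ℝ))]
  have h3 := neg_abs_le (4 * m * bog m V V1 t 2)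
  have : m * y + bog m V V1 t 2 + N / (4 * m) =
      (4 * m ^ 2 * y + 4 * m * bog m V V1 t 2 + N) / (4 * m) := by field_simp
  rw [this]
  exact div_nonneg (by linarith) (by positivity)

theorem Traj.hasDerivAt_integral_bog (h : Traj m V V1) (t : ℝ) :
    HasDerivAt (fun t => ∫ s in (0 : ℝ)..t, ‖bog m V V1 s‖ ^ 2) (‖bog m V V1 t‖ ^ 2) t :=
  intervalIntegral.integral_hasDerivAt_right ((h.continuous_bog.norm.pow 2).intervalIntegrable _ _)
    (h.continuous_bog.norm.pow 2).stronglyMeasurable.stronglyMeasurableAtFilter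
    (h.continuous_bog.norm.pow 2).continuousAt

theorem Traj.integral_bog_le (h : Traj m V V1) (hm : 1 ≤ m) {a b : ℝ} (hab : a ≤ b) :
    ∫ s in a..b, ‖bog m V V1 s‖ ^ 2 ≤ bogEnergy m V V1 := by
  rw [intervalIntegral.integral_of_le hab]
  exact setIntegral_le_integral (h.integrable_bog hm) (Eventually.of_forall fun t => by positivity)

theorem Traj.two_ge (h : Traj m V V1) (hm : 1 ≤ m) (h0 : V 0 2 = 0)
    (hE : bogEnergy m V V1 ≤ 2 * m) {t : ℝ} (ht : 0 ≤ t) : -(1 / 2) ≤ V t 2 := by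
  have hm' : (0 : ℝ) < m := by exact_mod_cast hm
  have hmono : Monotone fun t => V t 2 + (∫ s in (0 : ℝ)..t, ‖bog m V V1 s‖ ^ 2) / (4 * m) := by
    refine monotone_of_hasDerivAt_nonneg (fun t => ((hasDerivAt_coord (h.deriv t) 2).add
      ((h.hasDerivAt_integral_bog t).div_const _))) fun t => h.deriv_two_ge hm t
  have h1 := hmono ht
  simp only [intervalIntegral.integral_same, zero_div, h0, add_zero] at h1
  have h2 : (∫ s in (0 : ℝ)..t, ‖bog m V V1 s‖ ^ 2) / (4 * m) ≤ 1 / 2 := by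
    rw [div_le_iff₀ (by positivity)]
    linarith [h.integral_bog_le hm ht]
  linarith

theorem Traj.stable_right (h : Traj m V V1) (hm : 1 ≤ m) (h0 : V 0 = !₂[1, 0, 0])
    (hE : bogEnergy m V V1 ≤ 2 * m) {t : ℝ} (ht : 0 ≤ t) :
    ‖V t - Hp m t‖ ^ 2 ≤ 4 / m * bogEnergy m V V1 := by
  have hm' : (0 : ℝ) < m := by exact_mod_cast hm
  set D : ℝ → ℝ := fun t => 1 - (V t 0 * H₁ m t + V t 2 * H₃ m t) with hD
  set D' : ℝ → ℝ := fun t => -((bog m V V1 t 0 * H₁ m t + bog m V V1 t 2 * H₃ m t) +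
    m * (V t 2 + H₃ m t) * D t) with hD'
  have hDd : ∀ t, HasDerivAt D (D' t) t := fun t => by
    obtain ⟨b0, b1, b2⟩ := bog_apply m V V1 t
    refine ((((hasDerivAt_coord (h.deriv t) 0).mul (hasDerivAt_H₁ m t)).add
      ((hasDerivAt_coord (h.deriv t) 2).mul (hasDerivAt_H₃ m t))).const_sub 1).congr_deriv ?_
    simp only [hD', hD, b0, b2]
    linear_combination (-(m * V t 2)) * H_sq m t
  have hDn : ∀ t, ‖V t - Hp m t‖ ^ 2 = 2 * D t := fun t => by
    rw [@norm_sub_sq_real, h.norm, norm_Hp, inner_space]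
    simp [Hp, hD]; ring
  have hin : ∀ t, inner ℝ (V t) (Hp m t) = 1 - D t := fun t => by
    rw [inner_space]; simp [Hp, hD]
  have hinF : ∀ t, inner ℝ (bog m V V1 t) (Hp m t) =
      bog m V V1 t 0 * H₁ m t + bog m V V1 t 2 * H₃ m t := fun t => by
    rw [inner_space]; simp [Hp]
  have hD0 : ∀ t, 0 ≤ D t := fun t => by nlinarith [hDn t, sq_nonneg ‖V t - Hp m t‖]
  have hpd : ∀ t, HasDerivAt (fun t => 2 / (1 + H₃ m t)) (-(2 * (m * H₁ m t ^ 2)) / (1 + H₃ m t) ^ 2) t :=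
    fun t => by
      have := (hasDerivAt_const t (2 : ℝ)).div ((hasDerivAt_H₃ m t).const_add 1)
        (by linarith [neg_one_lt_H₃ m t])
      refine this.congr_deriv ?_
      ring
  have hanti : AntitoneOn (fun t => 2 / (1 + H₃ m t) * D t -
      2 / m * ∫ s in (0 : ℝ)..t, ‖bog m V V1 s‖ ^ 2) (Set.Ici 0) := by
    have hd : ∀ t, HasDerivAt (fun t => 2 / (1 + H₃ m t) * D t -
        2 / m * ∫ s in (0 : ℝ)..t, ‖bog m V V1 s‖ ^ 2)
        ((-(2 * (m * H₁ m t ^ 2)) / (1 + H₃ m t) ^ 2) * D t + 2 / (1 + H₃ m t) * D' t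
          - 2 / m * ‖bog m V V1 t‖ ^ 2) t := fun t =>
      ((hpd t).mul (hDd t)).sub ((h.hasDerivAt_integral_bog t).const_mul _)
    refine antitoneOn_of_hasDerivWithinAt_nonpos (convex_Ici 0)
      (fun t _ => (hd t).continuousAt.continuousWithinAt) (fun t _ => (hd t).hasDerivWithinAt) ?_
    intro s hs
    rw [interior_Ici] at hs
    have hs0 : 0 ≤ s := le_of_lt hs
    have hz := h.two_ge hm (by simp [h0]) hE hs0
    have h3 := H₃_nonneg m hs0
    have hp : 0 < 1 + H₃ m s := by linarith
    have hcs := inner_sq_le_of_orth (h.norm s) (norm_Hp m s) (h.inner_bog s)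
    rw [hin, hinF] at hcs
    set G := bog m V V1 s 0 * H₁ m s + bog m V V1 s 2 * H₃ m s
    set N := ‖bog m V V1 s‖ ^ 2 with hN
    have hN0 : 0 ≤ N := by positivity
    have hd0 := hD0 s
    have hG : |G| ≤ m / 2 * D s + N / m := by
      refine abs_le_of_sq_le_sq ?_ (by positivity)
      have e : (m / 2 * D s + N / m) ^ 2 = (m / 2 * D s - N / m) ^ 2 + 2 * D s * N := by
        field_simp; ring
      rw [e]
      nlinarith [sq_nonneg (m / 2 * D s - N / m), mul_nonneg hN0 (sq_nonneg (D s))]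
    have hkey : (-(2 * (m * H₁ m s ^ 2)) / (1 + H₃ m s) ^ 2) * D s + 2 / (1 + H₃ m s) * D' s
          = 2 / (1 + H₃ m s) * (-G - m * (1 + V s 2) * D s) := by
      have e1 : H₁ m s ^ 2 = (1 - H₃ m s) * (1 + H₃ m s) := by linarith [H_sq m s]
      simp only [hD', e1]
      field_simp
      ring
    rw [hkey]
    have hle : -G - m * (1 + V s 2) * D s ≤ N / m := by
      have := neg_abs_le G
      nlinarith [mul_nonneg hm'.le hd0]
    have hp2 : 2 / (1 + H₃ m s) ≤ 2 := by
      rw [div_le_iff₀ hp]; linarith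
    have hp0 : 0 ≤ 2 / (1 + H₃ m s) := by positivity
    have hNm : 0 ≤ N / m := by positivity
    have : 2 / (1 + H₃ m s) * (-G - m * (1 + V s 2) * D s) ≤ 2 * (N / m) :=
      (mul_le_mul_of_nonneg_left hle hp0).trans (mul_le_mul_of_nonneg_right hp2 hNm)
    have e2 : 2 / m * N = 2 * (N / m) := by ring
    linarith
  have hfin := hanti (Set.mem_Ici.2 le_rfl) (Set.mem_Ici.2 ht) ht
  have hD00 : D 0 = 0 := by
    simp [hD, h0, H₁_eq]; norm_num
  simp only [hD00, mul_zero, intervalIntegral.integral_same, sub_zero] at hfin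
  have hp1 : 1 ≤ 2 / (1 + H₃ m t) := by
    rw [le_div_iff₀ (by linarith [neg_one_lt_H₃ m t])]
    linarith [(abs_le.1 (abs_H₃_le_one m t)).2]
  have hb := h.integral_bog_le hm ht
  have hb2 : 2 / m * ∫ s in (0 : ℝ)..t, ‖bog m V V1 s‖ ^ 2 ≤ 2 / m * bogEnergy m V V1 := by gcongr
  have hDt := hD0 t
  have e3 : 4 / (m : ℝ) * bogEnergy m V V1 = 2 * (2 / m * bogEnergy m V V1) := by ring
  rw [hDn, e3]
  nlinarith

/-- Reflection of the third coordinate. -/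
def reflZ : Space →L[ℝ] Space := LinearMap.toContinuousLinearMap
  { toFun := fun y => !₂[y 0, y 1, -(y 2)]
    map_add' := fun x y => by ext i; fin_cases i <;> simp; ring
    map_smul' := fun c x => by ext i; fin_cases i <;> simp }

theorem reflZ_apply (y : Space) : reflZ y = !₂[y 0, y 1, -(y 2)] := rfl

theorem norm_reflZ (y : Space) : ‖reflZ y‖ = ‖y‖ := by
  rw [← sq_eq_sq₀ (norm_nonneg _) (norm_nonneg _), norm_sq_space, norm_sq_space, reflZ_apply]
  simp

theorem reflZ_northPole : reflZ northPole = -northPole := by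
  ext i; fin_cases i <;> simp [reflZ_apply, northPole]

theorem Traj.reflect (h : Traj m V V1) :
    Traj m (fun t => reflZ (V (-t))) (fun t => -reflZ (V1 (-t))) where
  norm t := by rw [norm_reflZ, h.norm]
  deriv t := by
    have h1 := (h.deriv (-t)).scomp t (hasDerivAt_neg t)
    have h2 := reflZ.hasFDerivAt.comp_hasDerivAt t h1
    refine h2.congr_deriv ?_
    simp
  cont := (reflZ.continuous.comp (h.cont.comp continuous_neg)).neg
  bot := by
    have := (reflZ.continuous.tendsto _).comp (h.top.comp tendsto_neg_atBot_atTop)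
    rwa [reflZ_northPole] at this
  top := by
    have := (reflZ.continuous.tendsto _).comp (h.bot.comp tendsto_neg_atTop_atBot)
    rwa [map_neg, reflZ_northPole, neg_neg] at this
  int := by
    have := h.int.comp_neg
    refine this.congr (Eventually.of_forall fun t => ?_)
    simp only [norm_neg, norm_reflZ, norm_rotGen_sq]
    simp [reflZ_apply]

theorem bog_reflect (t : ℝ) : ‖bog m (fun t => reflZ (V (-t))) (fun t => -reflZ (V1 (-t))) t‖ ^ 2 =
    ‖bog m V V1 (-t)‖ ^ 2 := by
  obtain ⟨b0, b1, b2⟩ := bog_apply m V V1 (-t)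
  obtain ⟨c0, c1, c2⟩ := bog_apply m (fun t => reflZ (V (-t))) (fun t => -reflZ (V1 (-t))) t
  rw [norm_sq_space, norm_sq_space, b0, b1, b2, c0, c1, c2]
  simp [reflZ_apply]
  ring

theorem bogEnergy_reflect :
    bogEnergy m (fun t => reflZ (V (-t))) (fun t => -reflZ (V1 (-t))) = bogEnergy m V V1 := by
  unfold bogEnergy
  simp only [bog_reflect]
  exact integral_neg_eq_self (fun t => ‖bog m V V1 t‖ ^ 2) volume

theorem Traj.stable (h : Traj m V V1) (hm : 1 ≤ m) (h0 : V 0 = !₂[1, 0, 0])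
    (hE : bogEnergy m V V1 ≤ 2 * m) (t : ℝ) :
    ‖V t - Hp m t‖ ^ 2 ≤ 4 / m * bogEnergy m V V1 := by
  rcases le_total 0 t with ht | ht
  · exact h.stable_right hm h0 hE ht
  · have := h.reflect.stable_right hm (by simp [h0, reflZ_apply]) (bogEnergy_reflect.trans_le hE)
      (neg_nonneg.2 ht)
    rw [bogEnergy_reflect] at this
    refine le_trans (le_of_eq ?_) this
    have e : Hp m (-t) = reflZ (Hp m t) := by
      ext i; fin_cases i <;> simp [Hp, reflZ_apply, H₁_neg, H₃_neg]
    rw [neg_neg, e, ← map_sub, norm_reflZ]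

theorem rot_northPole (a : ℝ) : rot a northPole = northPole := by
  ext i; fin_cases i <;> simp [rot, northPole]

theorem rot_two (a : ℝ) (y : Space) : rot a y 2 = y 2 := by simp [rot]

theorem Traj.shift (h : Traj m V V1) (a τ : ℝ) :
    Traj m (fun t => rot a (V (t + τ))) (fun t => rot a (V1 (t + τ))) where
  norm t := by rw [norm_rot, h.norm]
  deriv t := (rotL a).hasFDerivAt.comp_hasDerivAt t ((h.deriv (t + τ)).comp_add_const t τ)
  cont := (rotL a).continuous.comp (h.cont.comp (continuous_add_const τ))
  bot := by
    have := ((rotL a).continuous.tendsto _).comp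
      (h.bot.comp (tendsto_atBot_add_const_right _ τ tendsto_id))
    rw [map_neg, rotL_apply, rot_northPole] at this
    exact this
  top := by
    have := ((rotL a).continuous.tendsto _).comp
      (h.top.comp (tendsto_atTop_add_const_right _ τ tendsto_id))
    rw [rotL_apply, rot_northPole] at this
    exact this
  int := by
    refine (h.int.comp_add_right τ).congr (Eventually.of_forall fun t => ?_)
    simp only [norm_rot, rotGen_rot]

theorem bog_shift (a τ t : ℝ) : bog m (fun t => rot a (V (t + τ))) (fun t => rot a (V1 (t + τ))) t =
    rot a (bog m V V1 (t + τ)) := by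
  unfold bog
  rw [← rotL_apply a (V1 (t + τ) - _), map_sub, map_smul, map_sub, map_smul, rotL_apply, rotL_apply,
    rotL_apply, rot_northPole, rot_two]

theorem bogEnergy_shift (a τ : ℝ) :
    bogEnergy m (fun t => rot a (V (t + τ))) (fun t => rot a (V1 (t + τ))) = bogEnergy m V V1 := by
  unfold bogEnergy
  simp only [bog_shift, norm_rot]
  exact integral_add_right_eq_self (fun t => ‖bog m V V1 t‖ ^ 2) τ

theorem rot_rot_neg (a : ℝ) (y : Space) : rot a (rot (-a) y) = y := by
  rw [← rot_add]; simp

/-- A profile of small excess is close to a harmonic profile. -/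
theorem Traj.exists_stable (h : Traj m V V1) (hm : 1 ≤ m) (hE : bogEnergy m V V1 ≤ 2 * m) :
    ∃ τ a : ℝ, ∀ t, ‖rot a (V (t + τ)) - Hp m t‖ ^ 2 ≤ 4 / m * bogEnergy m V V1 := by
  have hz : ∃ τ, V τ 2 = 0 := by
    have hc := continuous_coord h.continuous 2
    have hb := h.tendsto_coord_bot 2
    have ht := h.tendsto_coord_top 2
    have e1 : (-northPole : Space) 2 = -1 := by simp [northPole]
    have e2 : (northPole : Space) 2 = 1 := by simp [northPole]
    rw [e1] at hb
    rw [e2] at ht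
    obtain ⟨a, ha⟩ := (hb.eventually (gt_mem_nhds (by norm_num : (-1 : ℝ) < 0))).exists
    obtain ⟨b, hb'⟩ := (ht.eventually (lt_mem_nhds (by norm_num : (0 : ℝ) < 1))).exists
    exact mem_range_of_exists_le_of_exists_ge hc ⟨a, ha.le⟩ ⟨b, hb'.le⟩
  obtain ⟨τ, hτ⟩ := hz
  set θ := Complex.arg ⟨V τ 0, V τ 1⟩ with hθ
  refine ⟨τ, -θ, ?_⟩
  have hs := h.sq τ
  rw [hτ] at hs
  have hn : ‖(⟨V τ 0, V τ 1⟩ : ℂ)‖ = 1 := by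
    rw [← sq_eq_sq₀ (norm_nonneg _) zero_le_one, Complex.sq_norm, Complex.normSq_apply]
    simp only
    linarith
  have hz := Complex.norm_mul_exp_arg_mul_I ⟨V τ 0, V τ 1⟩
  rw [hn, ← hθ, Complex.ofReal_one, one_mul] at hz
  have hc : cos θ = V τ 0 := by
    rw [← Complex.exp_ofReal_mul_I_re, hz]
  have hsn : sin θ = V τ 1 := by
    rw [← Complex.exp_ofReal_mul_I_im, hz]
  have h0 : rot (-θ) (V (0 + τ)) = !₂[1, 0, 0] := by
    rw [zero_add]
    ext i
    fin_cases i
    · simp [rot, hc, hsn]; linarith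
    · simp [rot, hc, hsn]; ring
    · simp [rot, hτ]
  have := (h.shift (-θ) τ).stable hm h0 (by rw [bogEnergy_shift]; exact hE)
  rw [bogEnergy_shift] at this
  exact this

end Traj

/-! ### The distance to the family of harmonic maps -/

/-- The derivative of the harmonic profile. -/
def Hp1 (m : ℕ) (t : ℝ) : Space := !₂[-(m * H₁ m t * H₃ m t), 0, m * H₁ m t ^ 2]

theorem hasDerivAt_Hp (m : ℕ) (t : ℝ) : HasDerivAt (Hp m) (Hp1 m t) t := by
  rw [hasDerivAt_euclidean]
  intro i
  fin_cases i
  · exact hasDerivAt_H₁ m t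
  · exact hasDerivAt_const _ _
  · exact hasDerivAt_H₃ m t

theorem continuous_Hp1 (m : ℕ) : Continuous (Hp1 m) := by
  have h1 := continuous_H₁ m
  have h3 := continuous_H₃ m
  refine (PiLp.continuous_toLp 2 _).comp (continuous_pi fun i => ?_)
  fin_cases i
  · exact ((continuous_const.mul h1).mul h3).neg
  · exact continuous_const
  · exact continuous_const.mul (h1.pow 2)

/-- The weighted distance between `e^{-αR} V(· + τ)` and the harmonic profile. -/
def distJ (m : ℕ) (V : ℝ → Space) (τ α : ℝ) : ℝ :=
  ∫ t, ‖rot (-α) (V (t + τ)) - Hp m t‖ ^ 2 * H₁ m t ^ 2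

section Traj

variable {m : ℕ} {V V1 : ℝ → Space}

theorem integrable_norm_sub_Hp_sq (hm : 1 ≤ m) {U : ℝ → Space} (hU : Continuous U)
    (hn : ∀ t, ‖U t‖ = 1) : Integrable fun t => ‖U t - Hp m t‖ ^ 2 * H₁ m t ^ 2 := by
  refine ((integrable_H₁_sq hm).const_mul 4).mono' ?_ (Eventually.of_forall fun t => ?_)
  · exact (((hU.sub (continuous_Hp m)).norm.pow 2).mul ((continuous_H₁ m).pow 2)).aestronglyMeasurable
  · rw [Real.norm_of_nonneg (by positivity)]
    have := norm_sub_le (U t) (Hp m t)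
    rw [hn, norm_Hp] at this
    gcongr
    nlinarith [norm_nonneg (U t - Hp m t)]

theorem Traj.integral_diff (h : Traj m V V1) (hm : 1 ≤ m) :
    Integrable (fun t => ‖V1 t - Hp1 m t‖ ^ 2 + m ^ 2 * ‖rotGen (V t - Hp m t)‖ ^ 2) ∧
    ∫ t, (‖V1 t - Hp1 m t‖ ^ 2 + m ^ 2 * ‖rotGen (V t - Hp m t)‖ ^ 2) =
      bogEnergy m V V1 + 2 * m ^ 2 * ∫ t, ‖V t - Hp m t‖ ^ 2 * H₁ m t ^ 2 := by
  have hm' : (0 : ℝ) < m := by exact_mod_cast hm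
  set X : ℝ → ℝ := fun t => V1 t 0 * Hp1 m t 0 + V1 t 2 * Hp1 m t 2 + m ^ 2 * (V t 0 * H₁ m t) with hX
  set Y : ℝ → ℝ := fun t => V t 0 * Hp1 m t 0 + V t 2 * Hp1 m t 2 with hY
  have hI := h.int
  have hJ := integrable_norm_sub_Hp_sq hm h.continuous h.norm
  have hH := integrable_H₁_sq hm
  have hVH : ∀ t, ‖V t - Hp m t‖ ^ 2 = 2 - 2 * (V t 0 * H₁ m t + V t 2 * H₃ m t) := fun t => by
    rw [@norm_sub_sq_real, h.norm, norm_Hp, inner_space]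
    simp [Hp]; ring
  have hc := continuous_coord h.continuous
  have hc1 := continuous_coord h.cont
  have hcH := continuous_coord (continuous_Hp1 m)
  have hXi : Integrable X := by
    refine ((hI.add (hH.const_mul (2 * m ^ 2)))).mono' ?_ (Eventually.of_forall fun t => ?_)
    · exact ((((hc1 0).mul (hcH 0)).add ((hc1 2).mul (hcH 2))).add
        (continuous_const.mul ((hc 0).mul (continuous_H₁ m)))).aestronglyMeasurable
    · change ‖X t‖ ≤ (‖V1 t‖ ^ 2 + m ^ 2 * ‖rotGen (V t)‖ ^ 2) + 2 * m ^ 2 * H₁ m t ^ 2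
      rw [Real.norm_eq_abs, norm_rotGen_sq, norm_sq_space]
      simp only [hX]
      have e : Hp1 m t 0 ^ 2 + Hp1 m t 2 ^ 2 = m ^ 2 * H₁ m t ^ 2 := by
        have := H_sq m t
        simp only [Hp1]
        simp
        linear_combination (m ^ 2 * H₁ m t ^ 2) * this
      rw [abs_le]
      constructor
      · nlinarith [sq_nonneg (V1 t 0 + Hp1 m t 0), sq_nonneg (V1 t 2 + Hp1 m t 2),
          sq_nonneg (V1 t 1), sq_nonneg (m * (V t 0 + H₁ m t)), sq_nonneg (m * V t 1),
          sq_nonneg (V1 t 0), sq_nonneg (V1 t 2), sq_nonneg (m * V t 0), sq_nonneg (m * H₁ m t)]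
      · nlinarith [sq_nonneg (V1 t 0 - Hp1 m t 0), sq_nonneg (V1 t 2 - Hp1 m t 2),
          sq_nonneg (V1 t 1), sq_nonneg (m * (V t 0 - H₁ m t)), sq_nonneg (m * V t 1),
          sq_nonneg (V1 t 0), sq_nonneg (V1 t 2), sq_nonneg (m * V t 0), sq_nonneg (m * H₁ m t)]
  have hYd : ∀ t, HasDerivAt Y (X t - 2 * m ^ 2 * H₁ m t ^ 2 + m ^ 2 * (‖V t - Hp m t‖ ^ 2 * H₁ m t ^ 2)) t := by
    intro t
    have d1 := hasDerivAt_H₁ m t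
    have d3 := hasDerivAt_H₃ m t
    have e0 := ((d1.const_mul (m : ℝ)).mul d3).neg
    have e2 := (d1.pow 2).const_mul (m : ℝ)
    have hd := ((hasDerivAt_coord (h.deriv t) 0).mul e0).add ((hasDerivAt_coord (h.deriv t) 2).mul e2)
    refine hd.congr_deriv ?_
    rw [hVH]
    simp only [hX, Hp1, Pi.pow_apply, Pi.neg_apply, Pi.mul_apply]
    simp
    linear_combination (m ^ 2 * V t 0 * H₁ m t) * H_sq m t
  have hYi : Integrable fun t => X t - 2 * m ^ 2 * H₁ m t ^ 2 +
      m ^ 2 * (‖V t - Hp m t‖ ^ 2 * H₁ m t ^ 2) :=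
    (hXi.sub (hH.const_mul _)).add (hJ.const_mul _)
  have hYb : ∀ t, |Y t| ≤ 2 * m * H₁ m t := fun t => by
    have b0 : |V t 0| ≤ 1 := by
      rw [← sq_le_one_iff_abs_le_one]; nlinarith [h.sq t, sq_nonneg (V t 1), sq_nonneg (V t 2)]
    have b2 : |V t 2| ≤ 1 := by
      rw [← sq_le_one_iff_abs_le_one]; nlinarith [h.sq t, sq_nonneg (V t 1), sq_nonneg (V t 0)]
    have e : Y t = m * H₁ m t * (-(V t 0 * H₃ m t) + V t 2 * H₁ m t) := by
      simp [hY, Hp1]; ring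
    have hp := H₁_pos m t
    rw [e, abs_mul, abs_of_pos (by positivity)]
    have : |-(V t 0 * H₃ m t) + V t 2 * H₁ m t| ≤ 2 := by
      refine (abs_add_le _ _).trans ?_
      rw [abs_neg, abs_mul, abs_mul, abs_of_pos hp]
      nlinarith [abs_H₃_le_one m t, H₁_le_one m t, abs_nonneg (V t 0), abs_nonneg (V t 2),
        abs_nonneg (H₃ m t), mul_le_one₀ b0 (abs_nonneg _) (abs_H₃_le_one m t),
        mul_le_one₀ b2 hp.le (H₁_le_one m t)]
    nlinarith [mul_pos hm' hp]
  have hYt : ∀ {l : Filter ℝ} {c : ℝ}, Tendsto (H₃ m) l (𝓝 c) → c ^ 2 = 1 → Tendsto Y l (𝓝 0) :=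
    fun {l c} hl hc2 => by
      have := (tendsto_H₁ hl hc2).const_mul (2 * m : ℝ)
      rw [mul_zero] at this
      exact squeeze_zero_norm hYb this
  have hYint := integral_of_hasDerivAt_of_tendsto hYd hYi (hYt (tendsto_H₃_atBot hm) (by norm_num))
    (hYt (tendsto_H₃_atTop hm) (by norm_num))
  have hXint : ∫ t, X t = 2 * m ^ 2 * (2 / m) - m ^ 2 * ∫ t, ‖V t - Hp m t‖ ^ 2 * H₁ m t ^ 2 := by
    have hs1 : Integrable fun t => X t - 2 * m ^ 2 * H₁ m t ^ 2 := hXi.sub (hH.const_mul _)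
    rw [integral_add hs1 (hJ.const_mul _), integral_sub hXi (hH.const_mul _), integral_const_mul, integral_const_mul,
      integral_H₁_sq hm] at hYint
    linarith
  have hpt : ∀ t, ‖V1 t - Hp1 m t‖ ^ 2 + m ^ 2 * ‖rotGen (V t - Hp m t)‖ ^ 2 =
      (‖V1 t‖ ^ 2 + m ^ 2 * ‖rotGen (V t)‖ ^ 2) + 2 * m ^ 2 * H₁ m t ^ 2 - 2 * X t := fun t => by
    rw [norm_rotGen_sq, norm_rotGen_sq, norm_sq_space, norm_sq_space]
    simp only [hX, Hp1, Hp]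
    simp
    linear_combination (m ^ 2 * H₁ m t ^ 2) * H_sq m t
  have hint : Integrable fun t => (‖V1 t‖ ^ 2 + m ^ 2 * ‖rotGen (V t)‖ ^ 2) +
      2 * m ^ 2 * H₁ m t ^ 2 - 2 * X t := (hI.add (hH.const_mul _)).sub (hXi.const_mul _)
  simp only [hpt]
  refine ⟨hint, ?_⟩
  have hs2 : Integrable fun t => (‖V1 t‖ ^ 2 + m ^ 2 * ‖rotGen (V t)‖ ^ 2) + 2 * m ^ 2 * H₁ m t ^ 2 :=
    hI.add (hH.const_mul _)
  rw [integral_sub hs2 (hXi.const_mul _), integral_add hI (hH.const_mul _),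
    integral_const_mul, integral_const_mul, hXint, integral_H₁_sq hm, h.integral_energy hm]
  field_simp
  ring

theorem Traj.distJ_nonneg (τ α : ℝ) : 0 ≤ distJ m V τ α :=
  integral_nonneg fun t => by positivity

/-- The distance of `u` to a harmonic map in terms of the profile. -/
theorem hdotENorm_sub_harmonicMap (hm : 1 ≤ m) {u : Plane → Space} (hu : IsSigma m u)
    (hp : ContDiffOn ℝ 1 (profile u) (Set.Ioi 0)) (h : Traj m (logProfile u) V1) {s : ℝ} (hs : 0 < s)
    (α : ℝ) : hdotENorm 1 (fun x => u x - harmonicMap m s α x) ^ 2 =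
      ENNReal.ofReal (2 * π * (bogEnergy m (logProfile u) V1 +
        2 * m ^ 2 * distJ m (logProfile u) (log s) α)) := by
  set τ := log s with hτ
  have hsτ : s = exp τ := (exp_log hs).symm
  have hQe := isEquivariant_harmonicMap m hs α
  have hQp : ∀ t, profile (harmonicMap m s α) (exp t) = rot α (Hp m (t - τ)) := fun t => by
    rw [profile_harmonicMap m hs (exp_pos t), Hp, H₁, H₃, exp_sub, ← hsτ]
  have hlog : logProfile (fun x => u x - harmonicMap m s α x) = fun t => logProfile u t -
      rotL α (Hp m (t - τ)) := by
    funext t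
    exact congrArg (fun y => profile u (exp t) - y) (hQp t)
  have hQd : ∀ t, HasDerivAt (fun t => rotL α (Hp m (t - τ))) (rotL α (Hp1 m (t - τ))) t := fun t =>
    (rotL α).hasFDerivAt.comp_hasDerivAt t ((hasDerivAt_Hp m (t - τ)).comp_sub_const t τ)
  have hw : ∀ I : Fin 1 → Fin 2, ∃ g, IsWeakDeriv I (fun x => u x - harmonicMap m s α x) g := by
    intro I
    obtain ⟨g, hg, _⟩ := hu.memHdot I
    exact ⟨_, hg.sub (isWeakDeriv_of_contDiff (contDiff_harmonicMap m s α) I)⟩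
  have hpQ : ContDiffOn ℝ 1 (profile fun x => u x - harmonicMap m s α x) (Set.Ioi 0) :=
    hp.sub ((contDiff_profile (contDiff_harmonicMap m s α)).of_le
      (WithTop.coe_le_coe.2 (le_top : (1 : ℕ∞) ≤ ⊤))).contDiffOn
  rw [(hu.isEquivariant.sub hQe).hdotENorm_one_sq_exp hpQ
    (P1 := fun t => V1 t - rotL α (Hp1 m (t - τ)))
    (fun t => by rw [hlog]; exact (h.deriv t).sub (hQd t)) hw, hlog]
  have hsh := h.shift (-α) τ
  obtain ⟨hi, he⟩ := hsh.integral_diff hm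
  rw [bogEnergy_shift] at he
  have hpos : ∀ t, 0 ≤ ‖rot (-α) (V1 (t + τ)) - Hp1 m t‖ ^ 2 +
      m ^ 2 * ‖rotGen (rot (-α) (logProfile u (t + τ)) - Hp m t)‖ ^ 2 := fun t => by positivity
  have hof := ofReal_integral_eq_lintegral_ofReal hi (Eventually.of_forall hpos)
  rw [distJ, ← he, ENNReal.ofReal_mul (show (0 : ℝ) ≤ 2 * π by positivity), hof]
  congr 1
  rw [← lintegral_add_right_eq_self _ τ]
  refine lintegral_congr fun t => ?_
  have key : ∀ x y : Space, x - rotL α y = rot α (rot (-α) x - y) := fun x y => by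
    conv_lhs => rw [← rot_rot_neg α x]
    rw [← rotL_apply α (rot (-α) x), ← map_sub, rotL_apply]
  simp only [add_sub_cancel_right]
  rw [key, key, norm_rot, rotGen_rot, norm_rot]

theorem isClosestHarmonic_iff (hm : 1 ≤ m) {u : Plane → Space} (hu : IsSigma m u)
    (hp : ContDiffOn ℝ 1 (profile u) (Set.Ioi 0)) (h : Traj m (logProfile u) V1) {s α : ℝ} :
    IsClosestHarmonic m u s α ↔ 0 < s ∧
      ∀ τ' α', distJ m (logProfile u) (log s) α ≤ distJ m (logProfile u) τ' α' := by
  have hm' : (0 : ℝ) < m := by exact_mod_cast hm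
  have hpi := pi_pos
  have hB : 0 ≤ bogEnergy m (logProfile u) V1 := integral_nonneg fun t => by positivity
  have hle : ∀ {s s' : ℝ} (_ : 0 < s) (_ : 0 < s') (α α' : ℝ),
      hdotENorm 1 (fun x => u x - harmonicMap m s α x) ≤
        hdotENorm 1 (fun x => u x - harmonicMap m s' α' x) ↔
      distJ m (logProfile u) (log s) α ≤ distJ m (logProfile u) (log s') α' := by
    intro s s' hs hs' α α'
    have hJ := Traj.distJ_nonneg (m := m) (V := logProfile u) (log s') α'
    rw [← (ENNReal.pow_right_strictMono (n := 2) (by norm_num)).le_iff_le,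
      hdotENorm_sub_harmonicMap hm hu hp h hs, hdotENorm_sub_harmonicMap hm hu hp h hs',
      ENNReal.ofReal_le_ofReal_iff (by positivity)]
    constructor
    · intro h1
      have h2 := le_of_mul_le_mul_left h1 (by positivity)
      exact le_of_mul_le_mul_left (by linarith) (by positivity : (0 : ℝ) < 2 * m ^ 2)
    · intro h1
      gcongr
  unfold IsClosestHarmonic
  refine and_congr_right fun hs => ⟨fun heq τ' α' => ?_, fun hmin => ?_⟩
  · have h1 : hdotENorm 1 (fun x => u x - harmonicMap m s α x) ≤
        hdotENorm 1 (fun x => u x - harmonicMap m (exp τ') α' x) := by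
      rw [heq]
      exact iInf_le_of_le (exp τ') (iInf_le_of_le (exp_pos τ') (iInf_le _ α'))
    rw [hle hs (exp_pos _), log_exp] at h1
    exact h1
  · refine le_antisymm ?_ ?_
    · exact le_iInf fun s' => le_iInf fun hs' => le_iInf fun α' => (hle hs hs' α α').2 (hmin _ _)
    · exact iInf_le_of_le s (iInf_le_of_le hs (iInf_le _ α))

end Traj

/-! ### Rigidity and existence of closest harmonic maps -/

theorem half_le_H₁ {m : ℕ} (hm : 1 ≤ m) {t : ℝ} (ht : t ∈ Set.Icc (0 : ℝ) (1 / m)) :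
    1 / 2 ≤ H₁ m t ∧ 1 ≤ exp (m * t) ∧ exp (m * t) ≤ 2.7182818286 := by
  have hm' : (0 : ℝ) < m := by exact_mod_cast hm
  have h1 : 1 ≤ exp (m * t) := Real.one_le_exp (mul_nonneg hm'.le ht.1)
  have h2 : exp (m * t) ≤ 2.7182818286 := by
    refine (exp_le_exp.2 ?_).trans exp_one_lt_d9.le
    have := mul_le_mul_of_nonneg_left ht.2 hm'.le
    rwa [mul_one_div_cancel hm'.ne'] at this
  refine ⟨?_, h1, h2⟩
  rw [H₁_eq, le_div_iff₀ (by positivity)]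
  nlinarith

theorem abs_exp_sub_one_le {m : ℕ} (hm : 1 ≤ m) (σ : ℝ) :
    |exp σ - 1| ≤ |exp (m * σ) ^ 2 - 1| := by
  rw [← exp_nat_mul, ← mul_assoc]
  have hm' : (1 : ℝ) ≤ m := by exact_mod_cast hm
  push_cast
  rcases le_total 0 σ with h | h
  · have h1 : σ ≤ 2 * m * σ := by nlinarith
    have h2 := Real.one_le_exp h
    have h3 := exp_le_exp.2 h1
    rw [abs_of_nonneg (by linarith), abs_of_nonneg (by linarith)]
    linarith
  · have h1 : 2 * m * σ ≤ σ := by nlinarith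
    have h2 := exp_le_one_iff.2 h
    have h3 := exp_le_exp.2 h1
    rw [abs_of_nonpos (by linarith), abs_of_nonpos (by linarith)]
    linarith

theorem abs_exp_sub_one_le_of_H₃ {m : ℕ} (hm : 1 ≤ m) {t σ η : ℝ}
    (ht : t ∈ Set.Icc (0 : ℝ) (1 / m)) (h : |H₃ m (t + σ) - H₃ m t| ≤ η) (hη : η ≤ 1 / 16) :
    |exp σ - 1| ≤ 18 * η := by
  refine (abs_exp_sub_one_le hm σ).trans ?_
  obtain ⟨-, h1, h2⟩ := half_le_H₁ hm ht
  have hx : exp (m * (t + σ)) = exp (m * t) * exp (m * σ) := by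
    rw [← exp_add]; ring_nf
  rw [H₃_eq', H₃_eq', hx] at h
  set A := exp (m * t)
  set b := exp (m * σ)
  have hb : 0 < b := exp_pos _
  have e : (1 - 2 * ((A * b) ^ 2 + 1)⁻¹ - (1 - 2 * (A ^ 2 + 1)⁻¹)) * ((A ^ 2 + 1) * ((A * b) ^ 2 + 1)) =
      2 * A ^ 2 * (b ^ 2 - 1) := by
    field_simp
    ring
  have h3 : 2 * A ^ 2 * |b ^ 2 - 1| ≤ η * ((A ^ 2 + 1) * ((A * b) ^ 2 + 1)) := by
    rw [← abs_of_nonneg (by positivity : 0 ≤ 2 * A ^ 2), ← abs_mul, ← e, abs_mul,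
      abs_of_nonneg (by positivity : 0 ≤ (A ^ 2 + 1) * ((A * b) ^ 2 + 1))]
    gcongr
  set X := |b ^ 2 - 1| with hX
  have hη0 : 0 ≤ η := (abs_nonneg _).trans h
  have hbX : b ^ 2 ≤ X + 1 := by linarith [le_abs_self (b ^ 2 - 1)]
  have hA2 : A ^ 2 ≤ 8 := by nlinarith
  have hA1 : 1 ≤ A ^ 2 := by nlinarith
  have hX0 : 0 ≤ X := abs_nonneg _
  have h4 : (A * b) ^ 2 + 1 ≤ 8 * X + 9 := by
    rw [mul_pow]; nlinarith [sq_nonneg b]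
  have h5 : η * ((A ^ 2 + 1) * ((A * b) ^ 2 + 1)) ≤ η * ((2 * A ^ 2) * (8 * X + 9)) := by
    gcongr; linarith
  have h6 : 2 * A ^ 2 * X ≤ 2 * A ^ 2 * (η * (8 * X + 9)) := by linarith
  have h7 : X ≤ η * (8 * X + 9) := le_of_mul_le_mul_left h6 (by positivity)
  nlinarith

theorem exists_abs_sub_le_of_sin {β c : ℝ} (hs : |sin β| ≤ c) (hc : 0 < cos β) :
    ∃ k : ℤ, |β - k * (2 * π)| ≤ 2 * c := by
  have hpi := pi_pos
  set k := round (β / (2 * π)) with hk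
  refine ⟨k, ?_⟩
  set x := β - k * (2 * π) with hx
  have hx1 : |x| ≤ π := by
    have h1 := abs_sub_round (β / (2 * π))
    have h2 : x = (β / (2 * π) - k) * (2 * π) := by
      rw [hx]; field_simp
    rw [h2, abs_mul, abs_of_pos (by positivity : 0 < 2 * π)]
    nlinarith
  have hsx : sin x = sin β := sin_sub_int_mul_two_pi β k
  have hcx : cos x = cos β := cos_sub_int_mul_two_pi β k
  have hxlt : |x| < π / 2 := by
    by_contra hcon
    push Not at hcon
    have := cos_nonpos_of_pi_div_two_le_of_le hcon (by linarith)
    rw [cos_abs, hcx] at this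
    linarith
  have h2 : 2 / π * |x| ≤ sin |x| := Real.mul_le_sin (abs_nonneg _) hxlt.le
  have h3 : sin |x| ≤ c := by
    refine (le_abs_self _).trans ?_
    rw [← hsx] at hs
    rcases abs_choice x with h | h
    · rwa [h]
    · rwa [h, sin_neg, abs_neg]
  have h4 : |x| = π / 2 * (2 / π * |x|) := by field_simp
  have h5 : 0 ≤ c := (abs_nonneg _).trans hs
  rw [h4]
  have h6 : 0 ≤ 2 / π * |x| := by positivity
  nlinarith [pi_le_four]

section Traj

variable {m : ℕ} {V V1 : ℝ → Space}

theorem norm_coord_le (y : Space) (i : Fin 3) : |y i| ≤ ‖y‖ := by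
  rw [← Real.norm_eq_abs]; exact PiLp.norm_apply_le y i

theorem Traj.distJ_le (h : Traj m V V1) (hm : 1 ≤ m) {τ a η : ℝ}
    (hst : ∀ t, ‖rot a (V (t + τ)) - Hp m t‖ ≤ η) : distJ m V τ (-a) ≤ 2 * η ^ 2 := by
  have hm' : (1 : ℝ) ≤ m := by exact_mod_cast hm
  unfold distJ
  have hsh := h.shift a τ
  rw [neg_neg]
  calc ∫ t, ‖rot a (V (t + τ)) - Hp m t‖ ^ 2 * H₁ m t ^ 2
      ≤ ∫ t, η ^ 2 * H₁ m t ^ 2 := by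
        refine integral_mono (integrable_norm_sub_Hp_sq hm hsh.continuous hsh.norm)
          ((integrable_H₁_sq hm).const_mul _) fun t => ?_
        have := hst t
        simp only
        gcongr
    _ = η ^ 2 * (2 / m) := by rw [integral_const_mul, integral_H₁_sq hm]
    _ ≤ 2 * η ^ 2 := by
        have : 2 / (m : ℝ) ≤ 2 := by rw [div_le_iff₀ (by positivity)]; linarith
        nlinarith [sq_nonneg η]

theorem Traj.rigid (h : Traj m V V1) (hm : 1 ≤ m) {τ₀ a η : ℝ} (hη : 64 * m * η ≤ 1)
    (hst : ∀ t, ‖rot a (V (t + τ₀)) - Hp m t‖ ≤ η) {τ α : ℝ} (hJ : distJ m V τ α ≤ 2 * η ^ 2) :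
    |exp (τ - τ₀) - 1| ≤ 72 * m * η ∧ ∃ k : ℤ, |α + a - k * (2 * π)| ≤ 20 * m * η := by
  have hm' : (1 : ℝ) ≤ m := by exact_mod_cast hm
  have hm0 : (0 : ℝ) < m := by linarith
  have hη0 : 0 ≤ η := (norm_nonneg _).trans (hst 0)
  have hsh := h.shift (-α) τ
  have hint := integrable_norm_sub_Hp_sq hm hsh.continuous hsh.norm
  have hcont : Continuous fun t => ‖rot (-α) (V (t + τ)) - Hp m t‖ ^ 2 * H₁ m t ^ 2 :=
    ((hsh.continuous.sub (continuous_Hp m)).norm.pow 2).mul ((continuous_H₁ m).pow 2)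
  -- a point where the two profiles are close
  obtain ⟨t, ht, hclose⟩ : ∃ t ∈ Set.Icc (0 : ℝ) (1 / m), ‖rot (-α) (V (t + τ)) - Hp m t‖ ≤ 3 * m * η := by
    by_contra hcon
    push Not at hcon
    have hlow : ∀ t ∈ Set.Icc (0 : ℝ) (1 / m), 9 / 4 * m ^ 2 * η ^ 2 <
        ‖rot (-α) (V (t + τ)) - Hp m t‖ ^ 2 * H₁ m t ^ 2 := fun t ht => by
      have h1 := hcon t ht
      have h2 := (half_le_H₁ hm ht).1
      have h3 : (3 * m * η) ^ 2 < ‖rot (-α) (V (t + τ)) - Hp m t‖ ^ 2 := by gcongr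
      have h4 : 1 / 4 ≤ H₁ m t ^ 2 := by nlinarith
      nlinarith [sq_nonneg (3 * m * η)]
    have h1m : (0 : ℝ) < 1 / m := by positivity
    have hi : ∫ t in (0 : ℝ)..(1 / m), (9 / 4 * m ^ 2 * η ^ 2 : ℝ) <
        ∫ t in (0 : ℝ)..(1 / m), ‖rot (-α) (V (t + τ)) - Hp m t‖ ^ 2 * H₁ m t ^ 2 := by
      refine intervalIntegral.integral_lt_integral_of_continuousOn_of_le_of_exists_lt h1m
        continuousOn_const hcont.continuousOn (fun t ht => (hlow t ⟨ht.1.le, ht.2⟩).le)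
        ⟨0, ⟨le_rfl, h1m.le⟩, hlow 0 ⟨le_rfl, h1m.le⟩⟩
    have hle : ∫ t in (0 : ℝ)..(1 / m), ‖rot (-α) (V (t + τ)) - Hp m t‖ ^ 2 * H₁ m t ^ 2 ≤ distJ m V τ α := by
      rw [intervalIntegral.integral_of_le h1m.le]
      exact setIntegral_le_integral hint (Eventually.of_forall fun t => by positivity)
    rw [intervalIntegral.integral_const, smul_eq_mul, sub_zero] at hi
    have e : 1 / (m : ℝ) * (9 / 4 * m ^ 2 * η ^ 2) = 9 / 4 * m * η ^ 2 := by field_simp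
    rw [e] at hi
    nlinarith [sq_nonneg η]
  set σ := τ - τ₀ with hσ
  set β := α + a with hβ
  have hV := hst (t + σ)
  rw [show t + σ + τ₀ = t + τ by rw [hσ]; ring] at hV
  have hdiff : ‖rot (-β) (Hp m (t + σ)) - Hp m t‖ ≤ 4 * m * η := by
    have e : rot (-α) (V (t + τ)) = rot (-β) (rot a (V (t + τ))) := by
      rw [← rot_add]; congr 1; rw [hβ]; ring
    have h1 : ‖rot (-β) (Hp m (t + σ)) - rot (-α) (V (t + τ))‖ ≤ η := by
      rw [e, ← rotL_apply, ← rotL_apply, ← map_sub, rotL_apply, norm_rot, norm_sub_rev]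
      exact hV
    calc _ = ‖(rot (-β) (Hp m (t + σ)) - rot (-α) (V (t + τ))) + (rot (-α) (V (t + τ)) - Hp m t)‖ := by
          congr 1; abel
      _ ≤ η + 3 * m * η := (norm_add_le _ _).trans (add_le_add h1 hclose)
      _ ≤ 4 * m * η := by nlinarith
  have c0 := (norm_coord_le _ 0).trans hdiff
  have c1 := (norm_coord_le _ 1).trans hdiff
  have c2 := (norm_coord_le _ 2).trans hdiff
  simp only [rot, Hp, cos_neg, sin_neg] at c0 c1 c2
  simp at c0 c1 c2
  have hη2 : 4 * m * η ≤ 1 / 16 := by linarith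
  refine ⟨(abs_exp_sub_one_le_of_H₃ hm ht c2 hη2).trans (by linarith), ?_⟩
  have hH := (half_le_H₁ hm ht).1
  have hcos : 2 / 5 ≤ cos β * H₁ m (t + σ) := by linarith [(abs_le.1 c0).1]
  have hHp := H₁_pos m (t + σ)
  have hcp : 0 < cos β := by
    by_contra hcon
    push Not at hcon
    nlinarith
  have hHσ : 2 / 5 ≤ H₁ m (t + σ) := by nlinarith [cos_le_one β]
  have hsin : |sin β| ≤ 10 * m * η := by
    rw [abs_of_pos hHp] at c1
    nlinarith [abs_nonneg (sin β)]
  obtain ⟨k, hk⟩ := exists_abs_sub_le_of_sin hsin hcp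
  exact ⟨k, hk.trans (by linarith)⟩

theorem continuous_rot : Continuous fun p : ℝ × Space => rot p.1 p.2 := by
  unfold rot
  refine (PiLp.continuous_toLp 2 _).comp (continuous_pi fun i => ?_)
  have hc : ∀ i : Fin 3, Continuous fun p : ℝ × Space => p.2 i := fun i =>
    (EuclideanSpace.proj (𝕜 := ℝ) i).continuous.comp continuous_snd
  have h0 := hc 0
  have h1 := hc 1
  have h2 := hc 2
  have hcos : Continuous fun p : ℝ × Space => cos p.1 := by fun_prop
  have hsin : Continuous fun p : ℝ × Space => sin p.1 := by fun_prop
  fin_cases i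
  · exact (hcos.mul h0).sub (hsin.mul h1)
  · exact (hsin.mul h0).add (hcos.mul h1)
  · exact h2

theorem Traj.continuous_distJ (h : Traj m V V1) (hm : 1 ≤ m) :
    Continuous fun p : ℝ × ℝ => distJ m V p.1 p.2 := by
  unfold distJ
  refine continuous_of_dominated (bound := fun t => 4 * H₁ m t ^ 2) (fun p => ?_) (fun p => ?_)
    ((integrable_H₁_sq hm).const_mul 4) (Eventually.of_forall fun t => ?_)
  · have hsh := h.shift (-p.2) p.1
    exact (integrable_norm_sub_Hp_sq hm hsh.continuous hsh.norm).1
  · refine Eventually.of_forall fun t => ?_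
    rw [Real.norm_of_nonneg (by positivity)]
    have := norm_sub_le (rot (-p.2) (V (t + p.1))) (Hp m t)
    rw [norm_rot, h.norm, norm_Hp] at this
    gcongr
    nlinarith [norm_nonneg (rot (-p.2) (V (t + p.1)) - Hp m t)]
  · have hV := h.continuous
    have h0 : Continuous fun p : ℝ × ℝ => ((-p.2, V (t + p.1)) : ℝ × Space) := by fun_prop
    have h1 := continuous_rot.comp h0
    have h2 : Continuous fun y : Space => ‖y - Hp m t‖ ^ 2 * H₁ m t ^ 2 := by fun_prop
    exact h2.comp h1

theorem distJ_periodic (τ α : ℝ) (k : ℤ) : distJ m V τ (α - k * (2 * π)) = distJ m V τ α := by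
  unfold distJ
  have : ∀ y : Space, rot (-(α - k * (2 * π))) y = rot (-α) y := fun y => by
    rw [rot_eq_smul, rot_eq_smul, cos_neg, sin_neg, cos_neg, sin_neg,
      cos_sub_int_mul_two_pi, sin_sub_int_mul_two_pi]
  simp only [this]

/-- Existence of a closest harmonic map. -/
theorem Traj.exists_min (h : Traj m V V1) (hm : 1 ≤ m) {τ₀ a η : ℝ} (hη : 144 * m * η ≤ 1)
    (hst : ∀ t, ‖rot a (V (t + τ₀)) - Hp m t‖ ≤ η) :
    ∃ τ α : ℝ, (∀ τ' α', distJ m V τ α ≤ distJ m V τ' α') ∧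
      |exp (τ - τ₀) - 1| ≤ 72 * m * η ∧ |α + a| ≤ 20 * m * η := by
  have hm' : (1 : ℝ) ≤ m := by exact_mod_cast hm
  have hη0 : 0 ≤ η := (norm_nonneg _).trans (hst 0)
  have hη' : 64 * m * η ≤ 1 := by nlinarith [mul_nonneg (by linarith : (0 : ℝ) ≤ m) hη0]
  have hJ0 := h.distJ_le hm hst
  have hK : IsCompact (Set.Icc (τ₀ - 1) (τ₀ + 1) ×ˢ Set.Icc (-a - 1) (-a + 1)) :=
    isCompact_Icc.prod isCompact_Icc
  obtain ⟨⟨τ, α⟩, hp, hmin⟩ := hK.exists_isMinOn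
    ⟨(τ₀, -a), ⟨by simp, by simp⟩⟩ (h.continuous_distJ hm).continuousOn
  have hglob : ∀ τ' α', distJ m V τ α ≤ distJ m V τ' α' := by
    intro τ' α'
    rcases le_or_gt (distJ m V τ' α') (2 * η ^ 2) with hle | hgt
    · obtain ⟨h1, k, h2⟩ := h.rigid hm hη' hst hle
      rw [← distJ_periodic τ' α' k]
      refine hmin (a := (τ', α' - k * (2 * π))) ⟨?_, ?_⟩
      · have h3 : |exp (τ' - τ₀) - 1| ≤ 1 / 2 := h1.trans (by linarith)
        have h4 := abs_le.1 h3
        have h5 : τ' - τ₀ ≤ 1 := by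
          rw [← exp_le_exp]
          linarith [Real.add_one_le_exp (1 : ℝ)]
        have h6 : -1 ≤ τ' - τ₀ := by
          rw [← exp_le_exp]
          have : exp (-1) ≤ 1 / 2 := by
            rw [exp_neg, inv_le_comm₀ (exp_pos _) (by norm_num)]
            linarith [Real.add_one_le_exp (1 : ℝ)]
          linarith
        exact ⟨by linarith, by linarith⟩
      · have h3 : |α' + a - k * (2 * π)| ≤ 1 := h2.trans (by linarith)
        have h4 := abs_le.1 h3
        exact ⟨by linarith, by linarith⟩
    · refine le_trans ?_ hgt.le
      exact (hmin (a := (τ₀, -a)) ⟨by simp, by simp⟩).trans hJ0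
  obtain ⟨h1, k, h2⟩ := h.rigid hm hη' hst ((hglob τ₀ (-a)).trans hJ0)
  refine ⟨τ, α - k * (2 * π), fun τ' α' => ?_, h1, ?_⟩
  · rw [distJ_periodic]; exact hglob τ' α'
  · rwa [show α - k * (2 * π) + a = α + a - k * (2 * π) by ring]

end Traj

/-! ### The orthogonality condition -/

section Orthogonality

variable {m : ℕ}

theorem exp_mul_mem (hm : 1 ≤ m) {σ : ℝ} (hσ : |σ| ≤ 1 / m) :
    1 / 3 ≤ exp (m * σ) ∧ exp (m * σ) ≤ 3 := by
  have hm' : (0 : ℝ) < m := by exact_mod_cast hm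
  have h : |m * σ| ≤ 1 := by
    rw [abs_mul, abs_of_pos hm']
    calc (m : ℝ) * |σ| ≤ m * (1 / m) := by gcongr
      _ = 1 := by field_simp
  have he : exp 1 ≤ 3 := exp_one_lt_d9.le.trans (by norm_num)
  have h1 := exp_le_exp.2 (abs_le.1 h).2
  have h2 := exp_le_exp.2 (abs_le.1 h).1
  refine ⟨le_trans ?_ h2, h1.trans he⟩
  rw [exp_neg, one_div]
  exact inv_anti₀ (exp_pos _) he

theorem H₁_shift_ge (hm : 1 ≤ m) {σ : ℝ} (hσ : |σ| ≤ 1 / m) (t : ℝ) :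
    H₁ m t / 3 ≤ H₁ m (t + σ) := by
  obtain ⟨h1, h2⟩ := exp_mul_mem hm hσ
  have hx : exp (m * (t + σ)) = exp (m * t) * exp (m * σ) := by
    rw [← exp_add]; ring_nf
  rw [H₁_eq, H₁_eq, hx]
  set A := exp (m * t)
  set B := exp (m * σ)
  have hA : 0 < A := exp_pos _
  rw [div_div, div_le_div_iff₀ (by positivity) (by positivity)]
  have : 0 ≤ 2 * A * (A ^ 2 * B * (3 - B) + (3 * B - 1)) :=
    mul_nonneg (by positivity) (add_nonneg (mul_nonneg (by positivity) (by linarith)) (by linarith))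
  nlinarith

theorem cross_ge (hm : 1 ≤ m) {σ : ℝ} (h0 : 0 ≤ σ) (hσ : σ ≤ 1 / m) (t : ℝ) :
    m * σ / 3 * H₁ m t ^ 2 ≤ H₁ m t * H₃ m (t + σ) - H₃ m t * H₁ m (t + σ) := by
  obtain ⟨-, h2⟩ := exp_mul_mem hm (σ := σ) (by rwa [abs_of_nonneg h0])
  have h1 := Real.add_one_le_exp (m * σ)
  have hx : exp (m * (t + σ)) = exp (m * t) * exp (m * σ) := by
    rw [← exp_add]; ring_nf
  rw [H₁_eq, H₁_eq, H₃_eq, H₃_eq, hx]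
  have hs : 0 ≤ m * σ := by positivity
  set A := exp (m * t)
  set B := exp (m * σ)
  have hA : 0 < A := exp_pos _
  have hB : 0 < B := exp_pos _
  have e : 2 * A / (A ^ 2 + 1) * (((A * B) ^ 2 - 1) / ((A * B) ^ 2 + 1)) -
      (A ^ 2 - 1) / (A ^ 2 + 1) * (2 * (A * B) / ((A * B) ^ 2 + 1)) =
      (B - 1) * (2 * A * (A ^ 2 * B + 1) / ((A ^ 2 + 1) * ((A * B) ^ 2 + 1))) := by
    field_simp
    ring
  have e2 : m * σ / 3 * (2 * A / (A ^ 2 + 1)) ^ 2 = m * σ * (4 * A ^ 2 / (3 * (A ^ 2 + 1) ^ 2)) := by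
    field_simp
    norm_num
  rw [e, e2]
  refine mul_le_mul (by linarith) ?_ (by positivity) (by linarith)
  rw [div_le_div_iff₀ (by positivity) (by positivity)]
  have h3 : (A * B) ^ 2 + 1 ≤ 3 * (A ^ 2 * B + 1) := by
    nlinarith [mul_nonneg (by positivity : 0 ≤ A ^ 2 * B) (by linarith : 0 ≤ 3 - B)]
  have h4 : 2 * A ≤ A ^ 2 + 1 := by nlinarith [sq_nonneg (A - 1)]
  calc 4 * A ^ 2 * ((A ^ 2 + 1) * ((A * B) ^ 2 + 1))
      ≤ 4 * A ^ 2 * ((A ^ 2 + 1) * (3 * (A ^ 2 * B + 1))) := by gcongr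
    _ = 2 * A * (2 * A) * ((A ^ 2 + 1) * (3 * (A ^ 2 * B + 1))) := by ring
    _ ≤ 2 * A * (A ^ 2 + 1) * ((A ^ 2 + 1) * (3 * (A ^ 2 * B + 1))) := by gcongr
    _ = _ := by ring

theorem cross_le (hm : 1 ≤ m) {σ : ℝ} (h0 : 0 ≤ σ) (hσ : σ ≤ 1 / m) (t : ℝ) :
    H₁ m t * H₃ m (t + -σ) - H₃ m t * H₁ m (t + -σ) ≤ -(m * σ / 3 * H₁ m t ^ 2) := by
  have := cross_ge hm h0 hσ (-t)
  rw [show -t + σ = -(t + -σ) by ring, H₁_neg, H₁_neg, H₃_neg, H₃_neg] at this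
  linarith

theorem integrable_H₁_pow (hm : 1 ≤ m) {k : ℕ} (hk : 2 ≤ k) : Integrable fun t => H₁ m t ^ k := by
  refine (integrable_H₁_sq hm).mono' ((continuous_H₁ m).pow k).aestronglyMeasurable
    (Eventually.of_forall fun t => ?_)
  rw [Real.norm_of_nonneg (pow_nonneg (H₁_pos m t).le _)]
  exact pow_le_pow_of_le_one (H₁_pos m t).le (H₁_le_one m t) hk

theorem integral_H₁_pow_pos (hm : 1 ≤ m) {k : ℕ} (hk : 2 ≤ k) : 0 < ∫ t, H₁ m t ^ k := by
  rw [integral_pos_iff_support_of_nonneg (fun t => pow_nonneg (H₁_pos m t).le _)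
    (integrable_H₁_pow hm hk)]
  have : Function.support (fun t => H₁ m t ^ k) = Set.univ := by
    ext t; simp [(H₁_pos m t).ne']
  simp [this]

theorem integrable_shift_mul {f w : ℝ → ℝ} (hf : Continuous f) (hb : ∀ t, |f t| ≤ 1)
    (hw : Integrable w) (σ : ℝ) : Integrable fun t => f (t + σ) * w t := by
  refine hw.norm.mono' ((hf.comp (continuous_add_const σ)).aestronglyMeasurable.mul hw.1)
    (Eventually.of_forall fun t => ?_)
  rw [norm_mul]
  exact mul_le_of_le_one_left (norm_nonneg _) (hb _)

theorem continuous_integral_shift {f w : ℝ → ℝ} (hf : Continuous f) (hb : ∀ t, |f t| ≤ 1)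
    (hw : Integrable w) : Continuous fun σ => ∫ t, f (t + σ) * w t := by
  refine continuous_of_dominated (fun σ => (integrable_shift_mul hf hb hw σ).1)
    (fun σ => Eventually.of_forall fun t => ?_) hw.norm (Eventually.of_forall fun t => ?_)
  · rw [norm_mul]
    exact mul_le_of_le_one_left (norm_nonneg _) (hb _)
  · exact (hf.comp (continuous_const.add continuous_id)).mul continuous_const

theorem abs_integral_mul_le {f w : ℝ → ℝ} {c : ℝ} (hb : ∀ t, |f t| ≤ c) (hw : Integrable w) :
    |∫ t, f t * w t| ≤ c * ∫ t, |w t| := by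
  rw [← integral_const_mul]
  refine norm_integral_le_of_norm_le (f := fun t => f t * w t) (hw.abs.const_mul c)
    (Eventually.of_forall fun t => ?_)
  rw [norm_mul]
  exact mul_le_mul_of_nonneg_right (hb t) (norm_nonneg _)

theorem abs_arctan_le (y : ℝ) : |arctan y| ≤ |y| := by
  have key : ∀ z : ℝ, 0 ≤ z → |arctan z| ≤ |z| := fun z hz => by
    rw [abs_of_nonneg hz, abs_of_nonneg (arctan_nonneg.2 hz)]
    have := Real.le_tan (arctan_nonneg.2 hz) (arctan_lt_pi_div_two z)
    rwa [tan_arctan] at this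
  rcases le_total 0 y with h | h
  · exact key y h
  · have := key (-y) (by linarith)
    rwa [arctan_neg, abs_neg, abs_neg] at this

/-- The two real components of the orthogonality condition. -/
def orthRe (m : ℕ) (U : ℝ → Space) : ℝ := ∫ t, U t 1 * H₁ m t ^ 3

/-- See `orthRe`. -/
def orthIm (m : ℕ) (U : ℝ → Space) : ℝ := ∫ t, (H₁ m t * U t 2 - H₃ m t * U t 0) * H₁ m t ^ 3

theorem exists_orth (hm : 1 ≤ m) : ∃ κ η₁ : ℝ, 0 < κ ∧ 0 < η₁ ∧ ∀ U : ℝ → Space, Continuous U →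
    (∀ t, ‖U t‖ = 1) → ∀ η, 0 ≤ η → η ≤ η₁ → (∀ t, ‖U t - Hp m t‖ ≤ η) → ∃ σ β : ℝ, |σ| ≤ κ * η ∧ |β| ≤ κ * η ∧
      orthRe m (fun t => rot (-β) (U (t + σ))) = 0 ∧ orthIm m (fun t => rot (-β) (U (t + σ))) = 0 := by
  have hm' : (0 : ℝ) < m := by exact_mod_cast hm
  have w3 := integrable_H₁_pow hm (k := 3) (by norm_num)
  have w4 := integrable_H₁_pow hm (k := 4) (by norm_num)
  have w5 := integrable_H₁_pow hm (k := 5) (by norm_num)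
  have N0 := integral_H₁_pow_pos hm (k := 3) (by norm_num)
  have M40 := integral_H₁_pow_pos hm (k := 4) (by norm_num)
  have M50 := integral_H₁_pow_pos hm (k := 5) (by norm_num)
  have w33 : Integrable fun t => H₃ m t * H₁ m t ^ 3 := by
    refine w3.norm.mono' ((continuous_H₃ m).aestronglyMeasurable.mul w3.1) (Eventually.of_forall fun t => ?_)
    rw [norm_mul]
    exact mul_le_of_le_one_left (norm_nonneg _) (abs_H₃_le_one m t)
  set N := ∫ t, H₁ m t ^ 3 with hN
  set M4 := ∫ t, H₁ m t ^ 4 with hM4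
  set M5 := ∫ t, H₁ m t ^ 5 with hM5
  have a3 : ∫ t, |H₁ m t ^ 3| = N := by
    simp_rw [abs_of_nonneg (pow_nonneg (H₁_pos m _).le 3)]; rfl
  have a33 : ∫ t, |H₃ m t * H₁ m t ^ 3| ≤ N := by
    refine integral_mono w33.abs w3 fun t => ?_
    simp only [abs_mul, abs_of_nonneg (pow_nonneg (H₁_pos m t).le 3)]
    exact mul_le_of_le_one_left (pow_nonneg (H₁_pos m t).le 3) (abs_H₃_le_one m t)
  set E := 3 * N + 6 * N ^ 2 / M4 with hE
  have E0 : 0 < E := by positivity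
  set κ := 3 * E / (m * M5) + 6 * N / M4 with hκ
  have κ0 : 0 < κ := by positivity
  refine ⟨κ, min (M4 / (6 * N)) (1 / (m * κ)), κ0, by positivity, ?_⟩
  intro U hU hUn η hη0 hη hst
  have hη1 : η * N ≤ M4 / 6 := by
    have := hη.trans (min_le_left _ _)
    rw [le_div_iff₀ (by positivity)] at this
    linarith
  have hσ₀ : κ * η ≤ 1 / m := by
    have := hη.trans (min_le_right _ _)
    rw [le_div_iff₀ (by positivity)] at this
    rw [le_div_iff₀ hm']
    linarith
  set σ₀ := κ * η with hσ₀d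
  have σ₀0 : 0 ≤ σ₀ := by positivity
  have hUi : ∀ (i : Fin 3) t, |U t i| ≤ 1 := fun i t => (norm_coord_le _ i).trans (hUn t).le
  have hUc := fun i : Fin 3 => continuous_coord hU i
  have hcl : ∀ (i : Fin 3) t, |U t i - Hp m t i| ≤ η := fun i t => (norm_coord_le (U t - Hp m t) i).trans (hst t)
  have hcl0 : ∀ t, |U t 0 - H₁ m t| ≤ η := fun t => hcl 0 t
  have hcl1 : ∀ t, |U t 1| ≤ η := fun t => by simpa [Hp] using hcl 1 t
  have hcl2 : ∀ t, |U t 2 - H₃ m t| ≤ η := fun t => hcl 2 t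
  set A : ℝ → ℝ := fun σ => ∫ t, U (t + σ) 0 * H₁ m t ^ 3 with hA
  set B : ℝ → ℝ := fun σ => ∫ t, U (t + σ) 1 * H₁ m t ^ 3 with hB
  set D0 : ℝ → ℝ := fun σ => ∫ t, U (t + σ) 0 * (H₃ m t * H₁ m t ^ 3) with hD0
  set D1 : ℝ → ℝ := fun σ => ∫ t, U (t + σ) 1 * (H₃ m t * H₁ m t ^ 3) with hD1
  set D2 : ℝ → ℝ := fun σ => ∫ t, U (t + σ) 2 * H₁ m t ^ 4 with hD2
  have iA := integrable_shift_mul (hUc 0) (hUi 0) w3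
  have iB := integrable_shift_mul (hUc 1) (hUi 1) w3
  have iD0 := integrable_shift_mul (hUc 0) (hUi 0) w33
  have iD1 := integrable_shift_mul (hUc 1) (hUi 1) w33
  have iD2 := integrable_shift_mul (hUc 2) (hUi 2) w4
  have cA : Continuous A := continuous_integral_shift (hUc 0) (hUi 0) w3
  have cB : Continuous B := continuous_integral_shift (hUc 1) (hUi 1) w3
  have cD0 : Continuous D0 := continuous_integral_shift (hUc 0) (hUi 0) w33
  have cD1 : Continuous D1 := continuous_integral_shift (hUc 1) (hUi 1) w33
  have cD2 : Continuous D2 := continuous_integral_shift (hUc 2) (hUi 2) w4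
  have bA : ∀ σ ∈ Set.Icc (-σ₀) σ₀, M4 / 6 ≤ A σ := by
    intro σ hσ
    have hσ' : |σ| ≤ 1 / m := (abs_le.2 hσ).trans hσ₀
    have : M4 / 3 - η * N ≤ A σ := by
      rw [hM4, hN, ← integral_div, ← integral_const_mul, ← integral_sub (w4.div_const 3) (w3.const_mul η)]
      refine integral_mono ((w4.div_const 3).sub (w3.const_mul η)) (iA σ) fun t => ?_
      have h1 := H₁_shift_ge hm hσ' t
      have h2 := (abs_le.1 (hcl0 (t + σ))).1
      have h3 := pow_pos (H₁_pos m t) 3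
      have h4 : H₁ m t / 3 - η ≤ U (t + σ) 0 := by linarith
      have h5 := mul_le_mul_of_nonneg_right h4 h3.le
      simp only
      linarith [h5, (by ring : (H₁ m t / 3 - η) * H₁ m t ^ 3 = H₁ m t ^ 4 / 3 - η * H₁ m t ^ 3)]
    linarith
  have bB : ∀ σ, |B σ| ≤ η * N := fun σ => by
    rw [← a3]; exact abs_integral_mul_le (fun t => hcl1 (t + σ)) w3
  have bD1 : ∀ σ, |D1 σ| ≤ η * N := fun σ =>
    (abs_integral_mul_le (fun t => hcl1 (t + σ)) w33).trans (mul_le_mul_of_nonneg_left a33 hη0)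
  have bD0 : ∀ σ, |D0 σ| ≤ N := fun σ =>
    (abs_integral_mul_le (fun t => hUi 0 (t + σ)) w33).trans (by linarith)
  set x : ℝ → ℝ := fun σ => B σ / A σ with hx
  set G : ℝ → ℝ := fun σ => D2 σ - cos (arctan (x σ)) * D0 σ - sin (arctan (x σ)) * D1 σ
    with hG
  have cx : ContinuousOn x (Set.Icc (-σ₀) σ₀) := cB.continuousOn.div cA.continuousOn fun σ hσ =>
    ((by positivity : 0 < M4 / 6).trans_le (bA σ hσ)).ne'
  have cG : ContinuousOn G (Set.Icc (-σ₀) σ₀) := by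
    have := Real.continuous_arctan.comp_continuousOn cx
    exact (cD2.continuousOn.sub ((continuous_cos.comp_continuousOn this).mul cD0.continuousOn)).sub
      ((continuous_sin.comp_continuousOn this).mul cD1.continuousOn)
  have bx : ∀ σ ∈ Set.Icc (-σ₀) σ₀, |x σ| ≤ 6 * N / M4 * η := by
    intro σ hσ
    have h1 := bA σ hσ
    have h2 : 0 < A σ := (by positivity : 0 < M4 / 6).trans_le h1
    rw [hx]
    simp only
    rw [abs_div, abs_of_pos h2, div_le_iff₀ h2]
    calc |B σ| ≤ η * N := bB σ
      _ = 6 * N / M4 * η * (M4 / 6) := by field_simp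
      _ ≤ _ := by gcongr
  have x1 : 6 * N / M4 * η ≤ 1 := by
    rw [div_mul_eq_mul_div, div_le_one M40]; linarith
  have bcos : ∀ σ ∈ Set.Icc (-σ₀) σ₀, |1 - cos (arctan (x σ))| ≤ 6 * N / M4 * η := by
    intro σ hσ
    have h1 := Real.one_sub_sq_div_two_le_cos (x := arctan (x σ))
    have h2 := abs_arctan_le (x σ)
    have h3 := bx σ hσ
    have h4 := cos_le_one (arctan (x σ))
    rw [abs_of_nonneg (by linarith)]
    have h5 : arctan (x σ) ^ 2 ≤ 6 * N / M4 * η := by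
      rw [← sq_abs]
      have : |arctan (x σ)| ≤ 6 * N / M4 * η := h2.trans h3
      nlinarith [abs_nonneg (arctan (x σ))]
    nlinarith [sq_nonneg (arctan (x σ))]
  have bG : ∀ σ ∈ Set.Icc (-σ₀) σ₀, |G σ - (D2 σ - D0 σ)| ≤ 6 * N / M4 * η * N + η * N := by
    intro σ hσ
    have e : G σ - (D2 σ - D0 σ) = (1 - cos (arctan (x σ))) * D0 σ +
      -(sin (arctan (x σ)) * D1 σ) := by rw [hG]; simp only; ring
    rw [e]
    refine (abs_add_le _ _).trans (add_le_add ?_ ?_)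
    · rw [abs_mul]
      exact mul_le_mul (bcos σ hσ) (bD0 σ) (abs_nonneg _) (by positivity)
    · rw [abs_neg, abs_mul]
      exact (mul_le_of_le_one_left (abs_nonneg _) (Real.abs_sin_le_one _)).trans (bD1 σ)
  have eD : ∀ σ, D2 σ - D0 σ = ∫ t, (H₁ m t * U (t + σ) 2 - H₃ m t * U (t + σ) 0) * H₁ m t ^ 3 := fun σ => by
    rw [hD2, hD0]
    simp only
    rw [← integral_sub (iD2 σ) (iD0 σ)]
    congr 1; funext t; ring
  have iD : ∀ σ, Integrable fun t => (H₁ m t * U (t + σ) 2 - H₃ m t * U (t + σ) 0) * H₁ m t ^ 3 := fun σ =>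
    ((iD2 σ).sub (iD0 σ)).congr (Eventually.of_forall fun t => by simp only [Pi.sub_apply]; ring)
  have herr : ∀ σ t, |(H₁ m t * U (t + σ) 2 - H₃ m t * U (t + σ) 0) -
      (H₁ m t * H₃ m (t + σ) - H₃ m t * H₁ m (t + σ))| ≤ 2 * η := by
    intro σ t
    have e : (H₁ m t * U (t + σ) 2 - H₃ m t * U (t + σ) 0) -
      (H₁ m t * H₃ m (t + σ) - H₃ m t * H₁ m (t + σ)) = H₁ m t * (U (t + σ) 2 - H₃ m (t + σ)) +
        -(H₃ m t * (U (t + σ) 0 - H₁ m (t + σ))) := by ring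
    rw [e, two_mul]
    refine (abs_add_le _ _).trans (add_le_add ?_ ?_)
    · rw [abs_mul, abs_of_pos (H₁_pos m t)]
      exact (mul_le_of_le_one_left (abs_nonneg _) (H₁_le_one m t)).trans (hcl2 _)
    · rw [abs_neg, abs_mul]
      exact (mul_le_of_le_one_left (abs_nonneg _) (abs_H₃_le_one m t)).trans (hcl0 _)
  have ig : Integrable fun t => m * σ₀ / 3 * H₁ m t ^ 5 - 2 * η * H₁ m t ^ 3 :=
    (w5.const_mul _).sub (w3.const_mul _)
  have eg : ∫ t, (m * σ₀ / 3 * H₁ m t ^ 5 - 2 * η * H₁ m t ^ 3) = m * σ₀ / 3 * M5 - 2 * η * N := by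
    rw [integral_sub (w5.const_mul _) (w3.const_mul _), integral_const_mul, integral_const_mul]
  have up : m * σ₀ / 3 * M5 - 2 * η * N ≤ D2 σ₀ - D0 σ₀ := by
    rw [eD, ← eg]
    refine integral_mono ig (iD _) fun t => ?_
    have h1 := cross_ge hm σ₀0 hσ₀ t
    have h2 := (abs_le.1 (herr σ₀ t)).1
    have h3 := mul_le_mul_of_nonneg_right (by linarith : m * σ₀ / 3 * H₁ m t ^ 2 - 2 * η ≤
      H₁ m t * U (t + σ₀) 2 - H₃ m t * U (t + σ₀) 0) (pow_pos (H₁_pos m t) 3).le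
    refine le_trans (le_of_eq ?_) h3
    ring
  have down : D2 (-σ₀) - D0 (-σ₀) ≤ -(m * σ₀ / 3 * M5 - 2 * η * N) := by
    rw [eD, ← eg, ← integral_neg]
    refine integral_mono (iD _) ig.neg fun t => ?_
    have h1 := cross_le hm σ₀0 hσ₀ t
    have h2 := (abs_le.1 (herr (-σ₀) t)).2
    have h3 := mul_le_mul_of_nonneg_right (by linarith : H₁ m t * U (t + -σ₀) 2 - H₃ m t * U (t + -σ₀) 0 ≤
      -(m * σ₀ / 3 * H₁ m t ^ 2 - 2 * η)) (pow_pos (H₁_pos m t) 3).le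
    refine h3.trans (le_of_eq ?_)
    ring
  have key : E * η ≤ m * σ₀ / 3 * M5 := by
    rw [hσ₀d]
    have h1 : 3 * E / (m * M5) ≤ κ := by
      rw [hκ]; exact le_add_of_nonneg_right (by positivity)
    calc E * η = m * (3 * E / (m * M5) * η) / 3 * M5 := by field_simp
      _ ≤ _ := by gcongr
  have key2 : E * η = 2 * η * N + (6 * N / M4 * η * N + η * N) := by rw [hE]; ring
  have Gp : 0 ≤ G σ₀ := by
    have := (abs_le.1 (bG σ₀ ⟨by linarith, le_rfl⟩)).1
    linarith
  have Gm : G (-σ₀) ≤ 0 := by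
    have := (abs_le.1 (bG (-σ₀) ⟨le_rfl, by linarith⟩)).2
    linarith
  obtain ⟨σ, hσ, hGσ⟩ := intermediate_value_Icc (by linarith : -σ₀ ≤ σ₀) cG ⟨Gm, Gp⟩
  refine ⟨σ, arctan (x σ), abs_le.2 hσ, (abs_arctan_le _).trans ((bx σ hσ).trans ?_), ?_, ?_⟩
  · have : 6 * N / M4 ≤ κ := by rw [hκ]; exact le_add_of_nonneg_left (by positivity)
    exact mul_le_mul_of_nonneg_right this hη0
  · have hA0 : A σ ≠ 0 := ((by positivity : 0 < M4 / 6).trans_le (bA σ hσ)).ne'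
    have h1 : sin (arctan (x σ)) * A σ = cos (arctan (x σ)) * B σ := by
      rw [← Real.tan_mul_cos (cos_arctan_pos _).ne', tan_arctan, hx]
      field_simp
    have h2 : orthRe m (fun t => rot (-arctan (x σ)) (U (t + σ))) =
        -(sin (arctan (x σ)) * A σ) + cos (arctan (x σ)) * B σ := by
      rw [orthRe, hA, hB]
      simp only
      rw [neg_add_eq_sub, ← integral_const_mul, ← integral_const_mul,
        ← integral_sub ((iB σ).const_mul _) ((iA σ).const_mul _)]
      congr 1; funext t
      simp [rot]
      ring
    rw [h2, h1]; ring
  · have i1 : Integrable fun t => U (t + σ) 2 * H₁ m t ^ 4 -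
        cos (arctan (x σ)) * (U (t + σ) 0 * (H₃ m t * H₁ m t ^ 3)) := (iD2 σ).sub ((iD0 σ).const_mul _)
    rw [← hGσ, orthIm, hG, hD0, hD1, hD2]
    simp only
    rw [← integral_const_mul, ← integral_const_mul, ← integral_sub (iD2 σ) ((iD0 σ).const_mul _),
      ← integral_sub i1 ((iD1 σ).const_mul _)]
    congr 1; funext t
    simp [rot]
    ring

end Orthogonality

/-! ### Existence of modulation parameters -/

section Modulation

variable {m : ℕ}

theorem integrable_H₁ (hm : 1 ≤ m) : Integrable (H₁ m) := by
  have hm' : (m : ℝ) ≠ 0 := by positivity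
  have hd : ∀ t, HasDerivAt (fun t => 2 * arctan (exp (m * t))) (m * H₁ m t) t := fun t => by
    refine ((hasDerivAt_exp_mul m t).arctan.const_mul 2).congr_deriv ?_
    rw [H₁_eq, add_comm]
    field_simp
  have h : Integrable (fun t => m * H₁ m t) :=
    integrable_of_hasDerivAt_of_nonneg (B := π) hd (continuous_const.mul (continuous_H₁ m))
      (fun t => mul_nonneg (Nat.cast_nonneg _) (H₁_pos m t).le) (fun t => by
        have h1 := arctan_lt_pi_div_two (exp (m * t))
        have h2 := Real.neg_pi_div_two_lt_arctan (exp (m * t))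
        exact abs_le.2 ⟨by linarith, by linarith⟩)
  simpa [hm'] using h.const_mul (m : ℝ)⁻¹

theorem hasDerivAt_deriv_H₁ (m : ℕ) (t : ℝ) : HasDerivAt (fun t => -(m * H₁ m t * H₃ m t))
    (m ^ 2 * H₁ m t - 2 * m ^ 2 * H₁ m t ^ 3) t := by
  refine ((((hasDerivAt_H₁ m t).const_mul (m : ℝ)).mul (hasDerivAt_H₃ m t)).neg).congr_deriv ?_
  have := H_sq m t
  linear_combination (m ^ 2 * H₁ m t) * this

theorem Traj.integral_mul_H₁ {V V1 : ℝ → Space} (h : Traj m V V1) (hm : 1 ≤ m) {a a' : ℝ → ℝ}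
    (hd : ∀ t, HasDerivAt a (a' t) t) (hc : Continuous a') (hb : ∀ t, |a t| ≤ 2)
    (hb' : ∀ t, |a' t| ≤ 2 * ‖V1 t‖ + 2 * m * H₁ m t) :
    Integrable (fun t => a' t * -(m * H₁ m t * H₃ m t) + m ^ 2 * (a t * H₁ m t)) ∧
    ∫ t, (a' t * -(m * H₁ m t * H₃ m t) + m ^ 2 * (a t * H₁ m t)) = 2 * m ^ 2 * ∫ t, a t * H₁ m t ^ 3 := by
  have hm' : (1 : ℝ) ≤ m := by exact_mod_cast hm
  have ca := continuous_of_hasDerivAt hd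
  have c1 := continuous_H₁ m
  have c3 := continuous_H₃ m
  have i1 : Integrable fun t => a' t * -(m * H₁ m t * H₃ m t) := by
    refine ((h.integrable_norm_deriv_sq.add ((integrable_H₁_sq hm).const_mul (1 + 2 * m))).const_mul (m : ℝ)).mono'
      (by fun_prop : Continuous _).aestronglyMeasurable (Eventually.of_forall fun t => ?_)
    have hp := H₁_pos m t
    rw [Real.norm_eq_abs, abs_mul, abs_neg, abs_mul, abs_mul, abs_of_pos hp, Nat.abs_cast]
    calc |a' t| * (m * H₁ m t * |H₃ m t|) ≤ (2 * ‖V1 t‖ + 2 * m * H₁ m t) * (m * H₁ m t * 1) := by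
          gcongr
          · exact hb' t
          · exact abs_H₃_le_one m t
      _ ≤ m * (‖V1 t‖ ^ 2 + (1 + 2 * m) * H₁ m t ^ 2) := by
          nlinarith [mul_nonneg (by linarith : (0 : ℝ) ≤ m) (sq_nonneg (‖V1 t‖ - H₁ m t))]
  have i2 : Integrable fun t => a t * H₁ m t := by
    refine ((integrable_H₁ hm).const_mul 2).mono' (by fun_prop : Continuous _).aestronglyMeasurable
      (Eventually.of_forall fun t => ?_)
    rw [norm_mul, Real.norm_eq_abs, Real.norm_of_nonneg (H₁_pos m t).le]
    exact mul_le_mul_of_nonneg_right (hb t) (H₁_pos m t).le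
  have i3 : Integrable fun t => a t * H₁ m t ^ 3 := by
    refine ((integrable_H₁_pow hm (k := 3) (by norm_num)).const_mul 2).mono'
      (by fun_prop : Continuous _).aestronglyMeasurable (Eventually.of_forall fun t => ?_)
    have := pow_pos (H₁_pos m t) 3
    rw [norm_mul, Real.norm_eq_abs, Real.norm_of_nonneg this.le]
    exact mul_le_mul_of_nonneg_right (hb t) this.le
  have hI : Integrable (fun t => a' t * -(m * H₁ m t * H₃ m t) + m ^ 2 * (a t * H₁ m t)) :=
    i1.add (i2.const_mul _)
  refine ⟨hI, ?_⟩
  have hD : ∀ t, HasDerivAt (fun t => a t * -(m * H₁ m t * H₃ m t))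
      ((a' t * -(m * H₁ m t * H₃ m t) + m ^ 2 * (a t * H₁ m t)) - 2 * m ^ 2 * (a t * H₁ m t ^ 3)) t := fun t =>
    ((hd t).mul (hasDerivAt_deriv_H₁ m t)).congr_deriv (by ring)
  have hlim : ∀ l : Filter ℝ, Tendsto (H₁ m) l (𝓝 0) →
      Tendsto (fun t => a t * -(m * H₁ m t * H₃ m t)) l (𝓝 0) := by
    intro l hl
    refine squeeze_zero_norm (a := fun t => 2 * m * H₁ m t) (fun t => ?_) (by simpa using hl.const_mul (2 * (m : ℝ)))
    have hp := H₁_pos m t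
    rw [Real.norm_eq_abs, abs_mul, abs_neg, abs_mul, abs_mul, abs_of_pos hp, Nat.abs_cast]
    calc |a t| * (m * H₁ m t * |H₃ m t|) ≤ 2 * (m * H₁ m t * 1) := by
          gcongr
          · exact hb t
          · exact abs_H₃_le_one m t
      _ = _ := by ring
  have := integral_of_hasDerivAt_of_tendsto hD (hI.sub (i3.const_mul _))
    (hlim _ (tendsto_H₁ (tendsto_H₃_atBot hm) (by norm_num)))
    (hlim _ (tendsto_H₁ (tendsto_H₃_atTop hm) (by norm_num)))
  rw [integral_sub hI (i3.const_mul _), integral_const_mul, sub_zero] at this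
  linarith

theorem abs_mul_le_mul {x y c d : ℝ} (h1 : |x| ≤ c) (h2 : |y| ≤ d) : |x * y| ≤ c * d := by
  rw [abs_mul]; exact mul_le_mul h1 h2 (abs_nonneg _) ((abs_nonneg _).trans h1)

/-- The second component of `U` in the frame along `H`. -/
def frameIm (m : ℕ) (U : ℝ → Space) (t : ℝ) : ℝ := H₁ m t * U t 2 - H₃ m t * U t 0

/-- The derivative of `frameIm`. -/
def frameIm' (m : ℕ) (U U1 : ℝ → Space) (t : ℝ) : ℝ :=
  (-(m * H₁ m t * H₃ m t) * U t 2 + H₁ m t * U1 t 2) - (m * H₁ m t ^ 2 * U t 0 + H₃ m t * U1 t 0)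

section

variable {U U1 : ℝ → Space}

theorem hasDerivAt_frameIm (hU : Traj m U U1) (t : ℝ) : HasDerivAt (frameIm m U) (frameIm' m U U1 t) t := by
  have e : frameIm m U = fun t => H₁ m t * U t 2 - H₃ m t * U t 0 := rfl
  have h0 := hasDerivAt_coord (hU.deriv t) 0
  have h2 := hasDerivAt_coord (hU.deriv t) 2
  rw [e]
  exact ((hasDerivAt_H₁ m t).fun_mul h2).fun_sub ((hasDerivAt_H₃ m t).fun_mul h0)

theorem continuous_frameIm' (hU : Traj m U U1) : Continuous (frameIm' m U U1) := by
  have c0 := continuous_coord hU.continuous 0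
  have c2 := continuous_coord hU.continuous 2
  have c0' := continuous_coord hU.cont 0
  have c2' := continuous_coord hU.cont 2
  have c1 := continuous_H₁ m
  have c3 := continuous_H₃ m
  exact ((((continuous_const.mul c1).mul c3).neg.mul c2).add (c1.mul c2')).sub
    (((continuous_const.mul (c1.pow 2)).mul c0).add (c3.mul c0'))

theorem Traj.abs_coord_le (hU : Traj m U U1) (i : Fin 3) (t : ℝ) : |U t i| ≤ 1 :=
  (norm_coord_le _ i).trans (hU.norm t).le

theorem abs_H₁_le_one (m : ℕ) (t : ℝ) : |H₁ m t| ≤ 1 := by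
  rw [abs_of_pos (H₁_pos m t)]; exact H₁_le_one m t

theorem Traj.abs_frameIm_le (hU : Traj m U U1) (t : ℝ) : |frameIm m U t| ≤ 2 := by
  refine (abs_sub _ _).trans ?_
  have e1 := abs_mul_le_mul (abs_H₁_le_one m t) (hU.abs_coord_le 2 t)
  have e2 := abs_mul_le_mul (abs_H₃_le_one m t) (hU.abs_coord_le 0 t)
  linarith

theorem Traj.abs_frameIm'_le (hU : Traj m U U1) (t : ℝ) :
    |frameIm' m U U1 t| ≤ 2 * ‖U1 t‖ + 2 * m * H₁ m t := by
  have hp := H₁_pos m t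
  have e0 : |-(m * H₁ m t * H₃ m t)| ≤ m * H₁ m t * 1 := by
    rw [abs_neg]
    exact abs_mul_le_mul (by rw [abs_of_nonneg (by positivity)]) (abs_H₃_le_one m t)
  have e1 := abs_mul_le_mul e0 (hU.abs_coord_le 2 t)
  have e2 := abs_mul_le_mul (abs_H₁_le_one m t) (norm_coord_le (U1 t) 2)
  have e3' : |m * H₁ m t ^ 2| ≤ m * H₁ m t := by
    rw [abs_of_nonneg (by positivity)]
    have := H₁_le_one m t
    have hm0 : (0 : ℝ) ≤ m := by positivity
    nlinarith [mul_nonneg hm0 (mul_nonneg hp.le (by linarith : 0 ≤ 1 - H₁ m t))]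
  have e3 := abs_mul_le_mul e3' (hU.abs_coord_le 0 t)
  have e4 := abs_mul_le_mul (abs_H₃_le_one m t) (norm_coord_le (U1 t) 0)
  have := (abs_sub _ _).trans (add_le_add ((abs_add_le _ _).trans (add_le_add e1 e2))
    ((abs_add_le _ _).trans (add_le_add e3 e4)))
  refine this.trans (le_of_eq ?_)
  ring

end

theorem integral_Ioi_eq_integral_exp {E : Type*} [NormedAddCommGroup E] [NormedSpace ℝ E] (g : ℝ → E) :
    ∫ r in Set.Ioi (0 : ℝ), g r = ∫ t, exp t • g (exp t) := by
  have := integral_image_eq_integral_abs_deriv_smul (s := Set.univ) (f := exp) (f' := exp)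
    MeasurableSet.univ (fun t _ => (hasDerivAt_exp t).hasDerivWithinAt) exp_injective.injOn g
  rw [Set.image_univ, range_exp] at this
  rw [this, Measure.restrict_univ]
  simp only [Real.abs_exp]

theorem innerHe_eq (hm : 1 ≤ m) {u : Plane → Space} {V1 : ℝ → Space} (h : Traj m (logProfile u) V1)
    {s : ℝ} (hs : 0 < s) (α : ℝ) : innerHe m (zCoord m u s α) (fun r => (h₁ m r : ℂ)) =
      2 * m ^ 2 * (orthRe m (fun t => rot (-α) (logProfile u (t + log s))) +
        orthIm m (fun t => rot (-α) (logProfile u (t + log s))) * Complex.I) := by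
  have hU := h.shift (-α) (log s)
  set U : ℝ → Space := fun t => rot (-α) (logProfile u (t + log s)) with hUd
  set U1 : ℝ → Space := fun t => rot (-α) (V1 (t + log s)) with hU1
  have d1 := fun t => hasDerivAt_coord (hU.deriv t) 1
  have db := hasDerivAt_frameIm hU
  obtain ⟨iR, eR⟩ := hU.integral_mul_H₁ hm d1 (continuous_coord hU.cont 1)
    (fun t => (hU.abs_coord_le 1 t).trans (by norm_num))
    (fun t => (norm_coord_le _ 1).trans (by
      have := H₁_pos m t
      have : 0 ≤ 2 * m * H₁ m t := by positivity
      linarith [norm_nonneg (U1 t)]))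
  obtain ⟨iI, eI⟩ := hU.integral_mul_H₁ hm db (continuous_frameIm' hU) hU.abs_frameIm_le hU.abs_frameIm'_le
  set b := frameIm m U with hb
  set b' := frameIm' m U U1 with hb'
  set ζ : ℝ → ℂ := fun t => (U t 1 : ℂ) + (b t : ℂ) * Complex.I with hζ
  have hz : ∀ r, 0 < r → zCoord m u s α r = ζ (log r) := by
    intro r hr
    have e : profile u (s * r) = logProfile u (log r + log s) := by
      rw [logProfile, exp_add, exp_log hr, exp_log hs, mul_comm]
    rw [zCoord, e, hζ]
    apply Complex.ext
    · simp [inner_space, hUd]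
    · simp [inner_space, hUd, hb, frameIm, H₁, H₃, exp_log hr]
      ring
  have dζ : ∀ t, HasDerivAt ζ ((U1 t 1 : ℂ) + (b' t : ℂ) * Complex.I) t := fun t =>
    (d1 t).ofReal_comp.add ((db t).ofReal_comp.mul_const _)
  have dz : ∀ t, deriv (zCoord m u s α) (exp t) =
      ((exp t)⁻¹ : ℝ) • ((U1 t 1 : ℂ) + (b' t : ℂ) * Complex.I) := by
    intro t
    have h1 : HasDerivAt log (exp t)⁻¹ (exp t) := hasDerivAt_log (exp_pos t).ne'
    have h2 : HasDerivAt (ζ ∘ log) (((exp t)⁻¹ : ℝ) • ((U1 t 1 : ℂ) + (b' t : ℂ) * Complex.I))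
        (exp t) := HasDerivAt.scomp (exp t) (by rw [log_exp]; exact dζ t) h1
    refine (h2.congr_of_eventuallyEq ?_).deriv
    filter_upwards [lt_mem_nhds (exp_pos t)] with r hr using hz r hr
  have dh : ∀ t, deriv (fun r => (h₁ m r : ℂ)) (exp t) =
      (((exp t)⁻¹ * -(m * H₁ m t * H₃ m t) : ℝ) : ℂ) := by
    intro t
    have h1 : HasDerivAt log (exp t)⁻¹ (exp t) := hasDerivAt_log (exp_pos t).ne'
    have h2 : HasDerivAt (H₁ m ∘ log) ((-(m * H₁ m t * H₃ m t)) * (exp t)⁻¹)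
        (exp t) := HasDerivAt.comp (exp t) (by rw [log_exp]; exact hasDerivAt_H₁ m t) h1
    rw [mul_comm]
    refine (h2.ofReal_comp.congr_of_eventuallyEq ?_).deriv
    filter_upwards [lt_mem_nhds (exp_pos t)] with r hr
    simp [H₁, exp_log hr]
  rw [innerHe, integral_Ioi_eq_integral_exp]
  have key : ∀ t, exp t • ((deriv (zCoord m u s α) (exp t) *
      starRingEnd ℂ (deriv (fun r => (h₁ m r : ℂ)) (exp t)) + ((m : ℂ) ^ 2 / (exp t : ℂ) ^ 2) *
      (zCoord m u s α (exp t) * starRingEnd ℂ (h₁ m (exp t) : ℂ))) * (exp t : ℂ)) =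
      ((U1 t 1 * -(m * H₁ m t * H₃ m t) + m ^ 2 * (U t 1 * H₁ m t) : ℝ) : ℂ) +
      ((b' t * -(m * H₁ m t * H₃ m t) + m ^ 2 * (b t * H₁ m t) : ℝ) : ℂ) * Complex.I := by
    intro t
    have he : (exp t : ℂ) ≠ 0 := Complex.ofReal_ne_zero.2 (exp_pos t).ne'
    rw [dz, dh, hz _ (exp_pos t), log_exp, Complex.conj_ofReal, Complex.conj_ofReal,
      Complex.real_smul, Complex.real_smul, hζ]
    change (exp t : ℂ) * (((((exp t)⁻¹ : ℝ) : ℂ) * _ * _ + _ * (_ * (H₁ m t : ℂ))) * _) = _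
    generalize exp t = E at *
    push_cast
    field_simp
    ring
  simp_rw [key]
  rw [integral_add iR.ofReal (iI.ofReal.mul_const _), integral_mul_const, integral_complex_ofReal,
    integral_complex_ofReal,
    eR, eI, orthRe, show orthIm m U = ∫ t, b t * H₁ m t ^ 3 from rfl]
  push_cast
  ring

/-- A stable representation of the profile, with error proportional to the excess. -/
theorem exists_stable_of_excess (hm : 1 ≤ m) {u : Plane → Space} {V1 : ℝ → Space}
    (h : Traj m (logProfile u) V1)
    (he : excess m u = sqrt (π * bogEnergy m (logProfile u) V1)) (h1 : excess m u ≤ 1) :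
    ∃ τ a : ℝ, ∀ t, ‖rot a (logProfile u (t + τ)) - Hp m t‖ ≤ 2 * excess m u := by
  have hm' : (1 : ℝ) ≤ m := by exact_mod_cast hm
  have hB : 0 ≤ bogEnergy m (logProfile u) V1 := integral_nonneg fun t => by positivity
  have hsq : excess m u ^ 2 = π * bogEnergy m (logProfile u) V1 := by
    rw [he, sq_sqrt (by positivity)]
  have h0 : 0 ≤ excess m u := by rw [he]; positivity
  have hpi := pi_gt_three
  have hB1 : bogEnergy m (logProfile u) V1 ≤ excess m u ^ 2 := by rw [hsq]; nlinarith
  obtain ⟨τ, a, hst⟩ := h.exists_stable hm (by nlinarith)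
  refine ⟨τ, a, fun t => ?_⟩
  refine abs_le_of_sq_le_sq' ?_ (by positivity) |>.2
  refine (hst t).trans ?_
  rw [div_mul_eq_mul_div, div_le_iff₀ (by linarith)]
  nlinarith [sq_nonneg (excess m u)]

theorem exists_modulation (hm : 1 ≤ m) : ∃ K₀ d : ℝ, 0 < K₀ ∧ 0 < d ∧ ∀ u : Plane → Space, IsSigma m u →
    ∀ V1, ContDiffOn ℝ 1 (profile u) (Set.Ioi 0) → Traj m (logProfile u) V1 →
    excess m u = sqrt (π * bogEnergy m (logProfile u) V1) → excess m u < d →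
    ∃ s α : ℝ, IsModulation m K₀ u s α := by
  have hm' : (1 : ℝ) ≤ m := by exact_mod_cast hm
  obtain ⟨κ, η₁, κ0, η₁0, H⟩ := exists_orth hm
  refine ⟨2 * (5 * κ + 164 * m), min 1 (min (η₁ / 2) (min (1 / (288 * m)) (1 / (2 * κ)))), by positivity,
    by positivity, ?_⟩
  intro u hu V1 hp h he hd
  obtain ⟨hd1, hd2⟩ := lt_min_iff.1 hd
  obtain ⟨hd2, hd3⟩ := lt_min_iff.1 hd2
  obtain ⟨hd3, hd4⟩ := lt_min_iff.1 hd3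
  rw [lt_div_iff₀ (by positivity)] at hd3 hd4
  have h0 : 0 ≤ excess m u := sqrt_nonneg _
  obtain ⟨τ₀, a, hst⟩ := exists_stable_of_excess hm h he hd1.le
  set η := 2 * excess m u with hη
  have hη0 : 0 ≤ η := by positivity
  obtain ⟨τ, α, hmin, hτ, hα⟩ := h.exists_min hm (by rw [hη]; linarith) hst
  have hU := h.shift a τ₀
  obtain ⟨σ, β, hσ, hβ, h1, h2⟩ := H _ hU.continuous hU.norm η hη0 (by linarith) hst
  have hκη : κ * η ≤ 1 := by rw [hη]; linarith
  have hrot : ∀ t, rot (-(β - a)) (logProfile u (t + log (exp (τ₀ + σ)))) =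
      rot (-β) (rot a (logProfile u (t + σ + τ₀))) := fun t => by
    rw [← rot_add, log_exp]
    congr 1
    · ring
    · congr 1; ring
  refine ⟨exp (τ₀ + σ), β - a, exp_pos _, ?_, exp τ, α, ?_, ?_⟩
  · rw [innerHe_eq hm h (exp_pos _)]
    simp only [hrot]
    rw [h1, h2]
    simp
  · rw [isClosestHarmonic_iff hm hu hp h, log_exp]
    exact ⟨exp_pos _, hmin⟩
  · have e1 : exp (τ₀ + σ) / exp τ = exp σ / exp (τ - τ₀) := by
      rw [← exp_sub, ← exp_sub]; congr 1; ring
    rw [e1]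
    have hX : |exp (τ - τ₀) - 1| ≤ 1 / 2 := hτ.trans (by rw [hη]; linarith)
    have hX2 : 1 / 2 ≤ exp (τ - τ₀) := by linarith [(abs_le.1 hX).1]
    have hS := Real.abs_exp_sub_one_le (hσ.trans hκη)
    have hY : |exp σ / exp (τ - τ₀) - 1| ≤ 2 * (2 * (κ * η) + 72 * m * η) := by
      rw [div_sub_one (exp_pos _).ne', abs_div, abs_of_pos (exp_pos _), div_le_iff₀ (exp_pos _)]
      calc |exp σ - exp (τ - τ₀)| = |(exp σ - 1) - (exp (τ - τ₀) - 1)| := by congr 1; ring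
        _ ≤ 2 * (κ * η) + 72 * m * η := (abs_sub _ _).trans (by linarith)
        _ ≤ 2 * (2 * (κ * η) + 72 * m * η) * (1 / 2) := by nlinarith [mul_nonneg κ0.le hη0]
        _ ≤ _ := by gcongr
    have hZ : |β - a - α| ≤ κ * η + 20 * m * η := by
      rw [show β - a - α = β - (α + a) by ring]
      exact (abs_sub _ _).trans (add_le_add hβ hα)
    calc _ ≤ 2 * (2 * (κ * η) + 72 * m * η) + (κ * η + 20 * m * η) := add_le_add hY hZ
      _ = _ := by rw [hη]; ring

theorem IsModulation.mono {K K' : ℝ} (hK : K ≤ K') {u : Plane → Space} {s α : ℝ}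
    (h : IsModulation m K u s α) : IsModulation m K' u s α := by
  obtain ⟨h1, h2, s', α', h3, h4⟩ := h
  exact ⟨h1, h2, s', α', h3, h4.trans (mul_le_mul_of_nonneg_right hK (sqrt_nonneg _))⟩

/-- Modulation parameters determine the scale of the map. -/
theorem IsModulation.le_exp (hm : 1 ≤ m) {u : Plane → Space} (hu : IsSigma m u) {V1 : ℝ → Space}
    (hp : ContDiffOn ℝ 1 (profile u) (Set.Ioi 0)) (h : Traj m (logProfile u) V1) {τ₀ a η : ℝ}
    (hη : 144 * m * η ≤ 1) (hst : ∀ t, ‖rot a (logProfile u (t + τ₀)) - Hp m t‖ ≤ η) {K s α : ℝ}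
    (hK : K * excess m u ≤ 1) (hs : IsModulation m K u s α) : s ≤ 4 * exp τ₀ := by
  have hm' : (1 : ℝ) ≤ m := by exact_mod_cast hm
  have hη0 : 0 ≤ η := (norm_nonneg _).trans (hst 0)
  obtain ⟨h1, -, s', α', h3, h4⟩ := hs
  obtain ⟨hs', hmin⟩ := (isClosestHarmonic_iff hm hu hp h).1 h3
  have h5 := (h.rigid hm (by nlinarith [mul_nonneg (by linarith : (0 : ℝ) ≤ m) hη0]) hst
    ((hmin τ₀ (-a)).trans (h.distJ_le hm hst))).1
  rw [exp_sub, exp_log hs'] at h5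
  have h6 := (abs_le.1 h5).2
  have h7 : s' / exp τ₀ ≤ 2 := by linarith
  rw [div_le_iff₀ (exp_pos _)] at h7
  have h8 : s / s' ≤ 2 := by linarith [h4.trans hK, abs_nonneg (α - α'), le_abs_self (s / s' - 1)]
  rw [div_le_iff₀ hs'] at h8
  linarith

end Modulation

/-! ### Coulomb frames -/

/-- `E` is a unit vector field along `V`, tangent to the sphere and parallel. -/
structure ParallelFrame (V V1 E : ℝ → Space) : Prop where
  deriv : ∀ t, HasDerivAt E (-(inner ℝ (E t) (V1 t) • V t)) t
  norm : ∀ t, ‖E t‖ = 1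
  orth : ∀ t, inner ℝ (E t) (V t) = 0

section Coulomb

variable {m : ℕ}

theorem contDiffOn_one_of_hasDerivAt {p p1 : ℝ → Space} (hd : ∀ r, 0 < r → HasDerivAt p (p1 r) r)
    (hc : ContinuousOn p1 (Set.Ioi 0)) : ContDiffOn ℝ 1 p (Set.Ioi 0) := by
  rw [show (1 : WithTop ℕ∞) = 0 + 1 by simp, contDiffOn_succ_iff_deriv_of_isOpen isOpen_Ioi]
  refine ⟨fun r hr => (hd r hr).differentiableAt.differentiableWithinAt, by simp, ?_⟩
  exact contDiffOn_zero.2 (hc.congr fun r hr => (hd r hr).deriv)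

theorem uIcc_half_subset {r : ℝ} (hr : 0 < r) : Set.uIcc (r / 2) (2 * r) ⊆ Set.Ioi 0 := by
  rw [Set.uIcc_of_le (by linarith)]
  exact fun y hy => lt_of_lt_of_le (by linarith : 0 < r / 2) hy.1

/-- An absolutely continuous function whose derivative agrees a.e. with a continuous one is `C¹`. -/
theorem hasDerivAt_of_absolutelyContinuous {e G : ℝ → Space}
    (hac : ∀ a b, 0 < a → a ≤ b → AbsolutelyContinuousOnInterval e a b) (hG : ContinuousOn G (Set.Ioi 0))
    (hd : ∀ᵐ x, 0 < x → HasDerivAt e (G x) x) {r : ℝ} (hr : 0 < r) : HasDerivAt e (G r) r := by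
  have hdP : ∀ x, 0 < x → HasDerivAt (fun x => ∫ t in (1 : ℝ)..x, G t) (G x) x := fun x hx => by
    have hi : IntervalIntegrable G volume 1 x := (hG.mono fun y hy =>
      lt_of_lt_of_le (lt_min one_pos hx) hy.1).intervalIntegrable
    exact intervalIntegral.integral_hasDerivAt_right hi
      (hG.stronglyMeasurableAtFilter isOpen_Ioi x hx) (hG.continuousAt (isOpen_Ioi.mem_nhds hx))
  have hsub := uIcc_half_subset hr
  obtain ⟨C, hC⟩ := ((hac (r / 2) (2 * r) (by linarith) (by linarith)).sub
    ((contDiffOn_one_of_hasDerivAt hdP hG).mono hsub).absolutelyContinuousOnInterval).const_of_ae_hasDerivAt_zero (by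
      filter_upwards [hd] with x hx hx1
      have := (hx (hsub hx1)).sub (hdP x (hsub hx1))
      rwa [sub_self] at this)
  have hev : e =ᶠ[𝓝 r] fun x => (∫ t in (1 : ℝ)..x, G t) + C := by
    filter_upwards [Icc_mem_nhds (by linarith : r / 2 < r) (by linarith : r < 2 * r)] with x hx
    have := hC x (by rwa [Set.uIcc_of_le (by linarith)])
    simp only [Pi.sub_apply] at this
    rw [← this]; abel
  exact ((hdP r hr).add_const C).congr_of_eventuallyEq hev

/-- A Coulomb frame is continuously differentiable. -/
theorem IsCoulombFrame.hasDerivAt {u : Plane → Space} {e v1 : ℝ → Space} (he : IsCoulombFrame u e)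
    (hd : ∀ r, 0 < r → HasDerivAt (profile u) (v1 r) r) (hc : ContinuousOn v1 (Set.Ioi 0)) {r : ℝ} (hr : 0 < r) :
    HasDerivAt e (-(inner ℝ (e r) (v1 r) • profile u r)) r := by
  have hce : ContinuousOn e (Set.Ioi 0) := by
    intro x hx
    have hx' : (0 : ℝ) < x := hx
    have h := (he.absolutelyContinuous (x / 2) (2 * x) (by linarith) (by linarith)).continuousOn
    rw [Set.uIcc_of_le (by linarith)] at h
    exact (h.continuousAt (Icc_mem_nhds (by linarith) (by linarith))).continuousWithinAt
  have hcp : ContinuousOn (profile u) (Set.Ioi 0) := fun x hx => (hd x hx).continuousAt.continuousWithinAt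
  refine hasDerivAt_of_absolutelyContinuous (G := fun r => -(inner ℝ (e r) (v1 r) • profile u r))
    he.absolutelyContinuous ((hce.inner (𝕜 := ℝ) hc).smul hcp).neg ?_ hr
  filter_upwards [(ae_restrict_iff' measurableSet_Ioi).1 he.parallel] with x hx hx0
  have := hx hx0
  rwa [(hd x hx0).deriv] at this

/-- A Coulomb frame, in logarithmic coordinates, is a parallel orthonormal frame. -/
theorem IsCoulombFrame.parallelFrame {u : Plane → Space} (hu : IsSigma m u) {e v1 : ℝ → Space}
    (he : IsCoulombFrame u e) (hd : ∀ r, 0 < r → HasDerivAt (profile u) (v1 r) r)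
    (hc : ContinuousOn v1 (Set.Ioi 0)) :
    ParallelFrame (logProfile u) (logDeriv v1) (fun t => e (exp t)) := by
  set V := logProfile u with hV
  set V1 : ℝ → Space := fun t => exp t • v1 (exp t) with hV1
  set E : ℝ → Space := fun t => e (exp t) with hE
  have hn : ∀ t, inner ℝ (V t) (V t) = 1 := fun t => by
    rw [real_inner_self_eq_norm_sq, hV, logProfile, profile, hu.sphere, one_pow]
  have dV : ∀ t, HasDerivAt V (V1 t) t := fun t => hasDerivAt_comp_exp (hd _ (exp_pos t))
  have dE : ∀ t, HasDerivAt E (-(inner ℝ (E t) (V1 t) • V t)) t := fun t => by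
    refine (hasDerivAt_comp_exp (he.hasDerivAt hd hc (exp_pos t))).congr_deriv ?_
    rw [hV1, hE, hV, logProfile, smul_neg, smul_smul]
    simp only [inner_smul_right]
  have lV : Tendsto V atTop (𝓝 northPole) := hu.tendsto_infty.comp tendsto_exp_atTop
  have lE : Tendsto E atTop (𝓝 !₂[1, 0, 0]) := he.tendsto_infty.comp tendsto_exp_atTop
  have const : ∀ (f : ℝ → ℝ) (c : ℝ), (∀ t, HasDerivAt f 0 t) → Tendsto f atTop (𝓝 c) → ∀ t, f t = c := by
    intro f c hf hl t
    have h1 : f = fun _ => f t := funext fun s =>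
      is_const_of_deriv_eq_zero (fun x => (hf x).differentiableAt) (fun x => (hf x).deriv) s t
    rw [h1] at hl
    exact tendsto_nhds_unique tendsto_const_nhds hl
  have orth : ∀ t, inner ℝ (E t) (V t) = 0 := by
    refine const _ 0 (fun t => ?_) ?_
    · refine ((dE t).inner ℝ (dV t)).congr_deriv ?_
      rw [inner_neg_left, real_inner_smul_left, hn]
      ring
    · have := lE.inner (𝕜 := ℝ) lV
      simpa [inner_space, northPole] using this
  refine ⟨dE, fun t => ?_, orth⟩
  have h1 : inner ℝ (E t) (E t) = 1 := by
    refine const (fun t => inner ℝ (E t) (E t)) 1 (fun t => ?_) ?_ t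
    · refine ((dE t).inner ℝ (dE t)).congr_deriv ?_
      rw [inner_neg_left, inner_neg_right, real_inner_smul_left, real_inner_smul_right,
        real_inner_comm (E t) (V t), orth]
      simp
    · have := lE.inner (𝕜 := ℝ) lE
      rw [inner_space !₂[(1 : ℝ), 0, 0]] at this
      simpa only [PiLp.toLp_apply, Matrix.cons_val, mul_one, mul_zero, add_zero] using this
  rw [real_inner_self_eq_norm_sq] at h1
  nlinarith [norm_nonneg (E t)]

section Algebra

variable {a b c a' b' c' k ε : ℝ}

theorem chart_identity_diag (hε : ε ^ 2 = 1) (hn : a ^ 2 + b ^ 2 + c ^ 2 = 1) (ho : a * a' + b * b' + c * c' = 0)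
    (hk : k * (1 + ε * c) = 1) :
    -(2 * a * a' * k - a ^ 2 * (ε * c') * k ^ 2) = (a' * b - a * b') * k * (-(a * b) * k) -
      ((1 - a ^ 2 * k) * a' + -(a * b) * k * b' + -(ε * a) * c') * a := by
  grind

theorem chart_identity_off (hε : ε ^ 2 = 1) (hn : a ^ 2 + b ^ 2 + c ^ 2 = 1) (ho : a * a' + b * b' + c * c' = 0)
    (hk : k * (1 + ε * c) = 1) :
    -((a' * b + a * b') * k - a * b * (ε * c') * k ^ 2) = (a' * b - a * b') * k * (1 - b ^ 2 * k) -
      ((1 - a ^ 2 * k) * a' + -(a * b) * k * b' + -(ε * a) * c') * b := by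
  grind

theorem chart_identity_vert (hε : ε ^ 2 = 1) (hn : a ^ 2 + b ^ 2 + c ^ 2 = 1) (ho : a * a' + b * b' + c * c' = 0)
    (hk : k * (1 + ε * c) = 1) :
    -(ε * a') = (a' * b - a * b') * k * (-(ε * b)) -
      ((1 - a ^ 2 * k) * a' + -(a * b) * k * b' + -(ε * a) * c') * c := by
  grind

theorem chart_identity_basis (hε : ε ^ 2 = 1) (hn : a ^ 2 + b ^ 2 + c ^ 2 = 1)
    (ho : a' * a + b' * b + c' * c = 0) (hk : k * (1 + ε * c) = 1) :
    (a' * (1 - a ^ 2 * k) + b' * -(a * b * k) + c' * -(ε * a)) * (1 - a ^ 2 * k) +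
      (a' * -(a * b * k) + b' * (1 - b ^ 2 * k) + c' * -(ε * b)) * -(a * b * k) = a' ∧
    (a' * (1 - a ^ 2 * k) + b' * -(a * b * k) + c' * -(ε * a)) * -(ε * a) +
      (a' * -(a * b * k) + b' * (1 - b ^ 2 * k) + c' * -(ε * b)) * -(ε * b) = c' := by
  constructor <;> grind

theorem chart_identity_orth (hε : ε ^ 2 = 1) (hn : a ^ 2 + b ^ 2 + c ^ 2 = 1)
    (hk : k * (1 + ε * c) = 1) :
    (1 - a ^ 2 * k) * a + -(a * b * k) * b + -(ε * a) * c = 0 := by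
  grind

end Algebra

/-- The chart of the frame bundle over `{1 + ε v₃ > 0}`: first vector. -/
def chartX (ε : ℝ) (y : Space) : Space :=
  !₂[1 - y 0 ^ 2 * (1 + ε * y 2)⁻¹, -(y 0 * y 1 * (1 + ε * y 2)⁻¹), -(ε * y 0)]

/-- Second vector of the chart. -/
def chartY (ε : ℝ) (y : Space) : Space :=
  !₂[-(y 0 * y 1 * (1 + ε * y 2)⁻¹), 1 - y 1 ^ 2 * (1 + ε * y 2)⁻¹, -(ε * y 1)]

/-- The connection form of the chart. -/
def chartForm (ε : ℝ) (y y' : Space) : ℝ := (y' 0 * y 1 - y 0 * y' 1) * (1 + ε * y 2)⁻¹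

/-- The vector with coordinates `(c, s)` in the chart rotated by the angle `ψ`. -/
def chartVec (ε ψ c s : ℝ) (y : Space) : Space :=
  (c * cos ψ + s * sin ψ) • chartX ε y + (s * cos ψ - c * sin ψ) • chartY ε y

section Chart

variable {ε : ℝ} {V : ℝ → Space} {V1 : Space} {t : ℝ}

theorem hasDerivAt_chartX (hε : ε ^ 2 = 1)
    (hV : HasDerivAt V V1 t) (hn : V t 0 ^ 2 + V t 1 ^ 2 + V t 2 ^ 2 = 1)
    (ho : V t 0 * V1 0 + V t 1 * V1 1 + V t 2 * V1 2 = 0) (hD : 0 < 1 + ε * V t 2) :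
    HasDerivAt (fun t => chartX ε (V t)) (chartForm ε (V t) V1 • chartY ε (V t) -
      (inner ℝ (chartX ε (V t)) V1) • V t) t := by
  have h0 := hasDerivAt_coord hV 0
  have h1 := hasDerivAt_coord hV 1
  have h2 := hasDerivAt_coord hV 2
  have hk := ((h2.const_mul ε).const_add 1).fun_inv hD.ne'
  have hkk : (1 + ε * V t 2)⁻¹ * (1 + ε * V t 2) = 1 := inv_mul_cancel₀ hD.ne'
  have hsq : -(ε * V1 2) / (1 + ε * V t 2) ^ 2 = -(ε * V1 2) * (1 + ε * V t 2)⁻¹ ^ 2 := by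
    rw [inv_pow, div_eq_mul_inv]
  rw [hsq] at hk
  refine hasDerivAt_euclidean.2 fun i => ?_
  fin_cases i
  on_goal 1 => refine (((h0.fun_pow 2).fun_mul hk).const_sub 1).congr_deriv ?_
  on_goal 2 => refine (((h0.fun_mul h1).fun_mul hk).fun_neg).congr_deriv ?_
  on_goal 3 => refine ((h0.const_mul ε).fun_neg).congr_deriv ?_
  all_goals simp only [chartX, chartY, chartForm, inner_space, PiLp.sub_apply, PiLp.smul_apply, smul_eq_mul,
      Matrix.cons_val, Fin.zero_eta, Fin.mk_one, Fin.reduceFinMk]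
  · linear_combination chart_identity_diag hε hn ho hkk
  · linear_combination chart_identity_off hε hn ho hkk
  · linear_combination chart_identity_vert hε hn ho hkk

theorem hasDerivAt_chartY (hε : ε ^ 2 = 1)
    (hV : HasDerivAt V V1 t) (hn : V t 0 ^ 2 + V t 1 ^ 2 + V t 2 ^ 2 = 1)
    (ho : V t 0 * V1 0 + V t 1 * V1 1 + V t 2 * V1 2 = 0) (hD : 0 < 1 + ε * V t 2) :
    HasDerivAt (fun t => chartY ε (V t)) (-chartForm ε (V t) V1 • chartX ε (V t) -
      (inner ℝ (chartY ε (V t)) V1) • V t) t := by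
  have h0 := hasDerivAt_coord hV 0
  have h1 := hasDerivAt_coord hV 1
  have h2 := hasDerivAt_coord hV 2
  have hk := ((h2.const_mul ε).const_add 1).fun_inv hD.ne'
  have hkk : (1 + ε * V t 2)⁻¹ * (1 + ε * V t 2) = 1 := inv_mul_cancel₀ hD.ne'
  have hsq : -(ε * V1 2) / (1 + ε * V t 2) ^ 2 = -(ε * V1 2) * (1 + ε * V t 2)⁻¹ ^ 2 := by
    rw [inv_pow, div_eq_mul_inv]
  rw [hsq] at hk
  have hn' : V t 1 ^ 2 + V t 0 ^ 2 + V t 2 ^ 2 = 1 := by linarith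
  have ho' : V t 1 * V1 1 + V t 0 * V1 0 + V t 2 * V1 2 = 0 := by linarith
  refine hasDerivAt_euclidean.2 fun i => ?_
  fin_cases i
  on_goal 1 => refine (((h0.fun_mul h1).fun_mul hk).fun_neg).congr_deriv ?_
  on_goal 2 => refine (((h1.fun_pow 2).fun_mul hk).const_sub 1).congr_deriv ?_
  on_goal 3 => refine ((h1.const_mul ε).fun_neg).congr_deriv ?_
  all_goals simp only [chartX, chartY, chartForm, inner_space, PiLp.sub_apply, PiLp.smul_apply, smul_eq_mul,
      Matrix.cons_val, Fin.zero_eta, Fin.mk_one, Fin.reduceFinMk]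
  · linear_combination chart_identity_off hε hn' ho' hkk
  · linear_combination chart_identity_diag hε hn' ho' hkk
  · linear_combination chart_identity_vert hε hn' ho' hkk

/-- Rotating the chart by the integral of its connection form gives a parallel field. -/
theorem hasDerivAt_chart (hε : ε ^ 2 = 1)
    (hV : HasDerivAt V V1 t) (hn : V t 0 ^ 2 + V t 1 ^ 2 + V t 2 ^ 2 = 1)
    (ho : V t 0 * V1 0 + V t 1 * V1 1 + V t 2 * V1 2 = 0) (hD : 0 < 1 + ε * V t 2) {ψ : ℝ → ℝ}
    (hψ : HasDerivAt ψ (chartForm ε (V t) V1) t) (c s : ℝ) {E : ℝ → Space}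
    (hE : E = fun t => chartVec ε (ψ t) c s (V t)) :
    HasDerivAt E (-(inner ℝ (E t) V1 • V t)) t := by
  have h1 := (hψ.cos.const_mul c).fun_add (hψ.sin.const_mul s)
  have h2 := (hψ.cos.const_mul s).fun_sub (hψ.sin.const_mul c)
  subst hE
  refine ((h1.fun_smul (hasDerivAt_chartX hε hV hn ho hD)).fun_add
    (h2.fun_smul (hasDerivAt_chartY hε hV hn ho hD))).congr_deriv ?_
  simp only [chartVec, inner_add_left, real_inner_smul_left]
  module

/-- The chart is a basis of the tangent plane. -/
theorem eq_chart (hε : ε ^ 2 = 1) {y w : Space} (hn : y 0 ^ 2 + y 1 ^ 2 + y 2 ^ 2 = 1)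
    (ho : w 0 * y 0 + w 1 * y 1 + w 2 * y 2 = 0) (hD : 0 < 1 + ε * y 2) :
    inner ℝ w (chartX ε y) • chartX ε y + inner ℝ w (chartY ε y) • chartY ε y = w := by
  have hkk : (1 + ε * y 2)⁻¹ * (1 + ε * y 2) = 1 := inv_mul_cancel₀ hD.ne'
  have hn' : y 1 ^ 2 + y 0 ^ 2 + y 2 ^ 2 = 1 := by linarith
  have ho' : w 1 * y 1 + w 0 * y 0 + w 2 * y 2 = 0 := by linarith
  obtain ⟨e0, e2⟩ := chart_identity_basis hε hn ho hkk
  obtain ⟨e1, -⟩ := chart_identity_basis hε hn' ho' hkk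
  ext i
  fin_cases i
  all_goals simp only [chartX, chartY, inner_space, PiLp.add_apply, PiLp.smul_apply, smul_eq_mul,
      Matrix.cons_val, Fin.zero_eta, Fin.mk_one, Fin.reduceFinMk]
  · linear_combination e0
  · linear_combination e1
  · linear_combination e2

theorem chart_orth (hε : ε ^ 2 = 1) {y : Space} (hn : y 0 ^ 2 + y 1 ^ 2 + y 2 ^ 2 = 1)
    (hD : 0 < 1 + ε * y 2) (a b : ℝ) {w : Space} (hw : w = a • chartX ε y + b • chartY ε y) :
    w 0 * y 0 + w 1 * y 1 + w 2 * y 2 = 0 := by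
  have hkk : (1 + ε * y 2)⁻¹ * (1 + ε * y 2) = 1 := inv_mul_cancel₀ hD.ne'
  subst hw
  simp only [chartX, chartY, PiLp.add_apply, PiLp.smul_apply, smul_eq_mul,
      PiLp.toLp_apply, Matrix.cons_val]
  linear_combination a * chart_identity_orth hε hn hkk +
    b * chart_identity_orth hε (show y 1 ^ 2 + y 0 ^ 2 + y 2 ^ 2 = 1 by linarith) hkk


theorem continuousAt_chart {y : Space} (hD : 0 < 1 + ε * y 2) :
    ContinuousAt (chartX ε) y ∧ ContinuousAt (chartY ε) y := by
  have hc : ∀ i : Fin 3, ContinuousAt (fun y : Space => y i) y := fun i =>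
    (EuclideanSpace.proj (𝕜 := ℝ) i).continuous.continuousAt
  have h0 := hc 0
  have h1 := hc 1
  have h2 := hc 2
  have hk : ContinuousAt (fun y : Space => (1 + ε * y 2)⁻¹) y :=
    (continuousAt_const.add (continuousAt_const.mul h2)).inv₀ hD.ne'
  constructor
  · refine (PiLp.continuous_toLp 2 _).continuousAt.comp (continuousAt_pi.2 fun i => ?_)
    fin_cases i
    · exact continuousAt_const.sub ((h0.pow 2).mul hk)
    · exact ((h0.mul h1).mul hk).neg
    · exact (continuousAt_const.mul h0).neg
  · refine (PiLp.continuous_toLp 2 _).continuousAt.comp (continuousAt_pi.2 fun i => ?_)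
    fin_cases i
    · exact ((h0.mul h1).mul hk).neg
    · exact continuousAt_const.sub ((h1.pow 2).mul hk)
    · exact (continuousAt_const.mul h1).neg

/-- A globally defined version of the connection form. -/
def chartFormCut (ε : ℝ) (y y' : Space) : ℝ := (y' 0 * y 1 - y 0 * y' 1) * (max (1 + ε * y 2) (1 / 2))⁻¹

theorem Traj.regular_chartFormCut {V V1 : ℝ → Space} (h : Traj m V V1) (hm : 1 ≤ m) (ε : ℝ) :
    Continuous (fun t => chartFormCut ε (V t) (V1 t)) ∧
      Integrable (fun t => chartFormCut ε (V t) (V1 t)) := by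
  have hpos : ∀ t, 1 / 2 ≤ max (1 + ε * V t 2) (1 / 2) := fun t => le_max_right _ _
  have c0 := continuous_coord h.continuous 0
  have c1 := continuous_coord h.continuous 1
  have c2 := continuous_coord h.continuous 2
  have d0 := continuous_coord h.cont 0
  have d1 := continuous_coord h.cont 1
  have hc : Continuous (fun t => chartFormCut ε (V t) (V1 t)) :=
    ((d0.mul c1).sub (c0.mul d1)).mul
      (((continuous_const.add (continuous_const.mul c2)).max continuous_const).inv₀ fun t => by
        have := hpos t; positivity)
  refine ⟨hc, (h.int.const_mul 2).mono' hc.aestronglyMeasurable (Eventually.of_forall fun t => ?_)⟩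
  have hm' : (1 : ℝ) ≤ m := by exact_mod_cast hm
  rw [chartFormCut, norm_mul, norm_inv, Real.norm_eq_abs, Real.norm_eq_abs]
  have h1 : |max (1 + ε * V t 2) (1 / 2)|⁻¹ ≤ 2 := by
    rw [abs_of_nonneg (by linarith [hpos t]), inv_le_comm₀ (by linarith [hpos t]) two_pos]
    linarith [hpos t]
  have h2 : |V1 t 0 * V t 1 - V t 0 * V1 t 1| ≤ ‖V1 t‖ ^ 2 + m ^ 2 * ‖rotGen (V t)‖ ^ 2 := by
    rw [norm_rotGen_sq, norm_sq_space, abs_le]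
    have : V t 0 ^ 2 + V t 1 ^ 2 ≤ m ^ 2 * (V t 0 ^ 2 + V t 1 ^ 2) :=
      le_mul_of_one_le_left (by positivity) (by nlinarith)
    constructor <;>
    nlinarith [sq_nonneg (V1 t 0 - V t 1), sq_nonneg (V1 t 1 + V t 0), sq_nonneg (V1 t 0 + V t 1),
      sq_nonneg (V1 t 1 - V t 0), sq_nonneg (V1 t 2)]
  rw [mul_comm]
  exact mul_le_mul h1 h2 (abs_nonneg _) two_pos.le

theorem Traj.hasDerivAt_chartVec {V V1 : ℝ → Space} (h : Traj m V V1) (hm : 1 ≤ m) (hε : ε ^ 2 = 1)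
    {t : ℝ} (hD : 1 / 2 ≤ 1 + ε * V t 2) (τ b c s : ℝ) {E : ℝ → Space}
    (hE : E = fun t => chartVec ε ((∫ x in τ..t, chartFormCut ε (V x) (V1 x)) - b) c s (V t)) :
    HasDerivAt E (-(inner ℝ (E t) (V1 t) • V t)) t := by
  obtain ⟨hc, -⟩ := h.regular_chartFormCut hm ε
  have hψ : HasDerivAt (fun t => (∫ x in τ..t, chartFormCut ε (V x) (V1 x)) - b)
      (chartForm ε (V t) (V1 t)) t := by
    have e : chartForm ε (V t) (V1 t) = chartFormCut ε (V t) (V1 t) := by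
      rw [chartForm, chartFormCut, max_eq_left hD]
    rw [e]
    exact (intervalIntegral.integral_hasDerivAt_right (hc.intervalIntegrable _ _)
      hc.stronglyMeasurable.stronglyMeasurableAtFilter hc.continuousAt).sub_const b
  exact hasDerivAt_chart hε (h.deriv t) (h.sq t) (h.orth t) (by linarith) hψ c s hE

theorem Traj.exists_parallel {V V1 : ℝ → Space} (h : Traj m V V1) (hm : 1 ≤ m) {τ : ℝ}
    (hR : ∀ t, τ ≤ t → -(1 / 2) ≤ V t 2) (hL : ∀ t, t ≤ τ → V t 2 ≤ 1 / 2) :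
    ∃ E : ℝ → Space, (∀ t, HasDerivAt E (-(inner ℝ (E t) (V1 t) • V t)) t) ∧
      Tendsto E atTop (𝓝 !₂[1, 0, 0]) := by
  obtain ⟨-, hi⟩ := h.regular_chartFormCut hm 1
  set b := ∫ x in Set.Ioi τ, chartFormCut 1 (V x) (V1 x) with hb
  set P : ℝ → ℝ → ℝ → Space := fun c s t =>
    chartVec 1 ((∫ x in τ..t, chartFormCut 1 (V x) (V1 x)) - b) c s (V t) with hP
  set M : ℝ → ℝ → ℝ → Space := fun c s t =>
    chartVec (-1) ((∫ x in τ..t, chartFormCut (-1) (V x) (V1 x)) - 0) c s (V t) with hM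
  have dP : ∀ c s t, τ ≤ t → HasDerivAt (P c s) (-(inner ℝ (P c s t) (V1 t) • V t)) t := fun c s t ht =>
    h.hasDerivAt_chartVec hm (by norm_num) (by linarith [hR t ht]) τ b c s rfl
  have dM : ∀ c s t, t ≤ τ → HasDerivAt (M c s) (-(inner ℝ (M c s t) (V1 t) • V t)) t := fun c s t ht =>
    h.hasDerivAt_chartVec hm (by norm_num) (by linarith [hL t ht]) τ 0 c s rfl
  set w := P 1 0 τ with hw
  have hworth : w 0 * V τ 0 + w 1 * V τ 1 + w 2 * V τ 2 = 0 :=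
    chart_orth (by norm_num) (h.sq τ) (by linarith [hR τ le_rfl]) _ _ rfl
  set c := inner ℝ w (chartX (-1) (V τ)) with hc
  set s := inner ℝ w (chartY (-1) (V τ)) with hs
  have hmatch : M c s τ = w := by
    rw [hM]
    simp only [chartVec, intervalIntegral.integral_same, sub_zero, cos_zero, sin_zero, mul_one, mul_zero,
      add_zero]
    exact eq_chart (by norm_num) (h.sq τ) hworth (by linarith [hL τ le_rfl])
  refine ⟨fun t => if τ ≤ t then P 1 0 t else M c s t, fun t => ?_, ?_⟩
  · beta_reduce
    rcases lt_trichotomy t τ with ht | rfl | ht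
    · rw [if_neg (not_le.2 ht)]
      refine (dM c s t ht.le).congr_of_eventuallyEq ?_
      filter_upwards [gt_mem_nhds ht] with x hx using if_neg (not_le.2 hx)
    · rw [if_pos le_rfl]
      rw [← hasDerivWithinAt_univ, ← Set.Iic_union_Ici (a := t)]
      refine HasDerivWithinAt.union ?_ ?_
      · have := (dM c s t le_rfl).hasDerivWithinAt (s := Set.Iic t)
        rw [hmatch, hw] at this
        refine this.congr (fun x hx => ?_) ?_
        · rcases eq_or_lt_of_le (show x ≤ t from hx) with rfl | hx'
          · rw [if_pos le_rfl, hmatch]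
          · exact if_neg (not_le.2 hx')
        · rw [if_pos le_rfl, hmatch]
      · exact (dP 1 0 t le_rfl).hasDerivWithinAt.congr (fun x hx => if_pos hx) (if_pos le_rfl)
    · rw [if_pos ht.le]
      refine (dP 1 0 t ht.le).congr_of_eventuallyEq ?_
      filter_upwards [lt_mem_nhds ht] with x hx using if_pos hx.le
  · have hk : 0 < 1 + 1 * northPole 2 := by simp [northPole]
    have h1 : Tendsto (fun t => (∫ x in τ..t, chartFormCut 1 (V x) (V1 x)) - b) atTop (𝓝 0) := by
      rw [← sub_self b]
      exact (intervalIntegral_tendsto_integral_Ioi τ hi.integrableOn tendsto_id).sub_const b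
    have hcos := (continuous_cos.tendsto _).comp h1
    have hsin := (continuous_sin.tendsto _).comp h1
    obtain ⟨kX, kY⟩ := continuousAt_chart hk
    have hX := kX.tendsto.comp h.top
    have hY := kY.tendsto.comp h.top
    have hl := (((hcos.const_mul 1).add (hsin.const_mul 0)).smul hX).add
      (((hcos.const_mul 0).sub (hsin.const_mul 1)).smul hY)
    have hv : (1 * cos 0 + 0 * sin 0) • chartX 1 northPole +
        (0 * cos 0 - 1 * sin 0) • chartY 1 northPole = !₂[1, 0, 0] := by
      ext i; fin_cases i <;> simp [chartX, northPole]
    rw [hv] at hl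
    refine hl.congr' ?_
    filter_upwards [eventually_ge_atTop τ] with t ht
    rw [if_pos ht]
    rfl

/-- Existence of a Coulomb frame. -/
theorem exists_isCoulombFrame {u : Plane → Space} {v1 : ℝ → Space}
    (hd : ∀ r, 0 < r → HasDerivAt (profile u) (v1 r) r) (hc : ContinuousOn v1 (Set.Ioi 0)) {E : ℝ → Space}
    (hE : ∀ t, HasDerivAt E (-(inner ℝ (E t) (exp t • v1 (exp t)) • logProfile u t)) t)
    (hl : Tendsto E atTop (𝓝 !₂[1, 0, 0])) : IsCoulombFrame u (fun r => E (log r)) := by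
  have hcE := continuous_of_hasDerivAt hE
  have hce : ContinuousOn (fun r => E (log r)) (Set.Ioi 0) :=
    hcE.comp_continuousOn (continuousOn_log.mono fun x hx => (ne_of_gt hx : x ≠ 0))
  have hcp : ContinuousOn (profile u) (Set.Ioi 0) := fun x hx => (hd x hx).continuousAt.continuousWithinAt
  have hde : ∀ r, 0 < r → HasDerivAt (fun r => E (log r))
      (-(inner ℝ (E (log r)) (v1 r) • profile u r)) r := fun r hr => by
    refine (HasDerivAt.scomp r (hE (log r)) (hasDerivAt_log hr.ne')).congr_deriv ?_
    rw [exp_log hr, logProfile, exp_log hr, real_inner_smul_right, smul_neg, smul_smul,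
      inv_mul_cancel_left₀ hr.ne']
  refine ⟨fun a b ha hab => ?_, hl.comp tendsto_log_atTop, ?_⟩
  · refine ((contDiffOn_one_of_hasDerivAt hde ((hce.inner (𝕜 := ℝ) hc).smul hcp).neg).mono
      ?_).absolutelyContinuousOnInterval
    rw [Set.uIcc_of_le hab]
    exact fun x hx => lt_of_lt_of_le ha hx.1
  · refine (ae_restrict_iff' measurableSet_Ioi).2 (Eventually.of_forall fun r hr => ?_)
    rw [(hd r hr).deriv]
    exact hde r hr

end Chart

end Coulomb

/-! ### A weighted Hardy inequality -/

/-- The weight of the third-order energy in the logarithmic coordinate. -/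
notation "ω(" t ")" => Real.exp (-(4 * t))

section Hardy

theorem hardy_quadratic {c ρ : ℝ} (hc : 3 ≤ c) (h1 : -2 ≤ ρ) (h2 : ρ ≤ 0) (x y : ℝ) :
    x ^ 2 / 3 + y ^ 2 ≤ x ^ 2 + 2 * ρ * (x * y) + (c - 2 * ρ) * y ^ 2 := by
  have h3 : 0 ≤ (ρ + 2) * (1 - 3 / 2 * ρ) := mul_nonneg (by linarith) (by linarith)
  nlinarith [sq_nonneg (x + 3 / 2 * ρ * y), mul_nonneg h3 (sq_nonneg y),
    mul_nonneg (by linarith : 0 ≤ c - 3) (sq_nonneg y)]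

theorem hardy_pointwise {c ρ χ δ w x y f : ℝ} (hc : 3 ≤ c) (h1 : -2 ≤ ρ) (h2 : ρ ≤ 0) (hχ0 : 0 ≤ χ)
    (hχ : χ ≤ 1) :
    (w * χ) ^ 2 * (x ^ 2 / 6 + y ^ 2 / 2) ≤
      (f * y * (w * χ) ^ 2 + c * y ^ 2 * (w * χ) ^ 2 + x ^ 2 * (w * χ) ^ 2 +
        (x * y - y ^ 2) * (2 * ρ * (w * χ) ^ 2 + 2 * w ^ 2 * χ * δ)) +
      (w * χ) ^ 2 * f ^ 2 / 2 + w ^ 2 * (6 * δ ^ 2 + 2 * |δ|) * y ^ 2 := by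
  have hq := mul_le_mul_of_nonneg_left (hardy_quadratic hc h1 h2 x y) (sq_nonneg (w * χ))
  have e1 : 0 ≤ (w * χ) ^ 2 * (f + y) ^ 2 := by positivity
  have e2 : 0 ≤ w ^ 2 * (χ * x + 6 * δ * y) ^ 2 := by positivity
  have e3 : 0 ≤ w ^ 2 * y ^ 2 * (|δ| - χ * δ) := by
    refine mul_nonneg (by positivity) ?_
    have h4 := mul_le_mul_of_nonneg_left (le_abs_self δ) hχ0
    have h5 := mul_le_mul_of_nonneg_right hχ (abs_nonneg δ)
    linarith
  nlinarith

/-- Local absolute continuity. -/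
def LocallyAC (g : ℝ → ℝ) : Prop := ∀ a b, AbsolutelyContinuousOnInterval g a b

theorem locallyAC_of_hasDerivAt {g g' : ℝ → ℝ} (hd : ∀ t, HasDerivAt g (g' t) t) (hc : Continuous g') :
    LocallyAC g := fun _ _ => by
  refine ContDiffOn.absolutelyContinuousOnInterval (ContDiff.contDiffOn ?_)
  rw [contDiff_one_iff_deriv]
  refine ⟨fun t => (hd t).differentiableAt, ?_⟩
  rwa [show deriv g = g' from funext fun t => (hd t).deriv]

theorem LocallyAC.continuous {g : ℝ → ℝ} (h : LocallyAC g) : Continuous g := by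
  refine continuous_iff_continuousAt.2 fun t => ?_
  have := (h (t - 1) (t + 1)).continuousOn
  rw [Set.uIcc_of_le (by linarith)] at this
  exact this.continuousAt (Icc_mem_nhds (by linarith) (by linarith))

theorem LocallyAC.ae_hasDerivAt {g : ℝ → ℝ} (h : LocallyAC g) : ∀ᵐ t, HasDerivAt g (deriv g t) t := by
  have : ∀ n : ℕ, ∀ᵐ t, t ∈ Set.uIcc (-(n : ℝ)) n → DifferentiableAt ℝ g t := fun n =>
    (h _ _).ae_differentiableAt
  filter_upwards [ae_all_iff.2 this] with t ht
  obtain ⟨n, hn⟩ := exists_nat_ge |t|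
  refine (ht n ?_).hasDerivAt
  rw [Set.uIcc_of_le (by linarith [abs_nonneg t])]
  exact abs_le.1 hn

theorem LocallyAC.mul {f g : ℝ → ℝ} (hf : LocallyAC f) (hg : LocallyAC g) : LocallyAC fun t => f t * g t :=
  fun a b => (hf a b).fun_mul (hg a b)

theorem LocallyAC.sub {f g : ℝ → ℝ} (hf : LocallyAC f) (hg : LocallyAC g) : LocallyAC fun t => f t - g t :=
  fun a b => (hf a b).fun_sub (hg a b)

variable {Q Q1 : ℝ → ℝ} {c : ℝ}

theorem hardy_cutoff (hc : 3 ≤ c) (hd : ∀ t, HasDerivAt Q (Q1 t) t) (hac : LocallyAC Q1)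
    (hQ : Integrable fun t => Q t ^ 2)
    (hf : Integrable fun t => ω(t) * (deriv Q1 t - 2 * Q1 t - c * Q t) ^ 2) {κ N : ℝ}
    (hκ : 0 < κ) (hN : 1 ≤ N) :
    ∫ t in -N..N, ((exp (2 * t) + κ)⁻¹ * (1 - (t / N) ^ 2)) ^ 2 * (Q1 t ^ 2 / 6 + Q t ^ 2 / 2) ≤
      1 / 2 * (∫ t, ω(t) * (deriv Q1 t - 2 * Q1 t - c * Q t) ^ 2) +
        28 / (N * κ ^ 2) * ∫ t, Q t ^ 2 := by
  have hN0 : 0 < N := by linarith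
  set w : ℝ → ℝ := fun t => (exp (2 * t) + κ)⁻¹ with hw
  set χ : ℝ → ℝ := fun t => 1 - (t / N) ^ 2 with hχ
  set δ : ℝ → ℝ := fun t => -(2 * (t / N) * (1 / N)) with hδ
  set ρ : ℝ → ℝ := fun t => -(2 * exp (2 * t)) * w t with hρ
  set f : ℝ → ℝ := fun t => deriv Q1 t - 2 * Q1 t - c * Q t with hfd
  have hpos : ∀ t, 0 < exp (2 * t) + κ := fun t => by positivity
  have dw : ∀ t, HasDerivAt w (ρ t * w t) t := fun t => by
    have h1 : HasDerivAt (fun t => exp (2 * t) + κ) (exp (2 * t) * (2 * 1)) t :=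
      (((hasDerivAt_id t).const_mul 2).exp).add_const κ
    refine (h1.fun_inv (hpos t).ne').congr_deriv ?_
    rw [hρ, hw]
    field_simp
  have dχ : ∀ t, HasDerivAt χ (δ t) t := fun t => by
    have h1 : HasDerivAt (fun t : ℝ => t / N) (1 / N) t := (hasDerivAt_id t).div_const N
    refine ((h1.fun_pow 2).const_sub 1).congr_deriv ?_
    rw [hδ]; norm_num
  have dW : ∀ t, HasDerivAt (fun t => (w t * χ t) ^ 2)
      (2 * ρ t * (w t * χ t) ^ 2 + 2 * w t ^ 2 * χ t * δ t) t := fun t => by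
    refine (((dw t).fun_mul (dχ t)).fun_pow 2).congr_deriv ?_
    ring
  have cexp : Continuous fun t : ℝ => exp (2 * t) := by fun_prop
  have cw := continuous_of_hasDerivAt dw
  have cχ := continuous_of_hasDerivAt dχ
  have cδ : Continuous δ := by rw [hδ]; fun_prop
  have cρ : Continuous ρ := (continuous_const.mul cexp).neg.mul cw
  have cQ := continuous_of_hasDerivAt hd
  have cQ1 := hac.continuous
  have acQ := locallyAC_of_hasDerivAt hd cQ1
  have acW : LocallyAC fun t => (w t * χ t) ^ 2 := locallyAC_of_hasDerivAt dW (by fun_prop)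
  set Φ : ℝ → ℝ := fun t => (Q1 t * Q t) * (w t * χ t) ^ 2 - (Q t * Q t) * (w t * χ t) ^ 2 with hΦ
  have acΦ : LocallyAC Φ := ((hac.mul acQ).mul acW).sub ((acQ.mul acQ).mul acW)
  have dΦ : ∀ᵐ t, deriv Φ t = f t * Q t * (w t * χ t) ^ 2 + c * Q t ^ 2 * (w t * χ t) ^ 2 +
      Q1 t ^ 2 * (w t * χ t) ^ 2 + (Q1 t * Q t - Q t ^ 2) *
        (2 * ρ t * (w t * χ t) ^ 2 + 2 * w t ^ 2 * χ t * δ t) := by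
    filter_upwards [hac.ae_hasDerivAt] with t ht
    have := (((ht.fun_mul (hd t)).fun_mul (dW t)).fun_sub (((hd t).fun_mul (hd t)).fun_mul (dW t))).deriv
    rw [hΦ, this, hfd]
    ring
  have wle : ∀ t, w t ≤ κ⁻¹ := fun t => inv_anti₀ hκ (by linarith [exp_pos (2 * t)])
  have w0 : ∀ t, 0 ≤ w t := fun t => (inv_pos.2 (hpos t)).le
  have wle' : ∀ t, w t ^ 2 ≤ ω(t) := fun t => by
    have h1 : w t ≤ exp (-(2 * t)) := by
      rw [exp_neg]
      exact inv_anti₀ (exp_pos _) (by linarith)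
    calc w t ^ 2 ≤ exp (-(2 * t)) ^ 2 := pow_le_pow_left₀ (w0 t) h1 2
      _ = _ := by rw [← exp_nat_mul]; congr 1; push_cast; ring
  have hpt : ∀ᵐ t, t ∈ Set.Icc (-N) N → (w t * χ t) ^ 2 * (Q1 t ^ 2 / 6 + Q t ^ 2 / 2) ≤
      deriv Φ t + 1 / 2 * (ω(t) * f t ^ 2) + 28 / (N * κ ^ 2) * Q t ^ 2 := by
    filter_upwards [dΦ] with t ht hmem
    have hx : |t / N| ≤ 1 := by rw [abs_div, abs_of_pos hN0, div_le_one hN0]; exact abs_le.2 hmem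
    have hx2 : (t / N) ^ 2 ≤ 1 := by rw [← sq_abs]; nlinarith [abs_nonneg (t / N)]
    have hχ0 : 0 ≤ χ t := by rw [hχ]; simp only; linarith
    have hχ1 : χ t ≤ 1 := by rw [hχ]; simp only; linarith [sq_nonneg (t / N)]
    have hδ1 : |δ t| ≤ 2 / N := by
      rw [hδ]; simp only
      rw [abs_neg, abs_mul, abs_mul, abs_two, abs_of_pos (by positivity : 0 < 1 / N)]
      calc 2 * |t / N| * (1 / N) ≤ 2 * 1 * (1 / N) := by gcongr
        _ = _ := by ring
    have hρ1 : -2 ≤ ρ t := by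
      rw [hρ, hw]; simp only
      rw [← div_eq_mul_inv, le_div_iff₀ (hpos t)]
      nlinarith
    have hρ2 : ρ t ≤ 0 := by
      rw [hρ]; simp only
      exact mul_nonpos_of_nonpos_of_nonneg (by linarith [exp_pos (2 * t)]) (w0 t)
    have h1 := hardy_pointwise (w := w t) (x := Q1 t) (y := Q t) (f := f t) (δ := δ t) hc hρ1 hρ2 hχ0 hχ1
    have h2 : (w t * χ t) ^ 2 * f t ^ 2 / 2 ≤ 1 / 2 * (ω(t) * f t ^ 2) := by
      have : (w t * χ t) ^ 2 ≤ ω(t) := by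
        rw [mul_pow]
        exact (mul_le_of_le_one_right (by positivity) (pow_le_one₀ hχ0 hχ1)).trans (wle' t)
      nlinarith [mul_le_mul_of_nonneg_right this (sq_nonneg (f t))]
    have h3 : w t ^ 2 * (6 * δ t ^ 2 + 2 * |δ t|) * Q t ^ 2 ≤ 28 / (N * κ ^ 2) * Q t ^ 2 := by
      refine mul_le_mul_of_nonneg_right ?_ (sq_nonneg _)
      have e1 : w t ^ 2 ≤ (κ ^ 2)⁻¹ := by rw [← inv_pow]; exact pow_le_pow_left₀ (w0 t) (wle t) 2
      have e2 : 6 * δ t ^ 2 + 2 * |δ t| ≤ 28 / N := by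
        rw [← sq_abs]
        have e3 : |δ t| ^ 2 ≤ (2 / N) ^ 2 := pow_le_pow_left₀ (abs_nonneg _) hδ1 2
        have e4 : (2 / N) ^ 2 ≤ 4 / N := by
          rw [div_pow, div_le_div_iff₀ (by positivity) hN0]; nlinarith
        have e5 : (28 : ℝ) / N = 6 * (4 / N) + 2 * (2 / N) := by ring
        linarith
      calc _ ≤ (κ ^ 2)⁻¹ * (28 / N) := mul_le_mul e1 e2 (by positivity) (by positivity)
        _ = _ := by field_simp
    rw [← ht] at h1
    linarith
  have i1 : IntervalIntegrable (deriv Φ) volume (-N) N := (acΦ _ _).intervalIntegrable_deriv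
  have i2 : IntervalIntegrable (fun t => 1 / 2 * (ω(t) * f t ^ 2)) volume (-N) N :=
    (hf.const_mul _).intervalIntegrable
  have i3 : IntervalIntegrable (fun t => 28 / (N * κ ^ 2) * Q t ^ 2) volume (-N) N :=
    (hQ.const_mul _).intervalIntegrable
  have i0 : IntervalIntegrable (fun t => (w t * χ t) ^ 2 * (Q1 t ^ 2 / 6 + Q t ^ 2 / 2)) volume (-N) N :=
    (by fun_prop : Continuous fun t => (w t * χ t) ^ 2 * (Q1 t ^ 2 / 6 + Q t ^ 2 / 2)).intervalIntegrable _ _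
  have hNN : -N ≤ N := by linarith
  have hle := intervalIntegral.integral_mono_ae_restrict hNN i0 ((i1.add i2).add i3)
    ((ae_restrict_iff' measurableSet_Icc).2 hpt)
  have e0 : ∫ t in -N..N, deriv Φ t = 0 := by
    rw [(acΦ _ _).integral_deriv_eq_sub]
    have h1 : χ N = 0 := by rw [hχ]; simp only; rw [div_self hN0.ne']; norm_num
    have h2 : χ (-N) = 0 := by rw [hχ]; simp only; rw [neg_div, div_self hN0.ne']; norm_num
    rw [hΦ]; simp only
    rw [h1, h2]; ring
  have split : ∫ t in -N..N, (deriv Φ t + 1 / 2 * (ω(t) * f t ^ 2) + 28 / (N * κ ^ 2) * Q t ^ 2) =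
      (∫ t in -N..N, 1 / 2 * (ω(t) * f t ^ 2)) + ∫ t in -N..N, 28 / (N * κ ^ 2) * Q t ^ 2 := by
    rw [intervalIntegral.integral_add (i1.add i2) i3, intervalIntegral.integral_add i1 i2, e0, zero_add]
  refine hle.trans (le_of_eq_of_le split (add_le_add ?_ ?_))
  · rw [intervalIntegral.integral_of_le hNN, ← integral_const_mul]
    exact setIntegral_le_integral (hf.const_mul _) (Eventually.of_forall fun t => by positivity)
  · rw [intervalIntegral.integral_of_le hNN, ← integral_const_mul]
    exact setIntegral_le_integral (hQ.const_mul _) (Eventually.of_forall fun t => by positivity)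

theorem hardy (hc : 3 ≤ c) (hd : ∀ t, HasDerivAt Q (Q1 t) t) (hac : LocallyAC Q1)
    (hQ : Integrable fun t => Q t ^ 2)
    (hf : Integrable fun t => ω(t) * (deriv Q1 t - 2 * Q1 t - c * Q t) ^ 2) :
    Integrable (fun t => ω(t) * (Q t ^ 2 + Q1 t ^ 2 + deriv Q1 t ^ 2)) ∧
    ∫ t, ω(t) * (Q t ^ 2 + Q1 t ^ 2 + deriv Q1 t ^ 2) ≤
      (6 + 3 * (1 + 12 + c ^ 2)) * ∫ t, ω(t) * (deriv Q1 t - 2 * Q1 t - c * Q t) ^ 2 := by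
  set A := ∫ t, ω(t) * (deriv Q1 t - 2 * Q1 t - c * Q t) ^ 2 with hA
  have cQ1 := hac.continuous
  have cQ := continuous_of_hasDerivAt hd
  set g : ℕ → ℝ → ℝ := fun n => Set.indicator (Set.Ioc (-((n + 1 : ℝ) ^ 3)) ((n + 1 : ℝ) ^ 3)) fun t =>
    ((exp (2 * t) + (n + 1 : ℝ)⁻¹)⁻¹ * (1 - (t / (n + 1 : ℝ) ^ 3) ^ 2)) ^ 2 * (Q1 t ^ 2 / 6 + Q t ^ 2 / 2) with hg
  have hcont : ∀ n : ℕ, Continuous fun t => ((exp (2 * t) + (n + 1 : ℝ)⁻¹)⁻¹ *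
      (1 - (t / (n + 1 : ℝ) ^ 3) ^ 2)) ^ 2 * (Q1 t ^ 2 / 6 + Q t ^ 2 / 2) := fun n => by
    have : Continuous fun t : ℝ => (exp (2 * t) + (n + 1 : ℝ)⁻¹)⁻¹ :=
      (by fun_prop : Continuous fun t : ℝ => exp (2 * t) + (n + 1 : ℝ)⁻¹).inv₀ fun t => by positivity
    fun_prop
  have hgm : ∀ n, Measurable (g n) := fun n => (hcont n).measurable.indicator measurableSet_Ioc
  have hgb : ∀ n : ℕ, ∫⁻ t, ENNReal.ofReal (g n t) ≤
      ENNReal.ofReal (1 / 2 * A + 28 / (n + 1 : ℝ) * ∫ t, Q t ^ 2) := by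
    intro n
    have hn : (1 : ℝ) ≤ (n + 1) ^ 3 := one_le_pow₀ (by linarith [Nat.cast_nonneg (α := ℝ) n])
    have h1 := hardy_cutoff hc hd hac hQ hf (κ := (n + 1 : ℝ)⁻¹) (by positivity) hn
    have hi : IntegrableOn (fun t => ((exp (2 * t) + (n + 1 : ℝ)⁻¹)⁻¹ *
      (1 - (t / (n + 1 : ℝ) ^ 3) ^ 2)) ^ 2 * (Q1 t ^ 2 / 6 + Q t ^ 2 / 2))
      (Set.Ioc (-((n + 1 : ℝ) ^ 3)) ((n + 1 : ℝ) ^ 3)) :=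
      ((hcont n).integrableOn_Icc).mono_set Set.Ioc_subset_Icc_self
    rw [← ofReal_integral_eq_lintegral_ofReal ((integrable_indicator_iff measurableSet_Ioc).2 hi)
      (Eventually.of_forall fun t => Set.indicator_nonneg (fun t _ => by positivity) t)]
    refine ENNReal.ofReal_le_ofReal ?_
    rw [integral_indicator measurableSet_Ioc, ← intervalIntegral.integral_of_le (by linarith)]
    refine h1.trans (le_of_eq ?_)
    rw [← hA]
    congr 2
    field_simp
  have hlim : ∀ t, Tendsto (fun n => g n t) atTop
      (𝓝 (ω(t) * (Q1 t ^ 2 / 6 + Q t ^ 2 / 2))) := by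
    intro t
    have hn : Tendsto (fun n : ℕ => ((n : ℝ) + 1)) atTop atTop :=
      tendsto_atTop_add_const_right _ _ tendsto_natCast_atTop_atTop
    have hinv := tendsto_inv_atTop_zero.comp hn
    have hn3 : Tendsto (fun n : ℕ => ((n : ℝ) + 1) ^ 3) atTop atTop := (tendsto_pow_atTop (by norm_num)).comp hn
    have h1 : Tendsto (fun n : ℕ => (exp (2 * t) + (n + 1 : ℝ)⁻¹)⁻¹) atTop (𝓝 (exp (2 * t) + 0)⁻¹) :=
      (hinv.const_add _).inv₀ (by positivity)
    have h2 : Tendsto (fun n : ℕ => 1 - (t / (n + 1 : ℝ) ^ 3) ^ 2) atTop (𝓝 (1 - 0 ^ 2)) :=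
      ((hn3.const_div_atTop t).pow 2).const_sub 1
    have h3 := ((h1.mul h2).pow 2).mul_const (Q1 t ^ 2 / 6 + Q t ^ 2 / 2)
    have e : ((exp (2 * t) + 0)⁻¹ * (1 - 0 ^ 2)) ^ 2 = ω(t) := by
      rw [add_zero, ← exp_neg, zero_pow two_ne_zero, sub_zero, mul_one, ← exp_nat_mul]
      congr 1; push_cast; ring
    rw [e] at h3
    refine h3.congr' ?_
    filter_upwards [hn3.eventually_gt_atTop |t|] with n hn
    rw [hg]; simp only
    rw [Set.indicator_of_mem]
    exact ⟨(abs_lt.1 hn).1, (abs_lt.1 hn).2.le⟩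
  have hfatou : ∫⁻ t, ENNReal.ofReal (ω(t) * (Q1 t ^ 2 / 6 + Q t ^ 2 / 2)) ≤
      ENNReal.ofReal (1 / 2 * A) := by
    have h1 : ∀ t, ENNReal.ofReal (ω(t) * (Q1 t ^ 2 / 6 + Q t ^ 2 / 2)) =
        liminf (fun n => ENNReal.ofReal (g n t)) atTop := fun t =>
      ((ENNReal.continuous_ofReal.tendsto _).comp (hlim t)).liminf_eq.symm
    simp_rw [h1]
    refine (lintegral_liminf_le fun n => (hgm n).ennreal_ofReal).trans ?_
    have h2 : Tendsto (fun n : ℕ => ENNReal.ofReal (1 / 2 * A + 28 / (n + 1 : ℝ) * ∫ t, Q t ^ 2)) atTop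
        (𝓝 (ENNReal.ofReal (1 / 2 * A))) := by
      refine (ENNReal.continuous_ofReal.tendsto _).comp ?_
      have hn : Tendsto (fun n : ℕ => ((n : ℝ) + 1)) atTop atTop :=
        tendsto_atTop_add_const_right _ _ tendsto_natCast_atTop_atTop
      simpa using ((hn.const_div_atTop 28).mul_const (∫ t, Q t ^ 2)).const_add (1 / 2 * A)
    rw [← h2.liminf_eq]
    exact liminf_le_liminf (Eventually.of_forall hgb)
  have cexp : Continuous fun t : ℝ => ω(t) := by fun_prop
  have hA0 : 0 ≤ A := integral_nonneg fun t => by positivity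
  have hI : Integrable fun t => ω(t) * (Q1 t ^ 2 / 6 + Q t ^ 2 / 2) := by
    refine ⟨(by fun_prop : Continuous _).aestronglyMeasurable, ?_⟩
    rw [hasFiniteIntegral_iff_ofReal (Eventually.of_forall fun t => by positivity)]
    exact hfatou.trans_lt ENNReal.ofReal_lt_top
  have hIle : ∫ t, ω(t) * (Q1 t ^ 2 / 6 + Q t ^ 2 / 2) ≤ 1 / 2 * A := by
    rw [← ofReal_integral_eq_lintegral_ofReal hI (Eventually.of_forall fun t => by positivity),
      ENNReal.ofReal_le_ofReal_iff (by positivity)] at hfatou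
    exact hfatou
  have hpt : ∀ t, ω(t) * (Q t ^ 2 + Q1 t ^ 2 + deriv Q1 t ^ 2) ≤
      (6 + 6 * (12 + c ^ 2)) * (ω(t) * (Q1 t ^ 2 / 6 + Q t ^ 2 / 2)) +
        3 * (ω(t) * (deriv Q1 t - 2 * Q1 t - c * Q t) ^ 2) := by
    intro t
    set f := deriv Q1 t - 2 * Q1 t - c * Q t with hf
    have e : deriv Q1 t = f + 2 * Q1 t + c * Q t := by rw [hf]; ring
    rw [e, mul_left_comm, mul_left_comm 3, ← mul_add]
    refine mul_le_mul_of_nonneg_left ?_ (exp_nonneg _)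
    nlinarith [sq_nonneg (f - 2 * Q1 t), sq_nonneg (f - c * Q t), sq_nonneg (2 * Q1 t - c * Q t),
      sq_nonneg (c * Q1 t), sq_nonneg (c * Q t), sq_nonneg (Q1 t), sq_nonneg (Q t)]
  have hI2 : Integrable fun t => (6 + 6 * (12 + c ^ 2)) * (ω(t) * (Q1 t ^ 2 / 6 + Q t ^ 2 / 2)) +
        3 * (ω(t) * (deriv Q1 t - 2 * Q1 t - c * Q t) ^ 2) := (hI.const_mul _).add (hf.const_mul _)
  have hI3 : Integrable (fun t => ω(t) * (Q t ^ 2 + Q1 t ^ 2 + deriv Q1 t ^ 2)) := by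
    refine hI2.mono' ?_ (Eventually.of_forall fun t => ?_)
    · exact (cexp.measurable.mul (((cQ.measurable.pow_const 2).add (cQ1.measurable.pow_const 2)).add
        ((measurable_deriv Q1).pow_const 2))).aestronglyMeasurable
    · rw [Real.norm_of_nonneg (by positivity)]; exact hpt t
  refine ⟨hI3, (integral_mono hI3 hI2 hpt).trans ?_⟩
  rw [integral_add (hI.const_mul _) (hf.const_mul _), integral_const_mul, integral_const_mul]
  have := mul_le_mul_of_nonneg_left hIle (by positivity : 0 ≤ 6 + 6 * (12 + c ^ 2))
  nlinarith

end Hardy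

/-! ### Pointwise bounds and the inner region -/

section Pointwise

theorem le_integral_add_integral {g h : ℝ → ℝ} (hac : LocallyAC g) (hg0 : ∀ t, 0 ≤ g t) (hg : Integrable g)
    (hh : Integrable h) (hd : ∀ᵐ t, |deriv g t| ≤ h t) (t : ℝ) : g t ≤ (∫ s, g s) + ∫ s, h s := by
  have h0 : 0 ≤ᵐ[volume] h := by filter_upwards [hd] with s hs using (abs_nonneg _).trans hs
  have key : ∀ s ∈ Set.Icc t (t + 1), g t ≤ g s + ∫ x, h x := by
    intro s hs
    have h1 := (hac t s).integral_deriv_eq_sub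
    have h2 : |∫ x in t..s, deriv g x| ≤ ∫ x, h x := by
      calc |∫ x in t..s, deriv g x| ≤ ∫ x in t..s, h x :=
            intervalIntegral.norm_integral_le_of_norm_le (f := deriv g) hs.1
              (hd.mono fun x hx _ => hx) hh.intervalIntegrable
        _ ≤ ∫ x, h x := by
            rw [intervalIntegral.integral_of_le hs.1]
            exact setIntegral_le_integral hh h0
    linarith [(abs_le.1 h2).1]
  have hint : ∫ s in t..(t + 1), g t ≤ ∫ s in t..(t + 1), (g s + ∫ x, h x) :=
    intervalIntegral.integral_mono_on (by linarith) (by simp)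
      (hg.intervalIntegrable.add (by simp)) key
  rw [intervalIntegral.integral_const, intervalIntegral.integral_add hg.intervalIntegrable (by simp),
    intervalIntegral.integral_const, add_sub_cancel_left, one_smul, one_smul] at hint
  refine hint.trans (add_le_add_left ?_ _)
  rw [intervalIntegral.integral_of_le (by linarith)]
  exact setIntegral_le_integral hg (Eventually.of_forall hg0)

theorem sq_le_of_forall_le {x a b : ℝ} (hx : 0 ≤ x) (ha : 0 ≤ a) (hb : 0 ≤ b)
    (h : ∀ l : ℝ, 0 < l → x ≤ a * l + b / l) : x ^ 2 ≤ 4 * a * b := by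
  rcases hx.eq_or_lt with rfl | hx0
  · rw [zero_pow two_ne_zero]; exact mul_nonneg (mul_nonneg zero_le_four ha) hb
  rcases ha.eq_or_lt with rfl | ha0
  · exfalso
    have := h ((b + 1) / x) (by positivity)
    rw [zero_mul, zero_add, div_div_eq_mul_div, le_div_iff₀ (by linarith)] at this
    nlinarith
  · have := h (x / (2 * a)) (by positivity)
    have e : a * (x / (2 * a)) = x / 2 := by field_simp
    rw [e, div_div_eq_mul_div] at this
    have h2 : x / 2 ≤ b * (2 * a) / x := by linarith
    rw [le_div_iff₀ hx0] at h2
    nlinarith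

theorem hasDerivAt_exp_neg_mul (k t : ℝ) : HasDerivAt (fun t => exp (-(k * t)))
    (-(k * exp (-(k * t)))) t := by
  refine ((((hasDerivAt_id t).const_mul k).fun_neg).exp).congr_deriv ?_
  simp; ring

theorem locallyAC_exp_neg_mul (k : ℝ) : LocallyAC fun t => exp (-(k * t)) :=
  locallyAC_of_hasDerivAt (hasDerivAt_exp_neg_mul k) (by fun_prop)

variable {Q Q1 : ℝ → ℝ}

theorem exp_mul_sq_le {A : ℝ} {f f' : ℝ → ℝ} (hac : LocallyAC f) (hd : ∀ᵐ t, HasDerivAt f (f' t) t)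
    {S : ℝ → ℝ} (hS : Integrable fun t => ω(t) * S t)
    (hA : ∫ t, ω(t) * S t ≤ A) (hle : ∀ t, f t ^ 2 + f' t ^ 2 ≤ S t) (t : ℝ) :
    ω(t) * f t ^ 2 ≤ 6 * A := by
  have cf := hac.continuous
  have hle1 : ∀ t, f t ^ 2 ≤ S t := fun t => (le_add_of_nonneg_right (sq_nonneg _)).trans (hle t)
  have hg : Integrable fun t => ω(t) * f t ^ 2 := by
    refine hS.mono' (by fun_prop : Continuous _).aestronglyMeasurable (Eventually.of_forall fun t => ?_)
    rw [Real.norm_of_nonneg (by positivity)]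
    exact mul_le_mul_of_nonneg_left (hle1 t) (exp_nonneg _)
  have hacg : LocallyAC fun t => ω(t) * f t ^ 2 := by
    have : (fun t => ω(t) * f t ^ 2) = fun t => ω(t) * (f t * f t) := by
      funext t; ring
    rw [this]
    exact (locallyAC_exp_neg_mul 4).mul (hac.mul hac)
  have := le_integral_add_integral hacg (fun t => by positivity) hg (hS.const_mul 5) (by
    filter_upwards [hd] with s hs
    rw [((hasDerivAt_exp_neg_mul 4 s).fun_mul (hs.fun_pow 2)).deriv, abs_le]
    have hE := exp_pos (-(4 * s))
    have h1 := mul_le_mul_of_nonneg_left (hle s) hE.le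
    have h2 := mul_nonneg hE.le (sq_nonneg (f s + f' s))
    have h3 := mul_nonneg hE.le (sq_nonneg (f s - f' s))
    have h4 := mul_nonneg hE.le (sq_nonneg (f s))
    have h5 := mul_nonneg hE.le (sq_nonneg (f' s))
    norm_num
    constructor <;> nlinarith) t
  rw [integral_const_mul] at this
  have h2 : ∫ t, ω(t) * f t ^ 2 ≤ ∫ t, ω(t) * S t :=
    integral_mono hg hS fun t => mul_le_mul_of_nonneg_left (hle1 t) (exp_nonneg _)
  linarith

theorem exp_two_mul_sq_le {A B : ℝ} (hd : ∀ t, HasDerivAt Q (Q1 t) t) (hc : Continuous Q1)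
    {S : ℝ → ℝ} (hS : Integrable fun t => ω(t) * S t)
    (hA : ∫ t, ω(t) * S t ≤ A) (hle : ∀ t, Q t ^ 2 + Q1 t ^ 2 ≤ S t)
    (hQ : Integrable fun t => Q t ^ 2) (hB : ∫ t, Q t ^ 2 ≤ B) (t : ℝ) :
    (exp (-(2 * t)) * Q t ^ 2) ^ 2 ≤ 25 * A * B := by
  have cQ := continuous_of_hasDerivAt hd
  have hS0 : ∀ t, 0 ≤ S t := fun t => le_trans (by positivity) (hle t)
  have hA0 : 0 ≤ A := (integral_nonneg fun t => mul_nonneg (exp_nonneg _) (hS0 t)).trans hA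
  have hB0 : 0 ≤ B := (integral_nonneg fun t => sq_nonneg _).trans hB
  have hE2 : ∀ t : ℝ, ω(t) = exp (-(2 * t)) ^ 2 := fun t => by
    rw [← exp_nat_mul]; congr 1; push_cast; ring
  refine (sq_le_of_forall_le (a := 5 / 2 * A) (b := 5 / 2 * B) (by positivity) (by positivity) (by positivity)
    fun l hl => ?_).trans (by linarith)
  set k : ℝ → ℝ := fun t => l * (ω(t) * S t) + l⁻¹ * Q t ^ 2 with hk
  have hki : Integrable k := (hS.const_mul l).add (hQ.const_mul _)
  have hkI : ∫ t, k t ≤ l * A + l⁻¹ * B := by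
    rw [hk, integral_add (hS.const_mul l) (hQ.const_mul _), integral_const_mul, integral_const_mul]
    gcongr
  -- two elementary consequences of the inequality of arithmetic and geometric means
  have am : ∀ t, ∀ x : ℝ, x ^ 2 ≤ S t → 2 * |exp (-(2 * t)) * (Q t * x)| ≤ k t := fun t x hx => by
    have h1 : 2 * |exp (-(2 * t)) * (Q t * x)| ≤ l * (exp (-(2 * t)) * x) ^ 2 + l⁻¹ * Q t ^ 2 := by
      have h2 : 0 ≤ l⁻¹ * (l * |exp (-(2 * t)) * x| - |Q t|) ^ 2 := by positivity
      have h3 : |exp (-(2 * t)) * (Q t * x)| = |exp (-(2 * t)) * x| * |Q t| := by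
        rw [← abs_mul]; congr 1; ring
      rw [h3, ← sq_abs (exp (-(2 * t)) * x), ← sq_abs (Q t)]
      have e : l⁻¹ * (l * |exp (-(2 * t)) * x| - |Q t|) ^ 2 = l * |exp (-(2 * t)) * x| ^ 2 +
        l⁻¹ * |Q t| ^ 2 - 2 * (|exp (-(2 * t)) * x| * |Q t|) := by field_simp; ring
      linarith
    refine h1.trans (add_le_add_left (mul_le_mul_of_nonneg_left ?_ hl.le) _)
    rw [mul_pow, ← hE2]
    exact mul_le_mul_of_nonneg_left hx (exp_nonneg _)
  have hg2 : ∀ t, 2 * (exp (-(2 * t)) * Q t ^ 2) ≤ k t := fun t => by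
    have := am t (Q t) ((le_add_of_nonneg_right (sq_nonneg _)).trans (hle t))
    rwa [← pow_two, abs_of_nonneg (by positivity)] at this
  have hgi : Integrable fun t => exp (-(2 * t)) * Q t ^ 2 := by
    refine hki.mono' (by fun_prop : Continuous _).aestronglyMeasurable (Eventually.of_forall fun t => ?_)
    rw [Real.norm_of_nonneg (by positivity)]
    have : 0 ≤ exp (-(2 * t)) * Q t ^ 2 := by positivity
    linarith [hg2 t]
  have hdg : ∀ t, HasDerivAt (fun t => exp (-(2 * t)) * Q t ^ 2)
      (-(2 * exp (-(2 * t))) * Q t ^ 2 + exp (-(2 * t)) * (2 * Q t * Q1 t)) t := fun t => by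
    refine ((hasDerivAt_exp_neg_mul 2 t).fun_mul ((hd t).fun_pow 2)).congr_deriv ?_
    norm_num
  have := le_integral_add_integral (locallyAC_of_hasDerivAt hdg (by fun_prop)) (fun t => by positivity) hgi
    (hki.const_mul 2) (Eventually.of_forall fun t => by
      rw [(hdg t).deriv]
      refine (abs_add_le _ _).trans ?_
      have h1 := hg2 t
      have h2 := am t (Q1 t) ((le_add_of_nonneg_left (sq_nonneg _)).trans (hle t))
      have h3 : |-(2 * exp (-(2 * t))) * Q t ^ 2| = 2 * (exp (-(2 * t)) * Q t ^ 2) := by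
        rw [neg_mul, abs_neg, abs_of_nonneg (by positivity)]; ring
      have h4 : |exp (-(2 * t)) * (2 * Q t * Q1 t)| = 2 * |exp (-(2 * t)) * (Q t * Q1 t)| := by
        rw [← abs_two, ← abs_mul, abs_two]; congr 1; ring
      rw [h3, h4]
      linarith) t
  have h5 : ∫ t, exp (-(2 * t)) * Q t ^ 2 ≤ (l * A + l⁻¹ * B) / 2 := by
    refine (integral_mono hgi (hki.div_const 2) fun t => ?_).trans ?_
    · simp only; linarith [hg2 t]
    · rw [integral_div]; linarith
  rw [integral_const_mul] at this
  have h6 : 0 ≤ l * A := by positivity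
  have h7 : 0 ≤ l⁻¹ * B := by positivity
  have h8 : 5 / 2 * B / l = 5 / 2 * (l⁻¹ * B) := by field_simp
  rw [h8]
  linarith

/-- Pointwise control of the nonlinear terms. -/
theorem nonlinear_le {p p1 q q1 : ℝ → ℝ} {A B : ℝ} (hB1 : B ≤ 1)
    (dp : ∀ t, HasDerivAt p (p1 t) t) (dq : ∀ t, HasDerivAt q (q1 t) t) (acp : LocallyAC p1)
    (acq : LocallyAC q1) {S : ℝ → ℝ} (hS : Integrable fun t => ω(t) * S t)
    (hA : ∫ t, ω(t) * S t ≤ A)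
    (hle : ∀ t, p t ^ 2 + q t ^ 2 + p1 t ^ 2 + q1 t ^ 2 + deriv p1 t ^ 2 + deriv q1 t ^ 2 ≤ S t)
    (hp : Integrable fun t => p t ^ 2) (hq : Integrable fun t => q t ^ 2)
    (hpB : ∫ t, p t ^ 2 ≤ B) (hqB : ∫ t, q t ^ 2 ≤ B) (t : ℝ) :
    ω(t) * ((p t ^ 2 + q t ^ 2) ^ 2 + (p t ^ 2 + q t ^ 2) * (p1 t ^ 2 + q1 t ^ 2) +
      (p t ^ 2 + q t ^ 2) ^ 3) ≤ 124 * A * (p t ^ 2 + q t ^ 2) := by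
  have hS0 : ∀ t, 0 ≤ S t := fun t => le_trans (by positivity) (hle t)
  have hA0 : 0 ≤ A := (integral_nonneg fun t => mul_nonneg (exp_nonneg _) (hS0 t)).trans hA
  have parts : ∀ t, (p t ^ 2 + p1 t ^ 2 ≤ S t ∧ q t ^ 2 + q1 t ^ 2 ≤ S t) ∧
      p1 t ^ 2 + deriv p1 t ^ 2 ≤ S t ∧ q1 t ^ 2 + deriv q1 t ^ 2 ≤ S t := fun t => by
    have h0 := hle t
    have h1 := sq_nonneg (p t)
    have h2 := sq_nonneg (q t)
    have h3 := sq_nonneg (p1 t)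
    have h4 := sq_nonneg (q1 t)
    have h5 := sq_nonneg (deriv p1 t)
    have h6 := sq_nonneg (deriv q1 t)
    refine ⟨⟨?_, ?_⟩, ?_, ?_⟩ <;> linarith
  have b1 := exp_mul_sq_le (locallyAC_of_hasDerivAt dp acp.continuous) (Eventually.of_forall dp) hS hA
    (fun t => (parts t).1.1) t
  have b2 := exp_mul_sq_le (locallyAC_of_hasDerivAt dq acq.continuous) (Eventually.of_forall dq) hS hA
    (fun t => (parts t).1.2) t
  have b3 := exp_mul_sq_le acp acp.ae_hasDerivAt hS hA (fun t => (parts t).2.1) t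
  have b4 := exp_mul_sq_le acq acq.ae_hasDerivAt hS hA (fun t => (parts t).2.2) t
  have b5 := exp_two_mul_sq_le dp acp.continuous hS hA (fun t => (parts t).1.1) hp hpB t
  have b6 := exp_two_mul_sq_le dq acq.continuous hS hA (fun t => (parts t).1.2) hq hqB t
  have hE2 : ω(t) = exp (-(2 * t)) ^ 2 := by
    rw [← exp_nat_mul]; congr 1; push_cast; ring
  set n := p t ^ 2 + q t ^ 2 with hn
  set n1 := p1 t ^ 2 + q1 t ^ 2 with hn1
  have hn0 : 0 ≤ n := by positivity
  have c1 : ω(t) * n ≤ 12 * A := by rw [hn, mul_add]; linarith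
  have c2 : ω(t) * n1 ≤ 12 * A := by rw [hn1, mul_add]; linarith
  have c3 : ω(t) * n ^ 2 ≤ 100 * A := by
    have hAB : 25 * A * B ≤ 25 * A := mul_le_of_le_one_right (by positivity) hB1
    rw [hE2, ← mul_pow, hn, mul_add]
    nlinarith [sq_nonneg (exp (-(2 * t)) * p t ^ 2 - exp (-(2 * t)) * q t ^ 2)]
  have e : ω(t) * (n ^ 2 + n * n1 + n ^ 3) = (ω(t) * n +
      ω(t) * n1 + ω(t) * n ^ 2) * n := by ring
  rw [e]
  exact mul_le_mul_of_nonneg_right (by linarith) hn0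

theorem inner_region {m j : ℕ} (hj : 3 ≤ (j + 1) * m) {y y' n : ℝ → ℝ} {t₁ A : ℝ}
    (hd : ∀ t, HasDerivAt y (y' t) t) (hc : Continuous y') (hcn : Continuous n) (hn0 : ∀ t, 0 ≤ n t)
    (h0 : ∀ t, 0 ≤ y t) (h1 : ∀ t, y t ≤ 1)
    (hlow : ∀ t ≤ t₁, 5 / 3 * m * y t - 2 * (n t * sqrt (y t)) ≤ y' t)
    (hi : Integrable fun t => ω(t) * n t ^ 2)
    (hA : ∫ t, ω(t) * n t ^ 2 ≤ A) :
    IntegrableOn (fun t => ω(t) * y t ^ (j + 1)) (Set.Iic t₁) ∧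
    ∫ t in Set.Iic t₁, ω(t) * y t ^ (j + 1) ≤
      2 * ω(t₁) + 4 * (j + 1) ^ 2 * A := by
  have cy := continuous_of_hasDerivAt hd
  have hj' : (3 : ℝ) ≤ (j + 1) * m := by exact_mod_cast hj
  set g : ℝ → ℝ := fun t => ω(t) * y t ^ (j + 1) with hg
  have cg : Continuous g := by fun_prop
  have hdg : ∀ t, HasDerivAt g (-(4 * ω(t)) * y t ^ (j + 1) +
      ω(t) * ((j + 1 : ℕ) * y t ^ j * y' t)) t := fun t =>
    (hasDerivAt_exp_neg_mul 4 t).fun_mul ((hd t).fun_pow (j + 1))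
  have hb : ∀ a ≤ t₁, ∫ t in a..t₁, g t ≤ 2 * ω(t₁) + 4 * (j + 1) ^ 2 * A := by
    intro a ha
    have hpt : ∀ t ∈ Set.Icc a t₁, 1 / 2 * g t - 2 * (j + 1) ^ 2 * (ω(t) * n t ^ 2) ≤
        -(4 * ω(t)) * y t ^ (j + 1) + ω(t) * ((j + 1 : ℕ) * y t ^ j * y' t) := by
      intro t ht
      have hs := sq_sqrt (h0 t)
      set σ := sqrt (y t) with hσ
      have hσ0 : 0 ≤ σ := sqrt_nonneg _
      have l1 := mul_le_mul_of_nonneg_left (hlow t ht.2) (by positivity : (0 : ℝ) ≤ (j + 1))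
      have l2 : (j + 1) * (5 / 3 * m * y t) ≥ 5 * y t := by nlinarith [h0 t]
      have l3 : 1 / 2 * y t - 2 * (j + 1) ^ 2 * n t ^ 2 ≤ (j + 1) * y' t - 4 * y t := by
        nlinarith [sq_nonneg (σ - 2 * ((j + 1) * n t))]
      have hyj : 0 ≤ y t ^ j := pow_nonneg (h0 t) j
      have hyj1 : y t ^ j ≤ 1 := pow_le_one₀ (h0 t) (h1 t)
      have l4 := mul_le_mul_of_nonneg_left l3 hyj
      have l5 : y t ^ j * (2 * (j + 1) ^ 2 * n t ^ 2) ≤ 2 * (j + 1) ^ 2 * n t ^ 2 :=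
        mul_le_of_le_one_left (by positivity) hyj1
      have l6 : 1 / 2 * y t ^ (j + 1) - 2 * (j + 1) ^ 2 * n t ^ 2 ≤
          -4 * y t ^ (j + 1) + (j + 1) * y t ^ j * y' t := by
        rw [pow_succ]; nlinarith
      have l7 := mul_le_mul_of_nonneg_left l6 (exp_pos (-(4 * t))).le
      rw [hg]; push_cast; linarith
    have ig : IntervalIntegrable g volume a t₁ := cg.intervalIntegrable _ _
    have hI := intervalIntegral.integral_mono_on ha
      ((ig.const_mul (1 / 2)).sub (hi.intervalIntegrable.const_mul (2 * ((j : ℝ) + 1) ^ 2)))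
      ((by fun_prop : Continuous fun t => -(4 * ω(t)) * y t ^ (j + 1) +
        ω(t) * ((j + 1 : ℕ) * y t ^ j * y' t)).intervalIntegrable a t₁) hpt
    rw [intervalIntegral.integral_eq_sub_of_hasDerivAt (fun t _ => hdg t)
      ((by fun_prop : Continuous fun t => -(4 * ω(t)) * y t ^ (j + 1) +
        ω(t) * ((j + 1 : ℕ) * y t ^ j * y' t)).intervalIntegrable a t₁),
      intervalIntegral.integral_sub (ig.const_mul _) (hi.intervalIntegrable.const_mul _),
      intervalIntegral.integral_const_mul, intervalIntegral.integral_const_mul] at hI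
    have g1 : g t₁ ≤ ω(t₁) :=
      mul_le_of_le_one_right (exp_nonneg _) (pow_le_one₀ (h0 _) (h1 _))
    have g0 : 0 ≤ g a := mul_nonneg (exp_nonneg _) (pow_nonneg (h0 _) _)
    have hn : ∫ t in a..t₁, ω(t) * n t ^ 2 ≤ A := by
      rw [intervalIntegral.integral_of_le ha]
      exact (setIntegral_le_integral hi (Eventually.of_forall fun t => by positivity)).trans hA
    have := mul_le_mul_of_nonneg_left hn (by positivity : (0 : ℝ) ≤ 2 * (j + 1) ^ 2)
    linarith
  have hint : IntegrableOn g (Set.Iic t₁) := by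
    refine integrableOn_Iic_of_intervalIntegral_norm_bounded (l := atBot) (a := id)
      (2 * ω(t₁) + 4 * (j + 1) ^ 2 * A) t₁
      (fun i => cg.integrableOn_Icc.mono_set Set.Ioc_subset_Icc_self) tendsto_id ?_
    filter_upwards [eventually_le_atBot t₁] with a ha
    have : ∀ t, ‖g t‖ = g t := fun t =>
      Real.norm_of_nonneg (mul_nonneg (exp_nonneg _) (pow_nonneg (h0 _) _))
    simp only [this]
    exact hb a ha
  refine ⟨hint, le_of_tendsto (intervalIntegral_tendsto_integral_Iic t₁ hint tendsto_id) ?_⟩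
  filter_upwards [eventually_le_atBot t₁] with a ha using hb a ha

theorem residual_integral {m : ℕ} (hm : 1 ≤ m) {y y' n z : ℝ → ℝ} {t₁ A : ℝ}
    (hd : ∀ t, HasDerivAt y (y' t) t) (hc : Continuous y') (hcn : Continuous n) (hn0 : ∀ t, 0 ≤ n t)
    (hcz : Continuous z) (hyz : ∀ t, y t = 1 - z t ^ 2) (h0 : ∀ t, 0 ≤ y t) (hz : ∀ t ≤ t₁, z t ≤ 0)
    (hlow : ∀ t ≤ t₁, 5 / 3 * m * y t - 2 * (n t * sqrt (y t)) ≤ y' t)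
    (hi : Integrable fun t => ω(t) * n t ^ 2)
    (hA : ∫ t, ω(t) * n t ^ 2 ≤ A) :
    Integrable (fun t => ω(t) * (y t ^ 3 + y t ^ 2 * (1 + m * z t) ^ 2)) ∧
    ∫ t, ω(t) * (y t ^ 3 + y t ^ 2 * (1 + m * z t) ^ 2) ≤
      (1 + (1 + m) ^ 2) * (3 * ω(t₁) + 36 * A) := by
  have h1 : ∀ t, y t ≤ 1 := fun t => by rw [hyz]; linarith [sq_nonneg (z t)]
  have hzb : ∀ t, |z t| ≤ 1 := fun t => by
    have := h0 t
    rw [hyz] at this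
    exact abs_le.2 ⟨by nlinarith, by nlinarith⟩
  have cy := continuous_of_hasDerivAt hd
  have hA0 : 0 ≤ A := (integral_nonneg fun t => by positivity).trans hA
  have hmz : ∀ t, (1 + m * z t) ^ 2 ≤ (1 + m) ^ 2 := fun t => by
    have := abs_le.1 (hzb t)
    have hm0 : (1 : ℝ) ≤ m := by exact_mod_cast hm
    exact sq_le_sq' (by nlinarith) (by nlinarith)
  set C : ℝ := 1 + (1 + m) ^ 2 with hC
  set G : ℝ → ℝ := fun t => ω(t) * (y t ^ 3 + y t ^ 2 * (1 + m * z t) ^ 2) with hG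
  have cG : Continuous G := by fun_prop
  have hG0 : ∀ t, 0 ≤ G t := fun t => by
    have := h0 t
    rw [hG]; positivity
  have hout : ∀ t, G t ≤ C * ω(t) := fun t => by
    rw [hG, mul_comm C]
    refine mul_le_mul_of_nonneg_left ?_ (exp_nonneg _)
    have e1 : y t ^ 3 ≤ 1 := pow_le_one₀ (h0 t) (h1 t)
    have e2 : y t ^ 2 * (1 + m * z t) ^ 2 ≤ 1 * (1 + m) ^ 2 :=
      mul_le_mul (pow_le_one₀ (h0 t) (h1 t)) (hmz t) (sq_nonneg _) zero_le_one
    rw [hC]; linarith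
  have hin : ∃ j : ℕ, j + 1 ≤ 3 ∧ 3 ≤ (j + 1) * m ∧
      ∀ t ≤ t₁, G t ≤ C * (ω(t) * y t ^ (j + 1)) := by
    rcases hm.eq_or_lt with rfl | hm2
    · refine ⟨2, le_rfl, by norm_num, fun t ht => ?_⟩
      rw [hG, mul_left_comm]
      refine mul_le_mul_of_nonneg_left ?_ (exp_nonneg _)
      have e1 : 1 + z t ≤ y t := by
        rw [hyz]; nlinarith [hz t ht, (abs_le.1 (hzb t)).1]
      have e2 : 0 ≤ 1 + z t := by linarith [(abs_le.1 (hzb t)).1]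
      have e3 : y t ^ 2 * (1 + z t) ^ 2 ≤ y t ^ 3 := by
        have : (1 + z t) ^ 2 ≤ y t := by nlinarith [h1 t]
        calc _ ≤ y t ^ 2 * y t := mul_le_mul_of_nonneg_left this (sq_nonneg _)
          _ = _ := by ring
      have := pow_nonneg (h0 t) 3
      rw [hC]; push_cast; norm_num
      linarith
    · refine ⟨1, by norm_num, by omega, fun t ht => ?_⟩
      rw [hG, mul_left_comm]
      refine mul_le_mul_of_nonneg_left ?_ (exp_nonneg _)
      have e1 : y t ^ 3 ≤ y t ^ 2 := pow_le_pow_of_le_one (h0 t) (h1 t) (by norm_num)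
      have e2 := mul_le_mul_of_nonneg_left (hmz t) (sq_nonneg (y t))
      rw [hC, show 1 + 1 = 2 from rfl, add_mul, one_mul, mul_comm (_ ^ 2) (y t ^ 2)]
      linarith
  obtain ⟨j, hj3, hjm, hin⟩ := hin
  obtain ⟨hI, hIle⟩ := inner_region hjm hd hc hcn hn0 h0 h1 hlow hi hA
  have hG1 : IntegrableOn G (Set.Iic t₁) := by
    refine (hI.const_mul C).mono' cG.aestronglyMeasurable.restrict
      ((ae_restrict_iff' measurableSet_Iic).2 (Eventually.of_forall fun t ht => ?_))
    rw [Real.norm_of_nonneg (hG0 t)]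
    exact hin t ht
  have hexp : IntegrableOn (fun t : ℝ => ω(t)) (Set.Ioi t₁) := by
    simpa [neg_mul] using integrableOn_exp_mul_Ioi (a := -4) (by norm_num) t₁
  have hexpI : ∫ t in Set.Ioi t₁, ω(t) ≤ ω(t₁) := by
    have := integral_exp_mul_Ioi (a := -4) (by norm_num) t₁
    simp only [neg_mul] at this
    rw [this, neg_div_neg_eq]
    linarith [exp_pos (-(4 * t₁))]
  have hG2 : IntegrableOn G (Set.Ioi t₁) := by
    refine (hexp.const_mul C).mono' cG.aestronglyMeasurable.restrict
      (Eventually.of_forall fun t => ?_)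
    rw [Real.norm_of_nonneg (hG0 t)]
    exact hout t
  have hGI : Integrable G := by
    rw [← integrableOn_univ, ← Set.Iic_union_Ioi (a := t₁)]
    exact hG1.union hG2
  refine ⟨hGI, ?_⟩
  rw [← intervalIntegral.integral_Iic_add_Ioi hG1 hG2]
  have b1 : ∫ t in Set.Iic t₁, G t ≤ C * (2 * ω(t₁) + 36 * A) := by
    refine (setIntegral_mono_on hG1 (hI.const_mul C) measurableSet_Iic hin).trans ?_
    rw [integral_const_mul]
    refine mul_le_mul_of_nonneg_left (hIle.trans (add_le_add_right ?_ _)) (by positivity)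
    refine mul_le_mul_of_nonneg_right ?_ hA0
    have : (j : ℝ) + 1 ≤ 3 := by exact_mod_cast hj3
    nlinarith [Nat.cast_nonneg (α := ℝ) j]
  have b2 : ∫ t in Set.Ioi t₁, G t ≤ C * ω(t₁) := by
    refine (setIntegral_mono_on hG2 (hexp.const_mul C) measurableSet_Ioi fun t _ => hout t).trans ?_
    rw [integral_const_mul]
    exact mul_le_mul_of_nonneg_left hexpI (by positivity)
  refine (add_le_add b1 b2).trans (le_of_eq ?_)
  ring

end Pointwise

/-! ### Algebraic estimate of the third-order jet -/

section ScalarBound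

theorem sq_sum_six_le (a b c d e f : ℝ) :
    (a + b + c + d + e + f) ^ 2 ≤ 6 * (a ^ 2 + b ^ 2 + c ^ 2 + d ^ 2 + e ^ 2 + f ^ 2) := by
  nlinarith [sq_nonneg (a - b), sq_nonneg (a - c), sq_nonneg (a - d), sq_nonneg (a - e), sq_nonneg (a - f),
    sq_nonneg (b - c), sq_nonneg (b - d), sq_nonneg (b - e), sq_nonneg (b - f), sq_nonneg (c - d),
    sq_nonneg (c - e), sq_nonneg (c - f), sq_nonneg (d - e), sq_nonneg (d - f), sq_nonneg (e - f)]

theorem abs_mul_le_of_nonneg {m x c : ℝ} (hm : 0 ≤ m) (h : |x| ≤ c) : |m * x| ≤ m * c := by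
  rw [abs_mul, abs_of_nonneg hm]; exact mul_le_mul_of_nonneg_left h hm

theorem le_cube {m : ℝ} (hm : 0 ≤ m) : m ≤ (1 + m) ^ 3 := by
  have h2 := pow_nonneg hm 2
  have h3 := pow_nonneg hm 3
  linarith

theorem sq_le_cube {m : ℝ} (hm : 0 ≤ m) : m ^ 2 ≤ (1 + m) ^ 3 := by
  have h2 := pow_nonneg hm 2
  have h3 := pow_nonneg hm 3
  linarith

variable {m p q k l z N s : ℝ}

theorem abs_pair_le (hk : |k| ≤ s) (hl : |l| ≤ s) (hp : |p| ≤ N) (hq : |q| ≤ N) :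
    |p * k + q * l| ≤ 2 * (N * s) := by
  have h1 := abs_mul_le_mul hp hk
  have h2 := abs_mul_le_mul hq hl
  linarith [abs_add_le (p * k) (q * l)]

/-- The tangential components. -/
theorem tangential_le (hm : 1 ≤ m) (hs0 : 0 ≤ s) (hs : s ≤ 1) (hz : |z| ≤ 1) (hk : |k| ≤ s) (hl : |l| ≤ s)
    (hp : |p| ≤ N) (hq : |q| ≤ N) (hN : p ^ 2 + q ^ 2 = N ^ 2) {p1 p2 N1 : ℝ} (hp1 : |p1| ≤ N1) :
    |p2 - m * ((p * k + q * l + m * s ^ 2) * p + z * p1) -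
      (p ^ 2 + q ^ 2 + 2 * m * (p * k + q * l) + 2 * m ^ 2 * s ^ 2) * (p + m * k) - 2 * (p1 - m * z * p)| ≤
    10 * (1 + m) ^ 3 * (|p2| + N + N1 + N ^ 2 + N ^ 3 + s ^ 3) := by
  have hm0 : 0 ≤ m := by linarith
  have hN0 : 0 ≤ N := (abs_nonneg _).trans hp
  have hN10 : 0 ≤ N1 := (abs_nonneg _).trans hp1
  have hF := abs_pair_le hk hl hp hq
  set F := p * k + q * l with hFd
  have hz' : |F + m * s ^ 2| ≤ 2 * (N * s) + m * s ^ 2 := by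
    have := abs_add_le F (m * s ^ 2)
    rw [abs_of_nonneg (by positivity : 0 ≤ m * s ^ 2)] at this
    linarith
  have hB : |p ^ 2 + q ^ 2 + 2 * m * F + 2 * m ^ 2 * s ^ 2| ≤ N ^ 2 + 4 * m * (N * s) + 2 * m ^ 2 * s ^ 2 := by
    have h1 := abs_mul_le_of_nonneg (by positivity : 0 ≤ 2 * m) hF
    have h2 := abs_add_le (p ^ 2 + q ^ 2 + 2 * m * F) (2 * m ^ 2 * s ^ 2)
    have h3 := abs_add_le (p ^ 2 + q ^ 2) (2 * m * F)
    rw [hN, abs_of_nonneg (sq_nonneg N)] at h3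
    rw [hN, abs_of_nonneg (by positivity : 0 ≤ 2 * m ^ 2 * s ^ 2)] at h2
    rw [hN]
    linarith
  have ha : |p + m * k| ≤ N + m * s := by
    have := abs_mul_le_of_nonneg hm0 hk
    linarith [abs_add_le p (m * k)]
  have t1 := abs_mul_le_of_nonneg hm0 (abs_mul_le_mul hz' hp)
  have t2 := abs_mul_le_of_nonneg hm0 (abs_mul_le_mul hz hp1)
  have t3 := abs_mul_le_mul hB ha
  have t4 := abs_mul_le_of_nonneg hm0 (abs_mul_le_mul hz hp)
  set B := p ^ 2 + q ^ 2 + 2 * m * F + 2 * m ^ 2 * s ^ 2 with hBd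
  have split : |p2 - m * ((F + m * s ^ 2) * p + z * p1) - B * (p + m * k) - 2 * (p1 - m * z * p)| ≤
      |p2| + m * ((2 * (N * s) + m * s ^ 2) * N) + m * (1 * N1) +
        (N ^ 2 + 4 * m * (N * s) + 2 * m ^ 2 * s ^ 2) * (N + m * s) + 2 * N1 + 2 * (m * (1 * N)) := by
    rw [abs_le]
    have a0 := abs_le.1 (le_refl |p2|)
    have a1 := abs_le.1 t1
    have a2 := abs_le.1 t2
    have a3 := abs_le.1 t3
    have a4 := abs_le.1 t4
    have a5 := abs_le.1 hp1
    constructor <;> linarith [a0.1, a0.2, a1.1, a1.2, a2.1, a2.2, a3.1, a3.2, a4.1, a4.2, a5.1, a5.2]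
  refine split.trans ?_
  have e1 : N * s ≤ N := mul_le_of_le_one_right hN0 hs
  have e2 : s ^ 2 ≤ 1 := pow_le_one₀ hs0 hs
  have e3 : N ^ 2 * s ≤ N ^ 2 := mul_le_of_le_one_right (sq_nonneg N) hs
  have e4 : N * s ^ 2 ≤ N := mul_le_of_le_one_right hN0 e2
  have expand : |p2| + m * ((2 * (N * s) + m * s ^ 2) * N) + m * (1 * N1) +
        (N ^ 2 + 4 * m * (N * s) + 2 * m ^ 2 * s ^ 2) * (N + m * s) + 2 * N1 + 2 * (m * (1 * N)) =
      |p2| + 7 * m * (N ^ 2 * s) + 7 * m ^ 2 * (N * s ^ 2) + (m + 2) * N1 + N ^ 3 +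
        2 * m ^ 3 * s ^ 3 + 2 * m * N := by ring
  rw [expand]
  have c3 := sq_le_cube hm0
  have c2 := le_cube hm0
  have c1 : 1 ≤ (1 + m) ^ 3 := one_le_pow₀ (by linarith)
  have c4 : m ^ 3 ≤ (1 + m) ^ 3 := pow_le_pow_left₀ hm0 (by linarith) 3
  set D := (1 + m) ^ 3
  have f0 := mul_le_mul_of_nonneg_right (by linarith : 1 ≤ 10 * D) (abs_nonneg p2)
  have f1 := mul_le_mul_of_nonneg_left e3 (by positivity : 0 ≤ 7 * m)
  have f1' := mul_le_mul_of_nonneg_right (by linarith : 7 * m ≤ 10 * D) (sq_nonneg N)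
  have f2 := mul_le_mul_of_nonneg_left e4 (by positivity : 0 ≤ 7 * m ^ 2)
  have f2' := mul_le_mul_of_nonneg_right (by linarith : 7 * m ^ 2 + 2 * m ≤ 10 * D) hN0
  have f3 := mul_le_mul_of_nonneg_right (by linarith : m + 2 ≤ 10 * D) hN10
  have f4 := mul_le_mul_of_nonneg_right (by linarith : 1 ≤ 10 * D) (pow_nonneg hN0 3)
  have f5 := mul_le_mul_of_nonneg_right (by linarith : 2 * m ^ 3 ≤ 10 * D) (pow_nonneg hs0 3)
  linarith

/-- The normal component, in which the leading terms combine to a multiple of `y (1 + m z)`. -/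
theorem normal_le (hm : 1 ≤ m) (hs : s ≤ 1) (hz : |z| ≤ 1) (hk : |k| ≤ s) (hl : |l| ≤ s)
    (hp : |p| ≤ N) (hq : |q| ≤ N) (hN : p ^ 2 + q ^ 2 = N ^ 2) {p1 q1 N1 y : ℝ} (hp1 : |p1| ≤ N1)
    (hq1 : |q1| ≤ N1) :
    |(2 * (p * p1 + q * q1) + 2 * m * (p1 * k + q1 * l - z * (p * (p + m * k) + q * (q + m * l))) +
        2 * m ^ 2 * (-(2 * z * (p * k + q * l + m * y)))) + (p + m * k) * (p1 - m * z * p) +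
        (q + m * l) * (q1 - m * z * q) - 2 * (p ^ 2 + q ^ 2 + 2 * m * (p * k + q * l) + 2 * m ^ 2 * y)| ≤
    22 * (1 + m) ^ 3 * (N * N1 + N1 + N ^ 2 + N + |y * (1 + m * z)|) := by
  have hm0 : 0 ≤ m := by linarith
  have hN0 : 0 ≤ N := (abs_nonneg _).trans hp
  have hN10 : 0 ≤ N1 := (abs_nonneg _).trans hp1
  have hk1 := hk.trans hs
  have hl1 := hl.trans hs
  have hF : |p * k + q * l| ≤ 2 * (N * 1) := abs_pair_le hk1 hl1 hp hq
  have hG : |p1 * k + q1 * l| ≤ 2 * (N1 * 1) := abs_pair_le hk1 hl1 hp1 hq1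
  have hPP : |p * p1 + q * q1| ≤ 2 * (N * N1) := by
    have h1 := abs_mul_le_mul hp hp1
    have h2 := abs_mul_le_mul hq hq1
    linarith [abs_add_le (p * p1) (q * q1)]
  have t1 := abs_mul_le_of_nonneg (by positivity : 0 ≤ m) hG
  have t2 : |z * N ^ 2| ≤ 1 * N ^ 2 := abs_mul_le_mul hz (by rw [abs_of_nonneg (sq_nonneg N)])
  have t2' := abs_mul_le_of_nonneg hm0 t2
  have t3 := abs_mul_le_of_nonneg (sq_nonneg m) (abs_mul_le_mul hz hF)
  have t4 := abs_mul_le_of_nonneg hm0 hF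
  have t5 := abs_mul_le_of_nonneg (sq_nonneg m) (le_refl |y * (1 + m * z)|)
  have e : (2 * (p * p1 + q * q1) + 2 * m * (p1 * k + q1 * l - z * (p * (p + m * k) + q * (q + m * l))) +
        2 * m ^ 2 * (-(2 * z * (p * k + q * l + m * y)))) + (p + m * k) * (p1 - m * z * p) +
        (q + m * l) * (q1 - m * z * q) - 2 * (p ^ 2 + q ^ 2 + 2 * m * (p * k + q * l) + 2 * m ^ 2 * y) =
      3 * (p * p1 + q * q1) + 3 * (m * (p1 * k + q1 * l)) - 3 * (m * (z * N ^ 2)) -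
        7 * (m ^ 2 * (z * (p * k + q * l))) - 2 * N ^ 2 - 4 * (m * (p * k + q * l)) -
        4 * (m ^ 2 * (y * (1 + m * z))) := by
    rw [← hN]; ring
  rw [e]
  have split : |3 * (p * p1 + q * q1) + 3 * (m * (p1 * k + q1 * l)) - 3 * (m * (z * N ^ 2)) -
        7 * (m ^ 2 * (z * (p * k + q * l))) - 2 * N ^ 2 - 4 * (m * (p * k + q * l)) -
        4 * (m ^ 2 * (y * (1 + m * z)))| ≤ 6 * (N * N1) + 6 * m * N1 + (3 * m + 2) * N ^ 2 +
        (14 * m ^ 2 + 8 * m) * N + 4 * m ^ 2 * |y * (1 + m * z)| := by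
    rw [abs_le]
    have a0 := abs_le.1 hPP
    have a1 := abs_le.1 t1
    have a2 := abs_le.1 t2'
    have a3 := abs_le.1 t3
    have a4 := abs_le.1 t4
    have a5 := abs_le.1 t5
    have a6 := sq_nonneg N
    constructor <;> linarith [a0.1, a0.2, a1.1, a1.2, a2.1, a2.2, a3.1, a3.2, a4.1, a4.2, a5.1, a5.2]
  refine split.trans ?_
  have c3 := sq_le_cube hm0
  have c2 := le_cube hm0
  have c1 : 1 ≤ (1 + m) ^ 3 := one_le_pow₀ (by linarith)
  set D := (1 + m) ^ 3
  have f0 := mul_le_mul_of_nonneg_right (by linarith : 6 ≤ 22 * D) (mul_nonneg hN0 hN10)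
  have f1 := mul_le_mul_of_nonneg_right (by linarith : 6 * m ≤ 22 * D) hN10
  have f2 := mul_le_mul_of_nonneg_right (by linarith : 3 * m + 2 ≤ 22 * D) (sq_nonneg N)
  have f3 := mul_le_mul_of_nonneg_right (by linarith : 14 * m ^ 2 + 8 * m ≤ 22 * D) hN0
  have f4 := mul_le_mul_of_nonneg_right (by linarith : 4 * m ^ 2 ≤ 22 * D) (abs_nonneg (y * (1 + m * z)))
  linarith

/-- The error terms that control the third-order jet. -/
def jetMajorant (m p q p1 q1 p2 q2 z : ℝ) : ℝ :=
  (p ^ 2 + q ^ 2 + p1 ^ 2 + q1 ^ 2 + p2 ^ 2 + q2 ^ 2) +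
    ((p ^ 2 + q ^ 2) ^ 2 + (p ^ 2 + q ^ 2) * (p1 ^ 2 + q1 ^ 2) + (p ^ 2 + q ^ 2) ^ 3) +
    ((1 - z ^ 2) ^ 3 + (1 - z ^ 2) ^ 2 * (1 + m * z) ^ 2)

theorem abs_mul_sub_le (hm : 1 ≤ m) (hz : |z| ≤ 1) (hp : |p| ≤ N) {p1 N1 : ℝ} (hp1 : |p1| ≤ N1) :
    |m * (p1 - m * z * p)| ≤ (1 + m) ^ 3 * (N1 + N) := by
  have hm0 : 0 ≤ m := by linarith
  have hN0 : 0 ≤ N := (abs_nonneg _).trans hp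
  have hN10 : 0 ≤ N1 := (abs_nonneg _).trans hp1
  have c3 := sq_le_cube hm0
  have c2 := le_cube hm0
  have hX' : |p1 - m * z * p| ≤ N1 + m * N := by
    have := abs_mul_le_of_nonneg hm0 (abs_mul_le_mul hz hp)
    rw [← mul_assoc] at this
    linarith [abs_sub p1 (m * z * p)]
  refine (abs_mul_le_of_nonneg hm0 hX').trans ?_
  have a1 := mul_le_mul_of_nonneg_right c2 hN10
  have a2 := mul_le_mul_of_nonneg_right c3 hN0
  linarith

theorem abs_mul_density_le (hm : 1 ≤ m) (hs0 : 0 ≤ s) (hs : s ≤ 1) (hk : |k| ≤ s) (hl : |l| ≤ s)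
    (hp : |p| ≤ N) (hq : |q| ≤ N) (hN : p ^ 2 + q ^ 2 = N ^ 2) :
    |m * ((p ^ 2 + q ^ 2 + 2 * m * (p * k + q * l) + 2 * m ^ 2 * s ^ 2) * s)| ≤
      (1 + m) ^ 3 * (N ^ 2 + 4 * N + 2 * s ^ 3) := by
  have hm0 : 0 ≤ m := by linarith
  have hN0 : 0 ≤ N := (abs_nonneg _).trans hp
  have n2 := sq_nonneg N
  have hF := abs_pair_le hk hl hp hq
  have hB' : |p ^ 2 + q ^ 2 + 2 * m * (p * k + q * l) + 2 * m ^ 2 * s ^ 2| ≤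
      N ^ 2 + 4 * m * (N * s) + 2 * m ^ 2 * s ^ 2 := by
    have h1 := abs_mul_le_of_nonneg (by positivity : 0 ≤ 2 * m) hF
    rw [hN]
    refine (abs_add_three _ _ _).trans ?_
    rw [abs_of_nonneg n2, abs_of_nonneg (by positivity : 0 ≤ 2 * m ^ 2 * s ^ 2)]
    linarith
  refine (abs_mul_le_of_nonneg hm0 (abs_mul_le_mul hB' (le_of_eq (abs_of_nonneg hs0)))).trans ?_
  have b1 : N ^ 2 * s ≤ N ^ 2 := mul_le_of_le_one_right n2 hs
  have b2 : N * s ^ 2 ≤ N := mul_le_of_le_one_right hN0 (pow_le_one₀ hs0 hs)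
  have c3 := sq_le_cube hm0
  have c2 := le_cube hm0
  have c4 : m ^ 3 ≤ (1 + m) ^ 3 := pow_le_pow_left₀ hm0 (by linarith) 3
  set D := (1 + m) ^ 3
  have a1 := mul_le_mul c2 b1 (by positivity) (by linarith)
  have a2 := mul_le_mul c3 b2 (by positivity) (by linarith [sq_nonneg m])
  have a3 := mul_le_mul_of_nonneg_right c4 (pow_nonneg hs0 3)
  linarith

theorem sq_six_le {N1 p2 M r : ℝ} (h : N ^ 2 + N1 ^ 2 + p2 ^ 2 + N ^ 4 + N ^ 6 + s ^ 6 ≤ M)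
    (hr : |r| ≤ 10 * m * (|p2| + N + N1 + N ^ 2 + N ^ 3 + s ^ 3)) : r ^ 2 ≤ 600 * (m ^ 2 * M) := by
  have h1 := sq_sum_six_le |p2| N N1 (N ^ 2) (N ^ 3) (s ^ 3)
  rw [sq_abs] at h1
  have h2 : (|p2| + N + N1 + N ^ 2 + N ^ 3 + s ^ 3) ^ 2 ≤ 6 * M := by
    refine h1.trans ?_
    have e : (N ^ 2) ^ 2 = N ^ 4 ∧ (N ^ 3) ^ 2 = N ^ 6 ∧ (s ^ 3) ^ 2 = s ^ 6 :=
      ⟨by ring, by ring, by ring⟩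
    rw [e.1, e.2.1, e.2.2]
    linarith
  have h3 : r ^ 2 ≤ (10 * m * (|p2| + N + N1 + N ^ 2 + N ^ 3 + s ^ 3)) ^ 2 :=
    sq_le_sq' (abs_le.1 hr).1 (abs_le.1 hr).2
  have h4 := mul_le_mul_of_nonneg_left h2 (sq_nonneg m)
  rw [mul_pow] at h3
  linarith

theorem sq_five_le {N1 w M r : ℝ} (h : N ^ 2 + N1 ^ 2 + N ^ 2 * N1 ^ 2 + N ^ 4 + w ^ 2 ≤ M)
    (hr : |r| ≤ 22 * m * (N * N1 + N1 + N ^ 2 + N + |w|)) : r ^ 2 ≤ 2904 * (m ^ 2 * M) := by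
  have h1 := sq_sum_six_le (N * N1) N1 (N ^ 2) N |w| 0
  rw [sq_abs, add_zero] at h1
  have h2 : (N * N1 + N1 + N ^ 2 + N + |w|) ^ 2 ≤ 6 * M := by
    refine h1.trans ?_
    have e : (N ^ 2) ^ 2 = N ^ 4 := by ring
    rw [e, mul_pow]
    linarith
  have h3 : r ^ 2 ≤ (22 * m * (N * N1 + N1 + N ^ 2 + N + |w|)) ^ 2 :=
    sq_le_sq' (abs_le.1 hr).1 (abs_le.1 hr).2
  have h4 := mul_le_mul_of_nonneg_left h2 (sq_nonneg m)
  rw [mul_pow] at h3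
  linarith

theorem sq_two_le {N1 M r : ℝ} (h : N ^ 2 + N1 ^ 2 ≤ M) (hr : |r| ≤ m * (N1 + N)) :
    r ^ 2 ≤ 2 * (m ^ 2 * M) := by
  have h3 : r ^ 2 ≤ (m * (N1 + N)) ^ 2 := sq_le_sq' (abs_le.1 hr).1 (abs_le.1 hr).2
  have h4 := mul_le_mul_of_nonneg_left h (sq_nonneg m)
  have h5 := mul_nonneg (sq_nonneg m) (sq_nonneg (N1 - N))
  linarith

theorem sq_three_le {M r : ℝ} (h : N ^ 2 + N ^ 4 + s ^ 6 ≤ M)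
    (hr : |r| ≤ m * (N ^ 2 + 4 * N + 2 * s ^ 3)) :
    r ^ 2 ≤ 96 * (m ^ 2 * M) := by
  have h3 : r ^ 2 ≤ (m * (N ^ 2 + 4 * N + 2 * s ^ 3)) ^ 2 := sq_le_sq' (abs_le.1 hr).1 (abs_le.1 hr).2
  have h1 := sq_sum_six_le (N ^ 2) (4 * N) (2 * s ^ 3) 0 0 0
  have h2 : (N ^ 2 + 4 * N + 2 * s ^ 3) ^ 2 ≤ 96 * M := by
    have e3 : N ^ 2 + 4 * N + 2 * s ^ 3 + 0 + 0 + 0 = N ^ 2 + 4 * N + 2 * s ^ 3 := by ring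
    have e4 : (s ^ 3) ^ 2 = s ^ 6 := by ring
    have p4 : 0 ≤ N ^ 4 := by positivity
    have p6 : 0 ≤ (s ^ 3) ^ 2 := by positivity
    rw [e3] at h1
    refine h1.trans ?_
    rw [← e4] at h
    linarith
  have h4 := mul_le_mul_of_nonneg_left h2 (sq_nonneg m)
  rw [mul_pow] at h3
  linarith

theorem jet_combine {N1 p2 q2 w y D M X Y B T₁ T₂ T₃ : ℝ} (hs2 : s ^ 2 = y) (hy0 : 0 ≤ y) 
    (hMd : M = (N ^ 2 + N1 ^ 2 + p2 ^ 2 + q2 ^ 2) + (N ^ 4 + N ^ 2 * N1 ^ 2 + N ^ 6) + (y ^ 3 + w ^ 2))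
    (g1 : |T₁| ≤ 10 * D * (|p2| + N + N1 + N ^ 2 + N ^ 3 + s ^ 3))
    (g2 : |T₂| ≤ 10 * D * (|q2| + N + N1 + N ^ 2 + N ^ 3 + s ^ 3))
    (g3 : |T₃| ≤ 22 * D * (N * N1 + N1 + N ^ 2 + N + |w|))
    (x1 : |m * X| ≤ D * (N1 + N)) (x2 : |m * Y| ≤ D * (N1 + N))
    (x3 : |m * (B * s)| ≤ D * (N ^ 2 + 4 * N + 2 * s ^ 3)) :
    T₁ ^ 2 + T₂ ^ 2 + T₃ ^ 2 + m ^ 2 * (3 * (X ^ 2 + Y ^ 2 + B ^ 2 * y)) ≤ 10000 * (D ^ 2 * M) := by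
  have hs6 : s ^ 6 = y ^ 3 := by rw [← hs2]; ring
  have n4 : 0 ≤ N ^ 4 := by positivity
  have n6 : 0 ≤ N ^ 6 := by positivity
  have n2 : 0 ≤ N ^ 2 := by positivity
  have n12 : 0 ≤ N1 ^ 2 := by positivity
  have nm : 0 ≤ N ^ 2 * N1 ^ 2 := by positivity
  have y3 : 0 ≤ y ^ 3 := by positivity
  have yz : 0 ≤ w ^ 2 := sq_nonneg _
  have pp : 0 ≤ p2 ^ 2 := sq_nonneg _
  have qq : 0 ≤ q2 ^ 2 := sq_nonneg _
  have w1 := sq_six_le (M := M) (by rw [hs6]; linarith) g1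
  have w2 := sq_six_le (M := M) (by rw [hs6]; linarith) g2
  have w3 := sq_five_le (M := M) (by linarith) g3
  have w4 := sq_two_le (M := M) (by linarith) x1
  have w5 := sq_two_le (M := M) (by linarith) x2
  have w6 := sq_three_le (M := M) (by rw [hs6]; linarith) x3
  have eL : m ^ 2 * (3 * (X ^ 2 + Y ^ 2 + B ^ 2 * y)) = 3 * ((m * X) ^ 2 + (m * Y) ^ 2 + (m * (B * s)) ^ 2) := by
    rw [← hs2]; ring
  rw [eL]
  have hDM : 0 ≤ D ^ 2 * M := mul_nonneg (sq_nonneg _) (by linarith)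
  linarith

set_option maxHeartbeats 1000000 in
theorem jet_le (hm : 1 ≤ m) (hk : k ^ 2 + l ^ 2 + z ^ 2 = 1) {p1 q1 p2 q2 X Y B y T₁ T₂ T₃ : ℝ}
    (hy : y = 1 - z ^ 2) (hX : X = p1 - m * z * p) (hY : Y = q1 - m * z * q)
    (hB : B = p ^ 2 + q ^ 2 + 2 * m * (p * k + q * l) + 2 * m ^ 2 * y)
    (hT₁ : T₁ = p2 - m * ((p * k + q * l + m * y) * p + z * p1) - B * (p + m * k) - 2 * X)
    (hT₂ : T₂ = q2 - m * ((p * k + q * l + m * y) * q + z * q1) - B * (q + m * l) - 2 * Y)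
    (hT₃ : T₃ = (2 * (p * p1 + q * q1) + 2 * m * (p1 * k + q1 * l - z * (p * (p + m * k) + q * (q + m * l))) +
        2 * m ^ 2 * (-(2 * z * (p * k + q * l + m * y)))) + (p + m * k) * X + (q + m * l) * Y - 2 * B) :
    T₁ ^ 2 + T₂ ^ 2 + T₃ ^ 2 + m ^ 2 * (3 * (X ^ 2 + Y ^ 2 + B ^ 2 * y)) ≤
      10000 * (1 + m) ^ 6 * jetMajorant m p q p1 q1 p2 q2 z := by
  have hm0 : 0 ≤ m := by linarith
  have hy0 : 0 ≤ y := by rw [hy]; linarith [sq_nonneg k, sq_nonneg l]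
  have hy1 : y ≤ 1 := by rw [hy]; linarith [sq_nonneg z]
  have hky : k ^ 2 + l ^ 2 = y := by rw [hy]; linarith
  set s := sqrt y with hs
  set N := sqrt (p ^ 2 + q ^ 2) with hN
  set N1 := sqrt (p1 ^ 2 + q1 ^ 2) with hN1
  have hs0 : 0 ≤ s := sqrt_nonneg _
  have hN0 : 0 ≤ N := sqrt_nonneg _
  have hN10 : 0 ≤ N1 := sqrt_nonneg _
  have hs2 : s ^ 2 = y := sq_sqrt hy0
  have hN2 : N ^ 2 = p ^ 2 + q ^ 2 := sq_sqrt (by positivity)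
  have hN12 : N1 ^ 2 = p1 ^ 2 + q1 ^ 2 := sq_sqrt (by positivity)
  have ab : ∀ a c : ℝ, 0 ≤ c → a ^ 2 ≤ c ^ 2 → |a| ≤ c := fun a c hc h => abs_le_of_sq_le_sq h hc
  have hs1 : s ≤ 1 := (sq_le_one_iff₀ hs0).1 (by rw [hs2]; exact hy1)
  have hz1 : |z| ≤ 1 := ab _ _ zero_le_one (by linarith [sq_nonneg k, sq_nonneg l])
  have hk1 : |k| ≤ s := ab _ _ hs0 (by linarith [sq_nonneg l])
  have hl1 : |l| ≤ s := ab _ _ hs0 (by linarith [sq_nonneg k])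
  have hp : |p| ≤ N := ab _ _ hN0 (by linarith [sq_nonneg q])
  have hq : |q| ≤ N := ab _ _ hN0 (by linarith [sq_nonneg p])
  have hp1 : |p1| ≤ N1 := ab _ _ hN10 (by linarith [sq_nonneg q1])
  have hq1 : |q1| ≤ N1 := ab _ _ hN10 (by linarith [sq_nonneg p1])
  have g1 := tangential_le (p2 := p2) hm hs0 hs1 hz1 hk1 hl1 hp hq hN2.symm hp1
  have g2 := tangential_le (p2 := q2) hm hs0 hs1 hz1 hl1 hk1 hq hp (by rw [hN2]; ring) hq1
  have g3 := normal_le (y := y) hm hs1 hz1 hk1 hl1 hp hq hN2.symm hp1 hq1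
  have e1 : T₁ = p2 - m * ((p * k + q * l + m * s ^ 2) * p + z * p1) -
      (p ^ 2 + q ^ 2 + 2 * m * (p * k + q * l) + 2 * m ^ 2 * s ^ 2) * (p + m * k) - 2 * (p1 - m * z * p) := by
    rw [hT₁, hB, hX, hs2]
  have e2 : T₂ = q2 - m * ((q * l + p * k + m * s ^ 2) * q + z * q1) -
      (q ^ 2 + p ^ 2 + 2 * m * (q * l + p * k) + 2 * m ^ 2 * s ^ 2) * (q + m * l) - 2 * (q1 - m * z * q) := by
    rw [hT₂, hB, hY, hs2]; ring
  rw [hX, hY, hB] at hT₃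
  rw [← e1] at g1
  rw [← e2] at g2
  rw [← hT₃] at g3
  set D := (1 + m) ^ 3 with hD
  have hD6 : (1 + m) ^ 6 = D ^ 2 := by rw [hD]; ring
  have x1 := abs_mul_sub_le hm hz1 hp hp1
  have x2 := abs_mul_sub_le hm hz1 hq hq1
  have x3 := abs_mul_density_le hm hs0 hs1 hk1 hl1 hp hq hN2.symm
  rw [hs2, ← hB] at x3
  rw [← hX] at x1
  rw [← hY] at x2
  rw [← hD] at x1 x2 x3
  have hMd : jetMajorant m p q p1 q1 p2 q2 z = (N ^ 2 + N1 ^ 2 + p2 ^ 2 + q2 ^ 2) +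
      (N ^ 4 + N ^ 2 * N1 ^ 2 + N ^ 6) + (y ^ 3 + (y * (1 + m * z)) ^ 2) := by
    rw [jetMajorant, hN12, show N ^ 4 = (N ^ 2) ^ 2 by ring, show N ^ 6 = (N ^ 2) ^ 3 by ring, hN2, hy]
    ring
  rw [hD6, mul_assoc]
  exact jet_combine hs2 hy0 hMd g1 g2 g3 x1 x2 x3

end ScalarBound

/-! ### Third derivatives in a parallel frame -/

section FrameAlgebra

variable {v e w : Space}

theorem cross_apply (a b : Space) :
    cross a b = !₂[a 1 * b 2 - a 2 * b 1, a 2 * b 0 - a 0 * b 2, a 0 * b 1 - a 1 * b 0] := by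
  ext i
  fin_cases i <;> simp [cross, crossProduct]

theorem cross_zero_apply (a b : Space) : cross a b 0 = a 1 * b 2 - a 2 * b 1 := by simp [cross_apply]
theorem cross_one_apply (a b : Space) : cross a b 1 = a 2 * b 0 - a 0 * b 2 := by simp [cross_apply]
theorem cross_two_apply (a b : Space) : cross a b 2 = a 0 * b 1 - a 1 * b 0 := by simp [cross_apply]

theorem inner_cross_left (a b : Space) : inner ℝ (cross a b) a = 0 := by
  rw [inner_space, cross_zero_apply, cross_one_apply, cross_two_apply]; ring

theorem inner_cross_right (a b : Space) : inner ℝ (cross a b) b = 0 := by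
  rw [inner_space, cross_zero_apply, cross_one_apply, cross_two_apply]; ring

theorem gram_identity {v0 v1 v2 e0 e1 e2 w0 w1 w2 : ℝ} (hv : v0 ^ 2 + v1 ^ 2 + v2 ^ 2 = 1)
    (he : e0 ^ 2 + e1 ^ 2 + e2 ^ 2 = 1) (ho : e0 * v0 + e1 * v1 + e2 * v2 = 0)
    (hw : w0 * v0 + w1 * v1 + w2 * v2 = 0) :
    w0 = (w0 * e0 + w1 * e1 + w2 * e2) * e0 +
      (w0 * (v1 * e2 - v2 * e1) + w1 * (v2 * e0 - v0 * e2) + w2 * (v0 * e1 - v1 * e0)) * (v1 * e2 - v2 * e1) := by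
  linear_combination (-w0 * (e0 ^ 2 + e1 ^ 2 + e2 ^ 2) + e0 * (w0 * e0 + w1 * e1 + w2 * e2)) * hv - w0 * he +
    (w0 * (e0 * v0 + e1 * v1 + e2 * v2) - v0 * (w0 * e0 + w1 * e1 + w2 * e2)
      - e0 * (w0 * v0 + w1 * v1 + w2 * v2)) * ho + (e0 ^ 2 + e1 ^ 2 + e2 ^ 2) * v0 * hw

theorem norm_sq_cross (hv : ‖v‖ = 1) (he : ‖e‖ = 1) (ho : inner ℝ e v = 0) : ‖cross v e‖ ^ 2 = 1 := by
  have h1 := norm_sq_space v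
  have h2 := norm_sq_space e
  rw [hv, one_pow] at h1
  rw [he, one_pow] at h2
  rw [inner_space] at ho
  rw [norm_sq_space, cross_zero_apply, cross_one_apply, cross_two_apply]
  linear_combination -(e 0 ^ 2 + e 1 ^ 2 + e 2 ^ 2) * h1 - h2 - (e 0 * v 0 + e 1 * v 1 + e 2 * v 2) * ho

theorem eq_frame (hv : ‖v‖ = 1) (he : ‖e‖ = 1) (ho : inner ℝ e v = 0) (hw : inner ℝ w v = 0) :
    w = inner ℝ w e • e + inner ℝ w (cross v e) • cross v e := by
  have h1 := norm_sq_space v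
  have h2 := norm_sq_space e
  rw [hv, one_pow] at h1
  rw [he, one_pow] at h2
  rw [inner_space] at ho hw
  ext i
  simp only [PiLp.add_apply, PiLp.smul_apply, smul_eq_mul, inner_space w, cross_zero_apply, cross_one_apply,
    cross_two_apply]
  fin_cases i
  · simp only [Fin.zero_eta, cross_zero_apply]
    exact gram_identity h1.symm h2.symm ho hw
  · simp only [Fin.mk_one, cross_one_apply]
    have := gram_identity (v0 := v 1) (v1 := v 2) (v2 := v 0) (e0 := e 1) (e1 := e 2) (e2 := e 0) (w0 := w 1)
      (w1 := w 2) (w2 := w 0) (by linarith) (by linarith) (by linarith) (by linarith)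
    linear_combination this
  · simp only [Fin.reduceFinMk, cross_two_apply]
    have := gram_identity (v0 := v 2) (v1 := v 0) (v2 := v 1) (e0 := e 2) (e1 := e 0) (e2 := e 1) (w0 := w 2)
      (w1 := w 0) (w2 := w 1) (by linarith) (by linarith) (by linarith) (by linarith)
    linear_combination this

theorem cross_cross_self (hv : ‖e‖ = 1) (ho : inner ℝ e v = 0) : cross (cross v e) e = -v := by
  have h2 := norm_sq_space e
  rw [hv, one_pow] at h2
  rw [inner_space] at ho
  ext i
  fin_cases i <;> simp only [Fin.zero_eta, Fin.mk_one, Fin.reduceFinMk, PiLp.neg_apply, cross_zero_apply,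
    cross_one_apply, cross_two_apply]
  · linear_combination e 0 * ho + v 0 * h2
  · linear_combination e 1 * ho + v 1 * h2
  · linear_combination e 2 * ho + v 2 * h2

theorem norm_sq_comb (hv : ‖v‖ = 1) (he : ‖e‖ = 1) (ho : inner ℝ e v = 0) (a b c : ℝ) :
    ‖a • e + b • cross v e + c • v‖ ^ 2 = a ^ 2 + b ^ 2 + c ^ 2 := by
  have hf := norm_sq_cross hv he ho
  have h1 := inner_cross_left v e
  have h2 := inner_cross_right v e
  generalize cross v e = f at *
  rw [norm_add_sq_real, norm_add_sq_real, norm_smul, norm_smul, norm_smul, hv, he, mul_pow ‖b‖, hf]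
  simp only [inner_add_left, real_inner_smul_left, real_inner_smul_right, ho, h1, real_inner_comm f e, h2,
    Real.norm_eq_abs, mul_one, sq_abs]
  ring

theorem inner_northPole (w : Space) : inner ℝ northPole w = w 2 := by
  rw [inner_space]; simp [northPole]

theorem northPole_frame (hv : ‖v‖ = 1) (he : ‖e‖ = 1) (ho : inner ℝ e v = 0) :
    northPole = e 2 • e + cross v e 2 • cross v e + v 2 • v := by
  have hvv : inner ℝ v v = (1 : ℝ) := by rw [real_inner_self_eq_norm_sq, hv, one_pow]
  have h := eq_frame (w := northPole - v 2 • v) hv he ho (by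
    rw [inner_sub_left, inner_northPole, real_inner_smul_left, hvv]; ring)
  rw [inner_sub_left, inner_sub_left, inner_northPole, inner_northPole, real_inner_smul_left,
    real_inner_smul_left, real_inner_comm, ho, real_inner_comm, inner_cross_left, mul_zero, sub_zero,
    sub_zero] at h
  rw [← h]
  abel

theorem sq_third_coord (hv : ‖v‖ = 1) (he : ‖e‖ = 1) (ho : inner ℝ e v = 0) :
    e 2 ^ 2 + cross v e 2 ^ 2 + v 2 ^ 2 = 1 := by
  rw [← norm_sq_comb hv he ho, ← northPole_frame hv he ho, norm_northPole, one_pow]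

theorem rotGen_rotGen (y : Space) : rotGen (rotGen y) = y 2 • northPole - y := by
  ext i
  fin_cases i <;> simp [rotGen, northPole]

theorem norm_rotGen_comb_le (hv : ‖v‖ = 1) (he : ‖e‖ = 1) (ho : inner ℝ e v = 0) (a b c : ℝ) :
    ‖rotGen (a • e + b • cross v e + c • v)‖ ^ 2 ≤ 3 * (a ^ 2 + b ^ 2 + c ^ 2 * (1 - v 2 ^ 2)) := by
  have hf := norm_sq_cross hv he ho
  have hf1 : ‖cross v e‖ = 1 := by
    have := norm_nonneg (cross v e)
    nlinarith
  have hr : ‖rotGen v‖ ^ 2 = 1 - v 2 ^ 2 := by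
    have := norm_sq_space v
    rw [hv] at this
    rw [norm_rotGen_sq]; linarith
  have hA : ‖a • rotGenL e‖ ≤ |a| := by
    rw [norm_smul, Real.norm_eq_abs, rotGenL_apply]
    exact mul_le_of_le_one_right (abs_nonneg _) ((norm_rotGen_le e).trans he.le)
  have hB : ‖b • rotGenL (cross v e)‖ ≤ |b| := by
    rw [norm_smul, Real.norm_eq_abs, rotGenL_apply]
    exact mul_le_of_le_one_right (abs_nonneg _) ((norm_rotGen_le _).trans hf1.le)
  have hC : ‖c • rotGenL v‖ = |c| * ‖rotGen v‖ := by rw [norm_smul, Real.norm_eq_abs, rotGenL_apply]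
  rw [← rotGenL_apply, map_add, map_add, map_smul, map_smul, map_smul, ← hr]
  have ht := norm_add₃_le (a := a • rotGenL e) (b := b • rotGenL (cross v e)) (c := c • rotGenL v)
  have h2 := pow_le_pow_left₀ (norm_nonneg _) (ht.trans (add_le_add (add_le_add hA hB) hC.le)) 2
  refine h2.trans ?_
  have h3 : (|c| * ‖rotGen v‖) ^ 2 = c ^ 2 * ‖rotGen v‖ ^ 2 := by rw [mul_pow, sq_abs]
  have := sq_abs a
  have := sq_abs b
  nlinarith [sq_nonneg (|a| - |b|), sq_nonneg (|a| - |c| * ‖rotGen v‖), sq_nonneg (|b| - |c| * ‖rotGen v‖)]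

end FrameAlgebra

section FrameJet

variable {m : ℕ} {V V1 E : ℝ → Space}

/-- The first component of the vector field `bog` in the frame. -/
def bogRe (m : ℕ) (V V1 E : ℝ → Space) (t : ℝ) : ℝ := inner ℝ (bog m V V1 t) (E t)

/-- The second component of the vector field `bog` in the frame. -/
def bogIm (m : ℕ) (V V1 E : ℝ → Space) (t : ℝ) : ℝ := inner ℝ (bog m V V1 t) (cross (V t) (E t))

theorem inner_deriv_fst (f : ParallelFrame V V1 E) (t : ℝ) :
    inner ℝ (V1 t) (E t) = bogRe m V V1 E t + m * E t 2 := by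
  rw [bogRe, bog, inner_sub_left, real_inner_smul_left, inner_sub_left, inner_northPole, real_inner_smul_left,
    real_inner_comm (E t) (V t), f.orth]
  ring

theorem inner_deriv_snd (t : ℝ) :
    inner ℝ (V1 t) (cross (V t) (E t)) = bogIm m V V1 E t + m * cross (V t) (E t) 2 := by
  rw [bogIm, bog, inner_sub_left, real_inner_smul_left, inner_sub_left, inner_northPole, real_inner_smul_left,
    real_inner_comm _ (V t), inner_cross_left]
  ring

theorem Traj.inner_deriv (h : Traj m V V1) (t : ℝ) : inner ℝ (V1 t) (V t) = 0 := by
  have := h.orth t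
  rw [inner_space]
  linarith

theorem Traj.deriv_frame (h : Traj m V V1) (f : ParallelFrame V V1 E) (t : ℝ) :
    V1 t = (bogRe m V V1 E t + m * E t 2) • E t +
      (bogIm m V V1 E t + m * cross (V t) (E t) 2) • cross (V t) (E t) := by
  rw [← inner_deriv_fst f, ← inner_deriv_snd]
  exact eq_frame (h.norm t) (f.norm t) (f.orth t) (h.inner_deriv t)

theorem HasDerivAt.cross' {a b : ℝ → Space} {a' b' : Space} {t : ℝ} (ha : HasDerivAt a a' t)
    (hb : HasDerivAt b b' t) : HasDerivAt (fun s => cross (a s) (b s)) (cross a' (b t) + cross (a t) b') t := by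
  have A := fun i => hasDerivAt_coord ha i
  have B := fun i => hasDerivAt_coord hb i
  refine hasDerivAt_euclidean.2 fun i => ?_
  simp only [PiLp.add_apply]
  fin_cases i <;> simp only [Fin.zero_eta, Fin.mk_one, Fin.reduceFinMk, cross_zero_apply,
    cross_one_apply, cross_two_apply]
  · exact (((A 1).fun_mul (B 2)).fun_sub ((A 2).fun_mul (B 1))).congr_deriv (by ring)
  · exact (((A 2).fun_mul (B 0)).fun_sub ((A 0).fun_mul (B 2))).congr_deriv (by ring)
  · exact (((A 0).fun_mul (B 1)).fun_sub ((A 1).fun_mul (B 0))).congr_deriv (by ring)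

theorem cross_add_smul_left (a b : ℝ) (x y w : Space) :
    cross (a • x + b • y) w = a • cross x w + b • cross y w := by
  simp [cross]

theorem cross_self_smul (a : ℝ) (x : Space) : cross x (a • x) = 0 := by
  simp [cross]

theorem ParallelFrame.hasDerivAt_fst (h : Traj m V V1) (f : ParallelFrame V V1 E) (t : ℝ) :
    HasDerivAt E ((-(bogRe m V V1 E t + m * E t 2)) • V t) t :=
  (f.deriv t).congr_deriv (by rw [real_inner_comm, inner_deriv_fst (m := m) f, neg_smul])

theorem ParallelFrame.hasDerivAt_snd (h : Traj m V V1) (f : ParallelFrame V V1 E) (t : ℝ) :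
    HasDerivAt (fun s => cross (V s) (E s)) ((-(bogIm m V V1 E t + m * cross (V t) (E t) 2)) • V t) t := by
  refine (HasDerivAt.cross' (h.deriv t) (f.hasDerivAt_fst h t)).congr_deriv ?_
  rw [cross_self_smul, add_zero]
  conv_lhs => rw [h.deriv_frame f t]
  rw [cross_add_smul_left, cross_cross_self (f.norm t) (f.orth t)]
  have : cross (E t) (E t) = 0 := by simpa using cross_self_smul 1 (E t)
  rw [this, smul_zero, zero_add, smul_neg, neg_smul]

variable {V2 : ℝ → Space} {p1 q1 : ℝ → ℝ}

theorem Traj.deriv_deriv_frame (h : Traj m V V1) (f : ParallelFrame V V1 E) {t : ℝ}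
    (hV : HasDerivAt V1 (V2 t) t)
    (hp : HasDerivAt (bogRe m V V1 E) (p1 t) t) (hq : HasDerivAt (bogIm m V V1 E) (q1 t) t) :
    V2 t + (m : ℝ) ^ 2 • rotGen (rotGen (V t)) =
      (p1 t - m * V t 2 * bogRe m V V1 E t) • E t +
      (q1 t - m * V t 2 * bogIm m V V1 E t) • cross (V t) (E t) +
      (-(bogRe m V V1 E t ^ 2 + bogIm m V V1 E t ^ 2 +
        2 * m * (bogRe m V V1 E t * E t 2 + bogIm m V V1 E t * cross (V t) (E t) 2) +
        2 * m ^ 2 * (1 - V t 2 ^ 2))) • V t := by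
  have hE := f.hasDerivAt_fst h t
  have hF := f.hasDerivAt_snd h t
  have hk := hasDerivAt_coord hE 2
  have hl := hasDerivAt_coord hF 2
  have ha := hp.fun_add (hk.const_mul (m : ℝ))
  have hb := hq.fun_add (hl.const_mul (m : ℝ))
  have hd := (ha.fun_smul hE).fun_add (hb.fun_smul hF)
  have hV' : HasDerivAt V1 _ t := hd.congr_of_eventuallyEq (Eventually.of_forall fun s => h.deriv_frame f s)
  have key := hV.unique hV'
  have h1 := sq_third_coord (h.norm t) (f.norm t) (f.orth t)
  have h2 := northPole_frame (h.norm t) (f.norm t) (f.orth t)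
  rw [key, rotGen_rotGen]
  simp only [PiLp.smul_apply, smul_eq_mul]
  generalize cross (V t) (E t) = F at *
  nth_rewrite 1 [h2]
  rw [show (1 : ℝ) - V t 2 ^ 2 = E t 2 ^ 2 + F 2 ^ 2 by linarith]
  have h3 : V t 2 * V t 2 = 1 - E t 2 ^ 2 - F 2 ^ 2 := by linarith
  simp only [smul_add, smul_sub, smul_smul, ← neg_smul]
  match_scalars
  · linear_combination (m : ℝ) ^ 2 * h3
  · ring
  · ring

theorem Traj.jet_frame_le (h : Traj m V V1) (hm : 1 ≤ m) (f : ParallelFrame V V1 E)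
    (hV : ∀ t, HasDerivAt V1 (V2 t) t)
    (hp : ∀ t, HasDerivAt (bogRe m V V1 E) (p1 t) t) (hq : ∀ t, HasDerivAt (bogIm m V V1 E) (q1 t) t)
    {t p2 q2 : ℝ} (hp1 : HasDerivAt p1 p2 t) (hq1 : HasDerivAt q1 q2 t) {D : Space}
    (hD : HasDerivAt (fun t => V2 t + (m : ℝ) ^ 2 • rotGen (rotGen (V t))) D t) :
    ‖D - (2 : ℝ) • (V2 t + (m : ℝ) ^ 2 • rotGen (rotGen (V t)))‖ ^ 2 +
      m ^ 2 * ‖rotGen (V2 t + (m : ℝ) ^ 2 • rotGen (rotGen (V t)))‖ ^ 2 ≤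
    10000 * (1 + m) ^ 6 * jetMajorant m (bogRe m V V1 E t) (bogIm m V V1 E t) (p1 t) (q1 t) p2 q2 (V t 2) := by
  have hE := f.hasDerivAt_fst h t
  have hF := f.hasDerivAt_snd h t
  have hk := hasDerivAt_coord hE 2
  have hl := hasDerivAt_coord hF 2
  have hz := hasDerivAt_coord (h.deriv t) 2
  have hz' : V1 t 2 = bogRe m V V1 E t * E t 2 + bogIm m V V1 E t * cross (V t) (E t) 2 +
      m * (1 - V t 2 ^ 2) := by
    have h1 := sq_third_coord (h.norm t) (f.norm t) (f.orth t)
    have h2 := congrArg (fun y : Space => y 2) (h.deriv_frame f t)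
    simp only [PiLp.add_apply, PiLp.smul_apply, smul_eq_mul] at h2
    rw [h2]
    linear_combination (m : ℝ) * h1
  have hX := hp1.fun_sub (((hz.const_mul (m : ℝ))).fun_mul (hp t))
  have hY := hq1.fun_sub (((hz.const_mul (m : ℝ))).fun_mul (hq t))
  have hy := (hz.fun_pow 2).const_sub 1
  have hB := ((((hp t).fun_pow 2).fun_add ((hq t).fun_pow 2)).fun_add
    ((((hp t).fun_mul hk).fun_add ((hq t).fun_mul hl)).const_mul (2 * (m : ℝ)))).fun_add
    (hy.const_mul (2 * (m : ℝ) ^ 2))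
  have hd := ((hX.fun_smul hE).fun_add (hY.fun_smul hF)).fun_add (hB.fun_neg.fun_smul (h.deriv t))
  have key := hD.unique (hd.congr_of_eventuallyEq
    (Eventually.of_forall fun s => h.deriv_deriv_frame f (hV s) (hp s) (hq s)))
  rw [h.deriv_deriv_frame f (hV t) (hp t) (hq t)]
  have hmR : (1 : ℝ) ≤ m := by exact_mod_cast hm
  have hrot := norm_rotGen_comb_le (h.norm t) (f.norm t) (f.orth t)
    (p1 t - m * V t 2 * bogRe m V V1 E t) (q1 t - m * V t 2 * bogIm m V V1 E t)
    (-(bogRe m V V1 E t ^ 2 + bogIm m V V1 E t ^ 2 +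
        2 * m * (bogRe m V V1 E t * E t 2 + bogIm m V V1 E t * cross (V t) (E t) 2) +
        2 * m ^ 2 * (1 - V t 2 ^ 2)))
  have hcomb := norm_sq_comb (h.norm t) (f.norm t) (f.orth t)
  have hVf := h.deriv_frame f t
  have hsq := sq_third_coord (h.norm t) (f.norm t) (f.orth t)
  simp only [PiLp.smul_apply, smul_eq_mul] at key
  rw [hz'] at key
  generalize hp0 : bogRe m V V1 E t = p at *
  generalize hq0 : bogIm m V V1 E t = q at *
  generalize hF0 : cross (V t) (E t) = F at *
  generalize hl0 : F 2 = l at *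
  generalize hk0 : E t 2 = k at *
  generalize hzz : V t 2 = z at *
  generalize hX0 : p1 t - m * z * p = X at *
  generalize hY0 : q1 t - m * z * q = Y at *
  generalize hB0 : p ^ 2 + q ^ 2 + 2 * m * (p * k + q * l) + 2 * m ^ 2 * (1 - z ^ 2) = B at *
  have hdiff : D - (2 : ℝ) • (X • E t + Y • F + (-B) • V t) =
      (p2 - m * ((p * k + q * l + m * (1 - z ^ 2)) * p + z * p1 t) - B * (p + m * k) - 2 * X) • E t +
      (q2 - m * ((p * k + q * l + m * (1 - z ^ 2)) * q + z * q1 t) - B * (q + m * l) - 2 * Y) • F +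
      (-((2 * (p * p1 t + q * q1 t) + 2 * m * (p1 t * k + q1 t * l - z * (p * (p + m * k) + q * (q + m * l))) +
        2 * m ^ 2 * (-(2 * z * (p * k + q * l + m * (1 - z ^ 2))))) + (p + m * k) * X + (q + m * l) * Y - 2 * B)) •
        V t := by
    rw [key, hVf]
    simp only [smul_add, smul_smul, neg_smul, smul_neg]
    match_scalars
    · push_cast; ring
    · push_cast; ring
    · push_cast; ring
  rw [hdiff, hcomb]
  have := jet_le (m := (m : ℝ)) hmR (k := k) (l := l) (z := z) hsq (p := p) (q := q) (p1 := p1 t) (q1 := q1 t)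
    (p2 := p2) (q2 := q2) rfl hX0.symm hY0.symm hB0.symm rfl rfl rfl
  rw [neg_sq] at hrot ⊢
  refine le_trans ?_ this
  gcongr

end FrameJet

/-! ### Second-order jets in logarithmic coordinates -/

section LogJet

theorem intervalIntegral_exp_of_le {g : ℝ → ℝ} {a b : ℝ} (hab : a ≤ b)
    (hg : IntervalIntegrable g volume (exp a) (exp b)) :
    IntervalIntegrable (fun s => exp s * g (exp s)) volume a b ∧
      ∫ s in a..b, exp s * g (exp s) = ∫ r in exp a..exp b, g r := by
  have hd : ∀ x ∈ Set.Ioc a b, HasDerivWithinAt exp (exp x) (Set.Ioc a b) x := fun x _ =>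
    (hasDerivAt_exp x).hasDerivWithinAt
  have hm : MonotoneOn exp (Set.Ioc a b) := exp_monotone.monotoneOn _
  have hab' := exp_monotone hab
  have h1 := integrableOn_image_iff_integrableOn_deriv_smul_of_monotoneOn measurableSet_Ioc hd hm g
  have h2 := integral_image_eq_integral_deriv_smul_of_monotoneOn measurableSet_Ioc hd hm g
  rw [image_exp_Ioc] at h1 h2
  rw [intervalIntegrable_iff_integrableOn_Ioc_of_le hab'] at hg
  rw [intervalIntegrable_iff_integrableOn_Ioc_of_le hab, intervalIntegral.integral_of_le hab,
    intervalIntegral.integral_of_le hab']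
  exact ⟨h1.1 hg, h2.symm⟩

theorem intervalIntegral_exp {g : ℝ → ℝ} (hg : ∀ a b : ℝ, 0 < a → a ≤ b → IntervalIntegrable g volume a b)
    (a b : ℝ) : IntervalIntegrable (fun s => exp s * g (exp s)) volume a b ∧
      ∫ s in a..b, exp s * g (exp s) = ∫ r in exp a..exp b, g r := by
  rcases le_total a b with h | h
  · exact intervalIntegral_exp_of_le h (hg _ _ (exp_pos _) (exp_monotone h))
  · have := intervalIntegral_exp_of_le h (hg _ _ (exp_pos _) (exp_monotone h))
    refine ⟨this.1.symm, ?_⟩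
    rw [intervalIntegral.integral_symm, this.2, ← intervalIntegral.integral_symm]

theorem LocallyAC.add {f g : ℝ → ℝ} (hf : LocallyAC f) (hg : LocallyAC g) : LocallyAC fun t => f t + g t :=
  fun a b => (hf a b).add (hg a b)

/-- A primitive of a locally integrable function on the half-line has the expected derivative a.e. -/
theorem ae_hasDerivAt_primitive {F : Type*} [NormedAddCommGroup F] [NormedSpace ℝ F] [CompleteSpace F]
    {g γ : ℝ → F} (hi : ∀ a b : ℝ, 0 < a → a ≤ b → IntervalIntegrable γ volume a b)
    (hg : ∀ r, 0 < r → g r = g 1 + ∫ t in (1 : ℝ)..r, γ t) :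
    ∀ᵐ r ∂(volume.restrict (Set.Ioi (0 : ℝ))), HasDerivAt g (γ r) r := by
  rw [ae_restrict_iff' measurableSet_Ioi]
  have h : ∀ n : ℕ, ∀ᵐ x, x ∈ Set.uIcc ((n + 1 : ℝ)⁻¹) (n + 1) → ∀ c ∈ Set.uIcc ((n + 1 : ℝ)⁻¹) (n + 1),
      HasDerivAt (fun x => ∫ t in c..x, γ t) (γ x) x := fun n =>
    (hi _ _ (by positivity) (by
      have h1 : (1 : ℝ) ≤ n + 1 := by linarith [n.cast_nonneg (α := ℝ)]
      exact (inv_le_one_of_one_le₀ h1).trans h1)).ae_hasDerivAt_integral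
  filter_upwards [ae_all_iff.2 h] with x hx hx0
  have hx0' : 0 < x := hx0
  obtain ⟨n, hn⟩ := exists_nat_ge (max x x⁻¹)
  have h1 : (1 : ℝ) ≤ n + 1 := by linarith [n.cast_nonneg (α := ℝ)]
  have h2 : (n + 1 : ℝ)⁻¹ ≤ 1 := inv_le_one_of_one_le₀ h1
  have hle : (n + 1 : ℝ)⁻¹ ≤ n + 1 := h2.trans h1
  have hxm : x ∈ Set.uIcc ((n + 1 : ℝ)⁻¹) (n + 1) := by
    rw [Set.uIcc_of_le hle]
    refine ⟨?_, by linarith [le_max_left x x⁻¹]⟩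
    rw [inv_le_comm₀ (by positivity) hx0']
    linarith [le_max_right x x⁻¹]
  have := hx n hxm 1 (by rw [Set.uIcc_of_le hle]; exact ⟨h2, h1⟩)
  refine (this.const_add (g 1)).congr_of_eventuallyEq ?_
  filter_upwards [isOpen_Ioi.mem_nhds hx0] with y hy using hg y hy

/-- Passage to logarithmic coordinates in `g'' + g'/r - n² g / r²`. -/
theorem exists_log_jet {g g1 g2 : ℝ → ℝ} (hd : ∀ r, 0 < r → HasDerivAt g (g1 r) r)
    (hi : ∀ a b : ℝ, 0 < a → a ≤ b → IntervalIntegrable g2 volume a b)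
    (hg : ∀ r, 0 < r → g1 r = g1 1 + ∫ t in (1 : ℝ)..r, g2 t) (c : ℝ) :
    ∃ p1 : ℝ → ℝ, (∀ t, HasDerivAt (fun t => exp t * g (exp t)) (p1 t) t) ∧ LocallyAC p1 ∧
      ∀ᵐ t, deriv p1 t - 2 * p1 t - c * (exp t * g (exp t)) = exp (3 * t) *
        (g2 (exp t) + (exp t)⁻¹ * g1 (exp t) - (c + 1) / (exp t) ^ 2 * g (exp t)) := by
  have dp : ∀ t, HasDerivAt (fun t => exp t * g (exp t))
      (exp t * g (exp t) + exp t * (exp t * g1 (exp t))) t := fun t =>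
    (hasDerivAt_exp t).fun_mul (hasDerivAt_comp_exp (hd _ (exp_pos t)))
  have hac1 : LocallyAC fun t => g1 (exp t) := by
    have e : (fun t => g1 (exp t)) = fun t => g1 1 + ∫ s in (0 : ℝ)..t, exp s * g2 (exp s) := by
      funext t
      rw [(intervalIntegral_exp hi 0 t).2, exp_zero]
      exact hg _ (exp_pos t)
    rw [e]
    refine LocallyAC.add (locallyAC_of_hasDerivAt (g' := fun _ => 0) (fun t => hasDerivAt_const t _)
      continuous_const) fun a b => ?_
    have h0 : -(|a| + |b|) ≤ |a| + |b| := by linarith [abs_nonneg a, abs_nonneg b]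
    refine ((intervalIntegral_exp hi (-(|a| + |b|)) (|a| + |b|)).1.absolutelyContinuousOnInterval_intervalIntegral
      (c := 0) ?_).mono (Set.uIcc_subset_uIcc ?_ ?_)
    all_goals rw [Set.uIcc_of_le h0]
    · exact ⟨by linarith [abs_nonneg a, abs_nonneg b], by linarith [abs_nonneg a, abs_nonneg b]⟩
    · exact abs_le.1 (by linarith [abs_nonneg b])
    · exact abs_le.1 (by linarith [abs_nonneg a])
  have hexp : LocallyAC exp := locallyAC_of_hasDerivAt hasDerivAt_exp continuous_exp
  have c1 : Continuous fun t => g1 (exp t) := hac1.continuous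
  have cg : Continuous fun t => exp t * g (exp t) :=
    continuous_of_hasDerivAt dp
  refine ⟨_, dp, ?_, ?_⟩
  · exact LocallyAC.add (locallyAC_of_hasDerivAt dp
      (cg.add (continuous_exp.mul (continuous_exp.mul c1)))) (hexp.mul (hexp.mul hac1))
  · filter_upwards [ae_exp_of_ae_Ioi (ae_hasDerivAt_primitive hi hg)] with t ht
    have h1 := hasDerivAt_exp t
    have h2 := (dp t).fun_add (h1.fun_mul (h1.fun_mul (hasDerivAt_comp_exp ht)))
    rw [h2.deriv]
    have h3 : exp (3 * t) = exp t ^ 3 := by rw [← exp_nat_mul]; norm_num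
    have h4 := (exp_pos t).ne'
    rw [h3]
    simp only [smul_eq_mul]
    field_simp
    ring

end LogJet

/-! ### The function `q` in logarithmic coordinates -/

section QFun

variable {m : ℕ} {u : Plane → Space} {e v1 : ℝ → Space}

theorem cross_rotGen {v : Space} (hv : ‖v‖ = 1) : cross v (rotGen v) = northPole - v 2 • v := by
  have h := norm_sq_space v
  rw [hv, one_pow] at h
  ext i
  simp only [PiLp.sub_apply, PiLp.smul_apply, smul_eq_mul]
  fin_cases i <;> simp only [Fin.zero_eta, Fin.mk_one, Fin.reduceFinMk, cross_zero_apply,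
    cross_one_apply, cross_two_apply, rotGen, northPole, PiLp.toLp_apply, Matrix.cons_val]
  · ring
  · ring
  · linear_combination -h

theorem exp_smul_wField (hu : IsSigma m u) (hd : ∀ r, 0 < r → HasDerivAt (profile u) (v1 r) r) (t : ℝ) :
    exp t • wField m u (exp t) =
      bog m (logProfile u) (logDeriv v1) t := by
  have hn : ‖profile u (exp t)‖ = 1 := hu.sphere _
  rw [wField, bog, (hd _ (exp_pos t)).deriv, cross_rotGen hn, smul_sub, smul_smul, logProfile]
  congr 2
  have := (exp_pos t).ne'
  field_simp

theorem exp_mul_qFun_re (hu : IsSigma m u) (hd : ∀ r, 0 < r → HasDerivAt (profile u) (v1 r) r) (t : ℝ) :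
    exp t * (qFun m u e (exp t)).re =
      bogRe m (logProfile u) (logDeriv v1) (fun t => e (exp t)) t := by
  rw [bogRe, ← exp_smul_wField hu hd, real_inner_smul_left]
  rfl

theorem exp_mul_qFun_im (hu : IsSigma m u) (hd : ∀ r, 0 < r → HasDerivAt (profile u) (v1 r) r) (t : ℝ) :
    exp t * (qFun m u e (exp t)).im =
      bogIm m (logProfile u) (logDeriv v1) (fun t => e (exp t)) t := by
  rw [bogIm, ← exp_smul_wField hu hd, real_inner_smul_left]
  rfl

theorem continuous_cross {a b : ℝ → Space} (ha : Continuous a) (hb : Continuous b) :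
    Continuous fun t => cross (a t) (b t) := by
  have A := continuous_coord ha
  have B := continuous_coord hb
  simp only [cross_apply]
  refine (PiLp.continuous_toLp 2 _).comp (continuous_pi fun i => ?_)
  fin_cases i
  · exact ((A 1).mul (B 2)).sub ((A 2).mul (B 1))
  · exact ((A 2).mul (B 0)).sub ((A 0).mul (B 2))
  · exact ((A 0).mul (B 1)).sub ((A 1).mul (B 0))

variable {V V1 E : ℝ → Space}

theorem ParallelFrame.continuous (f : ParallelFrame V V1 E) : Continuous E :=
  continuous_of_hasDerivAt f.deriv

theorem Traj.continuous_bogRe (h : Traj m V V1) (f : ParallelFrame V V1 E) : Continuous (bogRe m V V1 E) :=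
  h.continuous_bog.inner f.continuous

theorem Traj.continuous_bogIm (h : Traj m V V1) (f : ParallelFrame V V1 E) : Continuous (bogIm m V V1 E) :=
  h.continuous_bog.inner (continuous_cross h.continuous f.continuous)

theorem Traj.bogRe_sq_add (h : Traj m V V1) (f : ParallelFrame V V1 E) (t : ℝ) :
    bogRe m V V1 E t ^ 2 + bogIm m V V1 E t ^ 2 = ‖bog m V V1 t‖ ^ 2 := by
  have h1 := eq_frame (h.norm t) (f.norm t) (f.orth t) (h.inner_bog t)
  have h2 := norm_sq_comb (h.norm t) (f.norm t) (f.orth t) (bogRe m V V1 E t) (bogIm m V V1 E t) 0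
  rw [zero_smul, add_zero] at h2
  rw [h1]
  change _ = ‖bogRe m V V1 E t • E t + bogIm m V V1 E t • cross (V t) (E t)‖ ^ 2
  rw [h2]
  ring

theorem qFun_eq (hu : IsSigma m u) (hd : ∀ r, 0 < r → HasDerivAt (profile u) (v1 r) r) {r : ℝ} (hr : 0 < r) :
    qFun m u e r = (r⁻¹ : ℝ) • (⟨bogRe m (logProfile u) (logDeriv v1)
        (fun t => e (exp t)) (log r), bogIm m (logProfile u) (logDeriv v1)
        (fun t => e (exp t)) (log r)⟩ : ℂ) := by
  rw [← exp_mul_qFun_re hu hd, ← exp_mul_qFun_im hu hd, exp_log hr]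
  apply Complex.ext <;> simp [hr.ne']

end QFun

section QTilde

variable {m : ℕ} {u : Plane → Space} {e v1 : ℝ → Space}

theorem measurable_angle : Measurable angle :=
  Complex.measurable_arg.comp toC.continuous.measurable

theorem measurable_weighted (c : ℝ) {p q p1 q1 : ℝ → ℝ} (hp : Measurable p) (hq : Measurable q)
    (hp1 : Measurable p1) (hq1 : Measurable q1) : Measurable fun t => ω(t) *
      ((deriv p1 t - 2 * p1 t - c * p t) ^ 2 + (deriv q1 t - 2 * q1 t - c * q t) ^ 2) := by
  have := measurable_deriv p1
  have := measurable_deriv q1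
  fun_prop

theorem continuousOn_qFun (hu : IsSigma m u) (he : IsCoulombFrame u e)
    (hd : ∀ r, 0 < r → HasDerivAt (profile u) (v1 r) r) (hc : ContinuousOn v1 (Set.Ioi 0)) :
    ContinuousOn (qFun m u e) (Set.Ioi 0) := by
  have h := (traj_logProfile hu hd hc).1
  have f := he.parallelFrame hu hd hc
  have hlog : ContinuousOn log (Set.Ioi 0) := continuousOn_log.mono fun x hx => (ne_of_gt hx : x ≠ 0)
  have h1 := (h.continuous_bogRe f).comp_continuousOn hlog
  have h2 := (h.continuous_bogIm f).comp_continuousOn hlog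
  refine ContinuousOn.congr (f := fun r => (r⁻¹ : ℝ) • ((bogRe m (logProfile u)
    (logDeriv v1) (fun t => e (exp t)) (log r) : ℂ) + (bogIm m (logProfile u)
    (logDeriv v1) (fun t => e (exp t)) (log r) : ℂ) * Complex.I)) ?_ ?_
  · have hi : ContinuousOn (fun r : ℝ => r⁻¹) (Set.Ioi 0) := continuousOn_inv₀.mono fun x hx => (ne_of_gt hx : x ≠ 0)
    exact hi.smul
      ((Complex.continuous_ofReal.comp_continuousOn h1).add
        ((Complex.continuous_ofReal.comp_continuousOn h2).mul continuousOn_const))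
  · intro r hr
    rw [qFun_eq hu hd hr, Complex.mk_eq_add_mul_I]

theorem norm_qFun_sq (hu : IsSigma m u) (he : IsCoulombFrame u e)
    (hd : ∀ r, 0 < r → HasDerivAt (profile u) (v1 r) r) (hc : ContinuousOn v1 (Set.Ioi 0)) (t : ℝ) :
    exp (2 * t) * ‖qFun m u e (exp t)‖ ^ 2 =
      ‖bog m (logProfile u) (logDeriv v1) t‖ ^ 2 := by
  rw [← (traj_logProfile hu hd hc).1.bogRe_sq_add (he.parallelFrame hu hd hc), ← exp_mul_qFun_re hu hd,
    ← exp_mul_qFun_im hu hd, Complex.sq_norm, Complex.normSq_apply, two_mul, exp_add]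
  ring

theorem aemeasurable_comp_norm {F : Type*} [NormedAddCommGroup F] [SecondCountableTopology F]
    [MeasurableSpace F] [BorelSpace F] {g : ℝ → F}
    (hg : ContinuousOn g (Set.Ioi 0)) : AEMeasurable (fun x : Plane => g ‖x‖) := by
  have h := hg.aemeasurable (μ := volume) measurableSet_Ioi
  have h1 : (fun x : Plane => g ‖x‖) =ᵐ[volume] fun x => h.mk g ‖x‖ := by
    filter_upwards [ae_norm_of_ae h.ae_eq_mk] with x hx using hx
  exact (h.measurable_mk.comp measurable_norm).aemeasurable.congr h1.symm

theorem memLp_qTilde (hm : 1 ≤ m) (hu : IsSigma m u) (he : IsCoulombFrame u e)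
    (hd : ∀ r, 0 < r → HasDerivAt (profile u) (v1 r) r) (hc : ContinuousOn v1 (Set.Ioi 0)) :
    MemLp (qTilde m u e) 2 volume := by
  have hq := aemeasurable_comp_norm (continuousOn_qFun hu he hd hc)
  have hq' := (continuousOn_qFun hu he hd hc).aemeasurable (μ := volume) measurableSet_Ioi
  have hT := (traj_logProfile hu hd hc).1
  have hn : ∀ x : Plane, ‖qTilde m u e x‖ₑ ^ 2 = ENNReal.ofReal (‖qFun m u e ‖x‖‖ ^ 2) := fun x => by
    rw [ofReal_norm_sq, qTilde, enorm_mul, mul_comm Complex.I, ← ofReal_norm, Complex.norm_exp_ofReal_mul_I,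
      ENNReal.ofReal_one, one_mul]
  refine ⟨?_, ?_⟩
  · refine AEMeasurable.aestronglyMeasurable (AEMeasurable.mul ?_ hq)
    refine (Complex.measurable_exp.comp (measurable_const.mul
      (Complex.measurable_ofReal.comp (measurable_const.mul measurable_angle)))).aemeasurable
  · have h1 : eLpNorm (qTilde m u e) 2 volume ^ 2 < ⊤ := by
      rw [eLpNorm_two_sq, lintegral_congr hn,
        lintegral_fun_norm_exp_of_aemeasurable (f := fun r => ENNReal.ofReal (‖qFun m u e r‖ ^ 2))
          ((hq'.norm.pow_const 2).ennreal_ofReal)]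
      refine ENNReal.mul_lt_top ENNReal.ofReal_lt_top ?_
      have e1 : ∀ t, ENNReal.ofReal (exp (2 * t)) * ENNReal.ofReal (‖qFun m u e (exp t)‖ ^ 2) =
          ENNReal.ofReal (‖bog m (logProfile u) (logDeriv v1) t‖ ^ 2) := fun t => by
        rw [← ENNReal.ofReal_mul (exp_nonneg _), norm_qFun_sq hu he hd hc]
      rw [lintegral_congr e1]
      exact (hT.integrable_bog hm).lintegral_lt_top
    exact ENNReal.pow_lt_top_iff.1 h1 |>.resolve_right (by norm_num)

/-- The estimate of `(p, q)` by the distributional Laplacian of `q̃`. -/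
theorem exists_frame_jet (hm : 1 ≤ m) (hu : IsSigma m u) (he : IsCoulombFrame u e)
    (hd : ∀ r, 0 < r → HasDerivAt (profile u) (v1 r) r) (hc : ContinuousOn v1 (Set.Ioi 0))
    {G : Plane → ℂ} (hG : IsWeakLaplacian (qTilde m u e) G) (hG2 : MemLp G 2 volume)
    {p q : ℝ → ℝ}
    (hp : p = bogRe m (logProfile u) (logDeriv v1) (fun t => e (exp t)))
    (hq : q = bogIm m (logProfile u) (logDeriv v1) (fun t => e (exp t))) :
    ∃ p1 q1 : ℝ → ℝ, (∀ t, HasDerivAt p (p1 t) t) ∧ (∀ t, HasDerivAt q (q1 t) t) ∧ LocallyAC p1 ∧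
      LocallyAC q1 ∧ ∫⁻ t, ENNReal.ofReal (ω(t) *
        ((deriv p1 t - 2 * p1 t - ((m + 1) ^ 2 - 1) * p t) ^ 2 +
          (deriv q1 t - 2 * q1 t - ((m + 1) ^ 2 - 1) * q t) ^ 2)) ≤ eLpNorm G 2 volume ^ 2 := by
  obtain ⟨g1, g2, hg1, hg2, hgi, hle⟩ := exists_jet_of_isWeakLaplacian (n := m + 1) (q := qFun m u e)
    (f := qTilde m u e) (fun x _ => by
      rw [qTilde, mul_comm Complex.I]; push_cast; rfl) (continuousOn_qFun hu he hd hc) (memLp_qTilde hm hu he hd hc)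
    hG hG2
  have ii : ∀ r, 0 < r → IntervalIntegrable g2 volume 1 r := fun r hr => by
    rcases le_total 1 r with h | h
    · exact hg2 _ _ one_pos h
    · exact (hg2 _ _ hr h).symm
  have pp : p = fun t => exp t * (qFun m u e (exp t)).re := funext fun t => by
    rw [hp, exp_mul_qFun_re hu hd]
  have qq : q = fun t => exp t * (qFun m u e (exp t)).im := funext fun t => by
    rw [hq, exp_mul_qFun_im hu hd]
  obtain ⟨p1, hp1, hpa, hpe⟩ := exists_log_jet (g := fun r => (qFun m u e r).re) (g1 := fun r => (g1 r).re)
    (g2 := fun r => (g2 r).re) (fun r hr => Complex.reCLM.hasFDerivAt.comp_hasDerivAt r (hg1 r hr))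
    (fun a b ha hab => (Complex.reCLM.integrable_comp (hg2 a b ha hab).1 |> fun h =>
      (intervalIntegrable_iff_integrableOn_Ioc_of_le hab).2 h))
    (fun r hr => by
      have := Complex.reCLM.intervalIntegral_comp_comm (ii r hr)
      simp only [Complex.reCLM_apply] at this
      rw [this, hgi r hr, Complex.add_re]) (((m : ℝ) + 1) ^ 2 - 1)
  obtain ⟨q1, hq1, hqa, hqe⟩ := exists_log_jet (g := fun r => (qFun m u e r).im) (g1 := fun r => (g1 r).im)
    (g2 := fun r => (g2 r).im) (fun r hr => Complex.imCLM.hasFDerivAt.comp_hasDerivAt r (hg1 r hr))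
    (fun a b ha hab => (Complex.imCLM.integrable_comp (hg2 a b ha hab).1 |> fun h =>
      (intervalIntegrable_iff_integrableOn_Ioc_of_le hab).2 h))
    (fun r hr => by
      have := Complex.imCLM.intervalIntegral_comp_comm (ii r hr)
      simp only [Complex.imCLM_apply] at this
      rw [this, hgi r hr, Complex.add_im]) (((m : ℝ) + 1) ^ 2 - 1)
  refine ⟨p1, q1, by rw [pp]; exact hp1, by rw [qq]; exact hq1, hpa, hqa, ?_⟩
  rw [pp, qq]
  set N : ℝ → ℝ := fun t => ω(t) *
    ((deriv p1 t - 2 * p1 t - ((m + 1) ^ 2 - 1) * (exp t * (qFun m u e (exp t)).re)) ^ 2 +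
      (deriv q1 t - 2 * q1 t - ((m + 1) ^ 2 - 1) * (exp t * (qFun m u e (exp t)).im)) ^ 2) with hN
  have hNm0 : Measurable N := measurable_weighted _ (continuous_of_hasDerivAt hp1).measurable
    (continuous_of_hasDerivAt hq1).measurable hpa.continuous.measurable hqa.continuous.measurable
  have hNm : Measurable fun r => ENNReal.ofReal (exp (-(2 * log r)) * N (log r)) := by
    exact ((measurable_exp.comp (measurable_log.const_mul 2).neg).mul (hNm0.comp measurable_log)).ennreal_ofReal
  have hEq : ∀ᵐ x : Plane, ENNReal.ofReal (‖g2 ‖x‖ + (‖x‖⁻¹ : ℝ) • g1 ‖x‖ -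
      (((m + 1 : ℕ) : ℝ) / ‖x‖ : ℝ) ^ 2 • qFun m u e ‖x‖‖ ^ 2) =
      ENNReal.ofReal (exp (-(2 * log ‖x‖)) * N (log ‖x‖)) := by
    refine ae_norm_of_ae (p := fun r => ENNReal.ofReal (‖g2 r + (r⁻¹ : ℝ) • g1 r -
      (((m + 1 : ℕ) : ℝ) / r : ℝ) ^ 2 • qFun m u e r‖ ^ 2) =
      ENNReal.ofReal (exp (-(2 * log r)) * N (log r))) (ae_Ioi_of_ae_exp ?_)
    filter_upwards [hpe, hqe] with t h1 h2
    congr 1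
    beta_reduce at h1 h2
    simp only [hN, log_exp]
    rw [h1, h2, Complex.sq_norm, Complex.normSq_apply]
    have e6 : exp (3 * t) ^ 2 = exp (2 * t) * exp (4 * t) := by
      rw [← exp_nat_mul, ← exp_add]; congr 1; push_cast; ring
    simp only [Complex.sub_re, Complex.add_re, Complex.smul_re, Complex.sub_im, Complex.add_im, Complex.smul_im,
      smul_eq_mul, div_pow, mul_pow, e6, exp_neg]
    have := (exp_pos (2 * t)).ne'
    have := (exp_pos (4 * t)).ne'
    push_cast
    field_simp
    ring
  rw [lintegral_congr_ae hEq, lintegral_fun_norm_exp hNm] at hle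
  have hpi : (1 : ℝ≥0∞) ≤ ENNReal.ofReal (2 * π) := by
    rw [← ENNReal.ofReal_one]
    exact ENNReal.ofReal_le_ofReal (by linarith [pi_gt_three])
  refine le_trans ?_ ((le_mul_of_one_le_left zero_le hpi).trans hle)
  refine le_of_eq (lintegral_congr fun t => ?_)
  rw [← ENNReal.ofReal_mul (exp_nonneg _), log_exp, exp_neg (2 * t),
    mul_inv_cancel_left₀ (exp_pos _).ne']

end QTilde

section Majorant

variable {m : ℕ} {V V1 E : ℝ → Space}

/-- The constant of the weighted Hardy inequality for the angular momentum `m + 1`. -/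
def hardyConst (m : ℕ) : ℝ := 6 + 3 * (1 + 12 + (((m : ℝ) + 1) ^ 2 - 1) ^ 2)

theorem hardyConst_nonneg (m : ℕ) : 0 ≤ hardyConst m := by unfold hardyConst; positivity

theorem integrable_left_of_add {w a b : ℝ → ℝ} (ha : AEStronglyMeasurable fun t => w t * a t ^ 2)
    (hw : ∀ t, 0 ≤ w t) (h : Integrable fun t => w t * (a t ^ 2 + b t ^ 2)) :
    Integrable fun t => w t * a t ^ 2 := by
  refine h.mono' ha (Eventually.of_forall fun t => ?_)
  rw [Real.norm_of_nonneg (mul_nonneg (hw t) (sq_nonneg _))]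
  exact mul_le_mul_of_nonneg_left (le_add_of_nonneg_right (sq_nonneg _)) (hw t)

theorem integrable_right_of_add {w a b : ℝ → ℝ} (hb : AEStronglyMeasurable fun t => w t * b t ^ 2)
    (hw : ∀ t, 0 ≤ w t) (h : Integrable fun t => w t * (a t ^ 2 + b t ^ 2)) :
    Integrable fun t => w t * b t ^ 2 :=
  integrable_left_of_add (b := a) hb hw (by simpa only [add_comm] using h)

/-- The weighted bound of the linear terms. -/
theorem linear_terms_le {m : ℕ} (hm : 1 ≤ m) {p q p1 q1 : ℝ → ℝ} (dp : ∀ t, HasDerivAt p (p1 t) t)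
    (dq : ∀ t, HasDerivAt q (q1 t) t) (acp : LocallyAC p1) (acq : LocallyAC q1)
    (hp : Integrable fun t => p t ^ 2) (hq : Integrable fun t => q t ^ 2)
    (hf : Integrable fun t => ω(t) * ((deriv p1 t - 2 * p1 t - ((m + 1) ^ 2 - 1) * p t) ^ 2 +
          (deriv q1 t - 2 * q1 t - ((m + 1) ^ 2 - 1) * q t) ^ 2)) :
    Integrable (fun t => ω(t) *
      (p t ^ 2 + q t ^ 2 + p1 t ^ 2 + q1 t ^ 2 + deriv p1 t ^ 2 + deriv q1 t ^ 2)) ∧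
    ∫ t, ω(t) * (p t ^ 2 + q t ^ 2 + p1 t ^ 2 + q1 t ^ 2 + deriv p1 t ^ 2 + deriv q1 t ^ 2) ≤
      hardyConst m * ∫ t, ω(t) * ((deriv p1 t - 2 * p1 t - ((m + 1) ^ 2 - 1) * p t) ^ 2 +
          (deriv q1 t - 2 * q1 t - ((m + 1) ^ 2 - 1) * q t) ^ 2) := by
  have hm' : (1 : ℝ) ≤ m := by exact_mod_cast hm
  have hc : (3 : ℝ) ≤ ((m : ℝ) + 1) ^ 2 - 1 := by nlinarith
  have cp := continuous_of_hasDerivAt dp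
  have cq := continuous_of_hasDerivAt dq
  have meas : ∀ {a b : ℝ → ℝ} (_ : Continuous a) (_ : Continuous b), AEStronglyMeasurable (fun t =>
      ω(t) * (deriv b t - 2 * b t - (((m : ℝ) + 1) ^ 2 - 1) * a t) ^ 2) volume := fun {a b} ha hb => by
    have h1 : Measurable (deriv b) := measurable_deriv b
    have h2 := ha.measurable
    have h3 := hb.measurable
    have h4 : Measurable fun t : ℝ => ω(t) :=
      (continuous_exp.comp (continuous_const.mul continuous_id).neg).measurable
    exact (h4.mul (((h1.sub (h3.const_mul 2)).sub (h2.const_mul _)).pow_const 2)).aestronglyMeasurable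
  have w0 : ∀ t : ℝ, 0 ≤ ω(t) := fun t => (exp_nonneg _)
  have ip := integrable_left_of_add (meas cp acp.continuous) w0 hf
  have iq := integrable_right_of_add (meas cq acq.continuous) w0 hf
  have H1 := hardy hc dp acp hp ip
  have H2 := hardy hc dq acq hq iq
  have es : (fun t => ω(t) *
      (p t ^ 2 + q t ^ 2 + p1 t ^ 2 + q1 t ^ 2 + deriv p1 t ^ 2 + deriv q1 t ^ 2)) = fun t =>
      ω(t) * (p t ^ 2 + p1 t ^ 2 + deriv p1 t ^ 2) +
      ω(t) * (q t ^ 2 + q1 t ^ 2 + deriv q1 t ^ 2) := by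
    funext t; ring
  have ef : (fun t => ω(t) * ((deriv p1 t - 2 * p1 t - (((m : ℝ) + 1) ^ 2 - 1) * p t) ^ 2 +
          (deriv q1 t - 2 * q1 t - (((m : ℝ) + 1) ^ 2 - 1) * q t) ^ 2)) = fun t =>
      ω(t) * (deriv p1 t - 2 * p1 t - (((m : ℝ) + 1) ^ 2 - 1) * p t) ^ 2 +
      ω(t) * (deriv q1 t - 2 * q1 t - (((m : ℝ) + 1) ^ 2 - 1) * q t) ^ 2 := by
    funext t; ring
  rw [es, ef, integral_add H1.1 H2.1, integral_add ip iq, mul_add]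
  exact ⟨H1.1.add H2.1, add_le_add H1.2 H2.2⟩

/-- The weighted bound of the term without derivatives. -/
theorem Traj.residual_le (h : Traj m V V1) (hm : 1 ≤ m) {t₁ A : ℝ} (ht : ∀ t ≤ t₁, V t 2 ≤ -(5 / 6))
    (hi : Integrable fun t => ω(t) * ‖bog m V V1 t‖ ^ 2)
    (hA : ∫ t, ω(t) * ‖bog m V V1 t‖ ^ 2 ≤ A) :
    Integrable (fun t => ω(t) *
      ((1 - V t 2 ^ 2) ^ 3 + (1 - V t 2 ^ 2) ^ 2 * (1 + m * V t 2) ^ 2)) ∧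
    ∫ t, ω(t) * ((1 - V t 2 ^ 2) ^ 3 + (1 - V t 2 ^ 2) ^ 2 * (1 + m * V t 2) ^ 2) ≤
      (1 + (1 + m) ^ 2) * (3 * ω(t₁) + 36 * A) := by
  have hz : ∀ t, HasDerivAt (fun t => V t 2) (V1 t 2) t := fun t => hasDerivAt_coord (h.deriv t) 2
  have hd : ∀ t, HasDerivAt (fun t => 1 - V t 2 ^ 2) (-(2 * V t 2 * V1 t 2)) t := fun t =>
    (((hz t).fun_pow 2).const_sub 1).congr_deriv (by simp)
  have cz := continuous_coord h.continuous 2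
  have cz1 := continuous_coord h.cont 2
  refine residual_integral hm (y := fun t => 1 - V t 2 ^ 2) (n := fun t => ‖bog m V V1 t‖) hd
    ((continuous_const.mul cz).mul cz1).neg h.continuous_bog.norm (fun _ => norm_nonneg _) cz (fun _ => rfl)
    h.one_sub_sq_nonneg (fun t ht' => by linarith [ht t ht']) (fun t ht' => ?_) hi hA
  have h1 := h.bog_two_sq_le t
  have h0 := h.one_sub_sq_nonneg t
  have h2 := Traj.deriv_two (m := m) (V := V) (V1 := V1) t
  have h3 : |bog m V V1 t 2| ≤ ‖bog m V V1 t‖ * sqrt (1 - V t 2 ^ 2) := by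
    refine abs_le_of_sq_le_sq ?_ (by positivity)
    rw [mul_pow, sq_sqrt h0]
    exact h1
  have hz1 : |V t 2| ≤ 1 := h.abs_coord_le 2 t
  have h4 := abs_mul_le_mul hz1 h3
  rw [one_mul] at h4
  have h5 := (abs_le.1 h4).2
  have h6 := mul_le_mul_of_nonneg_right (ht t ht') h0
  have hm' : (0 : ℝ) ≤ m := by positivity
  have h7 := mul_le_mul_of_nonneg_left h6 hm'
  rw [h2]
  linarith

/-- The weighted bound of the majorant of the third-order jet. -/
theorem integral_jetMajorant_le (h : Traj m V V1) (hm : 1 ≤ m) (f : ParallelFrame V V1 E)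
    (hB : bogEnergy m V V1 ≤ 1) {p q p1 q1 : ℝ → ℝ} (hpe : p = bogRe m V V1 E) (hqe : q = bogIm m V V1 E)
    (dp : ∀ t, HasDerivAt p (p1 t) t) (dq : ∀ t, HasDerivAt q (q1 t) t) (acp : LocallyAC p1) (acq : LocallyAC q1)
    {G : ℝ} (hf : Integrable fun t => ω(t) *
        ((deriv p1 t - 2 * p1 t - ((m + 1) ^ 2 - 1) * p t) ^ 2 +
          (deriv q1 t - 2 * q1 t - ((m + 1) ^ 2 - 1) * q t) ^ 2))
    (hG : ∫ t, ω(t) * ((deriv p1 t - 2 * p1 t - ((m + 1) ^ 2 - 1) * p t) ^ 2 +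
          (deriv q1 t - 2 * q1 t - ((m + 1) ^ 2 - 1) * q t) ^ 2) ≤ G)
    {t₁ : ℝ} (ht : ∀ t ≤ t₁, V t 2 ≤ -(5 / 6)) :
    Integrable (fun t => ω(t) *
      jetMajorant m (p t) (q t) (p1 t) (q1 t) (deriv p1 t) (deriv q1 t) (V t 2)) ∧
    ∫ t, ω(t) * jetMajorant m (p t) (q t) (p1 t) (q1 t) (deriv p1 t) (deriv q1 t) (V t 2) ≤
      (125 + 36 * (1 + (1 + m) ^ 2)) * (hardyConst m * G) + 3 * (1 + (1 + m) ^ 2) * ω(t₁) := by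
  have hn : ∀ t, p t ^ 2 + q t ^ 2 = ‖bog m V V1 t‖ ^ 2 := fun t => by rw [hpe, hqe, h.bogRe_sq_add f]
  have ib := h.integrable_bog hm
  have cp := continuous_of_hasDerivAt dp
  have cq := continuous_of_hasDerivAt dq
  have cp1 := acp.continuous
  have cq1 := acq.continuous
  have hp : Integrable fun t => p t ^ 2 := ib.mono' (cp.pow 2).aestronglyMeasurable
    (Eventually.of_forall fun t => by
      rw [Real.norm_of_nonneg (sq_nonneg _), ← hn]; linarith [sq_nonneg (q t)])
  have hq : Integrable fun t => q t ^ 2 := ib.mono' (cq.pow 2).aestronglyMeasurable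
    (Eventually.of_forall fun t => by
      rw [Real.norm_of_nonneg (sq_nonneg _), ← hn]; linarith [sq_nonneg (p t)])
  have hpB : ∫ t, p t ^ 2 ≤ bogEnergy m V V1 := integral_mono hp ib fun t => by
    beta_reduce; rw [← hn]; linarith [sq_nonneg (q t)]
  have hqB : ∫ t, q t ^ 2 ≤ bogEnergy m V V1 := integral_mono hq ib fun t => by
    beta_reduce; rw [← hn]; linarith [sq_nonneg (p t)]
  obtain ⟨iS, hS⟩ := linear_terms_le hm dp dq acp acq hp hq hf
  have hS' := hS.trans (mul_le_mul_of_nonneg_left hG (hardyConst_nonneg m))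
  set A := hardyConst m * G with hA
  have hnl := nonlinear_le hB dp dq acp acq iS hS' (fun t => le_rfl) hp hq hpB hqB
  have cw : Continuous fun t : ℝ => ω(t) :=
    continuous_exp.comp (continuous_const.mul continuous_id).neg
  have cN : Continuous fun t => ω(t) * ((p t ^ 2 + q t ^ 2) ^ 2 +
      (p t ^ 2 + q t ^ 2) * (p1 t ^ 2 + q1 t ^ 2) + (p t ^ 2 + q t ^ 2) ^ 3) := by
    have c1 := (cp.pow 2).add (cq.pow 2)
    exact cw.mul (((c1.pow 2).add (c1.mul ((cp1.pow 2).add (cq1.pow 2)))).add (c1.pow 3))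
  have iN : Integrable fun t => ω(t) * ((p t ^ 2 + q t ^ 2) ^ 2 +
      (p t ^ 2 + q t ^ 2) * (p1 t ^ 2 + q1 t ^ 2) + (p t ^ 2 + q t ^ 2) ^ 3) :=
    (ib.const_mul (124 * A)).mono' cN.aestronglyMeasurable (Eventually.of_forall fun t => by
      rw [Real.norm_of_nonneg (by positivity), ← hn]; exact hnl t)
  have A0 : 0 ≤ A := le_trans (integral_nonneg fun t => by positivity) hS'
  have hN : ∫ t, ω(t) * ((p t ^ 2 + q t ^ 2) ^ 2 +
      (p t ^ 2 + q t ^ 2) * (p1 t ^ 2 + q1 t ^ 2) + (p t ^ 2 + q t ^ 2) ^ 3) ≤ 124 * A := by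
    have h1 := integral_mono iN (ib.const_mul (124 * A)) fun t => by
      beta_reduce; rw [← hn]; exact hnl t
    rw [integral_const_mul] at h1
    exact h1.trans (mul_le_of_le_one_right (by positivity) hB)
  have ibw : Integrable fun t => ω(t) * ‖bog m V V1 t‖ ^ 2 :=
    iS.mono' (cw.mul (h.continuous_bog.norm.pow 2)).aestronglyMeasurable (Eventually.of_forall fun t => by
      rw [Real.norm_of_nonneg (by positivity), ← hn]
      refine mul_le_mul_of_nonneg_left ?_ (exp_nonneg _)
      linarith [sq_nonneg (p1 t), sq_nonneg (q1 t), sq_nonneg (deriv p1 t), sq_nonneg (deriv q1 t)])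
  have hbw : ∫ t, ω(t) * ‖bog m V V1 t‖ ^ 2 ≤ A := by
    refine le_trans (integral_mono ibw iS fun t => ?_) hS'
    beta_reduce
    rw [← hn]
    refine mul_le_mul_of_nonneg_left ?_ (exp_nonneg _)
    linarith [sq_nonneg (p1 t), sq_nonneg (q1 t), sq_nonneg (deriv p1 t), sq_nonneg (deriv q1 t)]
  obtain ⟨iR, hR⟩ := h.residual_le hm ht ibw hbw
  simp only [jetMajorant, mul_add (exp _) (_ + _ + _) (_ + _), mul_add (exp _) _ (_ + _ + _)]
  have iSN : Integrable fun t => ω(t) *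
      (p t ^ 2 + q t ^ 2 + p1 t ^ 2 + q1 t ^ 2 + deriv p1 t ^ 2 + deriv q1 t ^ 2) +
      ω(t) * ((p t ^ 2 + q t ^ 2) ^ 2 + (p t ^ 2 + q t ^ 2) * (p1 t ^ 2 + q1 t ^ 2) +
        (p t ^ 2 + q t ^ 2) ^ 3) := iS.add iN
  rw [integral_add iSN iR, integral_add iS iN]
  refine ⟨iSN.add iR, ?_⟩
  linarith

end Majorant

section Final

variable {m : ℕ} {u : Plane → Space} {e v1 v2 : ℝ → Space}

theorem measurable_jetMajorant (m : ℝ) {p q p1 q1 p2 q2 z : ℝ → ℝ} (hp : Measurable p) (hq : Measurable q)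
    (hp1 : Measurable p1) (hq1 : Measurable q1) (hp2 : Measurable p2) (hq2 : Measurable q2) (hz : Measurable z) :
    Measurable fun t => jetMajorant m (p t) (q t) (p1 t) (q1 t) (p2 t) (q2 t) (z t) := by
  unfold jetMajorant
  fun_prop

/-- The density of the third-order energy in logarithmic coordinates. -/
theorem jetEnergy_exp_le (hm : 1 ≤ m) (hu : IsSigma m u) (he : IsCoulombFrame u e)
    (hd : ∀ r, 0 < r → HasDerivAt (profile u) (v1 r) r) (hc : ContinuousOn v1 (Set.Ioi 0))
    (hd1 : ∀ r, 0 < r → HasDerivAt v1 (v2 r) r) {p q p1 q1 : ℝ → ℝ}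
    (hpe : p = bogRe m (logProfile u) (logDeriv v1) (fun t => e (exp t)))
    (hqe : q = bogIm m (logProfile u) (logDeriv v1) (fun t => e (exp t)))
    (dp : ∀ t, HasDerivAt p (p1 t) t) (dq : ∀ t, HasDerivAt q (q1 t) t) {t p2 q2 : ℝ} {c : Space}
    (hp1 : HasDerivAt p1 p2 t) (hq1 : HasDerivAt q1 q2 t) (hc2 : HasDerivAt v2 c (exp t)) :
    exp (6 * t) * jetEnergy m (exp t) (profile u (exp t), v1 (exp t), v2 (exp t), c) ≤
      10000 * (1 + m) ^ 6 * jetMajorant m (p t) (q t) (p1 t) (q1 t) p2 q2 (logProfile u t 2) := by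
  have h := (traj_logProfile hu hd hc).1
  have f := he.parallelFrame hu hd hc
  subst hpe hqe
  have hV2 : ∀ t, HasDerivAt (logDeriv v1)
      (exp t • (exp t • v2 (exp t)) + exp t • v1 (exp t)) t := fun t =>
    (hasDerivAt_exp t).fun_smul (hasDerivAt_comp_exp (hd1 _ (exp_pos t)))
  have hP : ∀ t, (exp t • (exp t • v2 (exp t)) + exp t • v1 (exp t)) +
      (m : ℝ) ^ 2 • rotGen (rotGen (logProfile u t)) =
      exp (2 * t) • radLapJet m (exp t) (profile u (exp t)) (v1 (exp t)) (v2 (exp t)) := by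
    intro t
    have h0 := (exp_pos t).ne'
    rw [radLapJet, smul_add, smul_add, smul_smul, smul_smul, smul_smul, two_mul, exp_add,
      rotGenL_apply, rotGenL_apply, logProfile]
    congr 2
    · congr 1; field_simp
    · field_simp
  have hD : HasDerivAt (fun t => (exp t • (exp t • v2 (exp t)) + exp t • v1 (exp t)) +
      (m : ℝ) ^ 2 • rotGen (rotGen (logProfile u t))) (exp (2 * t) • (exp t •
        derivRadLapJet m (exp t) (profile u (exp t)) (v1 (exp t)) (v2 (exp t)) c) +
      (2 * exp (2 * t)) •
        radLapJet m (exp t) (profile u (exp t)) (v1 (exp t)) (v2 (exp t))) t := by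
    have h1 := hasDerivAt_comp_exp (t := t) (hasDerivAt_radLapJet (n := m) (exp_pos t).ne' (hd _ (exp_pos t))
      (hd1 _ (exp_pos t)) hc2)
    have h2 : HasDerivAt (fun t : ℝ => exp (2 * t)) (2 * exp (2 * t)) t :=
      (((hasDerivAt_id t).const_mul (2 : ℝ)).exp).congr_deriv (by simp; ring)
    exact (h2.fun_smul h1).congr_of_eventuallyEq (Eventually.of_forall fun t => hP t)
  have key := h.jet_frame_le hm f hV2 dp dq hp1 hq1 hD
  refine le_trans (le_of_eq ?_) key
  rw [hP, smul_smul, smul_smul (2 : ℝ), add_sub_cancel_right, ← rotGenL_apply, map_smul, rotGenL_apply, norm_smul,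
    norm_smul, Real.norm_of_nonneg (by positivity), Real.norm_of_nonneg (by positivity), jetEnergy]
  have h0 := (exp_pos t).ne'
  have h6 : exp (6 * t) = exp t ^ 6 := by rw [← exp_nat_mul]; norm_num
  have h2 : exp (2 * t) = exp t ^ 2 := by rw [← exp_nat_mul]; norm_num
  rw [h6, h2]
  field_simp

/-- The third-order norm in logarithmic coordinates. -/
theorem lintegral_jetEnergy_le {C : ℝ} {j : ℝ → ℝ} {M : ℝ → ℝ} (hM : Measurable M) (hC : 0 ≤ C)
    (hM0 : ∀ t, 0 ≤ M t)
    (hi : Integrable fun t => ω(t) * M t)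
    (hj : ∀ᵐ t, exp (6 * t) * j (exp t) ≤ C * M t) :
    ∫⁻ x : Plane, ENNReal.ofReal (j ‖x‖) ≤
      ENNReal.ofReal (2 * π * (C * ∫ t, ω(t) * M t)) := by
  have hae : ∀ᵐ x : Plane, j ‖x‖ ≤ C * exp (-(6 * log ‖x‖)) * M (log ‖x‖) := by
    refine ae_norm_of_ae (ae_Ioi_of_ae_exp (p := fun r => j r ≤ C * exp (-(6 * log r)) * M (log r)) ?_)
    filter_upwards [hj] with t ht
    rw [log_exp, exp_neg]
    have := exp_pos (6 * t)
    rw [mul_assoc, mul_left_comm, ← div_eq_inv_mul, le_div_iff₀ this]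
    linarith
  have hmeas : Measurable fun r : ℝ => ENNReal.ofReal (C * exp (-(6 * log r)) * M (log r)) :=
    ((measurable_const.mul (measurable_exp.comp (measurable_log.const_mul 6).neg)).mul
      (hM.comp measurable_log)).ennreal_ofReal
  calc ∫⁻ x : Plane, ENNReal.ofReal (j ‖x‖)
      ≤ ∫⁻ x : Plane, ENNReal.ofReal (C * exp (-(6 * log ‖x‖)) * M (log ‖x‖)) :=
        lintegral_mono_ae (hae.mono fun x hx => ENNReal.ofReal_le_ofReal hx)
    _ = ENNReal.ofReal (2 * π) * ∫⁻ t : ℝ, ENNReal.ofReal (C * (ω(t) * M t)) := by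
        rw [lintegral_fun_norm_exp hmeas]
        congr 1
        refine lintegral_congr fun t => ?_
        rw [← ENNReal.ofReal_mul (exp_nonneg _), log_exp]
        congr 1
        have : ω(t) = exp (2 * t) * exp (-(6 * t)) := by
          rw [← exp_add]; congr 1; ring
        rw [this]; ring
    _ = _ := by
        rw [← ofReal_integral_eq_lintegral_ofReal (hi.const_mul C) (Eventually.of_forall fun t =>
          mul_nonneg hC (mul_nonneg (exp_nonneg _) (hM0 t))), integral_const_mul,
          ← ENNReal.ofReal_mul (by positivity)]

theorem jetMajorant_nonneg {m p q p1 q1 p2 q2 z : ℝ} (hz : 0 ≤ 1 - z ^ 2) :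
    0 ≤ jetMajorant m p q p1 q1 p2 q2 z := by
  unfold jetMajorant
  positivity

/-- The third-order norm in terms of the distributional Laplacian of `q̃` and of a radius below which `u`
is close to the south pole. -/
theorem hdotENorm_three_sq_le (hm : 1 ≤ m) (hu : IsSigma m u) (h3 : MemHdot 3 u) (h1 : excess m u ≤ 1)
    (he : IsCoulombFrame u e) {t₁ : ℝ} (ht : ∀ t ≤ t₁, logProfile u t 2 ≤ -(5 / 6)) {G : Plane → ℂ}
    (hG : IsWeakLaplacian (qTilde m u e) G) (hG2 : MemLp G 2 volume) :
    hdotENorm 3 u ^ 2 ≤ ENNReal.ofReal (2 * π * (10000 * (1 + m) ^ 6 *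
      ((125 + 36 * (1 + (1 + m) ^ 2)) * (hardyConst m * (eLpNorm G 2 volume ^ 2).toReal) +
        3 * (1 + (1 + m) ^ 2) * ω(t₁)))) := by
  obtain ⟨v1, v2, γ, hd, hd1, hγ, hγi, hle⟩ := exists_profile_jet hu.isEquivariant hu.continuousOn hu.memHdot h3
  have hc : ContinuousOn v1 (Set.Ioi 0) := fun r hr => (hd1 r hr).continuousAt.continuousWithinAt
  obtain ⟨h, hn⟩ := traj_logProfile hu hd hc
  have hex := excess_sq hm h hn
  have hB : bogEnergy m (logProfile u) (logDeriv v1) ≤ 1 := by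
    have h0 : 0 ≤ bogEnergy m (logProfile u) (logDeriv v1) :=
      integral_nonneg fun t => by positivity
    rw [hex, sqrt_le_one] at h1
    nlinarith [pi_gt_three]
  have f := he.parallelFrame hu hd hc
  obtain ⟨p1, q1, dp, dq, acp, acq, hlap⟩ := exists_frame_jet hm hu he hd hc hG hG2 rfl rfl
  generalize hpe : bogRe m (logProfile u) (logDeriv v1) (fun t => e (exp t)) = p at *
  generalize hqe : bogIm m (logProfile u) (logDeriv v1) (fun t => e (exp t)) = q at *
  have cp := continuous_of_hasDerivAt dp
  have cq := continuous_of_hasDerivAt dq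
  have hGt : eLpNorm G 2 volume ^ 2 < ⊤ := ENNReal.pow_lt_top hG2.2
  have h0 : ∀ t, 0 ≤ ω(t) * ((deriv p1 t - 2 * p1 t - ((m + 1) ^ 2 - 1) * p t) ^ 2 +
      (deriv q1 t - 2 * q1 t - ((m + 1) ^ 2 - 1) * q t) ^ 2) := fun t => by positivity
  have mf : Measurable fun t => ω(t) * ((deriv p1 t - 2 * p1 t - ((m + 1) ^ 2 - 1) * p t) ^ 2 +
      (deriv q1 t - 2 * q1 t - ((m + 1) ^ 2 - 1) * q t) ^ 2) :=
    measurable_weighted _ cp.measurable cq.measurable acp.continuous.measurable acq.continuous.measurable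
  have hf : Integrable fun t => ω(t) * ((deriv p1 t - 2 * p1 t - ((m + 1) ^ 2 - 1) * p t) ^ 2 +
      (deriv q1 t - 2 * q1 t - ((m + 1) ^ 2 - 1) * q t) ^ 2) := by
    refine ⟨mf.aestronglyMeasurable, ?_⟩
    rw [hasFiniteIntegral_iff_ofReal (Eventually.of_forall h0)]
    exact hlap.trans_lt hGt
  have hfG : ∫ t, ω(t) * ((deriv p1 t - 2 * p1 t - ((m + 1) ^ 2 - 1) * p t) ^ 2 +
      (deriv q1 t - 2 * q1 t - ((m + 1) ^ 2 - 1) * q t) ^ 2) ≤ (eLpNorm G 2 volume ^ 2).toReal := by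
    rw [integral_eq_lintegral_of_nonneg_ae (Eventually.of_forall h0) mf.aestronglyMeasurable]
    exact ENNReal.toReal_mono hGt.ne hlap
  obtain ⟨iM, hM⟩ := integral_jetMajorant_le h hm f hB hpe.symm hqe.symm dp dq acp acq hf hfG ht
  refine hle.trans ((lintegral_jetEnergy_le (j := fun r => jetEnergy m r (profile u r, v1 r, v2 r, γ r))
    (C := 10000 * (1 + m) ^ 6) (measurable_jetMajorant m cp.measurable cq.measurable
      acp.continuous.measurable acq.continuous.measurable (measurable_deriv p1) (measurable_deriv q1)
      (continuous_coord h.continuous 2).measurable) (by positivity)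
      (fun t => jetMajorant_nonneg (h.one_sub_sq_nonneg t)) iM ?_).trans (ENNReal.ofReal_le_ofReal ?_))
  · filter_upwards [acp.ae_hasDerivAt, acq.ae_hasDerivAt, ae_exp_of_ae_Ioi (ae_hasDerivAt_primitive hγ hγi)] with
      t a1 a2 a3
    exact jetEnergy_exp_le hm hu he hd hc hd1 hpe.symm hqe.symm dp dq a1 a2 a3
  · gcongr

end Final

section Conclusion

variable {m : ℕ} {u : Plane → Space}

theorem exists_H₃_le (hm : 1 ≤ m) : ∃ T : ℝ, ∀ t ≤ T, H₃ m t ≤ -(11 / 12) := by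
  have h := (tendsto_H₃_atBot hm).eventually (gt_mem_nhds (by norm_num : (-1 : ℝ) < -(11 / 12)))
  obtain ⟨T, hT⟩ := eventually_atBot.1 h
  exact ⟨T, fun t ht => (hT t ht).le⟩

theorem abs_third_coord_sub_le {τ a η : ℝ} {V : ℝ → Space} (h : ∀ t, ‖rot a (V (t + τ)) - Hp m t‖ ≤ η) (t : ℝ) :
    |V t 2 - H₃ m (t - τ)| ≤ η := by
  have h1 := (norm_coord_le (rot a (V (t - τ + τ)) - Hp m (t - τ)) 2).trans (h (t - τ))
  rw [PiLp.sub_apply, rot_two, sub_add_cancel] at h1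
  simpa [Hp] using h1

/-- Existence of a Coulomb frame along a map close to a harmonic map. -/
theorem exists_isCoulombFrame_of_stable (hm : 1 ≤ m) {v1 : ℝ → Space}
    (hd : ∀ r, 0 < r → HasDerivAt (profile u) (v1 r) r) (hc : ContinuousOn v1 (Set.Ioi 0))
    (h : Traj m (logProfile u) (logDeriv v1)) {τ a η : ℝ} (hη : η ≤ 1 / 2)
    (hst : ∀ t, ‖rot a (logProfile u (t + τ)) - Hp m t‖ ≤ η) : ∃ e : ℝ → Space, IsCoulombFrame u e := by
  have hz := abs_third_coord_sub_le hst
  obtain ⟨E, hE, hl⟩ := h.exists_parallel hm (τ := τ)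
    (fun t ht => by
      have h1 := H₃_nonneg m (sub_nonneg.2 ht)
      linarith [(abs_le.1 (hz t)).1])
    (fun t ht => by
      have h1 := H₃_nonneg m (sub_nonneg.2 ht)
      rw [← neg_sub, H₃_neg] at h1
      linarith [(abs_le.1 (hz t)).2])
  exact ⟨_, exists_isCoulombFrame hd hc hE hl⟩

theorem exp_neg_le_of_le {s τ T : ℝ} (hs : 0 < s) (h : s ≤ 4 * exp τ) :
    exp (-(4 * (τ + T))) ≤ 256 * exp (-(4 * T)) * ((s ^ 2)⁻¹) ^ 2 := by
  have h1 : s ^ 4 ≤ 256 * exp (4 * τ) := by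
    have h2 := pow_le_pow_left₀ hs.le h 4
    have h3 : exp (4 * τ) = exp τ ^ 4 := by rw [← exp_nat_mul]; norm_num
    rw [h3]
    linarith [mul_pow 4 (exp τ) 4]
  have h4 : exp (-(4 * (τ + T))) = exp (-(4 * T)) * (exp (4 * τ))⁻¹ := by
    rw [← exp_neg, ← exp_add]; congr 1; ring
  have h5 : (exp (4 * τ))⁻¹ ≤ 256 * (s ^ 4)⁻¹ := by
    rw [← div_eq_mul_inv, le_div_iff₀ (by positivity), inv_mul_le_iff₀ (exp_pos _)]
    linarith
  rw [h4]
  have h6 := mul_le_mul_of_nonneg_left h5 (exp_pos (-(4 * T))).le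
  refine h6.trans (le_of_eq ?_)
  have := hs.ne'
  field_simp

theorem le_mul_add_of_sq_le {X L : ℝ≥0∞} {a b c w : ℝ} (ha : a ≤ c ^ 2) (hb : b ≤ c ^ 2) (hc : 0 ≤ c) (hw : 0 ≤ w)
    (hL : L ≠ ⊤) (h : X ^ 2 ≤ ENNReal.ofReal (a * (L ^ 2).toReal + b * w ^ 2)) :
    X ≤ ENNReal.ofReal c * (L + ENNReal.ofReal w) := by
  rw [← ENNReal.pow_le_pow_left_iff two_ne_zero]
  lift L to NNReal using hL
  refine h.trans ?_
  have e : ENNReal.ofReal c * (L + ENNReal.ofReal w) = ENNReal.ofReal (c * (L + w)) := by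
    rw [ENNReal.ofReal_mul hc, ENNReal.ofReal_add L.coe_nonneg hw, ENNReal.ofReal_coe_nnreal]
  rw [e, ← ENNReal.ofReal_pow (by positivity)]
  refine ENNReal.ofReal_le_ofReal ?_
  rw [ENNReal.toReal_pow, ENNReal.coe_toReal, mul_pow]
  have h1 := mul_le_mul_of_nonneg_right ha (sq_nonneg (L : ℝ))
  have h2 := mul_le_mul_of_nonneg_right hb (sq_nonneg w)
  have h3 : 0 ≤ c ^ 2 * (2 * (L * w)) := by positivity
  linarith

theorem le_mul_laplacianENorm_add {F : Type*} [NormedAddCommGroup F] [NormedSpace ℝ F] {f : Plane → F}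
    {X b y : ℝ≥0∞} {c : ℝ} (hc : 0 < c)
    (h : ∀ G, IsWeakLaplacian f G → MemLp G 2 volume → X ≤ ENNReal.ofReal c * (eLpNorm G 2 volume + b)) :
    X ≤ ENNReal.ofReal c * (laplacianENorm f + y + b) := by
  have hc' : ENNReal.ofReal c ≠ 0 := (ENNReal.ofReal_pos.2 hc).ne'
  have key : X / ENNReal.ofReal c - b ≤ laplacianENorm f := by
    refine le_iInf₂ fun G hG => ?_
    rw [tsub_le_iff_right, ENNReal.div_le_iff hc' ENNReal.ofReal_ne_top, mul_comm]
    rcases eq_or_ne (eLpNorm G 2 volume) ⊤ with ht | ht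
    · rw [ht, top_add, ENNReal.mul_top hc']
      exact le_top
    · exact h G hG ⟨hG.2.1.aestronglyMeasurable, lt_top_iff_ne_top.2 ht⟩
  rw [tsub_le_iff_right, ENNReal.div_le_iff hc' ENNReal.ofReal_ne_top, mul_comm] at key
  refine key.trans ?_
  gcongr
  exact le_self_add

end Conclusion

end SchrodingerMap

end

theorem proposition3p8 (m : ℕ) (hm : 1 ≤ m) :
    ∃ K₀ : ℝ, 0 < K₀ ∧ ∀ K : ℝ, K₀ ≤ K →
      ∃ δ₀ : ℝ, 0 < δ₀ ∧ ∃ C : ℝ, 0 < C ∧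
        ∀ u : SchrodingerMap.Plane → SchrodingerMap.Space,
          SchrodingerMap.IsSigma m u → SchrodingerMap.MemHdot 3 u →
          SchrodingerMap.excess m u < δ₀ →
          (∃ e : ℝ → SchrodingerMap.Space, SchrodingerMap.IsCoulombFrame u e) ∧
          (∃ s α : ℝ, SchrodingerMap.IsModulation m K u s α) ∧
          ∀ (e : ℝ → SchrodingerMap.Space) (s α : ℝ),
            SchrodingerMap.IsCoulombFrame u e → SchrodingerMap.IsModulation m K u s α →
            SchrodingerMap.hdotENorm 3 u ≤
              ENNReal.ofReal C *
                (SchrodingerMap.laplacianENorm (SchrodingerMap.qTilde m u e)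
                  + MeasureTheory.eLpNorm
                      (fun x : SchrodingerMap.Plane => SchrodingerMap.qFun m u e ‖x‖)
                      6 MeasureTheory.volume ^ 2
                  + ENNReal.ofReal ((s ^ 2)⁻¹)) := by
  open SchrodingerMap in
  obtain ⟨K₀, d, hK₀, hd0, hmod⟩ := exists_modulation hm
  obtain ⟨T, hT⟩ := exists_H₃_le hm
  have hm' : (1 : ℝ) ≤ m := by exact_mod_cast hm
  have hκ := hardyConst_nonneg m
  let a : ℝ := 2 * Real.pi * (10000 * (1 + m) ^ 6 *
    ((125 + 36 * (1 + (1 + m) ^ 2)) * hardyConst m))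
  let b : ℝ := 2 * Real.pi * (10000 * (1 + m) ^ 6 * (3 * (1 + (1 + m) ^ 2) * (256 * Real.exp (-(4 * T)))))
  have ha : 0 ≤ a := by positivity
  have hb : 0 ≤ b := by positivity
  refine ⟨K₀, hK₀, fun K hK => ?_⟩
  have hK0 : 0 < K := hK₀.trans_le hK
  refine ⟨min d (min (1 / (288 * m)) (1 / K)), by positivity, 1 + a + b, by positivity, ?_⟩
  intro u hu h3 hδ
  obtain ⟨hδ1, hδ'⟩ := lt_min_iff.1 hδ
  obtain ⟨hδ2, hδ3⟩ := lt_min_iff.1 hδ'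
  rw [lt_div_iff₀ (by positivity)] at hδ2 hδ3
  have hex0 : 0 ≤ excess m u := Real.sqrt_nonneg _
  have hexm := mul_le_mul_of_nonneg_left hm' hex0
  obtain ⟨v1, v2, γ, hd, hd1, -⟩ := exists_profile_jet hu.isEquivariant hu.continuousOn hu.memHdot h3
  have hc : ContinuousOn v1 (Set.Ioi 0) := fun r hr => (hd1 r hr).continuousAt.continuousWithinAt
  have hp := contDiffOn_one_of_hasDerivAt hd hc
  obtain ⟨h, hn⟩ := traj_logProfile hu hd hc
  have hex := excess_sq hm h hn
  obtain ⟨τ, α₀, hst⟩ := exists_stable_of_excess hm h hex (by linarith)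
  refine ⟨exists_isCoulombFrame_of_stable hm hd hc h (by linarith) hst, ?_, ?_⟩
  · obtain ⟨s, α, hs⟩ := hmod u hu _ hp h hex hδ1
    exact ⟨s, α, hs.mono hK⟩
  · intro e s α he hs
    have hsτ := hs.le_exp hm hu hp h (by linarith) hst (by linarith)
    have hz := abs_third_coord_sub_le hst
    refine le_mul_laplacianENorm_add (by positivity) fun G hG hG2 => ?_
    have key := hdotENorm_three_sq_le hm hu h3 (by linarith) he (t₁ := τ + T) (fun t ht => by
      have h1 := hT (t - τ) (by linarith)
      linarith [(abs_le.1 (hz t)).2]) hG hG2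
    refine le_mul_add_of_sq_le (a := a) (b := b) (by nlinarith) (by nlinarith) (by positivity)
      (by positivity) hG2.2.ne (key.trans (ENNReal.ofReal_le_ofReal ?_))
    have hexp := exp_neg_le_of_le (T := T) hs.1 hsτ
    have h4 := mul_le_mul_of_nonneg_left hexp
      (by positivity : 0 ≤ 2 * Real.pi * (10000 * (1 + (m : ℝ)) ^ 6 * (3 * (1 + (1 + (m : ℝ)) ^ 2))))
    have e1 : b * ((s ^ 2)⁻¹) ^ 2 = 2 * Real.pi * (10000 * (1 + (m : ℝ)) ^ 6 * (3 * (1 + (1 + (m : ℝ)) ^ 2))) *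
      (256 * Real.exp (-(4 * T)) * ((s ^ 2)⁻¹) ^ 2) := by ring
    have e2 : a * (MeasureTheory.eLpNorm G 2 MeasureTheory.volume ^ 2).toReal = 2 * Real.pi * (10000 * (1 + (m : ℝ)) ^ 6 *
      ((125 + 36 * (1 + (1 + (m : ℝ)) ^ 2)) *
        (hardyConst m * (MeasureTheory.eLpNorm G 2 MeasureTheory.volume ^ 2).toReal))) := by ring
    rw [e1, e2]
    linarith
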